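/- Let $N\ge 2$, $q\in(1,\infty)$, $a\in(0,\infty)$, $\mathbb C_+=\{\lambda\in\mathbb C:\operatorname{Re}\lambda>0\}$, and let $\mathbb R^N_+=\{x=(x',x_N): x'\in\mathbb R^{N-1},\ x_N>0\}$. All functions are complex valued, $L_q$ and $H_q^m$ are the usual Lebesgue and Sobolev spaces, and $\lambda^{1/2},\lambda^{3/2},\sqrt{\,\cdot\,}$ are principal branches. For $r\in\mathbb R$ and a sequence $A=(A_k)_{k\ge0}$ of real numbers, let $\mathbb M_{r,1}(\mathbb C_+;A)$ be the set of functions $m(\xi',\lambda)$ on $(\mathbb R^{N-1}\setminus\{0\})\times\mathbb C_+$ that are infinitely differentiable in $\xi'$ and holomorphic in $\lambda$, and satisfy $$\Big|\partial_{\xi'}^{\alpha'}\Big(\lambda\frac{d}{d\lambda}\Big)^n m(\xi',\lambda)\Big|\le A_{|\alpha'|}\,(|\lambda|^{1/2}+|\xi'|)^{r-|\alpha'|}\qquad(n=0,1)$$ for all multi-indices $\alpha'$ and all $(\xi',\lambda)$; the class $\mathbb M_{r,1}(\mathbb C_+)$ of multipliers of order $r$ with type $1$ is the union of these sets over all $A$.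 For $l=1,2$, $w_l\in\mathbb M_{l-1,1}(\mathbb C_+)$, $\lambda\in\mathbb C_+$ and $f\in H_q^2(\mathbb R^N_+)$, set $$[W_l(\lambda)f](x)=\mathcal F_{\xi'}^{-1}\Big[w_l(\xi',\lambda)\,x_N\,e^{-\sqrt{|\xi'|^2+a\lambda}\,x_N}\,\widehat f(\xi',0)\Big](x'),\qquad x\in\mathbb R^N_+,$$ where $\widehat f(\cdot,0)$ is the Fourier transform in $x'\in\mathbb R^{N-1}$ of the boundary trace $f(\cdot,0)\in L_q(\mathbb R^{N-1})$, and $\mathcal F_{\xi'}^{-1}$ is the inverse Fourier transform on $\mathbb R^{N-1}$, in the sense of distributions. For $u\in H_q^2(\mathbb R^N_+)$ and $\rho\in H_q^3(\mathbb R^N_+)$ put $$\mathcal T_\lambda u=(\nabla^2u,\lambda^{1/2}\nabla u,\lambda u),\qquad \mathcal S^0_\lambda\rho=(\nabla^3\rho,\lambda^{1/2}\nabla^2\rho,\lambda\nabla\rho,\lambda^{3/2}\rho).$$ A family $\mathcal T\subset\mathcal L(X,Y)$ of bounded operators between Banach spaces is $\mathcal R$-bounded with exponent $p\in[1,\infty)$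 and constant $C$ if, for all $m\in\mathbb N$, $T_1,\dots,T_m\in\mathcal T$, $f_1,\dots,f_m\in X$ and all independent, symmetric, $\{-1,1\}$-valued random variables $r_1,\dots,r_m$ on $[0,1]$, $$\Big(\int_0^1\Big\|\sum_{j=1}^m r_j(u)T_jf_j\Big\|_Y^p\,du\Big)^{1/p}\le C\Big(\int_0^1\Big\|\sum_{j=1}^m r_j(u)f_j\Big\|_X^p\,du\Big)^{1/p}.$$ Then, for every sequence $A$, the following assertions hold. (1) There are $p\in[1,\infty)$ and $C>0$, depending only on $N$, $q$, $a$ and $A$, such that for every $w_1\in\mathbb M_{0,1}(\mathbb C_+;A)$ there is a holomorphic map $\widetilde W_1:\mathbb C_+\to\mathcal L(L_q(\mathbb R^N_+)^{N^2+N+1},H_q^3(\mathbb R^N_+))$ with $$W_1(\lambda)f=\widetilde W_1(\lambda)(\nabla^2f,\lambda^{1/2}\nabla f,\lambda f)\qquad(\lambda\in\mathbb C_+,\ f\in H_q^2(\mathbb R^N_+)),$$ and such that for $n=0,1$ the family $\{(\lambda\frac{d}{d\lambda})^n(\mathcal S^0_\lambda\widetilde W_1(\lambda)):\lambda\in\mathbb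 C_+\}$ is $\mathcal R$-bounded with exponent $p$ and constant $C$ on $\mathcal L(L_q(\mathbb R^N_+)^{N^2+N+1},L_q(\mathbb R^N_+)^{N^3+N^2+N+1})$. (2) There are $p\in[1,\infty)$ and $C>0$, depending only on $N$, $q$, $a$ and $A$, such that for every $w_2\in\mathbb M_{1,1}(\mathbb C_+;A)$ there is a holomorphic map $\widetilde W_2:\mathbb C_+\to\mathcal L(L_q(\mathbb R^N_+)^{N^2+N+1},H_q^2(\mathbb R^N_+))$ with $$W_2(\lambda)f=\widetilde W_2(\lambda)(\nabla^2f,\lambda^{1/2}\nabla f,\lambda f)\qquad(\lambda\in\mathbb C_+,\ f\in H_q^2(\mathbb R^N_+)),$$ and such that for $n=0,1$ the family $\{(\lambda\frac{d}{d\lambda})^n(\mathcal T_\lambda\widetilde W_2(\lambda)):\lambda\in\mathbb C_+\}$ is $\mathcal R$-bounded with exponent $p$ and constant $C$ on $\mathcal L(L_q(\mathbb R^N_+)^{N^2+N+1})$. -/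

import Mathlib

open MeasureTheory ProbabilityTheory Set
open scoped ENNReal ContDiff SchwartzMap

noncomputable section

/-! ## The half-space and its Lebesgue and Sobolev spaces

The dimension is `N = n + 1`; a point of `ℝ^N` is written `x = (x', x_N)`. -/

/-- The tangential space `ℝ^{N-1}`. -/
abbrev Tan (n : ℕ) := EuclideanSpace ℝ (Fin n)

/-- `ℝ^N = ℝ^{N-1} × ℝ`, with Lebesgue measure. -/
abbrev Space (n : ℕ) := Tan n × ℝ

/-- The half-space `x_N > 0`. -/
def halfSpace (n : ℕ) : Set (Space n) := {x | 0 < x.2}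

/-- The standard basis of `ℝ^N`; the last vector is the normal direction. -/
def basisVec (n : ℕ) : Fin (n + 1) → Space n :=
  Fin.lastCases (0, 1) (fun i => (EuclideanSpace.single i 1, 0))

/-- `L_q(ℝ^N_+)`, complex valued. -/
abbrev Lq (n : ℕ) (q : ℝ≥0∞) := Lp ℂ q ((volume : Measure (Space n)).restrict (halfSpace n))

/-- `L_q(ℝ^N_+)^{N^k}`: the components are indexed by the words `(j_1, …, j_k)`. -/
abbrev LqTensor (n : ℕ) (q : ℝ≥0∞) (k : ℕ) := (Fin k → Fin (n + 1)) → Lq n q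

/-- `∂_{j_1} ⋯ ∂_{j_k} φ (x)` for a smooth `φ` on `ℝ^N`. -/
def partialDeriv {n k : ℕ} (j : Fin k → Fin (n + 1)) (φ : Space n → ℂ) (x : Space n) : ℂ :=
  iteratedFDeriv ℝ k φ x (fun i => basisVec n (j i))

/-- `φ ∈ C_c^∞(ℝ^N)`. -/
def IsTest {n : ℕ} (φ : Space n → ℂ) : Prop := ContDiff ℝ ∞ φ ∧ HasCompactSupport φ

/-- `v = ∂_{j_1} ⋯ ∂_{j_k} u` weakly in the half-space. -/
def IsWeakDeriv {n k : ℕ} {q : ℝ≥0∞} (j : Fin k → Fin (n + 1)) (u v : Lq n q) : Prop :=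
  ∀ φ : Space n → ℂ, IsTest φ → tsupport φ ⊆ halfSpace n →
    ∫ x in halfSpace n, partialDeriv j φ x * u x = (-1) ^ k * ∫ x in halfSpace n, φ x * v x

theorem integrable_test_mul {n : ℕ} {q : ℝ≥0∞} [Fact (1 ≤ q)] {φ : Space n → ℂ}
    (hc : Continuous φ) (hs : HasCompactSupport φ) (u : Lq n q) :
    Integrable (fun x => φ x * u x) ((volume : Measure (Space n)).restrict (halfSpace n)) := by
  have h := ((Lp.memLp u).locallyIntegrable Fact.out).integrable_smul_left_of_hasCompactSupport hc hs
  simpa [smul_eq_mul] using h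

theorem IsTest.continuous_partialDeriv {n k : ℕ} {φ : Space n → ℂ} (h : IsTest φ)
    (j : Fin k → Fin (n + 1)) : Continuous (partialDeriv j φ) := by
  have h1 : Continuous (iteratedFDeriv ℝ k φ) :=
    h.1.continuous_iteratedFDeriv (by exact_mod_cast le_top)
  unfold partialDeriv
  fun_prop

theorem IsTest.hasCompactSupport_partialDeriv {n k : ℕ} {φ : Space n → ℂ} (h : IsTest φ)
    (j : Fin k → Fin (n + 1)) : HasCompactSupport (partialDeriv j φ) := by
  refine (h.2.iteratedFDeriv (𝕜 := ℝ) k).mono' ?_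
  refine subset_trans ?_ subset_closure
  intro x hx h0
  apply hx
  simp only [partialDeriv, h0]
  rfl

/-- `H_q^m(ℝ^N_+)`. An element is a function `u ∈ L_q` (the component of order `0`) together with
its weak derivatives of order at most `m`, all in `L_q`; these are determined by `u`. The norm is
the largest of the `L_q`-norms of the derivatives, which is equivalent to the usual one. -/
def sobolev (n : ℕ) (q : ℝ≥0∞) [Fact (1 ≤ q)] (m : ℕ) :
    Submodule ℂ ((k : Fin (m + 1)) → LqTensor n q k) where
  carrier := {U | ∀ (k : Fin (m + 1)) (j : Fin k → Fin (n + 1)),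
    IsWeakDeriv j (U ⟨0, m.succ_pos⟩ Fin.elim0) (U k j)}
  zero_mem' := by
    intro k j φ hφ hs
    have h0 : ((0 : Lq n q) : Space n → ℂ) =ᵐ[(volume : Measure (Space n)).restrict (halfSpace n)] 0 :=
      Lp.coeFn_zero _ _ _
    have e : ∀ ψ : Space n → ℂ, ∫ x in halfSpace n, ψ x * (0 : Lq n q) x = 0 := by
      intro ψ
      rw [integral_congr_ae (g := fun _ => 0), integral_zero]
      filter_upwards [h0] with x hx
      rw [hx, Pi.zero_apply, mul_zero]
    simp only [Pi.zero_apply]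
    rw [e, e, mul_zero]
  add_mem' := by
    intro U V hU hV k j φ hφ hs
    have e : ∀ ψ : Space n → ℂ, Continuous ψ → HasCompactSupport ψ → ∀ u v : Lq n q,
        ∫ x in halfSpace n, ψ x * (u + v : Lq n q) x
          = (∫ x in halfSpace n, ψ x * u x) + ∫ x in halfSpace n, ψ x * v x := by
      intro ψ h1 h2 u v
      rw [← integral_add (integrable_test_mul h1 h2 u) (integrable_test_mul h1 h2 v)]
      refine integral_congr_ae ?_
      filter_upwards [Lp.coeFn_add u v] with x hx
      rw [hx, Pi.add_apply, mul_add]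
    simp only [Pi.add_apply]
    rw [e _ (hφ.continuous_partialDeriv j) (hφ.hasCompactSupport_partialDeriv j),
      e _ hφ.1.continuous hφ.2, hU k j φ hφ hs, hV k j φ hφ hs, mul_add]
  smul_mem' := by
    intro c U hU k j φ hφ hs
    have e : ∀ ψ : Space n → ℂ, ∀ u : Lq n q,
        ∫ x in halfSpace n, ψ x * (c • u : Lq n q) x = c * ∫ x in halfSpace n, ψ x * u x := by
      intro ψ u
      rw [← integral_const_mul]
      refine integral_congr_ae ?_
      filter_upwards [Lp.coeFn_smul c u] with x hx
      rw [hx, Pi.smul_apply, smul_eq_mul]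
      ring
    simp only [Pi.smul_apply]
    rw [e, e, hU k j φ hφ hs]
    ring

/-- `u ↦ ∇^k u`, from `H_q^m` to `L_q^{N^k}`, for `k ≤ m`. -/
def weakGrad (n : ℕ) (q : ℝ≥0∞) [Fact (1 ≤ q)] {m : ℕ} (k : ℕ) (hk : k ≤ m) :
    sobolev n q m →L[ℂ] LqTensor n q k :=
  (ContinuousLinearMap.proj (R := ℂ) (φ := fun k : Fin (m + 1) => LqTensor n q k)
    ⟨k, Nat.lt_succ_of_le hk⟩).comp (sobolev n q m).subtypeL

/-- The function in `L_q` underlying an element of `H_q^m`. -/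
def toLq {n : ℕ} {q : ℝ≥0∞} [Fact (1 ≤ q)] {m : ℕ} (u : sobolev n q m) : Lq n q :=
  weakGrad n q 0 (Nat.zero_le m) u Fin.elim0

/-- `L_q(ℝ^N_+)^{N^2+N+1}`. -/
abbrev DataSpace (n : ℕ) (q : ℝ≥0∞) := LqTensor n q 2 × LqTensor n q 1 × LqTensor n q 0

/-- `L_q(ℝ^N_+)^{N^3+N^2+N+1}`. -/
abbrev TargetSpace (n : ℕ) (q : ℝ≥0∞) :=
  LqTensor n q 3 × LqTensor n q 2 × LqTensor n q 1 × LqTensor n q 0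

/-- `T_z u = (∇²u, z^{1/2} ∇u, z u)`, with the principal branch of the power. -/
def opT (n : ℕ) (q : ℝ≥0∞) [Fact (1 ≤ q)] (z : ℂ) : sobolev n q 2 →L[ℂ] DataSpace n q :=
  (weakGrad n q 2 le_rfl).prod
    ((z ^ (1 / 2 : ℂ) • weakGrad n q 1 (by norm_num)).prod (z • weakGrad n q 0 (by norm_num)))

/-- `S⁰_z u = (∇³u, z^{1/2} ∇²u, z ∇u, z^{3/2} u)`, with the principal branch of the powers. -/
def opS (n : ℕ) (q : ℝ≥0∞) [Fact (1 ≤ q)] (z : ℂ) : sobolev n q 3 →L[ℂ] TargetSpace n q :=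
  (weakGrad n q 3 le_rfl).prod
    ((z ^ (1 / 2 : ℂ) • weakGrad n q 2 (by norm_num)).prod
      ((z • weakGrad n q 1 (by norm_num)).prod (z ^ (3 / 2 : ℂ) • weakGrad n q 0 (by norm_num))))

/-! ## Symbols -/

/-- The open right half-plane `ℂ_+`. -/
def rightHalfPlane : Set ℂ := {z | 0 < z.re}

/-- The operator `z d/dz`. -/
def eulerDeriv {F : Type*} [NormedAddCommGroup F] [NormedSpace ℂ F] (f : ℂ → F) (z : ℂ) : F :=
  z • deriv f z

/-- `w` is a multiplier of order `r` with type `1` on `(ℝ^{N-1} ∖ {0}) × ℂ_+`, with the constants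
`A |α'|` in its estimates: `w` is smooth in `ξ' ≠ 0`, holomorphic in `z ∈ ℂ_+`, and
`|∂_{ξ'}^{α'} (z d/dz)^i w| ≤ A |α'| (|z|^{1/2} + |ξ'|)^{r - |α'|}` for `i = 0, 1` and all `α'`.
The partial derivatives of order `k` are indexed by words of length `k`. -/
structure IsMultiplierWith {n : ℕ} (r : ℝ) (A : ℕ → ℝ) (w : Tan n → ℂ → ℂ) : Prop where
  smooth : ∀ i ≤ 1, ∀ z ∈ rightHalfPlane,
    ContDiffOn ℝ ∞ (fun ξ => eulerDeriv^[i] (w ξ) z) {0}ᶜ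
  holomorphic : ∀ ξ ≠ 0, DifferentiableOn ℂ (w ξ) rightHalfPlane
  bound : ∀ i ≤ 1, ∀ (k : ℕ) (j : Fin k → Fin n), ∀ ξ ≠ 0, ∀ z ∈ rightHalfPlane,
    ‖iteratedFDeriv ℝ k (fun ξ => eulerDeriv^[i] (w ξ) z) ξ
        (fun l => EuclideanSpace.single (j l) 1)‖
      ≤ A k * (‖z‖ ^ (1 / 2 : ℝ) + ‖ξ‖) ^ (r - k)

/-! ## The boundary operators -/

/-- `∫ e^{-i x'·ξ'} u(x') dx'`. -/
def tanFourier {n : ℕ} (u : Tan n → ℂ) (ξ : Tan n) : ℂ :=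
  ∫ x, Complex.exp (-Complex.I * (inner ℝ x ξ : ℝ)) * u x

/-- `(2π)^{-(N-1)} ∫ e^{i x'·ξ'} v(ξ') dξ'`. -/
def tanFourierInv {n : ℕ} (v : Tan n → ℂ) (x : Tan n) : ℂ :=
  (1 / (2 * Real.pi) ^ n : ℝ) * ∫ ξ, Complex.exp (Complex.I * (inner ℝ x ξ : ℝ)) * v ξ

/-- `h = F^{-1}[σ ĝ]` in the sense of distributions on `ℝ^{N-1}`: for every Schwartz function `φ`,
`⟨h, φ⟩ = ⟨g, F[σ F^{-1} φ]⟩`, all integrals being absolutely convergent. -/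
def IsFourierMultiplier {n : ℕ} (σ g h : Tan n → ℂ) : Prop :=
  ∀ φ : 𝓢(Tan n, ℂ),
    Integrable (fun ξ => σ ξ * tanFourierInv φ ξ) ∧
    Integrable (fun x => h x * φ x) ∧
    Integrable (fun y => g y * tanFourier (fun ξ => σ ξ * tanFourierInv φ ξ) y) ∧
    ∫ x, h x * φ x = ∫ y, g y * tanFourier (fun ξ => σ ξ * tanFourierInv φ ξ) y

/-- `g ∈ L_q(ℝ^{N-1})` is the boundary trace `f(·, 0)` of `f ∈ H_q^2`: for all `φ ∈ C_c^∞(ℝ^N)`,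
`∫ (∂_N φ) f dx = - ∫ φ ∂_N f dx - ∫ φ(x', 0) g(x') dx'`, where `x_N > 0` in the first two
integrals. -/
def IsTrace {n : ℕ} {q : ℝ≥0∞} [Fact (1 ≤ q)] (f : sobolev n q 2)
    (g : Lp ℂ q (volume : Measure (Tan n))) : Prop :=
  ∀ φ : Space n → ℂ, IsTest φ →
    ∫ x in halfSpace n, partialDeriv (fun _ : Fin 1 => Fin.last n) φ x * toLq f x
      = -(∫ x in halfSpace n, φ x * weakGrad n q 1 (by norm_num) f (fun _ => Fin.last n) x)
        - ∫ x' : Tan n, φ (x', 0) * g x'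

/-- `w(ξ', z) x_N e^{-√(|ξ'|² + a z) x_N}`, with the square root of positive real part. -/
def boundarySymbol {n : ℕ} (w : Tan n → ℂ → ℂ) (a : ℝ) (z : ℂ) (t : ℝ) (ξ : Tan n) : ℂ :=
  w ξ z * t * Complex.exp (-(((‖ξ‖ ^ 2 : ℝ) : ℂ) + a * z) ^ (1 / 2 : ℂ) * t)

/-- `u = W(z) f`, where
`[W(z) f](x) = F^{-1}[w(ξ', z) x_N e^{-√(|ξ'|² + a z) x_N} f̂(ξ', 0)](x')`
and `f̂(·, 0)` is the Fourier transform of the trace of `f`. -/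
def IsBoundaryOperatorValue {n : ℕ} {q : ℝ≥0∞} [Fact (1 ≤ q)] (w : Tan n → ℂ → ℂ) (a : ℝ)
    (z : ℂ) (f : sobolev n q 2) (u : Lq n q) : Prop :=
  ∃ g : Lp ℂ q (volume : Measure (Tan n)), IsTrace f g ∧
    ∀ᵐ t ∂((volume : Measure ℝ).restrict (Ioi 0)),
      IsFourierMultiplier (boundarySymbol w a z t) g (fun x' => u (x', t))

/-! ## `R`-boundedness -/

/-- Independent, symmetric, `{-1, 1}`-valued random variables on `[0, 1]`. -/
structure IsRademacher {m : ℕ} (ρ : Fin m → unitInterval → ℝ) : Prop where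
  measurable : ∀ j, Measurable (ρ j)
  values : ∀ j u, ρ j u = -1 ∨ ρ j u = 1
  symmetric : ∀ j, IdentDistrib (ρ j) (fun u => -ρ j u)
  indep : iIndepFun ρ

/-- The family `𝒯` is `R`-bounded with exponent `p` and constant `C`. -/
def IsRBoundedWith {X Y : Type*} [NormedAddCommGroup X] [NormedSpace ℂ X]
    [NormedAddCommGroup Y] [NormedSpace ℂ Y] (p C : ℝ) (𝒯 : Set (X →L[ℂ] Y)) : Prop :=
  ∀ (m : ℕ) (T : Fin m → X →L[ℂ] Y) (f : Fin m → X) (ρ : Fin m → unitInterval → ℝ),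
    (∀ j, T j ∈ 𝒯) → IsRademacher ρ →
    (∫ u, ‖∑ j, (ρ j u : ℂ) • T j (f j)‖ ^ p) ^ (1 / p)
      ≤ C * (∫ u, ‖∑ j, (ρ j u : ℂ) • f j‖ ^ p) ^ (1 / p)

end

open Complex (abs_re_le_norm abs_im_le_norm normSq_eq_norm_sq normSq_apply norm_real measurable_ofReal log mul_im
  mul_re slitPlane mem_slitPlane_iff slitPlane_ne_zero add_re ofReal_re ofReal_im ofReal_pow norm_two ofReal_zero
  ofRealCLM I exp_add sub_re re_le_norm continuous_ofReal ofReal_one I_sq ofReal_sub I_re I_im add_im norm_I im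
  sub_im arg re_add_im norm_cpow_real real_smul exp_zero ofReal_exp re)
open ENNReal (ofReal_mul rpow_mul rpow_le_rpow rpow_one ofReal ofReal_ne_top toReal_ofReal toReal_mono toReal_pos
  ofReal_rpow_of_nonneg ofReal_toReal ofReal_le_ofReal toReal_nonneg coe_le_coe ofReal_lt_top mul_ne_top
  lintegral_mul_le_Lp_mul_Lq mul_rpow_of_nonneg rpow_ne_top_of_nonneg toReal_one one_ne_top mul_lt_top
  rpow_lt_top_of_nonneg HolderConjugate toReal_strict_mono)
open Real (norm_of_nonneg exp_pos exp_le_exp cosh rpow_natCast zero_rpow sq_sqrt sqrt_nonneg sqrt_eq_rpow mul_rpow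
  norm_eq_abs rpow_nonneg rpow_neg rpow_add sqrt_pos pi_gt_three exp_le_one_iff sqrt smoothTransition inv_rpow
  pi_ne_zero pi_pos cos sin)
open Finset (sum_div sum_nonneg sum_congr sum_le_sum sum_add_distrib sum_mul smul_sum mul_sum)
open ContinuousLinearMap (mul_apply' single comp_apply proj comp_smul snd fst smulRightL coe_snd' comp_finsetSum
  comp_zero smul_comp zero_comp)
open Function (uncurry iterate_one)
open WithLp (toLp)
open EuclideanSpace (norm_eq basisFun norm_sq_eq)
open HasCompactSupport (mul_right)
open MeasurableEquiv (funUnique)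
open Metric (ball mem_ball isOpen_ball)
open Prod (fst_add smul_fst snd_add smul_snd)
open Real (exp)
open scoped Real

noncomputable section

local notation "ℂ₊" => rightHalfPlane

local notation "𝐞(" x "," y ")" => Complex.exp (Complex.I * (inner ℝ x y : ℝ))

/-- Symbols on the half-space, functions of the tangential frequency, the spectral parameter and the
normal variable. -/
abbrev Symb (n : ℕ) := Tan n → ℂ → ℝ → ℂ

section
variable {m : ℕ} {ρ : Fin m → unitInterval → ℝ}

lemma holderConjugate_conjExponent {q : ℝ≥0∞} (hq1 : 1 < q) (hq2 : q ≠ ⊤) :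
    1 < q.conjExponent ∧ q.conjExponent ≠ ⊤ ∧ q.conjExponent.HolderConjugate q :=
  have : Fact (1 ≤ q) := ⟨hq1.le⟩
  have : q.conjExponent.HolderConjugate q := HolderConjugate.symm
  ⟨(HolderConjugate.lt_top_iff_one_lt q _).1 hq2.lt_top, ((HolderConjugate.lt_top_iff_one_lt _ q).2 hq1).ne, this⟩

lemma inv_pow_le_mul_inv_pow {a b c : ℝ} (ha : 0 < a) (hb : 0 < b) (h : b ≤ c * a) (k : ℕ) :
    (a ^ k)⁻¹ ≤ c ^ k * (b ^ k)⁻¹ := by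
  rw [← div_eq_mul_inv, inv_eq_one_div, div_le_div_iff₀ (by positivity) (by positivity), one_mul, ← mul_pow]
  gcongr

lemma inv_pi_mul_le {x : ℝ} (hx : 0 ≤ x) : 1 / π * x ≤ x :=
  mul_le_of_le_one_left hx (by rw [div_le_one pi_pos]; linarith [pi_gt_three])

lemma Real.HolderConjugate.mul_le_add {p q a b : ℝ} (h : p.HolderConjugate q) (ha : 0 ≤ a) (hb : 0 ≤ b) :
    a * b ≤ a ^ p + b ^ q :=
  (Real.young_inequality_of_nonneg ha hb h).trans
    (add_le_add (div_le_self (by positivity) h.lt.le) (div_le_self (by positivity) h.symm.lt.le))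

lemma one_lt_toReal {p : ℝ≥0∞} (hp1 : 1 < p) (hp2 : p ≠ ⊤) : 1 < p.toReal := by
  rw [← toReal_one]
  exact toReal_strict_mono hp2 hp1

/-! ## Khintchine's inequality -/

lemma IsRademacher.abs_eq (h : IsRademacher ρ) (j : Fin m) (u : unitInterval) : |ρ j u| = 1 := by
  rcases h.values j u with h | h <;> simp [h]

lemma IsRademacher.integral_eq_zero (h : IsRademacher ρ) (j : Fin m) : ∫ u, ρ j u = 0 := by
  have := (h.symmetric j).integral_eq
  rw [integral_neg] at this
  linarith

lemma IsRademacher.mgf_le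
    (h : IsRademacher ρ) (j : Fin m) (c : ℝ) : ∫ u, exp (c * ρ j u) ≤ exp (c ^ 2 / 2) := by
  have hint : ∀ c : ℝ, Integrable (fun u => exp (c * ρ j u)) := by
    intro c
    refine Integrable.of_bound (C := exp |c|)
      ((h.measurable j).const_mul c).exp.aestronglyMeasurable (.of_forall ?_)
    intro u
    rw [norm_of_nonneg (exp_pos _).le]
    refine exp_le_exp.2 ((le_abs_self _).trans ?_)
    rw [abs_mul, h.abs_eq, mul_one]
  have h1 : ∫ u, exp (c * ρ j u) = ∫ u, exp (-c * ρ j u) := by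
    have := ((h.symmetric j).comp (u := fun x => exp (c * x)) (by fun_prop)).integral_eq
    simpa [Function.comp_def] using this
  have h2 : ∫ u, exp (c * ρ j u) = cosh c := by
    have h3 : (∫ u, exp (c * ρ j u)) + ∫ u, exp (-c * ρ j u) = 2 * cosh c := by
      rw [← integral_add (hint _) (hint _)]
      rw [integral_congr_ae (g := fun _ => 2 * cosh c)]
      · simp
      · refine .of_forall fun u => ?_
        rcases h.values j u with h | h <;> simp only [h, Real.cosh_eq] <;> ring_nf
    linarith
  rw [h2]
  exact Real.cosh_le_exp_half_sq c

lemma IsRademacher.integrable_of_continuous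
    (h : IsRademacher ρ) {E : Type*} [NormedAddCommGroup E] {F : (Fin m → ℝ) → E}
    (hF : Continuous F) : Integrable (fun u => F (fun j => ρ j u)) := by
  have hK : IsCompact (Set.pi univ fun _ : Fin m => Icc (-1 : ℝ) 1) := isCompact_univ_pi fun _ => isCompact_Icc
  obtain ⟨C, hC⟩ := (hK.image hF).isBounded.exists_norm_le
  have hm : Measurable fun u j => ρ j u := measurable_pi_lambda _ h.measurable
  refine Integrable.of_bound (C := C)
    (hF.stronglyMeasurable.comp_measurable hm).aestronglyMeasurable (.of_forall ?_)
  intro u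
  refine hC _ ⟨_, ?_, rfl⟩
  intro j _
  exact abs_le.1 (h.abs_eq j u).le

lemma rpow_le_mul_exp (p : ℝ) : ∃ K : ℝ, 0 < K ∧ ∀ x : ℝ, 0 ≤ x → x ^ p ≤ K * exp x ∨ p < 0 := by
  rcases lt_or_ge p 0 with hp | hp
  · exact ⟨1, one_pos, fun x _ => Or.inr hp⟩
  refine ⟨1 + (⌈p⌉₊.factorial : ℝ), by positivity, fun x hx => Or.inl ?_⟩
  have h1 : x ^ ⌈p⌉₊ ≤ ⌈p⌉₊.factorial * exp x := by
    have := Real.pow_div_factorial_le_exp x hx ⌈p⌉₊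
    rwa [div_le_iff₀ (by positivity), mul_comm] at this
  have h2 : 1 ≤ exp x := Real.one_le_exp hx
  rcases le_total x 1 with h | h
  · have : x ^ p ≤ 1 := Real.rpow_le_one hx h hp
    nlinarith [pow_nonneg hx ⌈p⌉₊]
  · have : x ^ p ≤ x ^ ⌈p⌉₊ := by
      rw [← rpow_natCast]
      exact Real.rpow_le_rpow_of_exponent_le h (Nat.le_ceil p)
    nlinarith

lemma khintchine_upper_real (p : ℝ) (hp : 0 < p) : ∃ K : ℝ, 0 < K ∧
    ∀ (m : ℕ) (ρ : Fin m → unitInterval → ℝ), IsRademacher ρ → ∀ c : Fin m → ℝ,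
      ∫ u, |∑ j, ρ j u * c j| ^ p ≤ K * (∑ j, c j ^ 2) ^ (p / 2) := by
  obtain ⟨K, hK, hKx⟩ := rpow_le_mul_exp p
  have hKx' : ∀ x : ℝ, 0 ≤ x → x ^ p ≤ K * exp x := fun x hx =>
    (hKx x hx).resolve_right (not_lt.2 hp.le)
  refine ⟨K * (2 * exp (1 / 2)), by positivity, fun m ρ h c => ?_⟩
  -- the exponential moment
  have hexp : ∀ c : Fin m → ℝ, ∫ u, exp (∑ j, ρ j u * c j) ≤ exp ((∑ j, c j ^ 2) / 2) := by
    intro c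
    have hind : iIndepFun (fun j u => c j * ρ j u) volume := h.indep.comp (fun j x => c j * x) (fun j => by fun_prop)
    have h1 := hind.mgf_sum (t := 1) (fun j => (h.measurable j).const_mul _) Finset.univ
    have h2 : mgf (∑ j, fun u => c j * ρ j u) volume 1 = ∫ u, exp (∑ j, ρ j u * c j) := by simp [mgf, mul_comm]
    rw [← h2, h1, sum_div, Real.exp_sum]
    refine Finset.prod_le_prod (fun j _ => mgf_nonneg) fun j _ => ?_
    simpa [mgf] using h.mgf_le j (c j)
  have hnorm : ∀ c : Fin m → ℝ, ∑ j, c j ^ 2 = 1 → ∫ u, |∑ j, ρ j u * c j| ^ p ≤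
      K * (2 * exp (1 / 2)) := by
    intro c hc
    have hi1 : Integrable fun u => exp (∑ j, ρ j u * c j) :=
      h.integrable_of_continuous (F := fun r => exp (∑ j, r j * c j)) (by fun_prop)
    have hi2 : Integrable fun u => exp (∑ j, ρ j u * (-c j)) :=
      h.integrable_of_continuous (F := fun r => exp (∑ j, r j * (-c j))) (by fun_prop)
    have h1 := hexp c
    have h2 := hexp (fun j => -c j)
    simp only [neg_sq, hc] at h1 h2
    calc ∫ u, |∑ j, ρ j u * c j| ^ p
        ≤ ∫ u, K * (exp (∑ j, ρ j u * c j) + exp (∑ j, ρ j u * (-c j))) := by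
          refine integral_mono_of_nonneg (.of_forall fun u => by positivity)
            ((hi1.add hi2).const_mul K) (.of_forall fun u => ?_)
          refine (hKx' _ (abs_nonneg _)).trans ?_
          refine mul_le_mul_of_nonneg_left ?_ hK.le
          have : ∑ j, ρ j u * (-c j) = - ∑ j, ρ j u * c j := by simp
          rw [this]
          exact Real.exp_abs_le _
      _ = K * ((∫ u, exp (∑ j, ρ j u * c j)) + ∫ u, exp (∑ j, ρ j u * (-c j))) := by
          rw [integral_const_mul, integral_add hi1 hi2]
      _ ≤ _ := by
          refine mul_le_mul_of_nonneg_left ?_ hK.le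
          linarith
  set σ := ∑ j, c j ^ 2 with hσ
  have hσ0 : 0 ≤ σ := sum_nonneg fun j _ => sq_nonneg _
  rcases hσ0.eq_or_lt with h0 | h0
  · have hc : ∀ j, c j = 0 := by
      intro j
      have := (Finset.sum_eq_zero_iff_of_nonneg (fun j _ => sq_nonneg (c j))).1 (hσ ▸ h0.symm) j
        (Finset.mem_univ j)
      simpa using this
    simp only [hc, mul_zero, Finset.sum_const_zero, abs_zero, zero_rpow hp.ne', integral_zero]
    positivity
  · have h1 := hnorm (fun j => c j / √σ) (by
      simp only [div_pow, sq_sqrt hσ0]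
      rw [← sum_div, ← hσ, div_self h0.ne'])
    have h2 : ∀ u, |∑ j, ρ j u * (c j / √σ)| ^ p = |∑ j, ρ j u * c j| ^ p / σ ^ (p / 2) := by
      intro u
      have : ∑ j, ρ j u * (c j / √σ) = (∑ j, ρ j u * c j) / √σ := by
        rw [sum_div]; exact sum_congr rfl fun j _ => by ring
      rw [this, abs_div, abs_of_nonneg (sqrt_nonneg _),
        Real.div_rpow (abs_nonneg _) (sqrt_nonneg _), sqrt_eq_rpow, ← Real.rpow_mul hσ0]
      congr 2; ring
    simp only [h2] at h1
    rw [integral_div, div_le_iff₀ (by positivity)] at h1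
    exact h1

lemma khintchine_upper (p : ℝ) (hp : 0 < p) : ∃ K : ℝ, 0 < K ∧
    ∀ (m : ℕ) (ρ : Fin m → unitInterval → ℝ), IsRademacher ρ → ∀ c : Fin m → ℂ,
      ∫ u, ‖∑ j, (ρ j u : ℂ) * c j‖ ^ p ≤ K * (∑ j, ‖c j‖ ^ 2) ^ (p / 2) := by
  obtain ⟨K, hK, h⟩ := khintchine_upper_real p hp
  refine ⟨2 ^ p * (2 * K), by positivity, fun m ρ hρ c => ?_⟩
  have h1 := h m ρ hρ fun j => (c j).re
  have h2 := h m ρ hρ fun j => (c j).im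
  have e1 : ∑ j, (c j).re ^ 2 ≤ ∑ j, ‖c j‖ ^ 2 := sum_le_sum fun j _ => by
    rw [← sq_abs (c j).re]; exact pow_le_pow_left₀ (abs_nonneg _) (abs_re_le_norm _) 2
  have e2 : ∑ j, (c j).im ^ 2 ≤ ∑ j, ‖c j‖ ^ 2 := sum_le_sum fun j _ => by
    rw [← sq_abs (c j).im]; exact pow_le_pow_left₀ (abs_nonneg _) (abs_im_le_norm _) 2
  have e3 := Real.rpow_le_rpow (sum_nonneg fun j _ => sq_nonneg _) e1 (by positivity : 0 ≤ p / 2)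
  have e4 := Real.rpow_le_rpow (sum_nonneg fun j _ => sq_nonneg _) e2 (by positivity : 0 ≤ p / 2)
  have hc : Continuous fun x : ℝ => |x| ^ p := continuous_abs.rpow_const fun x => Or.inr hp.le
  have i1 : Integrable fun u => |∑ j, ρ j u * (c j).re| ^ p :=
    hρ.integrable_of_continuous (F := fun r => |∑ j, r j * (c j).re| ^ p) (hc.comp (by fun_prop))
  have i2 : Integrable fun u => |∑ j, ρ j u * (c j).im| ^ p :=
    hρ.integrable_of_continuous (F := fun r => |∑ j, r j * (c j).im| ^ p) (hc.comp (by fun_prop))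
  have key : ∀ u, ‖∑ j, (ρ j u : ℂ) * c j‖ ^ p ≤
      2 ^ p * (|∑ j, ρ j u * (c j).re| ^ p + |∑ j, ρ j u * (c j).im| ^ p) := by
    intro u
    set X := ∑ j, (ρ j u : ℂ) * c j with hX
    have hre : X.re = ∑ j, ρ j u * (c j).re := by simp [hX]
    have him : X.im = ∑ j, ρ j u * (c j).im := by simp [hX]
    rw [← hre, ← him]
    have hn : ‖X‖ ≤ 2 * max |X.re| |X.im| := by
      refine (Complex.norm_le_abs_re_add_abs_im X).trans ?_
      linarith [le_max_left |X.re| |X.im|, le_max_right |X.re| |X.im|]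
    refine (Real.rpow_le_rpow (norm_nonneg _) hn hp.le).trans ?_
    rw [mul_rpow (by norm_num) (by positivity)]
    refine mul_le_mul_of_nonneg_left ?_ (by positivity)
    have a1 : 0 ≤ |X.re| ^ p := by positivity
    have a2 : 0 ≤ |X.im| ^ p := by positivity
    rcases max_choice |X.re| |X.im| with h | h <;> rw [h] <;> linarith
  calc ∫ u, ‖∑ j, (ρ j u : ℂ) * c j‖ ^ p
      ≤ ∫ u, 2 ^ p * (|∑ j, ρ j u * (c j).re| ^ p + |∑ j, ρ j u * (c j).im| ^ p) :=
        integral_mono_of_nonneg (.of_forall fun u => by positivity)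
          ((i1.add i2).const_mul _) (.of_forall key)
    _ = 2 ^ p * ((∫ u, |∑ j, ρ j u * (c j).re| ^ p) + ∫ u, |∑ j, ρ j u * (c j).im| ^ p) := by
        rw [integral_const_mul, integral_add i1 i2]
    _ ≤ 2 ^ p * (2 * K) * (∑ j, ‖c j‖ ^ 2) ^ (p / 2) := by
        rw [mul_assoc]
        refine mul_le_mul_of_nonneg_left ?_ (by positivity)
        nlinarith

lemma IsRademacher.integral_mul
    (h : IsRademacher ρ) (i j : Fin m) : ∫ u, ρ i u * ρ j u = if i = j then 1 else 0 := by
  split_ifs with hij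
  · subst hij
    have : ∀ u, ρ i u * ρ i u = 1 := fun u => by rcases h.values i u with h | h <;> simp [h]
    simp [this]
  · rw [(h.indep.indepFun hij).integral_fun_mul_eq_mul_integral
      (h.measurable i).aestronglyMeasurable (h.measurable j).aestronglyMeasurable,
      h.integral_eq_zero, zero_mul]

lemma IsRademacher.integral_norm_sq (h : IsRademacher ρ) (c : Fin m → ℂ) :
    ∫ u, ‖∑ j, (ρ j u : ℂ) * c j‖ ^ 2 = ∑ j, ‖c j‖ ^ 2 := by
  have hreal : ∀ c : Fin m → ℝ, ∫ u, (∑ j, ρ j u * c j) ^ 2 = ∑ j, c j ^ 2 := by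
    intro c
    have : ∀ u, (∑ j, ρ j u * c j) ^ 2 = ∑ i, ∑ j, (c i * c j) * (ρ i u * ρ j u) := by
      intro u
      rw [sq, Finset.sum_mul_sum]
      exact sum_congr rfl fun i _ => sum_congr rfl fun j _ => by ring
    simp only [this]
    have hi : ∀ i j, Integrable fun u => (c i * c j) * (ρ i u * ρ j u) := fun i j =>
      h.integrable_of_continuous (F := fun r => (c i * c j) * (r i * r j)) (by fun_prop)
    rw [integral_finsetSum _ fun i _ => integrable_finsetSum _ fun j _ => hi i j]
    refine sum_congr rfl fun i _ => ?_
    rw [integral_finsetSum _ fun j _ => hi i j]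
    simp only [integral_const_mul, h.integral_mul]
    simp [sq]
  have h1 : ∀ u, ‖∑ j, (ρ j u : ℂ) * c j‖ ^ 2 =
      (∑ j, ρ j u * (c j).re) ^ 2 + (∑ j, ρ j u * (c j).im) ^ 2 := by
    intro u
    rw [← normSq_eq_norm_sq, normSq_apply]
    simp [sq]
  simp only [h1]
  rw [integral_add, hreal, hreal, ← sum_add_distrib]
  · refine sum_congr rfl fun j _ => ?_
    rw [← normSq_eq_norm_sq, normSq_apply]; ring
  · exact h.integrable_of_continuous (F := fun r => (∑ j, r j * (c j).re) ^ 2) (by fun_prop)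
  · exact h.integrable_of_continuous (F := fun r => (∑ j, r j * (c j).im) ^ 2) (by fun_prop)

lemma khintchine_lower (p : ℝ) (hp : 0 < p) : ∃ K : ℝ, 0 < K ∧
    ∀ (m : ℕ) (ρ : Fin m → unitInterval → ℝ), IsRademacher ρ → ∀ c : Fin m → ℂ,
      (∑ j, ‖c j‖ ^ 2) ^ (p / 2) ≤ K * ∫ u, ‖∑ j, (ρ j u : ℂ) * c j‖ ^ p := by
  obtain ⟨C4, hC4, h4⟩ := khintchine_upper 4 (by norm_num)
  set L := 4 * C4 * 2 ^ p with hL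
  have hLpos : 0 < L := by positivity
  refine ⟨2 * L, by positivity, fun m ρ h c => ?_⟩
  have elem : ∀ x : ℝ, 0 ≤ x → x ^ 2 ≤ 1 / 4 + L * x ^ p + x ^ (4 : ℝ) / (4 * C4) := by
    intro x hx
    have hx4 : x ^ (4 : ℝ) = (x ^ 2) ^ 2 := by rw [show (4 : ℝ) = (4 : ℕ) by norm_num, rpow_natCast]; ring
    rw [hx4]
    have a : 0 ≤ L * x ^ p := by positivity
    have b : 0 ≤ (x ^ 2) ^ 2 / (4 * C4) := by positivity
    rcases le_total x (1 / 2) with h1 | h1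
    · nlinarith
    rcases le_total (x ^ 2) (4 * C4) with h2 | h2
    · have : 1 ≤ 2 ^ p * x ^ p := by
        rw [← mul_rpow (by norm_num) hx]
        exact Real.one_le_rpow (by linarith) hp.le
      have : 4 * C4 ≤ L * x ^ p := by rw [hL]; nlinarith
      linarith
    · have : x ^ 2 ≤ (x ^ 2) ^ 2 / (4 * C4) := by rw [le_div_iff₀ (by positivity)]; nlinarith [sq_nonneg x]
      linarith
  have hnorm : ∀ c : Fin m → ℂ, ∑ j, ‖c j‖ ^ 2 = 1 → 1 ≤ 2 * L * ∫ u, ‖∑ j, (ρ j u : ℂ) * c j‖ ^ p := by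
    intro c hc
    have e2 := h.integral_norm_sq c
    have e4 := h4 m ρ h c
    rw [hc] at e2 e4
    rw [Real.one_rpow, mul_one] at e4
    have ip : ∀ p : ℝ, 0 < p → Integrable fun u => ‖∑ j, (ρ j u : ℂ) * c j‖ ^ p := fun p hp =>
      h.integrable_of_continuous (F := fun r => ‖∑ j, (r j : ℂ) * c j‖ ^ p)
        ((by fun_prop : Continuous fun r : Fin m → ℝ => ‖∑ j, (r j : ℂ) * c j‖).rpow_const
          fun x => Or.inr hp.le)
    have : (1 : ℝ) ≤ 1 / 4 + L * (∫ u, ‖∑ j, (ρ j u : ℂ) * c j‖ ^ p) +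
        (∫ u, ‖∑ j, (ρ j u : ℂ) * c j‖ ^ (4 : ℝ)) / (4 * C4) := by
      have hm : ∫ u, ‖∑ j, (ρ j u : ℂ) * c j‖ ^ 2 ≤ ∫ u, (1 / 4 + L * ‖∑ j, (ρ j u : ℂ) * c j‖ ^ p +
          ‖∑ j, (ρ j u : ℂ) * c j‖ ^ (4 : ℝ) / (4 * C4)) :=
        integral_mono_of_nonneg (.of_forall fun u => by positivity)
          (((integrable_const _).add ((ip p hp).const_mul L)).add ((ip 4 (by norm_num)).div_const _))
          (.of_forall fun u => elem _ (norm_nonneg _))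
      have hi : Integrable fun u => (1 / 4 : ℝ) + L * ‖∑ j, (ρ j u : ℂ) * c j‖ ^ p :=
        (integrable_const _).add ((ip p hp).const_mul L)
      rw [integral_add hi ((ip 4 (by norm_num)).div_const _), integral_add (integrable_const _)
          ((ip p hp).const_mul L), integral_const_mul,
        integral_div (4 * C4) fun u => ‖∑ j, (ρ j u : ℂ) * c j‖ ^ (4 : ℝ), e2] at hm
      simpa using hm
    have h5 : (∫ u, ‖∑ j, (ρ j u : ℂ) * c j‖ ^ (4 : ℝ)) / (4 * C4) ≤ 1 / 4 := by
      rw [div_le_iff₀ (by positivity)]; linarith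
    linarith
  set σ := ∑ j, ‖c j‖ ^ 2 with hσ
  have hσ0 : 0 ≤ σ := sum_nonneg fun j _ => sq_nonneg _
  rcases hσ0.eq_or_lt with h0 | h0
  · rw [← h0, zero_rpow (by positivity)]
    exact mul_nonneg (by positivity) (integral_nonneg fun u => by positivity)
  · have h1 := hnorm (fun j => c j / (√σ : ℝ)) (by
      simp only [norm_div, div_pow, norm_real, norm_of_nonneg (sqrt_nonneg σ), sq_sqrt hσ0]
      rw [← sum_div, ← hσ, div_self h0.ne'])
    have h2 : ∀ u, ‖∑ j, (ρ j u : ℂ) * (c j / (√σ : ℝ))‖ ^ p =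
        ‖∑ j, (ρ j u : ℂ) * c j‖ ^ p / σ ^ (p / 2) := by
      intro u
      have : ∑ j, (ρ j u : ℂ) * (c j / (√σ : ℝ)) = (∑ j, (ρ j u : ℂ) * c j) / (√σ : ℝ) := by
        rw [sum_div]; exact sum_congr rfl fun j _ => by ring
      rw [this, norm_div, norm_real, norm_of_nonneg (sqrt_nonneg σ),
        Real.div_rpow (norm_nonneg _) (sqrt_nonneg _), sqrt_eq_rpow, ← Real.rpow_mul hσ0]
      congr 2; ring
    simp only [h2] at h1
    rw [integral_div, ← mul_div_assoc, le_div_iff₀ (by positivity), one_mul] at h1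
    exact h1

/-! ## Calculus of `R`-bounded families -/

end

section RBounded
variable {X Y : Type*} [NormedAddCommGroup X] [NormedSpace ℂ X]
    [NormedAddCommGroup Y] [NormedSpace ℂ Y]
variable {m : ℕ} {ρ : Fin m → unitInterval → ℝ} {p C : ℝ} {𝒯 : Set (X →L[ℂ] Y)}

lemma IsRademacher.integrable_norm_rpow (h : IsRademacher ρ) (hp : 0 ≤ p) (f : Fin m → X) :
    Integrable fun u => ‖∑ j, (ρ j u : ℂ) • f j‖ ^ p :=
  h.integrable_of_continuous (F := fun r => ‖∑ j, (r j : ℂ) • f j‖ ^ p)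
    ((by fun_prop : Continuous fun r : Fin m → ℝ => ‖∑ j, (r j : ℂ) • f j‖).rpow_const
      fun x => Or.inr hp)

lemma IsRademacher.memLp (h : IsRademacher ρ) (p : ℝ≥0∞) (f : Fin m → X) :
    MemLp (fun u => ∑ j, (ρ j u : ℂ) • f j) p := by
  have hm : AEStronglyMeasurable (fun u => ∑ j, (ρ j u : ℂ) • f j) :=
    (h.integrable_of_continuous (F := fun r => ∑ j, (r j : ℂ) • f j) (by fun_prop)).aestronglyMeasurable
  refine MemLp.of_bound hm (∑ j, ‖f j‖) (.of_forall fun u => ?_)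
  refine (norm_sum_le _ _).trans (sum_le_sum fun j _ => ?_)
  rw [norm_smul, norm_real, norm_eq_abs, h.abs_eq, one_mul]

lemma IsRademacher.rpow_integral_eq (h : IsRademacher ρ) (hp : 0 < p) (f : Fin m → X) :
    (∫ u, ‖∑ j, (ρ j u : ℂ) • f j‖ ^ p) ^ (1 / p) =
      (eLpNorm (fun u => ∑ j, (ρ j u : ℂ) • f j) (ofReal p) volume).toReal := by
  rw [(h.memLp _ f).eLpNorm_eq_integral_rpow_norm (by simpa using hp) ofReal_ne_top,
    toReal_ofReal (by positivity), toReal_ofReal hp.le, one_div]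

lemma IsRBoundedWith.mono {C' : ℝ} {𝒯' : Set (X →L[ℂ] Y)} (h : IsRBoundedWith p C 𝒯)
    (hC : C ≤ C') (hT : 𝒯' ⊆ 𝒯) : IsRBoundedWith p C' 𝒯' := by
  intro m T f ρ hm hρ
  refine (h m T f ρ (fun j => hT (hm j)) hρ).trans (mul_le_mul_of_nonneg_right hC ?_)
  exact rpow_nonneg (integral_nonneg fun u => by positivity) _

lemma IsRademacher.rpow_integral_map_le (hp : 0 < p) (L : X →L[ℂ] Y) (hρ : IsRademacher ρ) (f : Fin m → X) :
    (∫ u, ‖∑ j, (ρ j u : ℂ) • L (f j)‖ ^ p) ^ (1 / p) ≤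
      ‖L‖ * (∫ u, ‖∑ j, (ρ j u : ℂ) • f j‖ ^ p) ^ (1 / p) := by
  have h0 : 0 ≤ ∫ u, ‖∑ j, (ρ j u : ℂ) • f j‖ ^ p := integral_nonneg fun u => by positivity
  have e : ‖L‖ * (∫ u, ‖∑ j, (ρ j u : ℂ) • f j‖ ^ p) ^ (1 / p) =
      (‖L‖ ^ p * ∫ u, ‖∑ j, (ρ j u : ℂ) • f j‖ ^ p) ^ (1 / p) := by
    rw [mul_rpow (by positivity) h0, ← Real.rpow_mul (norm_nonneg _), mul_one_div_cancel hp.ne', Real.rpow_one]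
  rw [e]
  refine Real.rpow_le_rpow (integral_nonneg fun u => by positivity) ?_ (by positivity)
  rw [← integral_const_mul]
  refine integral_mono_of_nonneg (.of_forall fun u => by positivity)
    ((hρ.integrable_norm_rpow hp.le f).const_mul _) (.of_forall fun u => ?_)
  have : ∑ j, (ρ j u : ℂ) • L (f j) = L (∑ j, (ρ j u : ℂ) • f j) := by simp
  simp only [this]
  rw [← mul_rpow (norm_nonneg _) (norm_nonneg _)]
  exact Real.rpow_le_rpow (norm_nonneg _) (L.le_opNorm _) hp.le

lemma IsRBoundedWith.comp {X' Y' : Type*} [NormedAddCommGroup X'] [NormedSpace ℂ X']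
    [NormedAddCommGroup Y'] [NormedSpace ℂ Y'] (hp : 0 < p) (hC : 0 ≤ C)
    (h : IsRBoundedWith p C 𝒯) (A : Y →L[ℂ] Y') (B : X' →L[ℂ] X) {𝒰 : Set (X' →L[ℂ] Y')}
    (hU : ∀ U ∈ 𝒰, ∃ T ∈ 𝒯, U = A.comp (T.comp B)) : IsRBoundedWith p (‖A‖ * C * ‖B‖) 𝒰 := by
  intro m U f ρ hm hρ
  choose T hT hUT using fun j => hU (U j) (hm j)
  have e : ∀ j, U j (f j) = A (T j (B (f j))) := fun j => by rw [hUT j]; rfl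
  simp only [e]
  calc _ ≤ ‖A‖ * (∫ u, ‖∑ j, (ρ j u : ℂ) • T j (B (f j))‖ ^ p) ^ (1 / p) := hρ.rpow_integral_map_le hp A _
    _ ≤ ‖A‖ * (C * (∫ u, ‖∑ j, (ρ j u : ℂ) • B (f j)‖ ^ p) ^ (1 / p)) := by gcongr; exact h m T _ ρ hT hρ
    _ ≤ ‖A‖ * (C * (‖B‖ * (∫ u, ‖∑ j, (ρ j u : ℂ) • f j‖ ^ p) ^ (1 / p))) := by
        gcongr; exact hρ.rpow_integral_map_le hp B _
    _ = _ := by ring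

lemma IsRBoundedWith.add {D : ℝ} (hp : 1 ≤ p) {𝒮 𝒰 : Set (X →L[ℂ] Y)}
    (h : IsRBoundedWith p C 𝒯) (h' : IsRBoundedWith p D 𝒮)
    (hU : ∀ U ∈ 𝒰, ∃ T ∈ 𝒯, ∃ S ∈ 𝒮, U = T + S) : IsRBoundedWith p (C + D) 𝒰 := by
  intro m U f ρ hm hρ
  choose T hT S hS hUT using fun j => hU (U j) (hm j)
  have hp0 : 0 < p := by linarith
  have h1 := h m T f ρ hT hρ
  have h2 := h' m S f ρ hS hρ
  rw [add_mul]
  refine le_trans ?_ (add_le_add h1 h2)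
  rw [hρ.rpow_integral_eq hp0, hρ.rpow_integral_eq hp0, hρ.rpow_integral_eq hp0]
  have e : (fun u => ∑ j, (ρ j u : ℂ) • U j (f j)) =
      (fun u => ∑ j, (ρ j u : ℂ) • T j (f j)) + fun u => ∑ j, (ρ j u : ℂ) • S j (f j) := by
    ext u
    simp [hUT, sum_add_distrib]
  rw [e, ← ENNReal.toReal_add (hρ.memLp _ _).eLpNorm_ne_top (hρ.memLp _ _).eLpNorm_ne_top]
  refine toReal_mono (ENNReal.add_ne_top.2 ⟨(hρ.memLp _ _).eLpNorm_ne_top, (hρ.memLp _ _).eLpNorm_ne_top⟩) ?_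
  exact eLpNorm_add_le (hρ.memLp 1 _).1 (hρ.memLp 1 _).1 (by simpa using hp)

lemma isRBoundedWith_zero (hp : 0 < p) : IsRBoundedWith p 0 {(0 : X →L[ℂ] Y)} := by
  intro m T f ρ hm hρ
  have : ∀ j, T j = 0 := fun j => by simpa using hm j
  simp [this, hp.ne']

lemma IsRBoundedWith.sum {ι : Type*} (hp : 1 ≤ p) (s : Finset ι) {C : ι → ℝ}
    {𝒯 : ι → Set (X →L[ℂ] Y)} (h : ∀ i ∈ s, IsRBoundedWith p (C i) (𝒯 i)) : ∀ {𝒰 : Set (X →L[ℂ] Y)},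
    (∀ U ∈ 𝒰, ∃ T : ι → X →L[ℂ] Y, (∀ i ∈ s, T i ∈ 𝒯 i) ∧ U = ∑ i ∈ s, T i) →
    IsRBoundedWith p (∑ i ∈ s, C i) 𝒰 := by
  classical
  induction s using Finset.induction_on with
  | empty =>
    intro 𝒰 hU
    refine (isRBoundedWith_zero (by linarith)).mono (by simp) fun U hm => ?_
    obtain ⟨T, -, rfl⟩ := hU U hm
    simp
  | insert i s hi ih =>
    intro 𝒰 hU
    rw [Finset.sum_insert hi]
    refine (h i (Finset.mem_insert_self _ _)).add hp
      (ih (fun j hj => h j (Finset.mem_insert_of_mem hj)) (𝒰 := {U | ∃ T : ι → X →L[ℂ] Y,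
        (∀ i ∈ s, T i ∈ 𝒯 i) ∧ U = ∑ i ∈ s, T i}) fun U hm => hm) fun U hm => ?_
    obtain ⟨T, hT, rfl⟩ := hU U hm
    exact ⟨T i, hT i (Finset.mem_insert_self _ _), ∑ j ∈ s, T j,
      ⟨T, fun j hj => hT j (Finset.mem_insert_of_mem hj), rfl⟩, Finset.sum_insert hi⟩

end RBounded

/-! ## `R`-boundedness of integral operators with a common majorant -/

section Majorant
variable {α : Type*} [MeasurableSpace α] {μ : Measure α} {q : ℝ≥0∞} [Fact (1 ≤ q)]
variable {m : ℕ}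

/-- The `q`-th power of the `L_q`-norm of the square function of `F`. -/
def squareFun (F : Fin m → Lp ℂ q μ) : ℝ≥0∞ :=
  ∫⁻ x, ‖toLp 2 (fun j => F j x)‖ₑ ^ q.toReal ∂μ

lemma toReal_exponent_pos (hq : q ≠ ⊤) : 0 < q.toReal :=
  toReal_pos (zero_lt_one.trans_le Fact.out).ne' hq

lemma ofReal_norm_Lp_rpow (hq : q ≠ ⊤) (f : Lp ℂ q μ) :
    ofReal (‖f‖ ^ q.toReal) = ∫⁻ x, ‖f x‖ₑ ^ q.toReal ∂μ := by
  have hq0 := toReal_exponent_pos hq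
  rw [← ofReal_rpow_of_nonneg (norm_nonneg _) hq0.le, Lp.norm_def, ofReal_toReal (Lp.eLpNorm_ne_top f),
    eLpNorm_eq_lintegral_rpow_enorm_toReal (zero_lt_one.trans_le Fact.out).ne' hq,
    ← rpow_mul, one_div, inv_mul_cancel₀ hq0.ne', rpow_one]

lemma ofReal_integral_rademacher [SFinite μ] (hq : q ≠ ⊤)
    {ρ : Fin m → unitInterval → ℝ} (hρ : IsRademacher ρ) (F : Fin m → Lp ℂ q μ) :
    ofReal (∫ u, ‖∑ j, (ρ j u : ℂ) • F j‖ ^ q.toReal) =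
      ∫⁻ x, ofReal (∫ u, ‖∑ j, (ρ j u : ℂ) * F j x‖ ^ q.toReal) ∂μ := by
  have hq0 := toReal_exponent_pos hq
  rw [ofReal_integral_eq_lintegral_ofReal (hρ.integrable_norm_rpow hq0.le F)
    (.of_forall fun u => by positivity)]
  have e : ∀ u, ofReal (‖∑ j, (ρ j u : ℂ) • F j‖ ^ q.toReal) =
      ∫⁻ x, ‖∑ j, (ρ j u : ℂ) * F j x‖ₑ ^ q.toReal ∂μ := by
    intro u
    rw [ofReal_norm_Lp_rpow hq]
    refine lintegral_congr_ae ?_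
    have h1 : ∀ j, ((ρ j u : ℂ) • F j : Lp ℂ q μ) =ᵐ[μ] fun x => (ρ j u : ℂ) * F j x := fun j =>
      Lp.coeFn_smul _ _
    have h2 : ((∑ j, (ρ j u : ℂ) • F j : Lp ℂ q μ) : α → ℂ) =ᵐ[μ]
        ∑ j, (((ρ j u : ℂ) • F j : Lp ℂ q μ) : α → ℂ) := Lp.coeFn_finsetSum _ _
    filter_upwards [h2, ae_all_iff.2 h1] with x h2 h1
    rw [h2, Finset.sum_apply]
    simp only [h1]
  simp only [e]
  rw [lintegral_lintegral_swap]
  · refine lintegral_congr fun x => ?_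
    have := hρ.integrable_norm_rpow hq0.le fun j => F j x
    simp only [smul_eq_mul] at this
    rw [ofReal_integral_eq_lintegral_ofReal this (.of_forall fun u => by positivity)]
    refine lintegral_congr fun u => ?_
    rw [← ofReal_rpow_of_nonneg (norm_nonneg _) hq0.le, ofReal_norm]
  · refine AEMeasurable.pow_const ?_ _
    refine AEStronglyMeasurable.enorm ?_
    have : ∀ j ∈ Finset.univ, AEStronglyMeasurable
        (fun z : unitInterval × α => (ρ j z.1 : ℂ) * F j z.2) (volume.prod μ) := fun j _ =>
      ((measurable_ofReal.comp (hρ.measurable j)).aestronglyMeasurable.comp_fst).mul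
        ((Lp.aestronglyMeasurable (F j)).comp_snd)
    simpa [Function.uncurry_def, Finset.sum_fn] using Finset.aestronglyMeasurable_sum _ this

lemma ofReal_sum_sq_rpow {p : ℝ} (hp : 0 < p) (c : Fin m → ℂ) :
    ofReal ((∑ j, ‖c j‖ ^ 2) ^ (p / 2)) = ‖toLp 2 c‖ₑ ^ p := by
  rw [← ofReal_norm, ofReal_rpow_of_nonneg (norm_nonneg _) hp.le, norm_eq,
    sqrt_eq_rpow, ← Real.rpow_mul (sum_nonneg fun j _ => sq_nonneg _)]
  congr 2; ring

lemma exists_rademacher_le_squareFun (hq : q ≠ ⊤) : ∃ K : ℝ, 0 < K ∧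
    ∀ (α : Type) [MeasurableSpace α] (μ : Measure α) [SFinite μ] (m : ℕ)
      (ρ : Fin m → unitInterval → ℝ), IsRademacher ρ → ∀ F : Fin m → Lp ℂ q μ,
      ofReal (∫ u, ‖∑ j, (ρ j u : ℂ) • F j‖ ^ q.toReal) ≤ ofReal K * squareFun F ∧
      squareFun F ≤ ofReal K * ofReal (∫ u, ‖∑ j, (ρ j u : ℂ) • F j‖ ^ q.toReal) := by
  have hq0 := toReal_exponent_pos hq
  obtain ⟨K, hK, h⟩ := khintchine_upper q.toReal hq0
  obtain ⟨L, hL, h'⟩ := khintchine_lower q.toReal hq0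
  refine ⟨max K L, lt_max_of_lt_left hK, fun α _ μ _ m ρ hρ F => ?_⟩
  rw [ofReal_integral_rademacher hq hρ, squareFun, ← lintegral_const_mul' _ _ ofReal_ne_top,
    ← lintegral_const_mul' _ _ ofReal_ne_top]
  constructor
  · refine lintegral_mono fun x => ?_
    simp only
    rw [← ofReal_sum_sq_rpow hq0, ← ofReal_mul (by positivity)]
    refine ofReal_le_ofReal ((h m ρ hρ _).trans ?_)
    gcongr
    exact le_max_left _ _
  · refine lintegral_mono fun x => ?_
    simp only
    rw [← ofReal_sum_sq_rpow hq0, ← ofReal_mul (by positivity)]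
    refine ofReal_le_ofReal ((h' m ρ hρ _).trans ?_)
    gcongr
    exact le_max_right _ _

/-- `T` is an integral operator whose kernel is bounded by `k0`. -/
def HasMajorant (k0 : α → α → ℝ≥0∞) (T : Lp ℂ q μ →L[ℂ] Lp ℂ q μ) : Prop :=
  ∃ k : α → α → ℂ, (∀ᵐ x ∂μ, AEStronglyMeasurable (k x) μ ∧ ∀ᵐ y ∂μ, ‖k x y‖ₑ ≤ k0 x y) ∧
    ∀ f : Lp ℂ q μ, ∀ᵐ x ∂μ, T f x = ∫ y, k x y * f y ∂μ

lemma squareFun_le_of_hasMajorant {k0 : α → α → ℝ≥0∞} {D : ℝ≥0∞} (hk₀ : ∀ g : α → ℝ≥0∞, AEMeasurable g μ →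
      ∫⁻ x, (∫⁻ y, k0 x y * g y ∂μ) ^ q.toReal ∂μ ≤ D * ∫⁻ x, g x ^ q.toReal ∂μ) (T : Fin m → Lp ℂ q μ →L[ℂ] Lp ℂ q μ) (hT : ∀ j, HasMajorant k0 (T j))
    (f : Fin m → Lp ℂ q μ) : squareFun (fun j => T j (f j)) ≤ D * squareFun f := by
  have hgm : AEStronglyMeasurable (fun y => toLp 2 (fun j => f j y)) μ :=
    (PiLp.continuous_toLp 2 _).comp_aestronglyMeasurable
      (aemeasurable_pi_lambda _ fun j => (Lp.aestronglyMeasurable (f j)).aemeasurable).aestronglyMeasurable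
  refine le_trans ?_ (hk₀ _ hgm.enorm)
  choose k hk hTk using hT
  refine lintegral_mono_ae ?_
  filter_upwards [ae_all_iff.2 hk, ae_all_iff.2 fun j => hTk j (f j)] with x hx hx2
  refine rpow_le_rpow ?_ toReal_nonneg
  by_cases htop : ∫⁻ y, k0 x y * ‖toLp 2 (fun j => f j y)‖ₑ ∂μ = ⊤
  · rw [htop]; exact le_top
  have hFm : ∀ j, AEStronglyMeasurable (fun y => k j x y * f j y) μ := fun j =>
    (hx j).1.mul (Lp.aestronglyMeasurable _)
  have hb : ∀ᵐ y ∂μ, ‖toLp 2 (fun j => k j x y * f j y)‖ₑ ≤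
      k0 x y * ‖toLp 2 (fun j => f j y)‖ₑ := by
    filter_upwards [ae_all_iff.2 fun j => (hx j).2] with y hy
    by_cases hk0 : k0 x y = ⊤
    · rw [hk0]
      by_cases hz : toLp 2 (fun j => f j y) = 0
      · have : ∀ j, f j y = 0 := fun j => congrFun (congrArg WithLp.ofLp hz) j
        simp only [this, mul_zero]
        have h0 : toLp 2 (fun _ : Fin m => (0 : ℂ)) = 0 := rfl
        rw [h0]; simp
      · rw [ENNReal.top_mul (by simpa using hz)]; exact le_top
    lift k0 x y to NNReal using hk0 with c
    have h1 : ‖toLp 2 (fun j => k j x y * f j y)‖ ≤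
        ‖(c : ℝ) • toLp 2 (fun j => f j y)‖ := by
      rw [norm_eq, norm_eq]
      refine Real.sqrt_le_sqrt (sum_le_sum fun j _ => ?_)
      refine pow_le_pow_left₀ (norm_nonneg _) ?_ 2
      simp only [norm_mul, PiLp.smul_apply, norm_smul]
      refine mul_le_mul_of_nonneg_right ?_ (norm_nonneg _)
      have := hy j
      rw [enorm_eq_nnnorm, coe_le_coe] at this
      simpa using NNReal.coe_le_coe.2 this
    have h2 : ‖toLp 2 (fun j => k j x y * f j y)‖ₑ ≤
        ‖(c : ℝ) • toLp 2 (fun j => f j y)‖ₑ := by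
      rw [enorm_eq_nnnorm, enorm_eq_nnnorm, coe_le_coe]; exact h1
    refine h2.trans ?_
    rw [enorm_smul]
    simp [enorm_eq_nnnorm]
  have hFm2 : AEStronglyMeasurable (fun y => toLp 2 (fun j => k j x y * f j y)) μ :=
    (PiLp.continuous_toLp 2 _).comp_aestronglyMeasurable 
      (aemeasurable_pi_lambda _ fun j => (hFm j).aemeasurable).aestronglyMeasurable
  have hFi : Integrable (fun y => toLp 2 (fun j => k j x y * f j y)) μ :=
    ⟨hFm2, lt_of_le_of_lt (lintegral_mono_ae hb) (lt_top_iff_ne_top.2 htop)⟩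
  have hFj : toLp 2 (fun j => T j (f j) x) =
      ∫ y, toLp 2 (fun j => k j x y * f j y) ∂μ := by
    ext j
    have := (EuclideanSpace.proj j : EuclideanSpace ℂ (Fin m) →L[ℂ] ℂ).integral_comp_comm hFi
    exact (hx2 j).trans this
  rw [hFj]
  exact (enorm_integral_le_lintegral_enorm _).trans (lintegral_mono_ae hb)

end Majorant

/-- Integral operators with a common majorant which is bounded on `L_q` are `R`-bounded. -/
lemma exists_isRBoundedWith_hasMajorant {q : ℝ≥0∞} [Fact (1 ≤ q)] (hq : q ≠ ⊤)
    {α : Type} [MeasurableSpace α] {μ : Measure α} [SFinite μ] {k0 : α → α → ℝ≥0∞} {D : ℝ≥0∞} (hD : D ≠ ⊤)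
    (hk₀ : ∀ g : α → ℝ≥0∞, AEMeasurable g μ →
      ∫⁻ x, (∫⁻ y, k0 x y * g y ∂μ) ^ q.toReal ∂μ ≤ D * ∫⁻ x, g x ^ q.toReal ∂μ) :
    ∃ C : ℝ, 0 ≤ C ∧ IsRBoundedWith q.toReal C {T : Lp ℂ q μ →L[ℂ] Lp ℂ q μ | HasMajorant k0 T} := by
  have hq0 := toReal_exponent_pos hq
  obtain ⟨K, hK, h⟩ := exists_rademacher_le_squareFun hq
  refine ⟨(K * D.toReal * K) ^ (1 / q.toReal), by positivity, fun m T f ρ hT hρ => ?_⟩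
  have h0 : ∀ g : Fin m → Lp ℂ q μ, 0 ≤ ∫ u, ‖∑ j, (ρ j u : ℂ) • g j‖ ^ q.toReal := fun g =>
    integral_nonneg fun u => by positivity
  rw [← mul_rpow (by positivity) (h0 _)]
  refine Real.rpow_le_rpow (h0 _) ?_ (by positivity)
  have h1 := (h α μ m ρ hρ fun j => T j (f j)).1
  have h2 := (h α μ m ρ hρ f).2
  have h3 := squareFun_le_of_hasMajorant hk₀ T hT f
  have h4 : ofReal (∫ u, ‖∑ j, (ρ j u : ℂ) • T j (f j)‖ ^ q.toReal) ≤
      ofReal ((K * D.toReal * K) * ∫ u, ‖∑ j, (ρ j u : ℂ) • f j‖ ^ q.toReal) := by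
    rw [ofReal_mul (by positivity), ofReal_mul (by positivity),
      ofReal_mul hK.le, ofReal_toReal hD, mul_assoc, mul_assoc]
    refine h1.trans ?_
    gcongr
    exact h3.trans (by gcongr)
  exact (ENNReal.ofReal_le_ofReal_iff (mul_nonneg (by positivity) (h0 _))).1 h4

/-! ## Integral operators on `L_q` -/

section Majorant
variable {α : Type*} [MeasurableSpace α] {μ : Measure α} {q : ℝ≥0∞}
variable {k0 : α → α → ℝ≥0∞}

/-- The majorant `k0` defines a bounded operator on `L_q`, with `q`-th power of the norm `D`. -/
def LqBounded (μ : Measure α) (q : ℝ≥0∞) (k0 : α → α → ℝ≥0∞) (D : ℝ≥0∞) : Prop :=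
  ∀ g : α → ℝ≥0∞, AEMeasurable g μ → ∫⁻ x, (∫⁻ y, k0 x y * g y ∂μ) ^ q.toReal ∂μ ≤ D * ∫⁻ x, g x ^ q.toReal ∂μ

lemma exists_integralOperator [Fact (1 ≤ q)] [SFinite μ] (hq : q ≠ ⊤) {D : ℝ}
    (hD : 0 ≤ D) (hk₀ : LqBounded μ q k0 (ofReal D)) {k : α → α → ℂ}
    (hk : AEStronglyMeasurable (uncurry k) (μ.prod μ)) (hkk : ∀ᵐ x ∂μ, ∀ᵐ y ∂μ, ‖k x y‖ₑ ≤ k0 x y) :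
    ∃ T : Lp ℂ q μ →L[ℂ] Lp ℂ q μ, (∀ f : Lp ℂ q μ, T f =ᵐ[μ] fun x => ∫ y, k x y * f y ∂μ) ∧
      ‖T‖ ≤ D ^ (1 / q.toReal) := by
  have hq0 := toReal_exponent_pos hq
  have hqr : q ≠ 0 := (zero_lt_one.trans_le Fact.out).ne'
  have hfin : ∀ f : Lp ℂ q μ, ∫⁻ x, (∫⁻ y, k0 x y * ‖f y‖ₑ ∂μ) ^ q.toReal ∂μ ≤
      ofReal D * ofReal (‖f‖ ^ q.toReal) := fun f => by
    rw [ofReal_norm_Lp_rpow hq]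
    exact hk₀ _ (Lp.aestronglyMeasurable f).enorm
  have hmeas : ∀ f : Lp ℂ q μ, AEStronglyMeasurable (fun x => ∫ y, k x y * f y ∂μ) μ := fun f =>
    (hk.mul (Lp.aestronglyMeasurable f).comp_snd).integral_prod_right'
  have hle : ∀ f : Lp ℂ q μ, ∀ᵐ x ∂μ, ∫⁻ y, ‖k x y * f y‖ₑ ∂μ ≤ ∫⁻ y, k0 x y * ‖f y‖ₑ ∂μ := fun f => by
    filter_upwards [hkk] with x hx
    refine lintegral_mono_ae ?_
    filter_upwards [hx] with y hy
    rw [enorm_mul]; gcongr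
  have hbound : ∀ f : Lp ℂ q μ, eLpNorm (fun x => ∫ y, k x y * f y ∂μ) q μ ≤
      ofReal (D ^ (1 / q.toReal) * ‖f‖) := fun f => by
    rw [eLpNorm_eq_lintegral_rpow_enorm_toReal hqr hq, one_div, ENNReal.rpow_inv_le_iff hq0]
    calc ∫⁻ x, ‖∫ y, k x y * f y ∂μ‖ₑ ^ q.toReal ∂μ
        ≤ ∫⁻ x, (∫⁻ y, k0 x y * ‖f y‖ₑ ∂μ) ^ q.toReal ∂μ := by
          refine lintegral_mono_ae ?_
          filter_upwards [hle f] with x hx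
          exact rpow_le_rpow ((enorm_integral_le_lintegral_enorm _).trans hx) hq0.le
      _ ≤ _ := hfin f
      _ = _ := by
          rw [← ofReal_mul hD, ofReal_rpow_of_nonneg (by positivity) hq0.le,
            mul_rpow (by positivity) (norm_nonneg _), ← Real.rpow_mul hD,
            inv_mul_cancel₀ hq0.ne', Real.rpow_one]
  have hmem : ∀ f : Lp ℂ q μ, MemLp (fun x => ∫ y, k x y * f y ∂μ) q μ := fun f =>
    ⟨hmeas f, (hbound f).trans_lt ofReal_lt_top⟩
  have hk' : ∀ᵐ x ∂μ, AEStronglyMeasurable (k x) μ := hk.prodMk_left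
  have hint : ∀ f : Lp ℂ q μ, ∀ᵐ x ∂μ, Integrable (fun y => k x y * f y) μ := fun f => by
    have h1 : ∫⁻ x, (∫⁻ y, ‖k x y * f y‖ₑ ∂μ) ^ q.toReal ∂μ ≠ ⊤ := by
      refine ne_top_of_le_ne_top (mul_ne_top ofReal_ne_top ofReal_ne_top)
        (le_trans (lintegral_mono_ae ?_) (hfin f))
      filter_upwards [hle f] with x hx
      exact rpow_le_rpow hx hq0.le
    have h2 : AEMeasurable (fun x => (∫⁻ y, ‖k x y * f y‖ₑ ∂μ) ^ q.toReal) μ :=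
      ((hk.mul (Lp.aestronglyMeasurable f).comp_snd).enorm.lintegral_prod_right').pow_const _
    filter_upwards [ae_lt_top' h2 h1, hk'] with x hx hx'
    refine ⟨hx'.mul (Lp.aestronglyMeasurable f), ?_⟩
    exact (ENNReal.rpow_lt_top_iff_of_pos hq0).1 hx
  refine ⟨LinearMap.mkContinuous
    { toFun := fun f => (hmem f).toLp _
      map_add' := fun f g => ?_
      map_smul' := fun c f => ?_ } (D ^ (1 / q.toReal)) fun f => ?_, fun f => ?_, ?_⟩
  · rw [← MemLp.toLp_add]
    refine (MemLp.toLp_eq_toLp_iff _ _).2 ?_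
    filter_upwards [hint f, hint g] with x hf hg
    rw [Pi.add_apply, ← integral_add hf hg]
    refine integral_congr_ae ?_
    filter_upwards [Lp.coeFn_add f g] with y hy
    rw [hy, Pi.add_apply, mul_add]
  · rw [RingHom.id_apply, ← MemLp.toLp_const_smul]
    refine (MemLp.toLp_eq_toLp_iff _ _).2 (.of_forall fun x => ?_)
    rw [Pi.smul_apply, smul_eq_mul]
    dsimp only
    rw [← integral_const_mul]
    refine integral_congr_ae ?_
    filter_upwards [Lp.coeFn_smul c f] with y hy
    rw [hy, Pi.smul_apply, smul_eq_mul]; ring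
  · change ‖(hmem f).toLp _‖ ≤ _
    rw [Lp.norm_toLp]
    exact ENNReal.toReal_le_of_le_ofReal (by positivity) (hbound f)
  · exact (hmem f).coeFn_toLp
  · exact LinearMap.mkContinuous_norm_le _ (by positivity) _

/-- Schur's test. -/
lemma lqBounded_of_schur [SFinite μ] {p p' : ℝ} (hp : p.HolderConjugate p') (hpq : q.toReal = p) (hk : Measurable (uncurry k0)) {h : α → ℝ≥0∞} (hh : Measurable h)
    (hpos : ∀ᵐ x ∂μ, h x ≠ 0) (hfin : ∀ᵐ x ∂μ, h x ≠ ⊤) {A : ℝ≥0∞}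
    (h1 : ∀ᵐ x ∂μ, ∫⁻ y, k0 x y * h y ^ p' ∂μ ≤ A * h x ^ p')
    (h2 : ∀ᵐ y ∂μ, ∫⁻ x, k0 x y * h x ^ p ∂μ ≤ A * h y ^ p) : LqBounded μ q k0 (A ^ (p / p') * A) := by
  intro g hg
  rw [hpq]
  have hp0 := hp.pos
  have hp0' := hp.symm.pos
  have step : ∀ᵐ x ∂μ, (∫⁻ y, k0 x y * g y ∂μ) ^ p ≤
      A ^ (p / p') * ∫⁻ y, (h x ^ p * k0 x y) * (g y ^ p * (h y)⁻¹ ^ p) ∂μ := by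
    filter_upwards [h1, hpos, hfin] with x hx hx0 hxt
    have hkx : Measurable (k0 x) := hk.of_uncurry_left
    have e1 : ∫⁻ y, k0 x y * g y ∂μ ≤ ∫⁻ y, ((fun y => (k0 x y) ^ (1 / p') * h y) *
        fun y => (k0 x y) ^ (1 / p) * (g y * (h y)⁻¹)) y ∂μ := by
      refine lintegral_mono_ae ?_
      filter_upwards [hpos, hfin] with y hy0 hyt
      simp only [Pi.mul_apply]
      have a : (k0 x y) = (k0 x y) ^ (1 / p') * (k0 x y) ^ (1 / p) := by
        rw [← ENNReal.rpow_add_of_nonneg _ _ (by positivity) (by positivity), one_div, one_div,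
          hp.symm.inv_add_inv_eq_one, rpow_one]
      have b : g y = h y * (g y * (h y)⁻¹) := by rw [mul_left_comm, ENNReal.mul_inv_cancel hy0 hyt, mul_one]
      calc k0 x y * g y = ((k0 x y) ^ (1 / p') * (k0 x y) ^ (1 / p)) * (h y * (g y * (h y)⁻¹)) := by rw [← a, ← b]
        _ ≤ _ := le_of_eq (by ring)
    have e2 := lintegral_mul_le_Lp_mul_Lq μ hp.symm
      (f := fun y => (k0 x y) ^ (1 / p') * h y) (g := fun y => (k0 x y) ^ (1 / p) * (g y * (h y)⁻¹))
      ((hkx.pow_const _).mul hh).aemeasurable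
      ((hkx.pow_const _).aemeasurable.mul (hg.mul hh.inv.aemeasurable))
    have e3 := rpow_le_rpow (e1.trans e2) hp0.le
    refine e3.trans ?_
    rw [mul_rpow_of_nonneg _ _ hp0.le, ← rpow_mul, ← rpow_mul, one_div_mul_cancel hp0.ne', rpow_one]
    have e4 : ∫⁻ y, ((k0 x y) ^ (1 / p') * h y) ^ p' ∂μ ≤ A * h x ^ p' := by
      refine le_trans (le_of_eq (lintegral_congr fun y => ?_)) hx
      rw [mul_rpow_of_nonneg _ _ hp0'.le, ← rpow_mul, one_div_mul_cancel hp0'.ne', rpow_one]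
    have e5 : ∀ y, ((k0 x y) ^ (1 / p) * (g y * (h y)⁻¹)) ^ p = k0 x y * (g y ^ p * (h y)⁻¹ ^ p) := by
      intro y
      rw [mul_rpow_of_nonneg _ _ hp0.le, ← rpow_mul, one_div_mul_cancel hp0.ne',
        rpow_one, mul_rpow_of_nonneg _ _ hp0.le]
    simp only [e5]
    have e6 : (A * h x ^ p') ^ (1 / p' * p) = A ^ (p / p') * h x ^ p := by
      rw [mul_rpow_of_nonneg _ _ (by positivity), ← rpow_mul]
      congr 2 <;> field_simp
    calc _ ≤ (A * h x ^ p') ^ (1 / p' * p) * ∫⁻ y, k0 x y * (g y ^ p * (h y)⁻¹ ^ p) ∂μ := by gcongr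
      _ = A ^ (p / p') * (h x ^ p * ∫⁻ y, k0 x y * (g y ^ p * (h y)⁻¹ ^ p) ∂μ) := by rw [e6, mul_assoc]
      _ = _ := by
          rw [← lintegral_const_mul' _ _ (rpow_ne_top_of_nonneg hp0.le hxt)]
          simp only [mul_assoc]
  have hm : AEMeasurable (uncurry fun x y => (h x ^ p * k0 x y) * (g y ^ p * (h y)⁻¹ ^ p)) (μ.prod μ) :=
    (((hh.comp measurable_fst).pow_const p).mul hk).aemeasurable.mul
      ((hg.pow_const p).mul ((hh.inv.pow_const p).aemeasurable)).comp_snd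
  calc ∫⁻ x, (∫⁻ y, k0 x y * g y ∂μ) ^ p ∂μ
      ≤ ∫⁻ x, A ^ (p / p') * ∫⁻ y, (h x ^ p * k0 x y) * (g y ^ p * (h y)⁻¹ ^ p) ∂μ ∂μ := lintegral_mono_ae step
    _ = A ^ (p / p') * ∫⁻ y, ∫⁻ x, (h x ^ p * k0 x y) * (g y ^ p * (h y)⁻¹ ^ p) ∂μ ∂μ := by
        have := hm.lintegral_prod_right'
        simp only [uncurry] at this
        rw [lintegral_const_mul'' _ this, lintegral_lintegral_swap hm]
    _ ≤ A ^ (p / p') * ∫⁻ y, A * g y ^ p ∂μ := by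
        refine mul_le_mul' le_rfl (lintegral_mono_ae ?_)
        filter_upwards [h2, hpos, hfin] with y hy hy0 hyt
        have hmy : Measurable fun x => h x ^ p * k0 x y := (hh.pow_const p).mul hk.of_uncurry_right
        rw [lintegral_mul_const _ hmy]
        calc (∫⁻ x, h x ^ p * k0 x y ∂μ) * (g y ^ p * (h y)⁻¹ ^ p)
            ≤ (A * h y ^ p) * (g y ^ p * (h y)⁻¹ ^ p) := by
              gcongr
              simpa only [mul_comm] using hy
          _ = A * g y ^ p * (h y * (h y)⁻¹) ^ p := by rw [mul_rpow_of_nonneg _ _ hp0.le]; ring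
          _ = A * g y ^ p := by rw [ENNReal.mul_inv_cancel hy0 hyt, ENNReal.one_rpow, mul_one]
    _ = _ := by rw [lintegral_const_mul'' _ (hg.pow_const p), mul_assoc]

end Majorant

section
variable {t β : ℝ} {z : ℂ}

/-! ## The homogeneous majorant on the half-space -/

lemma integrable_tail (n : ℕ) (ht : 0 < t) : Integrable fun y : Tan n => ((t + ‖y‖) ^ (n + 1))⁻¹ := by
  have h1 : Integrable fun y : Tan n => (1 + ‖y‖) ^ (-((n : ℝ) + 1)) := integrable_one_add_norm (by simp)
  have h2 := (h1.comp_smul (inv_ne_zero ht.ne')).const_mul ((t ^ (n + 1))⁻¹)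
  refine h2.congr (.of_forall fun y => ?_)
  simp only
  rw [norm_smul, norm_inv, norm_of_nonneg ht.le, rpow_neg (by positivity),
    show ((n : ℝ) + 1) = ((n + 1 : ℕ) : ℝ) by push_cast; ring, rpow_natCast, ← mul_inv,
    ← mul_pow]
  congr 2; field_simp

/-- `∫ (1 + |y|)^{-(n+1)} dy` over the tangential space. -/
def tailMass (n : ℕ) : ℝ := ∫ y : Tan n, ((1 + ‖y‖) ^ (n + 1))⁻¹

lemma tailMass_nonneg (n : ℕ) : 0 ≤ tailMass n := integral_nonneg fun y => by positivity

lemma integral_tail (n : ℕ) (ht : 0 < t) : ∫ y : Tan n, ((t + ‖y‖) ^ (n + 1))⁻¹ = tailMass n / t := by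
  have h := Measure.integral_comp_inv_smul (volume : Measure (Tan n))
    (fun y : Tan n => ((1 + ‖y‖) ^ (n + 1))⁻¹) t
  have e : ∀ y : Tan n, ((t + ‖y‖) ^ (n + 1))⁻¹ =
      (t ^ (n + 1))⁻¹ * ((1 + ‖t⁻¹ • y‖) ^ (n + 1))⁻¹ := by
    intro y
    rw [norm_smul, norm_inv, norm_of_nonneg ht.le, ← mul_inv, ← mul_pow]
    congr 2; field_simp
  simp only [e]
  rw [integral_const_mul, h]
  simp only [finrank_euclideanSpace, Fintype.card_fin, smul_eq_mul, tailMass, abs_of_pos (pow_pos ht n)]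
  rw [pow_succ]
  field_simp

lemma lintegral_tail (n : ℕ) (ht : 0 < t) (x : Tan n) :
    ∫⁻ y : Tan n, ofReal (((‖x - y‖ + t) ^ (n + 1))⁻¹) = ofReal (tailMass n / t) := by
  have h1 : ∫⁻ y : Tan n, ofReal (((‖x - y‖ + t) ^ (n + 1))⁻¹) =
      ∫⁻ y : Tan n, ofReal (((t + ‖y‖) ^ (n + 1))⁻¹) := by
    rw [lintegral_sub_left_eq_self (fun y : Tan n => ofReal (((‖y‖ + t) ^ (n + 1))⁻¹)) x]
    simp only [add_comm]
  rw [h1, ← integral_tail n ht, ofReal_integral_eq_lintegral_ofReal (integrable_tail n ht)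
    (.of_forall fun y => by positivity)]

/-- Lebesgue measure on the half-space. -/
abbrev halfVol (n : ℕ) : Measure (Space n) :=
  (volume : Measure (Space n)).restrict (halfSpace n)

lemma measurableSet_halfSpace (n : ℕ) : MeasurableSet (halfSpace n) :=
  measurableSet_lt measurable_const measurable_snd

lemma isOpen_halfSpace (n : ℕ) : IsOpen (halfSpace n) :=
  isOpen_lt continuous_const continuous_snd

lemma halfVol_eq_prod (n : ℕ) :
    halfVol n = (volume : Measure (Tan n)).prod ((volume : Measure ℝ).restrict (Ioi 0)) := by
  have : halfSpace n = (univ : Set (Tan n)) ×ˢ Ioi (0 : ℝ) := by ext x; simp [halfSpace]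
  rw [halfVol, this, Measure.volume_eq_prod, ← Measure.prod_restrict, Measure.restrict_univ]

lemma ae_halfVol (n : ℕ) : ∀ᵐ x ∂halfVol n, 0 < x.2 :=
  ae_restrict_mem (measurableSet_halfSpace n)

/-- The kernel `(|x' - y'| + x_N + y_N)^{-N}`. -/
def majorant (n : ℕ) (x y : Space n) : ℝ≥0∞ :=
  ofReal (((‖x.1 - y.1‖ + (x.2 + y.2)) ^ (n + 1))⁻¹)

lemma measurable_majorant (n : ℕ) : Measurable (uncurry (majorant n)) := by
  unfold majorant uncurry
  fun_prop

lemma majorant_comm (n : ℕ) (x y : Space n) : majorant n x y = majorant n y x := by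
  unfold majorant
  rw [norm_sub_rev, add_comm x.2]

lemma exists_lintegral_hilbert_le (h0 : 0 < β) (h1 : β < 1) : ∃ A : ℝ, 0 ≤ A ∧ ∀ x : ℝ, 0 < x →
      ∫⁻ s in Ioi (0 : ℝ), ofReal (1 / (x + s) * s ^ (-β)) ≤ ofReal (A * x ^ (-β)) := by
  refine ⟨1 / (1 - β) + 1 / β, by have : 0 < 1 - β := by linarith
                                  positivity, fun x hx => ?_⟩
  have hb : 0 < 1 - β := by linarith
  have e1 : ∫⁻ s in Ioc (0 : ℝ) x, ofReal (1 / (x + s) * s ^ (-β)) ≤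
      ofReal (1 / (1 - β) * x ^ (-β)) := by
    have hi : IntegrableOn (fun s : ℝ => x⁻¹ * s ^ (-β)) (Ioc 0 x) := by
      rw [← intervalIntegrable_iff_integrableOn_Ioc_of_le hx.le]
      exact (intervalIntegral.intervalIntegrable_rpow' (by linarith)).const_mul _
    have hv : ∫ s in Ioc (0 : ℝ) x, x⁻¹ * s ^ (-β) = 1 / (1 - β) * x ^ (-β) := by
      rw [← intervalIntegral.integral_of_le hx.le, intervalIntegral.integral_const_mul,
        integral_rpow (Or.inl (by linarith)), zero_rpow (by linarith), sub_zero,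
        rpow_add hx, Real.rpow_one, show -β + 1 = 1 - β by ring]
      field_simp
    rw [← hv, ofReal_integral_eq_lintegral_ofReal hi
      ((ae_restrict_mem measurableSet_Ioc).mono fun s hs => by have := hs.1; dsimp only [Pi.zero_apply]; positivity)]
    refine setLIntegral_mono' measurableSet_Ioc fun s hs => ?_
    have := hs.1
    refine ofReal_le_ofReal ?_
    rw [← one_div]
    gcongr
    linarith
  have e2 : ∫⁻ s in Ioi x, ofReal (1 / (x + s) * s ^ (-β)) ≤
      ofReal (1 / β * x ^ (-β)) := by
    have hi : IntegrableOn (fun s : ℝ => s ^ (-β - 1)) (Ioi x) := integrableOn_Ioi_rpow_of_lt (by linarith) hx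
    have hv : ∫ s in Ioi x, s ^ (-β - 1) = 1 / β * x ^ (-β) := by
      rw [integral_Ioi_rpow_of_lt (by linarith) hx]
      rw [show -β - 1 + 1 = -β by ring]
      field_simp
    rw [← hv, ofReal_integral_eq_lintegral_ofReal hi
      ((ae_restrict_mem measurableSet_Ioi).mono fun s hs => by
        have : x < s := hs
        have : 0 < s := by linarith
        dsimp only [Pi.zero_apply]; positivity)]
    refine setLIntegral_mono' measurableSet_Ioi fun s hs => ?_
    have h3 : x < s := hs
    have : 0 < s := by linarith
    refine ofReal_le_ofReal ?_
    rw [Real.rpow_sub_one this.ne', mul_comm, mul_one_div]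
    gcongr
    linarith
  rw [← Ioc_union_Ioi_eq_Ioi hx.le,
    lintegral_union measurableSet_Ioi (Set.disjoint_left.2 fun s h1 h2 => not_lt.2 h1.2 h2)]
  refine (add_le_add e1 e2).trans ?_
  rw [← ENNReal.ofReal_add (by positivity) (by positivity), add_mul]

lemma exists_lintegral_majorant_le (n : ℕ) (h0 : 0 < β) (h1 : β < 1) :
    ∃ A : ℝ, 0 ≤ A ∧ ∀ x : Space n, 0 < x.2 → ∫⁻ y, majorant n x y * ofReal (y.2 ^ (-β)) ∂halfVol n ≤
        ofReal A * ofReal (x.2 ^ (-β)) := by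
  obtain ⟨A, hA, hA'⟩ := exists_lintegral_hilbert_le h0 h1
  refine ⟨tailMass n * A, mul_nonneg (tailMass_nonneg n) hA, fun x hx => ?_⟩
  have hm : Measurable fun y => majorant n x y * ofReal (y.2 ^ (-β)) := by
    refine (measurable_majorant n).of_uncurry_left.mul ?_
    fun_prop
  rw [halfVol_eq_prod, lintegral_prod_symm _ hm.aemeasurable]
  have e : ∀ s ∈ Ioi (0 : ℝ), ∫⁻ y : Tan n, majorant n x (y, s) * ofReal ((y, s).2 ^ (-β)) =
      ofReal (tailMass n) * ofReal (1 / (x.2 + s) * s ^ (-β)) := by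
    intro s hs
    have hs' : 0 < s := hs
    have hmx : Measurable fun y : Tan n => majorant n x (y, s) :=
      (measurable_majorant n).of_uncurry_left.comp measurable_prodMk_right
    dsimp only
    rw [lintegral_mul_const _ hmx]
    unfold majorant
    simp only
    rw [lintegral_tail n (by positivity), ← ofReal_mul (by have := tailMass_nonneg n; positivity),
      ← ofReal_mul (tailMass_nonneg n)]
    congr 1; ring
  rw [setLIntegral_congr_fun measurableSet_Ioi e, lintegral_const_mul' _ _ ofReal_ne_top,
    ofReal_mul (tailMass_nonneg n), mul_assoc]
  gcongr
  rw [← ofReal_mul hA]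
  exact hA' _ hx

lemma exists_lqBounded_majorant (n : ℕ) {q : ℝ≥0∞} (hq1 : 1 < q) (hq2 : q ≠ ⊤) :
    ∃ D : ℝ, 0 ≤ D ∧ LqBounded (halfVol n) q (majorant n) (ofReal D) := by
  set p := q.toReal with hp
  have hp1r : 1 < p := one_lt_toReal hq1 hq2
  have hpc := Real.HolderConjugate.conjExponent hp1r
  set p' := p.conjExponent
  have hp0 := hpc.pos
  have hp0' := hpc.symm.pos
  obtain ⟨A, hA, hA'⟩ := exists_lintegral_majorant_le n (β := 1 / p) (by positivity)
    (by rw [div_lt_one hp0]; exact hp1r)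
  obtain ⟨B, hB, hB'⟩ := exists_lintegral_majorant_le n (β := 1 / p') (by positivity)
    (by rw [div_lt_one hp0']; exact hpc.symm.lt)
  set h : Space n → ℝ≥0∞ := fun x => ofReal (x.2 ^ (-(1 / (p * p')))) with hh
  have e1 : ∀ x : Space n, 0 < x.2 → h x ^ p' = ofReal (x.2 ^ (-(1 / p))) := by
    intro x hx
    rw [hh, ofReal_rpow_of_nonneg (by positivity) hp0'.le, ← Real.rpow_mul hx.le]
    congr 2; field_simp
  have e2 : ∀ x : Space n, 0 < x.2 → h x ^ p = ofReal (x.2 ^ (-(1 / p'))) := by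
    intro x hx
    rw [hh, ofReal_rpow_of_nonneg (by positivity) hp0.le, ← Real.rpow_mul hx.le]
    congr 2; field_simp
  have hm : Measurable h := by rw [hh]; fun_prop
  have key := lqBounded_of_schur (μ := halfVol n) (q := q) hpc hp.symm (measurable_majorant n) hm
    (A := ofReal (max A B)) ?_ ?_ ?_ ?_
  · refine ⟨max A B ^ (p / p') * max A B, by positivity, ?_⟩
    rwa [ofReal_mul (by positivity), ← ofReal_rpow_of_nonneg (by positivity)
      (by positivity)]
  · filter_upwards [ae_halfVol n] with x hx
    rw [hh]; simp only [ne_eq, ENNReal.ofReal_eq_zero, not_le]; positivity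
  · exact .of_forall fun x => ofReal_ne_top
  · filter_upwards [ae_halfVol n] with x hx
    rw [e1 x hx]
    refine le_trans (le_of_eq (lintegral_congr_ae ?_)) ((hA' x hx).trans ?_)
    · filter_upwards [ae_halfVol n] with y hy
      rw [e1 y hy]
    · gcongr; exact le_max_left _ _
  · filter_upwards [ae_halfVol n] with x hx
    rw [e2 x hx]
    refine le_trans (le_of_eq (lintegral_congr_ae ?_)) ((hB' x hx).trans ?_)
    · filter_upwards [ae_halfVol n] with y hy
      rw [e2 y hy, majorant_comm]
    · gcongr; exact le_max_right _ _

/-! ## Homogeneous symbols -/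

/-- The principal square root. -/
def sqz (z : ℂ) : ℂ := z ^ (1 / 2 : ℂ)

lemma sqz_sq (z : ℂ) : sqz z ^ 2 = z := by
  rw [sqz, ← Complex.cpow_nat_mul]; simp

lemma norm_sqz_sq (z : ℂ) : ‖sqz z‖ ^ 2 = ‖z‖ := by rw [← norm_pow, sqz_sq]

lemma sqz_ne_zero (hz : z ≠ 0) : sqz z ≠ 0 := fun h => hz (by rw [← sqz_sq z, h]; simp)

lemma sqz_re_nonneg (z : ℂ) : 0 ≤ (sqz z).re := by
  by_cases hz : z = 0
  · simp [sqz, hz]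
  rw [sqz, Complex.cpow_def_of_ne_zero hz, Complex.exp_re]
  refine mul_nonneg (exp_pos _).le (Real.cos_nonneg_of_mem_Icc ?_)
  have h1 := Complex.neg_pi_lt_arg z
  have h2 := Complex.arg_le_pi z
  have : (log z * (1 / 2)).im = z.arg / 2 := by rw [mul_im, Complex.log_im]; simp; ring
  rw [this]
  constructor <;> linarith

lemma sqz_re_sq (z : ℂ) : 2 * (sqz z).re ^ 2 = ‖z‖ + z.re := by
  have h1 := norm_sqz_sq z
  have h2 : (sqz z ^ 2).re = z.re := by rw [sqz_sq]
  rw [← normSq_eq_norm_sq, normSq_apply] at h1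
  rw [sq, mul_re] at h2
  nlinarith

lemma mem_slitPlane_of_pos {w : ℂ} (h : 0 < ‖w‖ + w.re) : w ∈ slitPlane := by
  rw [mem_slitPlane_iff]
  by_contra hc
  push Not at hc
  have h1 : ‖w‖ = |w.re| := by rw [Complex.abs_re_eq_norm.2 hc.2]
  rw [abs_of_nonpos hc.1] at h1
  linarith

lemma hasDerivAt_sqz (hz : z ∈ slitPlane) : HasDerivAt sqz (1 / (2 * sqz z)) z := by
  have h0 := slitPlane_ne_zero hz
  have h := (hasDerivAt_id z).cpow_const (c := (1 / 2 : ℂ)) hz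
  have hs := sqz_ne_zero h0
  refine h.congr_deriv ?_
  simp only [id]
  rw [Complex.cpow_sub _ _ h0, Complex.cpow_one]
  change 1 / 2 * (sqz z / z) * 1 = _
  nth_rw 2 [← sqz_sq z]
  field_simp

lemma rhp_slitPlane (hz : z ∈ ℂ₊) : z ∈ slitPlane :=
  mem_slitPlane_iff.2 (Or.inl hz)

lemma rhp_ne_zero (hz : z ∈ ℂ₊) : z ≠ 0 :=
  slitPlane_ne_zero (rhp_slitPlane hz)

lemma norm_sqz_pos (hz : z ∈ ℂ₊) : 0 < ‖sqz z‖ := norm_pos_iff.2 (sqz_ne_zero (rhp_ne_zero hz))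

lemma isOpen_rightHalfPlane : IsOpen ℂ₊ := isOpen_lt continuous_const Complex.continuous_re

end

section Symbols
variable {n : ℕ} {a : ℝ}
variable {z : ℂ} {d : ℤ} {S : Symb n}

/-- `|ξ|² + a z`. -/
def radicand (a : ℝ) (ξ : Tan n) (z : ℂ) : ℂ := ((‖ξ‖ ^ 2 : ℝ) : ℂ) + a * z

/-- `√(|ξ|² + a z)`. -/
def root (a : ℝ) (ξ : Tan n) (z : ℂ) : ℂ := sqz (radicand a ξ z)

/-- The weight `|z|^{1/2} + |ξ|`. -/
def weight (z : ℂ) (ξ : Tan n) : ℝ := ‖z‖ ^ (1 / 2 : ℝ) + ‖ξ‖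

lemma norm_sqz (z : ℂ) : ‖sqz z‖ = ‖z‖ ^ (1 / 2 : ℝ) := by
  rw [← sqrt_eq_rpow, ← norm_sqz_sq z, Real.sqrt_sq (norm_nonneg _)]

lemma weight_eq (z : ℂ) (ξ : Tan n) : weight z ξ = ‖sqz z‖ + ‖ξ‖ := by rw [weight, norm_sqz]

lemma weight_pos (hz : z ∈ ℂ₊) (ξ : Tan n) : 0 < weight z ξ := by
  rw [weight_eq]
  have := norm_pos_iff.2 (sqz_ne_zero (rhp_ne_zero hz))
  positivity

lemma radicand_re_pos (ha : 0 < a) (hz : z ∈ ℂ₊) (ξ : Tan n) : 0 < (radicand a ξ z).re := by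
  have : 0 < z.re := hz
  simp only [radicand, add_re, ofReal_re, mul_re, ofReal_im, zero_mul, sub_zero]
  positivity

lemma radicand_slitPlane (ha : 0 < a) (hz : z ∈ ℂ₊) (ξ : Tan n) : radicand a ξ z ∈ slitPlane :=
  mem_slitPlane_iff.2 (Or.inl (radicand_re_pos ha hz ξ))

lemma root_sq (ξ : Tan n) (z : ℂ) : root a ξ z ^ 2 = radicand a ξ z := sqz_sq _

lemma root_ne_zero (ha : 0 < a) (hz : z ∈ ℂ₊) (ξ : Tan n) : root a ξ z ≠ 0 :=
  sqz_ne_zero (slitPlane_ne_zero (radicand_slitPlane ha hz ξ))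

lemma le_norm_radicand (ha : 0 < a) (hz : z ∈ ℂ₊) (ξ : Tan n) :
    min 1 a / 3 * weight z ξ ^ 2 ≤ ‖radicand a ξ z‖ := by
  have hre : 0 < z.re := hz
  have h1 : (radicand a ξ z).re = ‖ξ‖ ^ 2 + a * z.re := by simp [radicand, -ofReal_pow]
  have h2 : (radicand a ξ z).im = a * z.im := by simp [radicand, -ofReal_pow]
  have h3 : ‖radicand a ξ z‖ ^ 2 = (‖ξ‖ ^ 2 + a * z.re) ^ 2 + (a * z.im) ^ 2 := by
    rw [← normSq_eq_norm_sq, normSq_apply, h1, h2]; ring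
  have h4 : ‖z‖ ^ 2 = z.re ^ 2 + z.im ^ 2 := by rw [← normSq_eq_norm_sq, normSq_apply]; ring
  set m := min 1 a with hm
  have hm0 : 0 < m := lt_min one_pos ha
  have h5 : m * (‖ξ‖ ^ 2 + ‖z‖) ≤ ‖ξ‖ ^ 2 + a * ‖z‖ := by
    have := min_le_left 1 a
    have := min_le_right 1 a
    nlinarith [sq_nonneg ‖ξ‖, norm_nonneg z]
  have h6 : (‖ξ‖ ^ 2 + a * ‖z‖) ^ 2 ≤ 2 * ‖radicand a ξ z‖ ^ 2 := by
    rw [h3]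
    have : 0 ≤ ‖ξ‖ ^ 2 * (a * z.re) := by positivity
    have h4' : (a * ‖z‖) ^ 2 = (a * z.re) ^ 2 + (a * z.im) ^ 2 := by rw [mul_pow, h4]; ring
    nlinarith [sq_nonneg (‖ξ‖ ^ 2 - a * ‖z‖)]
  have h7 : weight z ξ ^ 2 ≤ 2 * (‖ξ‖ ^ 2 + ‖z‖) := by
    rw [weight_eq, ← norm_sqz_sq z]; nlinarith [sq_nonneg (‖sqz z‖ - ‖ξ‖)]
  have h8 : ‖ξ‖ ^ 2 + a * ‖z‖ ≤ 3 / 2 * ‖radicand a ξ z‖ := by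
    refine abs_le_of_sq_le_sq' ?_ (by positivity) |>.2
    nlinarith [sq_nonneg ‖radicand a ξ z‖]
  nlinarith [norm_nonneg (radicand a ξ z)]

lemma norm_radicand_le (ha : 0 < a) (z : ℂ) (ξ : Tan n) : ‖radicand a ξ z‖ ≤ max 1 a * weight z ξ ^ 2 := by
  have h1 : ‖radicand a ξ z‖ ≤ ‖ξ‖ ^ 2 + a * ‖z‖ := by
    refine (norm_add_le _ _).trans ?_
    rw [norm_real, norm_mul, norm_real, norm_of_nonneg ha.le, norm_of_nonneg (sq_nonneg _)]
  rw [weight_eq]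
  refine h1.trans ?_
  rw [← norm_sqz_sq z]
  have := le_max_left 1 a
  have := le_max_right 1 a
  nlinarith [sq_nonneg ‖ξ‖, sq_nonneg ‖sqz z‖, mul_nonneg (norm_nonneg (sqz z)) (norm_nonneg ξ)]

/-- Symbols of order `d`: the linear span of products of coordinates, powers of `√z`, of `t` and of
the root, and the decaying exponential. -/
inductive IsSym (a : ℝ) : ℤ → (Symb n) → Prop
  | basic (i : ℤ) (l : ℕ) {d : ℤ} (h : d = i - l) :
      IsSym a d fun ξ z t => root a ξ z ^ i * (t : ℂ) ^ l * Complex.exp (-root a ξ z * t)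
  | smul (c : ℂ) {d : ℤ} {S : Symb n} : IsSym a d S → IsSym a d fun ξ z t => c * S ξ z t
  | add {d : ℤ} {S S' : Symb n} : IsSym a d S → IsSym a d S' → IsSym a d fun ξ z t => S ξ z t + S' ξ z t
  | mulCoord (j : Fin n) {d d' : ℤ} {S : Symb n} (h : d' = d + 1) : IsSym a d S →
      IsSym a d' fun ξ z t => (ξ j : ℂ) * S ξ z t
  | mulSqrt {d d' : ℤ} {S : Symb n} (h : d' = d + 1) : IsSym a d S → IsSym a d' fun ξ z t => sqz z * S ξ z t
  | congr {d : ℤ} {S S' : Symb n} (h : ∀ ξ, ∀ z ∈ ℂ₊, ∀ t, S ξ z t = S' ξ z t) :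
      IsSym a d S → IsSym a d S'

lemma IsSym.zero (d : ℤ) : IsSym a d fun (_ : Tan n) _ _ => 0 := by
  refine IsSym.congr ?_ ((IsSym.basic (a := a) (n := n) d 0 (d := d) (by simp)).smul 0)
  simp

lemma IsSym.exists_hasDerivAt_t (ha : 0 < a) (h : IsSym a d S) :
    ∃ S', IsSym a (d + 1) S' ∧ ∀ ξ, ∀ z ∈ ℂ₊, ∀ t, HasDerivAt (S ξ z) (S' ξ z t) t := by
  induction h with
  | @basic i l d h =>
    refine ⟨_, IsSym.add (S := fun ξ z t => (l : ℂ) * (root a ξ z ^ i * (t : ℂ) ^ (l - 1) *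
        Complex.exp (-root a ξ z * t))) ?_ (IsSym.smul (-1) (IsSym.basic (i + 1) l (by subst h; ring))), ?_⟩
    · rcases l with _ | l
      · simpa using IsSym.zero _
      · exact (IsSym.basic i l (by subst h; push_cast; ring)).smul _
    · intro ξ z hz t
      have h0 := root_ne_zero ha hz ξ
      have h1 : HasDerivAt (fun τ : ℂ => root a ξ z ^ i * τ ^ l * Complex.exp (-root a ξ z * τ))
          (root a ξ z ^ i * ((l : ℂ) * (t : ℂ) ^ (l - 1)) * Complex.exp (-root a ξ z * t) +
            root a ξ z ^ i * (t : ℂ) ^ l * (Complex.exp (-root a ξ z * t) * (-root a ξ z * 1))) (t : ℂ) :=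
        (((hasDerivAt_pow l (t : ℂ)).const_mul _).mul
          (((hasDerivAt_id (t : ℂ)).const_mul (-root a ξ z)).cexp))
      refine h1.comp_ofReal.congr_deriv ?_
      rw [zpow_add₀ h0, zpow_one]
      ring
  | smul c h ih =>
    obtain ⟨S', h', hd⟩ := ih
    exact ⟨_, h'.smul c, fun ξ z hz t => (hd ξ z hz t).const_mul c⟩
  | add h1 h2 ih1 ih2 =>
    obtain ⟨S1, h1', hd1⟩ := ih1
    obtain ⟨S2, h2', hd2⟩ := ih2
    exact ⟨_, h1'.add h2', fun ξ z hz t => (hd1 ξ z hz t).add (hd2 ξ z hz t)⟩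
  | mulCoord j h h' ih =>
    obtain ⟨S', h', hd⟩ := ih
    exact ⟨_, h'.mulCoord j (by rw [h]), fun ξ z hz t => (hd ξ z hz t).const_mul _⟩
  | mulSqrt h h' ih =>
    obtain ⟨S', h', hd⟩ := ih
    exact ⟨_, h'.mulSqrt (by rw [h]), fun ξ z hz t => (hd ξ z hz t).const_mul _⟩
  | congr h h' ih =>
    obtain ⟨S', h', hd⟩ := ih
    refine ⟨S', h', fun ξ z hz t => ?_⟩
    have : (fun t => _) = _ := funext fun t => h ξ z hz t
    exact this ▸ hd ξ z hz t

lemma hasDerivAt_root (ha : 0 < a) (hz : z ∈ ℂ₊) (ξ : Tan n) :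
    HasDerivAt (root a ξ) (a / (2 * root a ξ z)) z := by
  have h1 : HasDerivAt (radicand a ξ) (a * 1) z := ((hasDerivAt_id z).const_mul (a : ℂ)).const_add _
  refine ((hasDerivAt_sqz (radicand_slitPlane ha hz ξ)).comp z h1).congr_deriv ?_
  change 1 / (2 * root a ξ z) * _ = _
  ring

lemma IsSym.exists_hasDerivAt_z (ha : 0 < a) (h : IsSym a d S) : ∃ S', IsSym a d S' ∧ ∀ ξ, ∀ z ∈ ℂ₊, ∀ t,
      HasDerivAt (fun z => S ξ z t) (S' ξ z t / z) z := by
  induction h with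
  | @basic i l d h =>
    have s1 := ((IsSym.basic (a := a) (n := n) (i - 2) l (d := d - 2) (by subst h; ring)).mulSqrt
      (d' := d - 1) (by ring)).mulSqrt (d' := d) (by ring)
    have s2 := ((IsSym.basic (a := a) (n := n) (i - 1) (l + 1) (d := d - 2)
      (by subst h; push_cast; ring)).mulSqrt (d' := d - 1) (by ring)).mulSqrt (d' := d) (by ring)
    refine ⟨_, (s1.smul (i * a / 2)).add (s2.smul (-a / 2)), fun ξ z hz t => ?_⟩
    have h0 := root_ne_zero ha hz ξ
    have hz0 := rhp_ne_zero hz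
    have hr := hasDerivAt_root ha hz ξ
    have h1 : HasDerivAt (fun z => root a ξ z ^ i) (i * root a ξ z ^ (i - 1) * (a / (2 * root a ξ z))) z :=
      (hasDerivAt_zpow i _ (Or.inl h0)).comp z hr
    have h2 : HasDerivAt (fun z => Complex.exp (-root a ξ z * t))
        (Complex.exp (-root a ξ z * t) * (-(a / (2 * root a ξ z)) * t)) z :=
      (hr.neg.mul_const _).cexp
    refine ((h1.mul_const ((t : ℂ) ^ l)).mul h2).congr_deriv ?_
    have hs : sqz z * sqz z = z := by rw [← sq, sqz_sq]
    have e2 : root a ξ z ^ (i - 2) = root a ξ z ^ i / root a ξ z ^ 2 := by rw [zpow_sub₀ h0]; norm_cast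
    have e1 : root a ξ z ^ (i - 1) = root a ξ z ^ i / root a ξ z := zpow_sub_one₀ h0 i
    rw [e2, e1, eq_div_iff hz0]
    simp only [← mul_assoc]
    rw [mul_assoc (↑i * ↑a / 2 : ℂ), mul_assoc (-↑a / 2 : ℂ), hs, pow_succ]
    field_simp
    ring
  | smul c h ih =>
    obtain ⟨S', h', hd⟩ := ih
    exact ⟨_, h'.smul c, fun ξ z hz t => ((hd ξ z hz t).const_mul c).congr_deriv (by ring)⟩
  | add h1 h2 ih1 ih2 =>
    obtain ⟨S1, h1', hd1⟩ := ih1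
    obtain ⟨S2, h2', hd2⟩ := ih2
    exact ⟨_, h1'.add h2', fun ξ z hz t => ((hd1 ξ z hz t).add (hd2 ξ z hz t)).congr_deriv (by ring)⟩
  | mulCoord j h h' ih =>
    obtain ⟨S', h', hd⟩ := ih
    exact ⟨_, h'.mulCoord j h, fun ξ z hz t => ((hd ξ z hz t).const_mul _).congr_deriv (by ring)⟩
  | mulSqrt h h' ih =>
    obtain ⟨S', h'', hd⟩ := ih
    refine ⟨_, ((h'.smul (1 / 2)).add h'').mulSqrt h, fun ξ z hz t => ?_⟩
    have hz0 := rhp_ne_zero hz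
    have hs0 := sqz_ne_zero hz0
    refine ((hasDerivAt_sqz (rhp_slitPlane hz)).mul (hd ξ z hz t)).congr_deriv ?_
    have hs : sqz z ^ 2 = z := sqz_sq z
    have : 1 / (2 * sqz z) = sqz z / (2 * z) := by nth_rw 3 [← hs]; field_simp
    rw [this]
    field_simp
  | congr h h' ih =>
    obtain ⟨S', h', hd⟩ := ih
    refine ⟨S', h', fun ξ z hz t => ?_⟩
    refine (hd ξ z hz t).congr_of_eventuallyEq ?_
    filter_upwards [isOpen_rightHalfPlane.mem_nhds hz] with z' hz'
    exact (h ξ z' hz' t).symm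

lemma continuous_sqz_comp {X : Type*} [TopologicalSpace X] {f : X → ℂ} (hf : Continuous f)
    (h : ∀ x, f x ∈ slitPlane) : Continuous fun x => sqz (f x) :=
  hf.cpow continuous_const h

lemma IsSym.continuous (ha : 0 < a) (h : IsSym a d S) (hz : z ∈ ℂ₊) : Continuous fun p : Tan n × ℝ => S p.1 z p.2 := by
  induction h with
  | basic i l h =>
    have hr : Continuous fun p : Tan n × ℝ => root a p.1 z := by
      refine continuous_sqz_comp ?_ fun p => radicand_slitPlane ha hz _
      unfold radicand
      fun_prop
    have := hr.zpow₀ i fun p => Or.inl (root_ne_zero ha hz _)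
    fun_prop
  | smul c h ih => fun_prop
  | add h1 h2 ih1 ih2 => fun_prop
  | mulCoord j h h' ih => fun_prop
  | mulSqrt h h' ih => fun_prop
  | congr h h' ih => exact ih.congr fun p => h _ z hz _

end Symbols

section SymbolBounds
variable {n : ℕ} {a : ℝ}
variable {d : ℤ} {S : Symb n}

/-- The radicand along a complex line. -/
def lineRadicand (a : ℝ) (ξ h : Tan n) (z τ : ℂ) : ℂ :=
  radicand a ξ z + (2 * (inner ℝ ξ h : ℝ) * τ + (‖h‖ ^ 2 : ℝ) * τ ^ 2)

lemma lineRadicand_ofReal (ξ h : Tan n) (z : ℂ) (τ : ℝ) :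
    lineRadicand a ξ h z τ = radicand a (ξ + τ • h) z := by
  unfold lineRadicand radicand
  rw [norm_add_sq_real, inner_smul_right, norm_smul, mul_pow, norm_eq_abs, sq_abs]
  push_cast
  ring

lemma lineRadicand_bounds (ha : 0 < a) {z : ℂ} (hz : z ∈ ℂ₊) {ξ h : Tan n} {τ : ℂ}
    (hτ : ‖τ‖ * ‖h‖ ≤ min 1 a / 36 * weight z ξ) : 3 / 4 * ‖radicand a ξ z‖ ≤ ‖lineRadicand a ξ h z τ‖ ∧
    ‖lineRadicand a ξ h z τ‖ ≤ 5 / 4 * ‖radicand a ξ z‖ ∧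
    ‖radicand a ξ z‖ / 2 ≤ ‖lineRadicand a ξ h z τ‖ + (lineRadicand a ξ h z τ).re := by
  have hw := weight_pos hz ξ
  have hm : 0 < min 1 a := lt_min one_pos ha
  have hm1 : min 1 a ≤ 1 := min_le_left _ _
  have hξ : ‖ξ‖ ≤ weight z ξ := by rw [weight_eq]; linarith [norm_nonneg (sqz z)]
  set D := (2 * (inner ℝ ξ h : ℝ) * τ + (‖h‖ ^ 2 : ℝ) * τ ^ 2 : ℂ) with hD
  have h1 : ‖D‖ ≤ 2 * ‖ξ‖ * (‖τ‖ * ‖h‖) + (‖τ‖ * ‖h‖) ^ 2 := by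
    refine (norm_add_le _ _).trans (add_le_add ?_ (le_of_eq ?_))
    · rw [norm_mul, norm_mul, norm_real, norm_two]
      have := abs_real_inner_le_norm ξ h
      rw [← norm_eq_abs] at this
      nlinarith [norm_nonneg τ]
    · rw [norm_mul, norm_real, norm_pow, norm_pow, norm_norm]; ring
  have h2 : ‖D‖ ≤ ‖radicand a ξ z‖ / 4 := by
    have h3 := le_norm_radicand ha hz ξ
    have h4 : 0 ≤ ‖τ‖ * ‖h‖ := by positivity
    have h5 : ‖τ‖ * ‖h‖ ≤ weight z ξ := hτ.trans (by nlinarith)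
    have h6 : ‖D‖ ≤ 3 * weight z ξ * (‖τ‖ * ‖h‖) := by nlinarith
    have h7 : 3 * weight z ξ * (‖τ‖ * ‖h‖) ≤ 3 * weight z ξ * (min 1 a / 36 * weight z ξ) :=
      mul_le_mul_of_nonneg_left hτ (by positivity)
    nlinarith
  have e : lineRadicand a ξ h z τ = radicand a ξ z + D := rfl
  have hre : -‖D‖ ≤ D.re := (abs_le.1 (abs_re_le_norm D)).1
  have hpos := radicand_re_pos ha hz ξ
  have h8 := norm_add_le (radicand a ξ z) D
  have h9 := norm_sub_le (radicand a ξ z + D) D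
  rw [add_sub_cancel_right] at h9
  rw [e, add_re]
  refine ⟨by linarith, by linarith, by linarith⟩

lemma exists_zpow_le {c₁ c₂ : ℝ} (h₁ : 0 < c₁) (h₂ : 0 < c₂) (i : ℤ) : ∃ K : ℝ, 0 < K ∧
    ∀ s x : ℝ, 0 < s → c₁ * s ≤ x → x ≤ c₂ * s → x ^ i ≤ K * s ^ i := by
  rcases i with k | k
  · refine ⟨c₂ ^ k, by positivity, fun s x hs hx1 hx2 => ?_⟩
    simp only [Int.ofNat_eq_natCast, zpow_natCast]
    rw [← mul_pow]
    exact pow_le_pow_left₀ (by nlinarith) hx2 k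
  · refine ⟨(c₁ ^ (k + 1))⁻¹, by positivity, fun s x hs hx1 hx2 => ?_⟩
    simp only [zpow_negSucc]
    rw [← mul_inv, ← mul_pow]
    have : 0 < c₁ * s := by positivity
    gcongr

lemma exists_pow_mul_exp_le {c : ℝ} (hc : 0 < c) (l : ℕ) : ∃ K : ℝ, 0 < K ∧
    ∀ s t : ℝ, 0 < s → 0 < t → t ^ l * exp (-(2 * c * s * t)) ≤ K * s ^ (-(l : ℤ)) * exp (-(c * s * t)) := by
  refine ⟨l.factorial / c ^ l, by positivity, fun s t hs ht => ?_⟩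
  have h1 := Real.pow_div_factorial_le_exp (c * s * t) (by positivity) l
  have h2 : (t : ℝ) ^ l ≤ l.factorial / c ^ l * s ^ (-(l : ℤ)) * exp (c * s * t) := by
    rw [zpow_neg, zpow_natCast]
    rw [div_le_iff₀ (by positivity), mul_pow, mul_pow] at h1
    have e : ↑l.factorial / c ^ l * (s ^ l)⁻¹ * exp (c * s * t) =
        (exp (c * s * t) * l.factorial) / (c ^ l * s ^ l) := by field_simp
    rw [e, le_div_iff₀ (by positivity)]
    linarith
  have h3 : exp (c * s * t) * exp (-(2 * c * s * t)) = exp (-(c * s * t)) := by rw [← Real.exp_add]; congr 1; ring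
  calc _ ≤ (l.factorial / c ^ l * s ^ (-(l : ℤ)) * exp (c * s * t)) * exp (-(2 * c * s * t)) := by gcongr
    _ = _ := by rw [mul_assoc, h3]

/-- A symbol extends holomorphically along complex lines, with a bound of its order. -/
lemma IsSym.exists_line_bound (ha : 0 < a) (h : IsSym a d S) :
    ∃ C c : ℝ, 0 < C ∧ 0 < c ∧ ∀ z ∈ ℂ₊, ∀ t : ℝ, 0 < t → ∀ ξ h : Tan n, ∀ R : ℝ, 0 < R →
      R * ‖h‖ ≤ min 1 a / 36 * weight z ξ → ∃ g : ℂ → ℂ, DifferentiableOn ℂ g (ball 0 R) ∧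
        (∀ τ : ℝ, g τ = S (ξ + τ • h) z t) ∧
        ∀ τ ∈ ball (0 : ℂ) R, ‖g τ‖ ≤ C * weight z ξ ^ d * exp (-(c * weight z ξ * t)) := by
  induction h with
  | @basic i l d hd =>
    set κ := min 1 a / 3 with hκ
    have hm : 0 < min 1 a := lt_min one_pos ha
    have hκ0 : 0 < κ := by positivity
    have hM : 0 < max 1 a := lt_max_of_lt_left one_pos
    set c₁ := √(3 / 4 * κ) with hc₁
    set c₂ := √(5 / 4 * max 1 a) with hc₂
    have hc₁0 : 0 < c₁ := sqrt_pos.2 (by positivity)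
    have hc₂0 : 0 < c₂ := sqrt_pos.2 (by positivity)
    set c := √κ / 4 with hc
    have hc0 : 0 < c := by positivity
    obtain ⟨K1, hK₁, hK₁'⟩ := exists_zpow_le hc₁0 hc₂0 i
    obtain ⟨K2, hK₂, hK₂'⟩ := exists_pow_mul_exp_le hc0 l
    refine ⟨K1 * K2, c, by positivity, hc0, fun z hz t ht ξ h R hR hRh =>
      ⟨fun τ => sqz (lineRadicand a ξ h z τ) ^ i * (t : ℂ) ^ l *
        Complex.exp (-sqz (lineRadicand a ξ h z τ) * t), ?_, ?_, ?_⟩⟩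
    · intro τ hτ
      have hτ' : ‖τ‖ * ‖h‖ ≤ min 1 a / 36 * weight z ξ := by
        refine le_trans (mul_le_mul_of_nonneg_right ?_ (norm_nonneg _)) hRh
        simpa using (mem_ball.1 hτ).le
      have hb := lineRadicand_bounds ha hz hτ'
      have hr0 : 0 < ‖radicand a ξ z‖ := norm_pos_iff.2 (slitPlane_ne_zero (radicand_slitPlane ha hz ξ))
      have hsl : lineRadicand a ξ h z τ ∈ slitPlane := mem_slitPlane_of_pos (by linarith [hb.2.2])
      have hd : DifferentiableAt ℂ (fun τ => sqz (lineRadicand a ξ h z τ)) τ := by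
        refine (hasDerivAt_sqz hsl).differentiableAt.comp τ ?_
        unfold lineRadicand
        fun_prop
      have h0 : sqz (lineRadicand a ξ h z τ) ≠ 0 := sqz_ne_zero (slitPlane_ne_zero hsl)
      exact (((hd.zpow (Or.inl h0)).mul_const _).mul (hd.neg.mul_const _).cexp).differentiableWithinAt
    · intro τ
      simp only [lineRadicand_ofReal]
      rfl
    · intro τ hτ
      have hτ' : ‖τ‖ * ‖h‖ ≤ min 1 a / 36 * weight z ξ := by
        refine le_trans (mul_le_mul_of_nonneg_right ?_ (norm_nonneg _)) hRh
        simpa using (mem_ball.1 hτ).le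
      obtain ⟨hb1, hb2, hb3⟩ := lineRadicand_bounds ha hz hτ'
      have hw := weight_pos hz ξ
      set w := lineRadicand a ξ h z τ
      set s := weight z ξ
      have hl := le_norm_radicand ha hz ξ
      have hu := norm_radicand_le ha z ξ
      have n1 : c₁ * s ≤ ‖sqz w‖ := by
        refine (abs_le_of_sq_le_sq' ?_ (norm_nonneg _)).2
        rw [norm_sqz_sq, mul_pow, hc₁, sq_sqrt (by positivity)]
        nlinarith
      have n2 : ‖sqz w‖ ≤ c₂ * s := by
        refine (abs_le_of_sq_le_sq' ?_ (by positivity)).2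
        rw [norm_sqz_sq, mul_pow, hc₂, sq_sqrt (by positivity)]
        nlinarith
      have n3 : 2 * c * s ≤ (sqz w).re := by
        refine (abs_le_of_sq_le_sq' ?_ (sqz_re_nonneg _)).2
        have := sqz_re_sq w
        have hk : √κ ^ 2 = κ := sq_sqrt hκ0.le
        have : (2 * c * s) ^ 2 = κ * s ^ 2 / 4 := by
          rw [hc, show (2 * (√κ / 4) * s) ^ 2 = √κ ^ 2 * s ^ 2 / 4 by ring, hk]
        nlinarith
      rw [norm_mul, norm_mul, norm_zpow, norm_pow, norm_real, norm_of_nonneg ht.le, Complex.norm_exp]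
      have e1 : (-sqz w * (t : ℂ)).re = -((sqz w).re * t) := by simp
      rw [e1]
      calc ‖sqz w‖ ^ i * t ^ l * exp (-((sqz w).re * t))
          ≤ (K1 * s ^ i) * (t ^ l * exp (-(2 * c * s * t))) := by
            rw [mul_assoc]
            gcongr
            exact hK₁' s _ hw n1 n2
        _ ≤ (K1 * s ^ i) * (K2 * s ^ (-(l : ℤ)) * exp (-(c * s * t))) := by
            gcongr ?_ * ?_
            exact hK₂' s t hw ht
        _ = _ := by rw [hd, sub_eq_add_neg, zpow_add₀ hw.ne']; ring
  | smul k h ih =>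
    obtain ⟨C, c, hC, hc, H⟩ := ih
    refine ⟨(‖k‖ + 1) * C, c, by positivity, hc, fun z hz t ht ξ h R hR hRh => ?_⟩
    obtain ⟨g, hg1, hg2, hg3⟩ := H z hz t ht ξ h R hR hRh
    refine ⟨fun τ => k * g τ, hg1.const_mul _, fun τ => by simp only [hg2], fun τ hτ => ?_⟩
    rw [norm_mul, mul_assoc, mul_assoc, ← mul_assoc C]
    exact mul_le_mul (by linarith) (hg3 τ hτ) (norm_nonneg _) (by positivity)
  | add h1 h2 ih1 ih2 =>
    obtain ⟨C, c, hC, hc, H⟩ := ih1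
    obtain ⟨C', c', hC', hc', H'⟩ := ih2
    refine ⟨C + C', min c c', by positivity, lt_min hc hc', fun z hz t ht ξ h R hR hRh => ?_⟩
    obtain ⟨g, hg1, hg2, hg3⟩ := H z hz t ht ξ h R hR hRh
    obtain ⟨g', hg1', hg2', hg3'⟩ := H' z hz t ht ξ h R hR hRh
    refine ⟨fun τ => g τ + g' τ, hg1.add hg1', fun τ => by simp only [hg2, hg2'], fun τ hτ => ?_⟩
    have hw := weight_pos hz ξ
    refine (norm_add_le _ _).trans ?_
    rw [add_mul, add_mul]
    refine add_le_add ((hg3 τ hτ).trans ?_) ((hg3' τ hτ).trans ?_)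
    · gcongr; exact min_le_left _ _
    · gcongr; exact min_le_right _ _
  | @mulCoord j d d' S h h' ih =>
    obtain ⟨C, c, hC, hc, H⟩ := ih
    refine ⟨2 * C, c, by positivity, hc, fun z hz t ht ξ η R hR hRh => ?_⟩
    obtain ⟨g, hg1, hg2, hg3⟩ := H z hz t ht ξ η R hR hRh
    refine ⟨fun τ => ((ξ j : ℂ) + τ * (η j : ℂ)) * g τ, ?_, fun τ => ?_, fun τ hτ => ?_⟩
    · exact ((differentiableOn_id.mul_const _).const_add _).mul hg1
    · simp only [hg2]; simp
    · have hw := weight_pos hz ξ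
      have h1 : ‖(ξ j : ℂ) + τ * (η j : ℂ)‖ ≤ 2 * weight z ξ := by
        refine (norm_add_le _ _).trans ?_
        rw [norm_mul, norm_real, norm_real]
        have e1 : ‖ξ j‖ ≤ ‖ξ‖ := PiLp.norm_apply_le ξ j
        have e2 : ‖η j‖ ≤ ‖η‖ := PiLp.norm_apply_le η j
        have e3 : ‖τ‖ < R := by simpa using hτ
        have e4 : ‖τ‖ * ‖η j‖ ≤ R * ‖η‖ := by gcongr
        have e5 : min 1 a / 36 * weight z ξ ≤ weight z ξ := by
          have := min_le_left 1 a
          nlinarith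
        have e6 : ‖ξ‖ ≤ weight z ξ := by rw [weight_eq]; linarith [norm_nonneg (sqz z)]
        linarith
      rw [norm_mul]
      calc _ ≤ (2 * weight z ξ) * (C * weight z ξ ^ d * exp (-(c * weight z ξ * t))) :=
            mul_le_mul h1 (hg3 τ hτ) (norm_nonneg _) (by positivity)
        _ = _ := by rw [h, zpow_add_one₀ hw.ne']; ring
  | @mulSqrt d d' S h h' ih =>
    obtain ⟨C, c, hC, hc, H⟩ := ih
    refine ⟨C, c, by positivity, hc, fun z hz t ht ξ η R hR hRh => ?_⟩
    obtain ⟨g, hg1, hg2, hg3⟩ := H z hz t ht ξ η R hR hRh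
    refine ⟨fun τ => sqz z * g τ, hg1.const_mul _, fun τ => by simp only [hg2], fun τ hτ => ?_⟩
    have hw := weight_pos hz ξ
    have h1 : ‖sqz z‖ ≤ weight z ξ := by rw [weight_eq]; linarith [norm_nonneg ξ]
    rw [norm_mul]
    calc _ ≤ (weight z ξ) * (C * weight z ξ ^ d * exp (-(c * weight z ξ * t))) :=
            mul_le_mul h1 (hg3 τ hτ) (norm_nonneg _) (by positivity)
      _ = _ := by rw [h, zpow_add_one₀ hw.ne']; ring
  | congr h h' ih =>
    obtain ⟨C, c, hC, hc, H⟩ := ih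
    refine ⟨C, c, hC, hc, fun z hz t ht ξ η R hR hRh => ?_⟩
    obtain ⟨g, hg1, hg2, hg3⟩ := H z hz t ht ξ η R hR hRh
    exact ⟨g, hg1, fun τ => by rw [hg2, h _ z hz], hg3⟩

lemma iteratedDeriv_comp_ofReal {g : ℂ → ℂ} {R : ℝ} (hg : DifferentiableOn ℂ g (ball 0 R))
    (k : ℕ) : ∀ τ : ℝ, |τ| < R → iteratedDeriv k (fun τ : ℝ => g τ) τ = iteratedDeriv k g τ := by
  induction k with
  | zero => intro τ _; simp
  | succ k ih =>
    intro τ hτ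
    rw [iteratedDeriv_succ, iteratedDeriv_succ]
    have hmem : (τ : ℂ) ∈ ball (0 : ℂ) R := by simpa using hτ
    have h1 : iteratedDeriv k (fun τ : ℝ => g τ) =ᶠ[nhds τ] fun τ => iteratedDeriv k g τ := by
      have : {τ : ℝ | |τ| < R} ∈ nhds τ := (isOpen_lt continuous_abs continuous_const).mem_nhds hτ
      filter_upwards [this] with σ hσ using ih σ hσ
    rw [h1.deriv_eq]
    have han : AnalyticAt ℂ g τ := (hg.analyticOnNhd isOpen_ball) _ hmem
    have hd : DifferentiableAt ℂ (iteratedDeriv k g) τ := by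
      rw [iteratedDeriv_eq_iterate]
      exact (han.iterated_deriv k).differentiableAt
    exact hd.hasDerivAt.comp_ofReal.deriv

lemma IsSym.exists_iteratedDeriv_bound (ha : 0 < a) (h : IsSym a d S) :
    ∃ c : ℝ, 0 < c ∧ ∀ k : ℕ, ∃ C : ℝ, 0 < C ∧ ∀ z ∈ ℂ₊, ∀ t : ℝ, 0 < t → ∀ ξ h : Tan n,
      ContDiffAt ℝ ∞ (fun τ : ℝ => S (ξ + τ • h) z t) 0 ∧
      ‖iteratedDeriv k (fun τ : ℝ => S (ξ + τ • h) z t) 0‖ ≤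
        C * ‖h‖ ^ k * weight z ξ ^ (d - k) * exp (-(c * weight z ξ * t)) := by
  obtain ⟨C, c, hC, hc, H⟩ := h.exists_line_bound ha
  have hm : 0 < min 1 a := lt_min one_pos ha
  set ε := min 1 a / 36 with hε
  have hε0 : 0 < ε := by positivity
  refine ⟨c, hc, fun k => ⟨k.factorial * C * (2 / ε) ^ k, by positivity, fun z hz t ht ξ η => ?_⟩⟩
  have hw := weight_pos hz ξ
  rcases eq_or_ne η 0 with rfl | hη
  · simp only [smul_zero, add_zero]
    refine ⟨contDiffAt_const, ?_⟩
    rcases k with _ | k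
    · obtain ⟨g, -, hg2, hg3⟩ := H z hz t ht ξ 0 1 one_pos (by rw [norm_zero, mul_zero]; positivity)
      have := hg3 0 (by simp)
      have h0 := hg2 0
      simp only [ofReal_zero, zero_smul, add_zero] at h0
      rw [h0] at this
      simpa using this
    · rw [iteratedDeriv_const]
      simp only [Nat.succ_ne_zero, if_false, norm_zero]
      positivity
  have hη0 : 0 < ‖η‖ := norm_pos_iff.2 hη
  set R := ε * weight z ξ / ‖η‖ with hR
  have hR0 : 0 < R := by positivity
  obtain ⟨g, hg1, hg2, hg3⟩ := H z hz t ht ξ η R hR0 (by rw [hR, div_mul_cancel₀ _ hη0.ne'])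
  have e : (fun τ : ℝ => S (ξ + τ • η) z t) = fun τ : ℝ => g τ := funext fun τ => (hg2 τ).symm
  rw [e]
  have han : AnalyticAt ℂ g ((0 : ℝ) : ℂ) := (hg1.analyticOnNhd isOpen_ball) _ (by simpa using hR0)
  refine ⟨?_, ?_⟩
  · have h1 : ContDiffAt ℝ ∞ g ((0 : ℝ) : ℂ) := han.contDiffAt.restrict_scalars ℝ
    exact h1.comp (0 : ℝ) ofRealCLM.contDiff.contDiffAt
  · rw [iteratedDeriv_comp_ofReal hg1 k 0 (by simpa using hR0)]
    have hR2 : 0 < R / 2 := by positivity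
    have hcl : Metric.closedBall (0 : ℂ) (R / 2) ⊆ ball 0 R := Metric.closedBall_subset_ball (by linarith)
    have := Complex.norm_iteratedDeriv_le_of_forall_mem_sphere_norm_le k hR2
      ((hg1.mono hcl).diffContOnCl_ball subset_rfl)
      (fun τ hτ => hg3 τ (hcl (Metric.sphere_subset_closedBall hτ)))
    rw [ofReal_zero]
    refine this.trans (le_of_eq ?_)
    rw [hR, zpow_sub₀ hw.ne', zpow_natCast, div_pow, div_pow, div_pow, mul_pow]
    field_simp

end SymbolBounds

/-! ## Finite differences -/

lemma norm_fwdDiff_iter_le (j : ℕ) : ∀ (g : ℝ → ℂ) (τ0 C : ℝ),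
    (∀ τ ∈ Icc τ0 (τ0 + j), ContDiffAt ℝ j g τ ∧ ‖iteratedDeriv j g τ‖ ≤ C) →
    ‖(fwdDiff (1 : ℝ))^[j] g τ0‖ ≤ C := by
  induction j with
  | zero =>
    intro g τ0 C h
    simpa using (h τ0 (by simp)).2
  | succ j ih =>
    intro g τ0 C h
    rw [Function.iterate_succ_apply]
    refine ih _ _ _ fun τ hτ => ?_
    have hsub : Icc τ (τ + 1) ⊆ Icc τ0 (τ0 + (j + 1 : ℕ)) := by
      intro σ hσ
      push_cast
      exact ⟨hτ.1.trans hσ.1, by linarith [hσ.2, hτ.2]⟩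
    have c1 : ContDiffAt ℝ j g τ := (h τ (hsub (by simp))).1.of_le (by exact_mod_cast Nat.le_succ j)
    have c2 : ContDiffAt ℝ j (fun τ => g (τ + 1)) τ := by
      have : ContDiffAt ℝ j g (τ + 1) := (h (τ + 1) (hsub (by simp))).1.of_le (by exact_mod_cast Nat.le_succ j)
      exact this.comp τ (by fun_prop)
    refine ⟨c2.sub c1, ?_⟩
    have e : iteratedDeriv j (fwdDiff 1 g) τ = iteratedDeriv j g (τ + 1) - iteratedDeriv j g τ := by
      have := iteratedDeriv_sub c2 c1
      rw [iteratedDeriv_comp_add_const] at this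
      exact this
    rw [e]
    have hd : ∀ σ ∈ Icc τ (τ + 1), HasDerivWithinAt (iteratedDeriv j g) (iteratedDeriv (j + 1) g σ)
        (Icc τ (τ + 1)) σ := by
      intro σ hσ
      have h1 := (h σ (hsub hσ)).1.differentiableAt_iteratedFDeriv (m := j)
        (by exact_mod_cast Nat.lt_succ_self j)
      have : DifferentiableAt ℝ (iteratedDeriv j g) σ := by
        rw [iteratedDeriv_eq_equiv_comp]
        exact (LinearIsometryEquiv.differentiable _).differentiableAt.comp σ h1
      rw [iteratedDeriv_succ]
      exact this.hasDerivAt.hasDerivWithinAt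
    have := (convex_Icc τ (τ + 1)).norm_image_sub_le_of_norm_hasDerivWithin_le hd
      (fun σ hσ => (h σ (hsub hσ)).2) (left_mem_Icc.2 (by linarith)) (right_mem_Icc.2 (by linarith))
    simpa using this

section Lines
variable {n : ℕ}
variable {m : Tan n → ℂ} {B : Tan n → ℝ} {ξ h : Tan n} {C D : ℝ}

/-- `m` is smooth along lines away from the origin, with directional derivatives of order `k`
bounded by `B`. -/
def LineBound (m : Tan n → ℂ) (k : ℕ) (B : Tan n → ℝ) : Prop :=
  ∀ ξ ≠ 0, ∀ h, ContDiffAt ℝ ∞ (fun τ : ℝ => m (ξ + τ • h)) 0 ∧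
    ‖iteratedDeriv k (fun τ : ℝ => m (ξ + τ • h)) 0‖ ≤ ‖h‖ ^ k * B ξ

lemma LineBound.at_shift {k : ℕ} (H : LineBound m k B) (ξ h : Tan n)
    (τ : ℝ) (hτ : ξ + τ • h ≠ 0) : ContDiffAt ℝ ∞ (fun τ : ℝ => m (ξ + τ • h)) τ ∧
      ‖iteratedDeriv k (fun τ : ℝ => m (ξ + τ • h)) τ‖ ≤ ‖h‖ ^ k * B (ξ + τ • h) := by
  obtain ⟨h1, h2⟩ := H _ hτ h
  have e : (fun σ : ℝ => m (ξ + σ • h)) = fun σ : ℝ => (fun σ : ℝ => m (ξ + τ • h + σ • h)) (σ - τ) := by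
    ext σ
    dsimp only
    rw [add_assoc, ← add_smul]
    simp
  rw [e]
  refine ⟨?_, ?_⟩
  · refine ContDiffAt.comp τ (g := fun σ : ℝ => m (ξ + τ • h + σ • h)) ?_ (by fun_prop)
    simpa using h1
  · rw [iteratedDeriv_comp_sub_const k (fun σ : ℝ => m (ξ + τ • h + σ • h)) τ]
    simpa using h2

lemma fwdDiff_iter_line (m : Tan n → ℂ) (ξ h : Tan n) (j : ℕ) :
    (fwdDiff h)^[j] m ξ = (fwdDiff (1 : ℝ))^[j] (fun τ : ℝ => m (ξ + τ • h)) 0 := by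
  rw [fwdDiff_iter_eq_sum_shift, fwdDiff_iter_eq_sum_shift]
  simp [Nat.cast_smul_eq_nsmul]

lemma LineBound.norm_fwdDiff_le {j : ℕ} (H : LineBound m j B) (hne : ∀ τ ∈ Icc (0 : ℝ) j, ξ + τ • h ≠ 0 ∧ B (ξ + τ • h) ≤ C) :
    ‖(fwdDiff h)^[j] m ξ‖ ≤ ‖h‖ ^ j * C := by
  rw [fwdDiff_iter_line]
  refine norm_fwdDiff_iter_le j _ _ _ fun τ hτ => ?_
  rw [zero_add] at hτ
  obtain ⟨h1, h2⟩ := H.at_shift ξ h τ (hne τ hτ).1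
  refine ⟨h1.of_le (by exact_mod_cast le_top), h2.trans ?_⟩
  exact mul_le_mul_of_nonneg_left (hne τ hτ).2 (by positivity)

lemma norm_fwdDiff_iter_le_sum (m : Tan n → ℂ) (ξ h : Tan n) (j : ℕ)
    (hC : ∀ k ∈ Finset.range (j + 1), ‖m (ξ + k • h)‖ ≤ C) : ‖(fwdDiff h)^[j] m ξ‖ ≤ 2 ^ j * C := by
  rw [fwdDiff_iter_eq_sum_shift]
  refine (norm_sum_le _ _).trans ?_
  have e : (2 : ℝ) ^ j * C = ∑ k ∈ Finset.range (j + 1), (j.choose k : ℝ) * C := by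
    rw [← sum_mul]
    congr 1
    exact_mod_cast (Nat.sum_range_choose j).symm
  rw [e]
  refine sum_le_sum fun k hk => ?_
  rw [← Int.cast_smul_eq_zsmul ℝ, norm_smul]
  push_cast
  rw [norm_mul, norm_pow, norm_neg, norm_one, one_pow, one_mul, Real.norm_natCast]
  exact mul_le_mul_of_nonneg_left (hC k hk) (by positivity)

/-! ## Multipliers at a fixed value of the parameter -/

/-- The estimates of a multiplier of order `r` at a fixed `z`. -/
structure SymbolBound (r : ℤ) (A : ℕ → ℝ) (z : ℂ) (v : Tan n → ℂ) : Prop where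
  smooth : ContDiffOn ℝ ∞ v {0}ᶜ
  bound : ∀ (k : ℕ), ∀ ξ ≠ 0, ∀ h : Tan n, ‖iteratedFDeriv ℝ k v ξ (fun _ => h)‖ ≤ A k * ‖h‖ ^ k * weight z ξ ^ (r - k)

/-- In one variable, `v` is even; in more variables there is no condition. -/
def EvenIfOne (v : Tan n → ℂ) : Prop := n = 1 → ∀ ξ, v (-ξ) = v ξ

lemma ContDiffOn.line {v : Tan n → ℂ} (hv : ContDiffOn ℝ ∞ v {0}ᶜ) (ξ h : Tan n) (k : ℕ) :
    ∀ τ : ℝ, ξ + τ • h ≠ 0 → ContDiffAt ℝ ∞ (fun τ : ℝ => v (ξ + τ • h)) τ ∧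
      iteratedDeriv k (fun τ : ℝ => v (ξ + τ • h)) τ = iteratedFDeriv ℝ k v (ξ + τ • h) fun _ => h := by
  have hopen : IsOpen ({0}ᶜ : Set (Tan n)) := isOpen_compl_singleton
  have hline : Continuous fun τ : ℝ => ξ + τ • h := by fun_prop
  induction k with
  | zero =>
    intro τ hτ
    refine ⟨?_, by simp⟩
    exact (hv.contDiffAt (hopen.mem_nhds hτ)).comp τ (by fun_prop)
  | succ k ih =>
    intro τ hτ
    refine ⟨(ih τ hτ).1, ?_⟩
    rw [iteratedDeriv_succ]
    have he : iteratedDeriv k (fun τ : ℝ => v (ξ + τ • h)) =ᶠ[nhds τ]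
        fun τ => iteratedFDeriv ℝ k v (ξ + τ • h) fun _ => h := by
      filter_upwards [(hopen.preimage hline).mem_nhds hτ] with σ hσ using (ih σ hσ).2
    rw [he.deriv_eq]
    have hc : ContDiffAt ℝ ∞ v (ξ + τ • h) := hv.contDiffAt (hopen.mem_nhds hτ)
    have hd : DifferentiableAt ℝ (iteratedFDeriv ℝ k v) (ξ + τ • h) :=
      hc.differentiableAt_iteratedFDeriv (by exact_mod_cast ENat.natCast_lt_top k)
    have hl : HasDerivAt (fun τ : ℝ => ξ + τ • h) h τ := by simpa using ((hasDerivAt_id τ).smul_const h).const_add ξ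
    have h1 := hd.hasFDerivAt.comp_hasDerivAt τ hl
    have h2 := ((ContinuousMultilinearMap.apply ℝ (fun _ : Fin k => Tan n) ℂ fun _ => h).hasFDerivAt
      (x := iteratedFDeriv ℝ k v (ξ + τ • h))).comp_hasDerivAt τ h1
    rw [iteratedFDeriv_succ_apply_left]
    exact h2.deriv

lemma IsMultiplierWith.symbolBound {r : ℤ} {A : ℕ → ℝ} {w : Tan n → ℂ → ℂ}
    (hw : IsMultiplierWith (r : ℝ) A w) {i : ℕ} (hi : i ≤ 1) {z : ℂ} (hz : z ∈ ℂ₊) :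
    SymbolBound r (fun k => n ^ k * A k) z fun ξ => eulerDeriv^[i] (w ξ) z := by
  refine ⟨hw.smooth i hi z hz, fun k ξ hξ h => ?_⟩
  set T := iteratedFDeriv ℝ k (fun ξ => eulerDeriv^[i] (w ξ) z) ξ
  have hh : h = ∑ j : Fin n, h j • EuclideanSpace.single j (1 : ℝ) := by
    have := (basisFun (Fin n) ℝ).sum_repr h
    simpa using this.symm
  have e : T (fun _ => h) = ∑ j : Fin k → Fin n, (∏ l, h (j l)) •
      T fun l => EuclideanSpace.single (j l) (1 : ℝ) := by
    conv_lhs => rw [hh]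
    rw [ContinuousMultilinearMap.map_sum]
    exact sum_congr rfl fun j _ => T.map_smul_univ _ _
  rw [e]
  refine (norm_sum_le _ _).trans ?_
  have hw' := weight_pos hz ξ
  have hb : ∀ j : Fin k → Fin n, ‖(∏ l, h (j l)) • T fun l => EuclideanSpace.single (j l) (1 : ℝ)‖ ≤
      ‖h‖ ^ k * (A k * weight z ξ ^ (r - k)) := by
    intro j
    rw [norm_smul]
    refine mul_le_mul ?_ ?_ (norm_nonneg _) (by positivity)
    · rw [norm_prod]
      refine (Finset.prod_le_prod (fun l _ => norm_nonneg _) fun l _ => PiLp.norm_apply_le h (j l)).trans ?_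
      simp
    · have := hw.bound i hi k j ξ hξ z hz
      rwa [← weight, ← Int.cast_natCast (R := ℝ) k, ← Int.cast_sub, Real.rpow_intCast] at this
  refine (sum_le_sum fun j _ => hb j).trans (le_of_eq ?_)
  simp
  ring

/-- The product of a multiplier and a homogeneous symbol. -/
lemma IsSym.exists_lineBound_mul {a : ℝ} (ha : 0 < a) {d : ℤ} {S : Symb n}
    (h : IsSym a d S) (r : ℤ) (A : ℕ → ℝ) :
    ∃ c : ℝ, 0 < c ∧ ∀ k : ℕ, ∃ C : ℝ, 0 < C ∧ ∀ z ∈ ℂ₊, ∀ v, SymbolBound r A z v →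
      ∀ t : ℝ, 0 < t → LineBound (fun ξ => v ξ * S ξ z t) k
        fun ξ => C * weight z ξ ^ (r + d - k) * exp (-(c * weight z ξ * t)) := by
  obtain ⟨c, hc, H⟩ := h.exists_iteratedDeriv_bound ha
  choose C hC HC using H
  refine ⟨c, hc, fun k => ⟨∑ i ∈ Finset.range (k + 1), k.choose i * (|A i| * C (k - i)) + 1, ?_,
    fun z hz v hv t ht ξ hξ η => ?_⟩⟩
  · have : 0 ≤ ∑ i ∈ Finset.range (k + 1), k.choose i * (|A i| * C (k - i)) :=
      sum_nonneg fun i _ => mul_nonneg (by positivity) (mul_nonneg (abs_nonneg _) (hC _).le)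
    linarith
  have hw := weight_pos hz ξ
  have hξ0 : ξ + (0 : ℝ) • η ≠ 0 := by simpa using hξ
  have hv0 := (hv.smooth.line ξ η 0 0 hξ0).1
  have hS0 := (HC 0 z hz t ht ξ η).1
  refine ⟨hv0.mul hS0, ?_⟩
  have e := iteratedDeriv_mul (n := k) (hv0.of_le (by exact_mod_cast le_top))
    (hS0.of_le (by exact_mod_cast le_top))
  have e' : ((fun τ : ℝ => v (ξ + τ • η)) * fun τ : ℝ => S (ξ + τ • η) z t) =
      fun τ : ℝ => v (ξ + τ • η) * S (ξ + τ • η) z t := rfl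
  rw [← e', e]
  refine (norm_sum_le _ _).trans ?_
  have hb : ∀ i ∈ Finset.range (k + 1), ‖(k.choose i : ℂ) * iteratedDeriv i (fun τ : ℝ => v (ξ + τ • η)) 0 *
      iteratedDeriv (k - i) (fun τ : ℝ => S (ξ + τ • η) z t) 0‖ ≤
      k.choose i * (|A i| * C (k - i)) * (‖η‖ ^ k * weight z ξ ^ (r + d - k) *
        exp (-(c * weight z ξ * t))) := by
    intro i hi
    have hik : i ≤ k := Nat.lt_succ_iff.1 (Finset.mem_range.1 hi)
    rw [norm_mul, norm_mul, Complex.norm_natCast, (hv.smooth.line ξ η i 0 hξ0).2]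
    have b1 := hv.bound i (ξ + (0 : ℝ) • η) hξ0 η
    rw [zero_smul, add_zero] at b1 ⊢
    have b1' : ‖iteratedFDeriv ℝ i v ξ fun _ => η‖ ≤ |A i| * ‖η‖ ^ i * weight z ξ ^ (r - i) :=
      b1.trans (by gcongr; exact le_abs_self _)
    have b2 := (HC (k - i) z hz t ht ξ η).2
    calc _ ≤ (k.choose i : ℝ) * (|A i| * ‖η‖ ^ i * weight z ξ ^ (r - i)) *
          (C (k - i) * ‖η‖ ^ (k - i) * weight z ξ ^ (d - (k - i : ℕ)) * exp (-(c * weight z ξ * t))) := by gcongr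
      _ = k.choose i * (|A i| * C (k - i)) * ((‖η‖ ^ i * ‖η‖ ^ (k - i)) *
          (weight z ξ ^ (r - i) * weight z ξ ^ (d - (k - i : ℕ))) * exp (-(c * weight z ξ * t))) := by ring
      _ = _ := by
          rw [← pow_add, Nat.add_sub_cancel' hik, ← zpow_add₀ hw.ne']
          congr 3
          push_cast [hik]
          ring_nf
  refine (sum_le_sum hb).trans ?_
  rw [← sum_mul]
  have : 0 ≤ ‖η‖ ^ k * weight z ξ ^ (r + d - k) * exp (-(c * weight z ξ * t)) := by positivity
  calc _ ≤ (∑ i ∈ Finset.range (k + 1), k.choose i * (|A i| * C (k - i)) + 1) *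
        (‖η‖ ^ k * weight z ξ ^ (r + d - k) * exp (-(c * weight z ξ * t))) := by
        gcongr; linarith
    _ = _ := by ring

lemma LineBound.norm_le (H : LineBound m 0 B) (hξ : ξ ≠ 0) : ‖m ξ‖ ≤ B ξ := by
  simpa using (H ξ hξ 0).2

/-- A difference along a segment avoiding the origin. -/
lemma LineBound.norm_sub_le (H : LineBound m 1 fun _ => D)
    (hne : ∀ τ ∈ Icc (0 : ℝ) 1, ξ + τ • h ≠ 0) : ‖m (ξ + h) - m ξ‖ ≤ D * ‖h‖ := by
  have := H.norm_fwdDiff_le (ξ := ξ) (h := h) (C := D) fun τ hτ => ⟨hne τ (by simpa using hτ), le_rfl⟩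
  rw [mul_comm]
  simpa [fwdDiff] using this

/-- Lipschitz estimate across the origin, up to a null set. -/
lemma LineBound.ae_norm_sub_le (hn : 1 ≤ n) (hD : 0 ≤ D) (H : LineBound m 1 fun _ => D)
    (hm : n = 1 → ∀ η : Tan n, Filter.Tendsto (fun ε : ℝ => m (ε • η) - m (-(ε • η))) (nhdsWithin 0 (Ioi 0))
      (nhds 0)) (h : Tan n) : ∀ᵐ ξ : Tan n, ‖m (ξ + h) - m ξ‖ ≤ D * ‖h‖ := by
  rcases hn.eq_or_lt with h1 | h2
  · have hn1 : n = 1 := h1.symm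
    have : Nonempty (Fin n) := ⟨⟨0, by omega⟩⟩
    have hnt : Nontrivial (Tan n) := inferInstance
    filter_upwards [Measure.ae_ne volume (0 : Tan n), Measure.ae_ne volume (-h)] with ξ hξ1 hξ2
    by_cases hne : ∀ τ ∈ Icc (0 : ℝ) 1, ξ + τ • h ≠ 0
    · exact H.norm_sub_le hne
    push Not at hne
    obtain ⟨τ, hτ, h0⟩ := hne
    have hξ : ξ = -(τ • h) := eq_neg_of_add_eq_zero_left h0
    have hτ0 : 0 < τ := by
      rcases hτ.1.eq_or_lt with h | h
      · exact absurd (by rw [hξ, ← h]; simp) hξ1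
      · exact h
    have hτ1 : τ < 1 := by
      rcases hτ.2.eq_or_lt with h' | h'
      · exact absurd (by rw [hξ, h', one_smul]) hξ2
      · exact h'
    have hh : h ≠ 0 := by rintro rfl; exact hξ1 (by rw [hξ]; simp)
    have key : ∀ᶠ ε in nhdsWithin (0 : ℝ) (Ioi 0), ‖m (ξ + h) - m ξ‖ ≤
        D * ‖h‖ + ‖m (ε • h) - m (-(ε • h))‖ := by
      filter_upwards [Ioo_mem_nhdsGT (lt_min hτ0 (sub_pos.2 hτ1))] with ε hε
      have hε0 := hε.1
      have hετ : ε < τ := hε.2.trans_le (min_le_left _ _)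
      have hετ' : ε < 1 - τ := hε.2.trans_le (min_le_right _ _)
      have s1 : ‖m (-(ε • h)) - m ξ‖ ≤ D * ‖(τ - ε) • h‖ := by
        have := H.norm_sub_le (ξ := ξ) (h := (τ - ε) • h) fun σ hσ => by
          rw [hξ, smul_smul, ← neg_smul, ← add_smul]
          refine smul_ne_zero (ne_of_lt ?_) hh
          have : σ * (τ - ε) ≤ 1 * (τ - ε) := mul_le_mul_of_nonneg_right hσ.2 (by linarith)
          linarith
        rwa [show ξ + (τ - ε) • h = -(ε • h) by rw [hξ, sub_smul]; abel] at this
      have s2 : ‖m (ξ + h) - m (ε • h)‖ ≤ D * ‖(1 - τ - ε) • h‖ := by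
        have := H.norm_sub_le (ξ := ε • h) (h := (1 - τ - ε) • h) fun σ hσ => by
          rw [smul_smul, ← add_smul]
          refine smul_ne_zero (ne_of_gt ?_) hh
          have : 0 ≤ σ * (1 - τ - ε) := mul_nonneg hσ.1 (by linarith)
          linarith
        rwa [show ε • h + (1 - τ - ε) • h = ξ + h by rw [hξ, sub_smul, sub_smul, one_smul]; abel] at this
      rw [norm_smul, norm_of_nonneg (by linarith)] at s1 s2
      have e : m (ξ + h) - m ξ = (m (ξ + h) - m (ε • h)) + (m (ε • h) - m (-(ε • h))) + (m (-(ε • h)) - m ξ) := by ring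
      rw [e]
      refine (norm_add₃_le).trans ?_
      have : D * ((1 - τ - ε) * ‖h‖) + D * ((τ - ε) * ‖h‖) ≤ D * ‖h‖ := by
        have : 0 ≤ D * ‖h‖ := by positivity
        nlinarith
      linarith
    have hlim : Filter.Tendsto (fun ε : ℝ => D * ‖h‖ + ‖m (ε • h) - m (-(ε • h))‖)
        (nhdsWithin 0 (Ioi 0)) (nhds (D * ‖h‖ + 0)) := by
      have := (hm hn1 h).norm
      rw [norm_zero] at this
      exact this.const_add _
    rw [add_zero] at hlim
    exact ge_of_tendsto hlim key
  · have hs : (Submodule.span ℝ {h} : Submodule ℝ (Tan n)) ≠ ⊤ := by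
      intro htop
      have e1 := finrank_span_le_card (R := ℝ) ({h} : Set (Tan n))
      rw [htop, finrank_top] at e1
      simp at e1
      omega
    have h0 := Measure.addHaar_submodule (volume : Measure (Tan n)) _ hs
    have : ∀ᵐ ξ : Tan n, ξ ∉ (Submodule.span ℝ {h} : Submodule ℝ (Tan n)) := by rw [ae_iff]; simpa using h0
    filter_upwards [this] with ξ hξ
    refine H.norm_sub_le fun τ _ h0 => hξ ?_
    rw [eq_neg_of_add_eq_zero_left h0]
    exact Submodule.neg_mem _ (Submodule.smul_mem _ _ (Submodule.mem_span_singleton_self h))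

end Lines

section KernelBounds
variable {n : ℕ}
variable {m : Tan n → ℂ} {x : Tan n} {c M0 t₀ : ℝ} {r : ℤ} {A : ℕ → ℝ} {z : ℂ} {v : Tan n → ℂ} {d : ℤ} {S : Symb n}

/-! ## Decay of inverse Fourier transforms -/

lemma norm_exp_I_mul (r : ℝ) : ‖Complex.exp (I * (r : ℂ))‖ = 1 := by
  rw [mul_comm]; exact Complex.norm_exp_ofReal_mul_I r

lemma norm_exp_neg_I_mul (r : ℝ) : ‖Complex.exp (-I * (r : ℂ))‖ = 1 := by
  have := norm_exp_I_mul (-r)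
  simpa using this

lemma two_pi_pow_inv_le (n : ℕ) : ‖((1 / (2 * π) ^ n : ℝ) : ℂ)‖ ≤ 1 := by
  rw [norm_real, norm_of_nonneg (by positivity), div_le_one (by positivity)]
  exact one_le_pow₀ (by linarith [pi_gt_three])

lemma norm_tanFourierInv_le (m : Tan n → ℂ) (x : Tan n) : ‖tanFourierInv m x‖ ≤ ∫ ξ, ‖m ξ‖ := by
  unfold tanFourierInv
  rw [norm_mul]
  have h1 : ‖∫ ξ : Tan n, 𝐞(x,ξ) * m ξ‖ ≤ ∫ ξ, ‖m ξ‖ := by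
    refine (norm_integral_le_integral_norm _).trans (le_of_eq (integral_congr_ae ?_))
    refine .of_forall fun ξ => ?_
    simp only [norm_mul, norm_exp_I_mul, one_mul]
  calc _ ≤ 1 * ∫ ξ, ‖m ξ‖ := mul_le_mul (two_pi_pow_inv_le n) h1 (norm_nonneg _) zero_le_one
    _ = _ := one_mul _

lemma integrable_exp_mul_of (hm : Integrable m) (x : Tan n) : Integrable fun ξ => 𝐞(x,ξ) * m ξ := by
  refine hm.bdd_mul (c := 1) (by fun_prop) (.of_forall fun ξ => ?_)
  rw [norm_exp_I_mul]

lemma integrable_fwdDiff_iter (hm : Integrable m) (h : Tan n) (j : ℕ) : Integrable ((fwdDiff h)^[j] m) := by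
  induction j with
  | zero => exact hm
  | succ j ih =>
    rw [Function.iterate_succ_apply']
    exact (ih.comp_add_right h).sub ih

lemma tanFourierInv_fwdDiff_iter (hm : Integrable m) (hx : x ≠ 0) (j : ℕ) :
    tanFourierInv ((fwdDiff ((π / ‖x‖ ^ 2) • x))^[j] m) x = (-2) ^ j * tanFourierInv m x := by
  set h := (π / ‖x‖ ^ 2) • x with hh
  have hx0 : ‖x‖ ≠ 0 := norm_ne_zero_iff.2 hx
  have hin : inner ℝ x h = π := by rw [hh, inner_smul_right, real_inner_self_eq_norm_sq]; field_simp
  induction j with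
  | zero => simp
  | succ j ih =>
    rw [Function.iterate_succ_apply', pow_succ, mul_right_comm, ← ih]
    set g := (fwdDiff h)^[j] m with hg
    have hgi : Integrable g := integrable_fwdDiff_iter hm h j
    unfold tanFourierInv
    have e1 : ∫ ξ : Tan n, 𝐞(x,ξ) * g (ξ + h) =
        -∫ ξ : Tan n, 𝐞(x,ξ) * g ξ := by
      rw [← integral_add_right_eq_self (μ := (volume : Measure (Tan n)))
        (fun ξ : Tan n => 𝐞(x,ξ) * g ξ) h, ← integral_neg]
      refine integral_congr_ae (.of_forall fun ξ => ?_)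
      simp only [inner_add_right, hin]
      push_cast
      rw [mul_add, exp_add, mul_comm I (π : ℂ), Complex.exp_pi_mul_I]
      ring
    have e2 : ∫ ξ : Tan n, 𝐞(x,ξ) * fwdDiff h g ξ =
        -2 * ∫ ξ : Tan n, 𝐞(x,ξ) * g ξ := by
      have : ∀ ξ : Tan n, 𝐞(x,ξ) * fwdDiff h g ξ = 𝐞(x,ξ) * g (ξ + h) -
            𝐞(x,ξ) * g ξ := fun ξ => by
        rw [fwdDiff, mul_sub]
      simp only [this]
      rw [integral_sub (integrable_exp_mul_of (hgi.comp_add_right h) x) (integrable_exp_mul_of hgi x), e1]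
      ring
    rw [e2]
    ring

lemma norm_tanFourierInv_le_of_fwdDiff (hm : Integrable m) (hx : x ≠ 0)
    (j : ℕ) {g : Tan n → ℝ} (hg : Integrable g) (hb : ∀ᵐ ξ, ‖(fwdDiff ((π / ‖x‖ ^ 2) • x))^[j] m ξ‖ ≤ g ξ) :
    ‖tanFourierInv m x‖ ≤ ∫ ξ, g ξ := by
  have h1 := norm_tanFourierInv_le ((fwdDiff ((π / ‖x‖ ^ 2) • x))^[j] m) x
  rw [tanFourierInv_fwdDiff_iter hm hx, norm_mul, norm_pow, norm_neg, norm_two] at h1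
  have h2 : ‖tanFourierInv m x‖ ≤ 2 ^ j * ‖tanFourierInv m x‖ :=
    le_mul_of_one_le_left (norm_nonneg _) (one_le_pow₀ (by norm_num))
  exact h2.trans (h1.trans (integral_mono_ae (integrable_fwdDiff_iter hm _ j).norm hg hb))

lemma norm_pi_smul (hx : x ≠ 0) : ‖(π / ‖x‖ ^ 2) • x‖ = π / ‖x‖ := by
  have : ‖x‖ ≠ 0 := norm_ne_zero_iff.2 hx
  rw [norm_smul, norm_of_nonneg (by positivity)]
  field_simp

/-! ## Elementary bounds -/

lemma exists_pow_mul_exp_neg_le (hc : 0 < c) (l : ℕ) : ∃ K : ℝ, 0 < K ∧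
    ∀ y : ℝ, 0 ≤ y → y ^ l * exp (-(c * y)) ≤ K := by
  refine ⟨l.factorial / c ^ l, by positivity, fun y hy => ?_⟩
  have h1 := Real.pow_div_factorial_le_exp (c * y) (by positivity) l
  rw [div_le_iff₀ (by positivity), mul_pow] at h1
  rw [Real.exp_neg, ← div_eq_mul_inv, div_le_div_iff₀ (exp_pos _) (by positivity)]
  linarith

lemma exists_weight_exp_le (e : ℤ) {M₁ : ℝ} (hc : 0 < c) (hM₀ : 0 < M0)
    (ht0 : 0 < t₀) (N : ℕ) : ∃ C c' : ℝ, 0 < C ∧ 0 < c' ∧ ∀ M t y : ℝ, M0 ≤ M → M ≤ M₁ → t₀ ≤ t → 0 ≤ y →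
      (M + y) ^ e * exp (-(c * (M + y) * t)) ≤ C * exp (-(c' * t)) * ((1 + y) ^ N)⁻¹ := by
  set m0 := min M0 1 with hm₀
  have hm₀0 : 0 < m0 := lt_min hM₀ one_pos
  obtain ⟨K1, hK₁, H₁⟩ := exists_zpow_le hm₀0 (lt_max_of_lt_right one_pos : 0 < max M₁ 1) e
  obtain ⟨K2, hK₂, H₂⟩ := exists_pow_mul_exp_neg_le (c := c / 2 * m0 * t₀) (by positivity) (e.natAbs + N)
  refine ⟨K1 * K2, c / 2 * M0, by positivity, by positivity, fun M t y hM hM' ht hy => ?_⟩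
  have hM0 : 0 < M := hM₀.trans_le hM
  have ht0r : 0 < t := ht0.trans_le ht
  have h1 : (M + y) ^ e ≤ K1 * (1 + y) ^ e.natAbs := by
    have l1 : m0 * (1 + y) ≤ M + y := by
      have a1 := min_le_left M0 1
      have a2 := min_le_right M0 1
      nlinarith
    have l2 : M + y ≤ max M₁ 1 * (1 + y) := by
      have a1 := le_max_left M₁ 1
      have a2 := le_max_right M₁ 1
      nlinarith
    refine (H₁ (1 + y) (M + y) (by positivity) l1 l2).trans ?_
    gcongr
    rw [← zpow_natCast]
    refine zpow_le_zpow_right₀ (by linarith) ?_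
    rw [Int.natCast_natAbs]; exact le_abs_self e
  have h2 : exp (-(c * (M + y) * t)) ≤
      exp (-(c / 2 * M0 * t)) * exp (-(c / 2 * m0 * t₀ * (1 + y))) := by
    rw [← Real.exp_add]
    refine exp_le_exp.2 ?_
    have l1 : c / 2 * M0 * t ≤ c / 2 * (M + y) * t := by gcongr; linarith
    have l2 : c / 2 * m0 * t₀ * (1 + y) ≤ c / 2 * (M + y) * t := by
      have a1 := min_le_left M0 1
      have a2 := min_le_right M0 1
      calc c / 2 * m0 * t₀ * (1 + y) = c / 2 * (m0 * (1 + y)) * t₀ := by ring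
        _ ≤ c / 2 * (M + y) * t := by gcongr; nlinarith
    linarith
  have h3 := H₂ (1 + y) (by positivity)
  calc _ ≤ (K1 * (1 + y) ^ e.natAbs) * (exp (-(c / 2 * M0 * t)) * exp (-(c / 2 * m0 * t₀ * (1 + y)))) := by gcongr
    _ = K1 * exp (-(c / 2 * M0 * t)) *
        ((1 + y) ^ (e.natAbs + N) * exp (-(c / 2 * m0 * t₀ * (1 + y)))) * ((1 + y) ^ N)⁻¹ := by
        rw [pow_add]; field_simp
    _ ≤ K1 * exp (-(c / 2 * M0 * t)) * K2 * ((1 + y) ^ N)⁻¹ := by gcongr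
    _ = _ := by ring

/-! ## Kernel estimates -/

lemma SymbolBound.aestronglyMeasurable (hn : 1 ≤ n) (hv : SymbolBound r A z v) : AEStronglyMeasurable v := by
  have : Nonempty (Fin n) := ⟨⟨0, by omega⟩⟩
  have h1 : AEStronglyMeasurable v (volume.restrict ({0}ᶜ : Set (Tan n))) :=
    hv.smooth.continuousOn.aestronglyMeasurable (measurableSet_singleton 0).compl
  have h2 : ∀ᵐ ξ : Tan n, ξ ∈ ({0}ᶜ : Set (Tan n)) := Measure.ae_ne volume (0 : Tan n)
  rwa [Measure.restrict_eq_self_of_ae_mem h2] at h1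

lemma ae_ne_zero (hn : 1 ≤ n) : ∀ᵐ ξ : Tan n, ξ ≠ 0 := by
  have : Nonempty (Fin n) := ⟨⟨0, by omega⟩⟩
  exact Measure.ae_ne volume (0 : Tan n)

variable {a : ℝ}

/-- The symbol times the multiplier, dominated locally uniformly in `z`. -/
lemma IsSym.exists_mul_le (ha : 0 < a) (h : IsSym a d S)
    (r : ℤ) (A : ℕ → ℝ) (M₁ : ℝ) (hM₀ : 0 < M0) (ht0 : 0 < t₀) :
    ∃ C c' : ℝ, 0 < C ∧ 0 < c' ∧ ∀ z ∈ ℂ₊, M0 ≤ ‖sqz z‖ → ‖sqz z‖ ≤ M₁ →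
      ∀ v, SymbolBound r A z v → ∀ t : ℝ, t₀ ≤ t → ∀ ξ : Tan n, ξ ≠ 0 →
      ‖v ξ * S ξ z t‖ ≤ C * exp (-(c' * t)) * ((1 + ‖ξ‖) ^ (n + 1))⁻¹ := by
  obtain ⟨c, hc, H⟩ := h.exists_lineBound_mul ha r A
  obtain ⟨C, hC, H⟩ := H 0
  obtain ⟨C', c', hC', hc', H'⟩ := exists_weight_exp_le (M₁ := M₁) (r + d) hc hM₀ ht0 (n + 1)
  refine ⟨C * C', c', by positivity, hc', fun z hz hz0 hz1 v hv t ht ξ hξ => ?_⟩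
  have h1 := (H z hz v hv t (ht0.trans_le ht)).norm_le hξ
  have h2 := H' ‖sqz z‖ t ‖ξ‖ hz0 hz1 ht (norm_nonneg _)
  rw [← weight_eq] at h2
  rw [show r + d - (0 : ℕ) = r + d by simp] at h1
  refine h1.trans ?_
  calc _ = C * (weight z ξ ^ (r + d) * exp (-(c * weight z ξ * t))) := by ring
    _ ≤ C * (C' * exp (-(c' * t)) * ((1 + ‖ξ‖) ^ (n + 1))⁻¹) := by gcongr
    _ = _ := by ring

lemma IsSym.integrable_mul (hn : 1 ≤ n) (ha : 0 < a) (h : IsSym a d S) (hz : z ∈ ℂ₊)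
    (hv : SymbolBound r A z v) {t : ℝ} (ht : 0 < t) : Integrable fun ξ => v ξ * S ξ z t := by
  have hM := norm_sqz_pos hz
  obtain ⟨C, c, -, -, H⟩ := h.exists_mul_le ha r A ‖sqz z‖ hM ht
  refine ((integrable_tail n one_pos).const_mul (C * exp (-(c * t)))).mono'
    ((hv.aestronglyMeasurable hn).mul ?_) ?_
  · exact ((h.continuous ha hz).comp (by fun_prop : Continuous fun ξ : Tan n => (ξ, t))).aestronglyMeasurable
  · filter_upwards [ae_ne_zero hn] with ξ hξ
    exact H z hz le_rfl le_rfl v hv t le_rfl ξ hξ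

lemma tendsto_jump_zero (ha : 0 < a) (h : IsSym a d S) (hz : z ∈ ℂ₊) (hv : SymbolBound r A z v)
    (t : ℝ) (hev : ∀ ξ, v (-ξ) = v ξ) (η : Tan n) :
    Filter.Tendsto (fun ε : ℝ => v (ε • η) * S (ε • η) z t - v (-(ε • η)) * S (-(ε • η)) z t)
      (nhdsWithin 0 (Ioi 0)) (nhds 0) := by
  rcases eq_or_ne η 0 with rfl | hη
  · simp
  have hcS := h.continuous ha hz
  have hw : Continuous fun ε : ℝ => weight z (ε • η) := by unfold weight; fun_prop
  have hw' : Continuous fun ε : ℝ => weight z (ε • η) ^ r := hw.zpow₀ r fun ε => Or.inl (weight_pos hz _).ne'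
  have hd : Continuous fun ε : ℝ => S (ε • η) z t - S (-(ε • η)) z t :=
    (hcS.comp (by fun_prop : Continuous fun ε : ℝ => (ε • η, t))).sub
      (hcS.comp (by fun_prop : Continuous fun ε : ℝ => (-(ε • η), t)))
  have hlim : Filter.Tendsto (fun ε : ℝ => |A 0| * weight z (ε • η) ^ r *
      ‖S (ε • η) z t - S (-(ε • η)) z t‖) (nhdsWithin 0 (Ioi 0)) (nhds 0) := by
    have := (((continuous_const (y := |A 0|)).mul hw').mul hd.norm).tendsto 0
    simp only [Pi.mul_apply, zero_smul, neg_zero, sub_self, norm_zero, mul_zero] at this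
    exact this.mono_left nhdsWithin_le_nhds
  refine squeeze_zero_norm' ?_ hlim
  filter_upwards [self_mem_nhdsWithin] with ε hε
  have hε0 : (ε : ℝ) ≠ 0 := ne_of_gt hε
  rw [hev, ← mul_sub, norm_mul]
  gcongr
  have hp := weight_pos hz (ε • η)
  have := hv.bound 0 (ε • η) (smul_ne_zero hε0 hη) 0
  simp only [iteratedFDeriv_zero_apply, pow_zero, mul_one, Nat.cast_zero, sub_zero] at this
  refine this.trans ?_
  gcongr
  exact le_abs_self _

lemma far_segment {ξ h : Tan n} {j : ℕ} (hξ : ξ ≠ 0) (hfar : 2 * j * ‖h‖ ≤ ‖ξ‖) {τ : ℝ}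
    (hτ : τ ∈ Icc (0 : ℝ) j) : ‖ξ‖ / 2 ≤ ‖ξ + τ • h‖ ∧ ξ + τ • h ≠ 0 := by
  have h1 : ‖τ • h‖ ≤ ‖ξ‖ / 2 := by
    rw [norm_smul, norm_of_nonneg hτ.1]
    have := mul_le_mul_of_nonneg_right hτ.2 (norm_nonneg h)
    linarith
  have h2 : ‖ξ‖ ≤ ‖ξ + τ • h‖ + ‖τ • h‖ := by
    have := norm_sub_le (ξ + τ • h) (τ • h)
    rwa [add_sub_cancel_right] at this
  have h3 : ‖ξ‖ / 2 ≤ ‖ξ + τ • h‖ := by linarith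
  refine ⟨h3, norm_pos_iff.1 (lt_of_lt_of_le ?_ h3)⟩
  have := norm_pos_iff.2 hξ
  positivity

lemma ae_translate {p : Tan n → Prop} (hp : ∀ᵐ ξ, p ξ) (h : Tan n) : ∀ᵐ ξ, p (ξ + h) :=
  (quasiMeasurePreserving_add_right volume h).ae hp

/-- The kernel estimate for multipliers of order one. -/
lemma IsSym.exists_kernel_bound (hn : 1 ≤ n) (ha : 0 < a) (hdr : r + d = 1) (hS : IsSym a d S) (A : ℕ → ℝ) :
    ∃ C : ℝ, 0 < C ∧ ∀ z ∈ ℂ₊, ∀ v : Tan n → ℂ, SymbolBound r A z v → EvenIfOne v → ∀ t : ℝ, 0 < t → ∀ x : Tan n,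
      ‖tanFourierInv (fun ξ => v ξ * S ξ z t) x‖ ≤ C * ((‖x‖ + t) ^ (n + 1))⁻¹ := by
  obtain ⟨c, hc, H⟩ := hS.exists_lineBound_mul ha r A
  obtain ⟨C0, hC0, H₀⟩ := H 0
  obtain ⟨C1, hC1, H₁⟩ := H 1
  obtain ⟨C2, hC2, H₂⟩ := H (n + 2)
  obtain ⟨K, hK, HK⟩ := exists_pow_mul_exp_neg_le hc (n + 2)
  set B := C0 * (exp c * K) * tailMass n with hB
  set D := (2 ^ (n + 1) * C1 * (2 * (n + 2) + 1) ^ (n + 1) + C2 * 4 ^ (n + 1)) * (tailMass n * π ^ (n + 1)) with hD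
  have htm := tailMass_nonneg n
  have hB0 : 0 ≤ B := by positivity
  have hD0 : 0 ≤ D := by positivity
  refine ⟨(B + D + 1) * 2 ^ (n + 1), by positivity, fun z hz v hv hev t ht x => ?_⟩
  set m : Tan n → ℂ := fun ξ => v ξ * S ξ z t with hm
  have hmi : Integrable m := hS.integrable_mul hn ha hz hv ht
  -- the bound by a power of `t`
  have b1 : ‖tanFourierInv m x‖ ≤ B * (t ^ (n + 1))⁻¹ := by
    refine (norm_tanFourierInv_le m x).trans ?_
    have hb : ∀ᵐ ξ, ‖m ξ‖ ≤ C0 * (exp c * K) * (t ^ (n + 2))⁻¹ * ((1 / t + ‖ξ‖) ^ (n + 1))⁻¹ := by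
      filter_upwards [ae_ne_zero hn] with ξ hξ
      have hw := weight_pos hz ξ
      have h1 := (H₀ z hz v hv t ht).norm_le hξ
      simp only [hdr, Nat.cast_zero, sub_zero, zpow_one] at h1
      refine h1.trans ?_
      set y := weight z ξ * t with hy
      have hy0 : 0 < y := by positivity
      have h2 := HK (1 + y) (by positivity)
      have h3 : exp (-(c * (1 + y))) = exp (-(c * weight z ξ * t)) / exp c := by
        rw [← Real.exp_sub]; congr 1; rw [hy]; ring
      rw [h3, mul_div_assoc', div_le_iff₀ (exp_pos _)] at h2
      have h4 : ‖ξ‖ * t ≤ y := by rw [hy, weight_eq]; nlinarith [norm_nonneg (sqz z)]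
      have h5 : (weight z ξ) * exp (-(c * weight z ξ * t)) =
          t⁻¹ * (y * exp (-(c * weight z ξ * t))) := by rw [hy]; field_simp
      have h6 : y * exp (-(c * weight z ξ * t)) ≤ K * exp c * ((1 + y) ^ (n + 1))⁻¹ := by
        rw [← div_eq_mul_inv, le_div_iff₀ (by positivity)]
        refine le_trans ?_ h2
        rw [pow_succ (1 + y) (n + 1)]
        have : 0 < (1 + y) ^ (n + 1) * exp (-(c * weight z ξ * t)) := by positivity
        nlinarith
      have h7 : ((1 + y) ^ (n + 1))⁻¹ ≤ (t ^ (n + 1))⁻¹ * ((1 / t + ‖ξ‖) ^ (n + 1))⁻¹ := by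
        rw [← mul_inv, ← mul_pow]
        gcongr
        rw [mul_add, mul_one_div_cancel ht.ne']
        linarith
      calc C0 * weight z ξ * exp (-(c * weight z ξ * t))
          = C0 * (t⁻¹ * (y * exp (-(c * weight z ξ * t)))) := by rw [mul_assoc, h5]
        _ ≤ C0 * (t⁻¹ * (K * exp c * ((t ^ (n + 1))⁻¹ * ((1 / t + ‖ξ‖) ^ (n + 1))⁻¹))) :=
            mul_le_mul_of_nonneg_left (mul_le_mul_of_nonneg_left
              (h6.trans (mul_le_mul_of_nonneg_left h7 (by positivity))) (by positivity)) hC0.le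
        _ = _ := by rw [pow_succ t (n + 1), mul_inv]; ring
    refine (integral_mono_ae hmi.norm ((integrable_tail n (by positivity)).const_mul _) hb).trans
      (le_of_eq ?_)
    rw [integral_const_mul, integral_tail n (by positivity), hB]
    field_simp
    ring
  -- the bound by a power of `|x|`
  have b2 : x ≠ 0 → ‖tanFourierInv m x‖ ≤ D * (‖x‖ ^ (n + 1))⁻¹ := by
    intro hx
    have hx0 : 0 < ‖x‖ := norm_pos_iff.2 hx
    set h := (π / ‖x‖ ^ 2) • x with hh
    have hhn : ‖h‖ = π / ‖x‖ := norm_pi_smul hx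
    have hh0 : 0 < ‖h‖ := by rw [hhn]; positivity
    have hlip : LineBound m 1 fun _ => C1 := by
      intro ξ hξ η
      refine ⟨(H₁ z hz v hv t ht ξ hξ η).1, (H₁ z hz v hv t ht ξ hξ η).2.trans ?_⟩
      have hw := weight_pos hz ξ
      gcongr
      simp only [hdr, Nat.cast_one, sub_self, zpow_zero, mul_one]
      refine mul_le_of_le_one_right hC1.le (exp_le_one_iff.2 ?_)
      have : 0 ≤ c * weight z ξ * t := by positivity
      linarith
    have hae := hlip.ae_norm_sub_le hn hC1.le (fun h1 η => tendsto_jump_zero ha hS hz hv t (hev h1) η) h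
    have hbd : ∀ᵐ ξ, ‖(fwdDiff h)^[n + 2] m ξ‖ ≤ (2 ^ (n + 1) * C1 * (2 * (n + 2) + 1) ^ (n + 1) +
        C2 * 4 ^ (n + 1)) * ‖h‖ ^ (n + 2) * ((‖h‖ + ‖ξ‖) ^ (n + 1))⁻¹ := by
      have htr : ∀ᵐ ξ, ∀ k ∈ Finset.range (n + 2), ‖fwdDiff h m (ξ + k • h)‖ ≤ C1 * ‖h‖ :=
        (Finset.eventually_all _).2 fun k _ => ae_translate hae (k • h)
      filter_upwards [ae_ne_zero hn, htr] with ξ hξ hξ2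
      have hξ0 : 0 < ‖ξ‖ := norm_pos_iff.2 hξ
      rcases le_total (2 * (n + 2) * ‖h‖) ‖ξ‖ with hfar | hnear
      · have h1 := (H₂ z hz v hv t ht).norm_fwdDiff_le (ξ := ξ) (h := h)
          (C := C2 * 4 ^ (n + 1) * ((‖h‖ + ‖ξ‖) ^ (n + 1))⁻¹) fun τ hτ => by
            obtain ⟨s1, s2⟩ := far_segment (ξ := ξ) (h := h) (j := n + 2) hξ (by push_cast; linarith) hτ
            refine ⟨s2, ?_⟩
            have hw := weight_pos hz (ξ + τ • h)
            have e : (r + d - (n + 2 : ℕ) : ℤ) = -((n + 1 : ℕ) : ℤ) := by rw [hdr]; push_cast; ring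
            rw [e, zpow_neg, zpow_natCast, mul_assoc C2, mul_assoc C2]
            refine mul_le_mul_of_nonneg_left ?_ hC2.le
            have s3 : (‖h‖ + ‖ξ‖) / 4 ≤ weight z (ξ + τ • h) := by
              have : ‖ξ + τ • h‖ ≤ weight z (ξ + τ • h) := by rw [weight_eq]; linarith [norm_nonneg (sqz z)]
              have : ‖h‖ ≤ ‖ξ‖ := by
                have : (0 : ℝ) ≤ n := by positivity
                nlinarith
              linarith
            have s4 : (weight z (ξ + τ • h) ^ (n + 1))⁻¹ ≤ 4 ^ (n + 1) * ((‖h‖ + ‖ξ‖) ^ (n + 1))⁻¹ := by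
              exact inv_pow_le_mul_inv_pow (by positivity) (by positivity) (by linarith) _
            refine le_trans (mul_le_of_le_one_right (by positivity) (exp_le_one_iff.2 ?_)) s4
            have : 0 ≤ c * weight z (ξ + τ • h) * t := by positivity
            linarith
        refine h1.trans ?_
        have : 0 ≤ 2 ^ (n + 1) * C1 * (2 * (n + 2) + 1) ^ (n + 1) * ‖h‖ ^ (n + 2) *
          ((‖h‖ + ‖ξ‖) ^ (n + 1))⁻¹ := by positivity
        calc _ = C2 * 4 ^ (n + 1) * ‖h‖ ^ (n + 2) * ((‖h‖ + ‖ξ‖) ^ (n + 1))⁻¹ := by ring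
          _ ≤ _ := by rw [add_mul, add_mul]; linarith
      · have h1 := norm_fwdDiff_iter_le_sum (fwdDiff h m) ξ h (n + 1) hξ2
        rw [← Function.iterate_succ_apply (fwdDiff h) (n + 1) m] at h1
        refine h1.trans ?_
        have s1 : 1 ≤ (2 * (n + 2) + 1) ^ (n + 1) * ‖h‖ ^ (n + 1) * ((‖h‖ + ‖ξ‖) ^ (n + 1))⁻¹ := by
          rw [← div_eq_mul_inv, le_div_iff₀ (by positivity), one_mul, ← mul_pow]
          gcongr
          linarith
        have s2 : 0 ≤ C2 * 4 ^ (n + 1) * ‖h‖ ^ (n + 2) * ((‖h‖ + ‖ξ‖) ^ (n + 1))⁻¹ := by positivity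
        calc 2 ^ (n + 1) * (C1 * ‖h‖) = 2 ^ (n + 1) * (C1 * ‖h‖) * 1 := by ring
          _ ≤ 2 ^ (n + 1) * (C1 * ‖h‖) *
              ((2 * (n + 2) + 1) ^ (n + 1) * ‖h‖ ^ (n + 1) * ((‖h‖ + ‖ξ‖) ^ (n + 1))⁻¹) := by gcongr
          _ = 2 ^ (n + 1) * C1 * (2 * (n + 2) + 1) ^ (n + 1) * ‖h‖ ^ (n + 2) * ((‖h‖ + ‖ξ‖) ^ (n + 1))⁻¹ := by ring
          _ ≤ _ := by rw [add_mul, add_mul]; linarith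
    refine (norm_tanFourierInv_le_of_fwdDiff hmi hx (n + 2)
      ((integrable_tail n hh0).const_mul _) hbd).trans (le_of_eq ?_)
    rw [integral_const_mul, integral_tail n hh0, hD, hhn]
    simp only [div_pow]
    field_simp
    ring
  have hs : 0 < ‖x‖ + t := by positivity
  rcases le_total t ‖x‖ with h1 | h1
  · have hx : x ≠ 0 := by rintro rfl; rw [norm_zero] at h1; linarith
    have hx0 : 0 < ‖x‖ := norm_pos_iff.2 hx
    refine (b2 hx).trans ?_
    have : (‖x‖ ^ (n + 1))⁻¹ ≤ 2 ^ (n + 1) * ((‖x‖ + t) ^ (n + 1))⁻¹ := by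
      exact inv_pow_le_mul_inv_pow (by positivity) (by positivity) (by linarith) _
    calc _ ≤ (B + D + 1) * (2 ^ (n + 1) * ((‖x‖ + t) ^ (n + 1))⁻¹) := by gcongr; linarith
      _ = _ := by ring
  · refine b1.trans ?_
    have : (t ^ (n + 1))⁻¹ ≤ 2 ^ (n + 1) * ((‖x‖ + t) ^ (n + 1))⁻¹ := by
      exact inv_pow_le_mul_inv_pow (by positivity) (by positivity) (by linarith) _
    calc _ ≤ (B + D + 1) * (2 ^ (n + 1) * ((‖x‖ + t) ^ (n + 1))⁻¹) := by gcongr; linarith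
      _ = _ := by ring

/-- Decay of the kernel for fixed `z` and arbitrary order. -/
lemma IsSym.exists_kernel_decay (hn : 1 ≤ n) (ha : 0 < a) (hS : IsSym a d S) (hz : z ∈ ℂ₊)
    (hv : SymbolBound r A z v) (ht0 : 0 < t₀) : ∃ C c : ℝ, 0 < C ∧ 0 < c ∧ ∀ t : ℝ, t₀ ≤ t → ∀ x : Tan n,
      ‖tanFourierInv (fun ξ => v ξ * S ξ z t) x‖ ≤ C * exp (-(c * t)) * ((1 + ‖x‖) ^ n)⁻¹ := by
  have hM := norm_sqz_pos hz
  obtain ⟨C0, c₀, hC0, hc₀, H₀⟩ := hS.exists_mul_le ha r A ‖sqz z‖ hM ht0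
  obtain ⟨c, hc, H⟩ := hS.exists_lineBound_mul ha r A
  obtain ⟨C1, hC1, H₁⟩ := H n
  obtain ⟨C2, c₂, hC2, hc₂, H₂⟩ := exists_weight_exp_le (M₁ := ‖sqz z‖) (r + d - n) hc hM ht0 (n + 1)
  have htm := tailMass_nonneg n
  set c' := min c₀ c₂ with hc'
  have hc'0 : 0 < c' := lt_min hc₀ hc₂
  set D := (2 ^ n * C0 * (2 * n + 1) ^ (n + 1) + C1 * C2 * 2 ^ (n + 1)) * tailMass n * π ^ n with hD
  have hD0 : 0 ≤ D := by positivity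
  refine ⟨(C0 * tailMass n + D + 1) * 2 ^ n, c', by positivity, hc'0, fun t ht x => ?_⟩
  have ht0r : 0 < t := ht0.trans_le ht
  set m : Tan n → ℂ := fun ξ => v ξ * S ξ z t with hm
  have hmi : Integrable m := hS.integrable_mul hn ha hz hv ht0r
  set E := exp (-(c' * t)) with hE
  have hE₀ : exp (-(c₀ * t)) ≤ E := exp_le_exp.2 (neg_le_neg (mul_le_mul_of_nonneg_right (min_le_left _ _) ht0r.le))
  have hE₂ : exp (-(c₂ * t)) ≤ E := exp_le_exp.2 (neg_le_neg (mul_le_mul_of_nonneg_right (min_le_right _ _) ht0r.le))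
  have hE0 : 0 < E := exp_pos _
  have hm0 : ∀ᵐ ξ, ‖m ξ‖ ≤ C0 * E * ((1 + ‖ξ‖) ^ (n + 1))⁻¹ := by
    filter_upwards [ae_ne_zero hn] with ξ hξ
    exact (H₀ z hz le_rfl le_rfl v hv t ht ξ hξ).trans (by gcongr)
  have hm1 : LineBound m n fun ξ => C1 * C2 * E * ((1 + ‖ξ‖) ^ (n + 1))⁻¹ := by
    intro ξ hξ η
    refine ⟨(H₁ z hz v hv t ht0r ξ hξ η).1, (H₁ z hz v hv t ht0r ξ hξ η).2.trans ?_⟩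
    have h2 := H₂ ‖sqz z‖ t ‖ξ‖ le_rfl le_rfl ht (norm_nonneg _)
    rw [← weight_eq] at h2
    gcongr
    calc _ = C1 * (weight z ξ ^ (r + d - n) * exp (-(c * weight z ξ * t))) := by ring
      _ ≤ C1 * (C2 * E * ((1 + ‖ξ‖) ^ (n + 1))⁻¹) := by
          refine mul_le_mul_of_nonneg_left (h2.trans ?_) hC1.le
          gcongr
      _ = _ := by ring
  have b1 : ‖tanFourierInv m x‖ ≤ C0 * tailMass n * E := by
    refine (norm_tanFourierInv_le m x).trans ((integral_mono_ae hmi.norm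
      ((integrable_tail n one_pos).const_mul _) hm0).trans (le_of_eq ?_))
    rw [integral_const_mul, integral_tail n one_pos]
    ring
  rcases le_total ‖x‖ 1 with hx1 | hx1
  · have : 1 ≤ 2 ^ n * ((1 + ‖x‖) ^ n)⁻¹ := by
      rw [← div_eq_mul_inv, le_div_iff₀ (by positivity), one_mul]
      gcongr; linarith
    calc _ ≤ (C0 * tailMass n + D + 1) * E := b1.trans (by gcongr; linarith)
      _ = (C0 * tailMass n + D + 1) * E * 1 := (mul_one _).symm
      _ ≤ (C0 * tailMass n + D + 1) * E * (2 ^ n * ((1 + ‖x‖) ^ n)⁻¹) := by gcongr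
      _ = _ := by ring
  have hx0 : 0 < ‖x‖ := by linarith
  have hx : x ≠ 0 := norm_pos_iff.1 hx0
  set h := (π / ‖x‖ ^ 2) • x with hh
  have hhn : ‖h‖ = π / ‖x‖ := norm_pi_smul hx
  have hh0 : 0 < ‖h‖ := by rw [hhn]; positivity
  have hbd : ∀ᵐ ξ, ‖(fwdDiff h)^[n] m ξ‖ ≤
      2 ^ n * C0 * E * (2 * n + 1) ^ (n + 1) * ‖h‖ ^ (n + 1) * ((‖h‖ + ‖ξ‖) ^ (n + 1))⁻¹ +
        C1 * C2 * E * 2 ^ (n + 1) * ‖h‖ ^ n * ((1 + ‖ξ‖) ^ (n + 1))⁻¹ := by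
    have htr : ∀ᵐ ξ, ∀ k ∈ Finset.range (n + 1), ‖m (ξ + k • h)‖ ≤ C0 * E := by
      refine (Finset.eventually_all _).2 fun k _ => ae_translate (p := fun ξ => ‖m ξ‖ ≤ C0 * E) ?_ (k • h)
      filter_upwards [hm0] with ξ hξ
      refine hξ.trans (mul_le_of_le_one_right (by positivity) (inv_le_one_of_one_le₀ ?_))
      exact one_le_pow₀ (by linarith [norm_nonneg ξ])
    filter_upwards [ae_ne_zero hn, htr] with ξ hξ hξ2
    have hξ0 : 0 < ‖ξ‖ := norm_pos_iff.2 hξ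
    rcases le_total (2 * n * ‖h‖) ‖ξ‖ with hfar | hnear
    · have h1 := hm1.norm_fwdDiff_le (ξ := ξ) (h := h)
        (C := C1 * C2 * E * (2 ^ (n + 1) * ((1 + ‖ξ‖) ^ (n + 1))⁻¹)) fun τ hτ => by
          obtain ⟨s1, s2⟩ := far_segment (ξ := ξ) (h := h) (j := n) hξ hfar hτ
          refine ⟨s2, ?_⟩
          refine mul_le_mul_of_nonneg_left ?_ (by positivity)
          exact inv_pow_le_mul_inv_pow (by positivity) (by positivity) (by linarith) _
      refine h1.trans ?_
      have : 0 ≤ 2 ^ n * C0 * E * (2 * n + 1) ^ (n + 1) * ‖h‖ ^ (n + 1) * ((‖h‖ + ‖ξ‖) ^ (n + 1))⁻¹ := by positivity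
      calc _ = C1 * C2 * E * 2 ^ (n + 1) * ‖h‖ ^ n * ((1 + ‖ξ‖) ^ (n + 1))⁻¹ := by ring
        _ ≤ _ := by linarith
    · have h1 := norm_fwdDiff_iter_le_sum m ξ h n hξ2
      refine h1.trans ?_
      have s1 : 1 ≤ (2 * n + 1) ^ (n + 1) * ‖h‖ ^ (n + 1) * ((‖h‖ + ‖ξ‖) ^ (n + 1))⁻¹ := by
        rw [← div_eq_mul_inv, le_div_iff₀ (by positivity), one_mul, ← mul_pow]
        gcongr
        linarith
      have s2 : 0 ≤ C1 * C2 * E * 2 ^ (n + 1) * ‖h‖ ^ n * ((1 + ‖ξ‖) ^ (n + 1))⁻¹ := by positivity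
      calc 2 ^ n * (C0 * E) = 2 ^ n * (C0 * E) * 1 := by ring
        _ ≤ 2 ^ n * (C0 * E) * ((2 * n + 1) ^ (n + 1) * ‖h‖ ^ (n + 1) * ((‖h‖ + ‖ξ‖) ^ (n + 1))⁻¹) := by gcongr
        _ ≤ _ := by linarith
  have b2 : ‖tanFourierInv m x‖ ≤ D * E * (‖x‖ ^ n)⁻¹ := by
    refine (norm_tanFourierInv_le_of_fwdDiff hmi hx n (((integrable_tail n hh0).const_mul _).add
      ((integrable_tail n one_pos).const_mul _)) hbd).trans (le_of_eq ?_)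
    simp only [Pi.add_apply]
    rw [integral_add ((integrable_tail n hh0).const_mul _) ((integrable_tail n one_pos).const_mul _),
      integral_const_mul, integral_const_mul, integral_tail n hh0, integral_tail n one_pos, hD, hhn]
    simp only [div_pow]
    field_simp
    ring
  have : (‖x‖ ^ n)⁻¹ ≤ 2 ^ n * ((1 + ‖x‖) ^ n)⁻¹ := by
    exact inv_pow_le_mul_inv_pow (by positivity) (by positivity) (by linarith) _
  calc _ ≤ (C0 * tailMass n + D + 1) * E * (2 ^ n * ((1 + ‖x‖) ^ n)⁻¹) := by
        refine b2.trans (mul_le_mul ?_ this (by positivity) (by positivity))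
        gcongr
        have : 0 ≤ C0 * tailMass n := by positivity
        linarith
    _ = _ := by ring

end KernelBounds

/-! ## The kernels and their derivatives -/

section Kernels
variable {n : ℕ} {a : ℝ}
variable {d : ℤ} {S : Symb n} {z : ℂ} {v : Tan n → ℂ} {r : ℤ} {A : ℕ → ℝ} {w : Tan n → ℂ → ℂ}

/-- The kernel of the multiplier `v S`, as a function on `ℝ^N`. -/
def kern (v : Tan n → ℂ) (S : Symb n) (z : ℂ) (p : Space n) : ℂ :=
  tanFourierInv (fun ξ => v ξ * S ξ z p.2) p.1

/-- The symbol of the derivative in direction `j`. -/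
def symDeriv (j : Fin (n + 1)) (S : Symb n) : Symb n :=
  Fin.lastCases (motive := fun _ => Symb n) (fun ξ z t => deriv (S ξ z) t)
    (fun i ξ z t => I * ((ξ i : ℂ) * S ξ z t)) j

/-- The symbol of the derivative along a word. -/
def symWord : (k : ℕ) → (Fin k → Fin (n + 1)) → (Symb n) → Symb n
  | 0, _, S => S
  | k + 1, j, S => symWord k (Fin.tail j) (symDeriv (j 0) S)

lemma IsSym.deriv_coord (ha : 0 < a) (h : IsSym a d S) (j : Fin (n + 1)) :
    IsSym a (d + 1) (symDeriv j S) := by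
  induction j using Fin.lastCases with
  | last =>
    obtain ⟨S', h', hd⟩ := h.exists_hasDerivAt_t ha
    refine h'.congr fun ξ z hz t => ?_
    simp only [symDeriv, Fin.lastCases_last]
    exact (hd ξ z hz t).deriv.symm
  | cast i =>
    have : IsSym a (d + 1) fun ξ z t => I * ((ξ i : ℂ) * S ξ z t) := (h.mulCoord i rfl).smul _
    simpa only [symDeriv, Fin.lastCases_castSucc] using this

lemma IsSym.deriv_word (ha : 0 < a) (k : ℕ) : ∀ (j : Fin k → Fin (n + 1)) {d : ℤ} {S : Symb n},
    IsSym a d S → IsSym a (d + k) (symWord k j S) := by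
  induction k with
  | zero => intro j d S h; simpa [symWord] using h
  | succ k ih =>
    intro j d S h
    have := ih (Fin.tail j) (h.deriv_coord ha (j 0))
    rw [symWord]
    convert this using 1
    push_cast; ring

lemma IsSym.mulSqrt_pow (h : IsSym a d S) (k : ℕ) : IsSym a (d + k) fun ξ z t => sqz z ^ k * S ξ z t := by
  induction k with
  | zero => simpa using h
  | succ k ih =>
    refine (ih.mulSqrt (d' := d + (k + 1 : ℕ)) (by push_cast; ring)).congr fun ξ z _ t => ?_
    rw [pow_succ]; ring

lemma kern_const_mul (c : ℂ → ℂ) (v : Tan n → ℂ) (S : Symb n) (z : ℂ) (p : Space n) :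
    kern v (fun ξ z t => c z * S ξ z t) z p = c z * kern v S z p := by
  unfold kern tanFourierInv
  rw [mul_left_comm, ← integral_const_mul (c z)]
  congr 2
  ext ξ
  ring

/-- The integrand of the kernel, differentiated along a coordinate direction. -/
lemma IsSym.hasDerivAt_integrand (ha : 0 < a) (h : IsSym a d S)
    (j : Fin (n + 1)) (ξ : Tan n) (hz : z ∈ ℂ₊) (p : Space n) (τ : ℝ) :
    HasDerivAt (fun τ : ℝ => 𝐞((p + τ • basisVec n j).1,ξ) * S ξ z (p + τ • basisVec n j).2)
      (𝐞((p + τ • basisVec n j).1,ξ) * symDeriv j S ξ z (p + τ • basisVec n j).2) τ := by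
  induction j using Fin.lastCases with
  | last =>
    obtain ⟨S', h', hd⟩ := h.exists_hasDerivAt_t ha
    simp only [basisVec, symDeriv, Fin.lastCases_last, fst_add, smul_fst, smul_zero,
      add_zero, snd_add, smul_snd, smul_eq_mul, mul_one]
    rw [(hd ξ z hz (p.2 + τ)).deriv]
    have := HasDerivAt.comp_const_add p.2 τ (hd ξ z hz (p.2 + τ))
    exact this.const_mul _
  | cast i =>
    simp only [basisVec, symDeriv, Fin.lastCases_castSucc, fst_add, smul_fst, smul_zero, add_zero, snd_add, smul_snd]
    have e : ∀ τ : ℝ, (inner ℝ (p.1 + τ • EuclideanSpace.single i (1 : ℝ)) ξ : ℝ) =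
        inner ℝ p.1 ξ + τ * ξ i := by
      intro τ
      rw [inner_add_left, inner_smul_left, EuclideanSpace.inner_single_left]
      simp
    simp only [e]
    have h1 : HasDerivAt (fun τ : ℝ => I * ((inner ℝ p.1 ξ + τ * ξ i : ℝ) : ℂ)) (I * ((1 * ξ i : ℝ) : ℂ)) τ :=
      ((((hasDerivAt_id τ).mul_const (ξ i)).const_add (inner ℝ p.1 ξ)).ofReal_comp).const_mul _
    refine (h1.cexp.mul_const _).congr_deriv ?_
    push_cast
    ring

lemma kern_eq_integral (v : Tan n → ℂ) (S : Symb n) (z : ℂ) (p : Space n) :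
    kern v S z p = (1 / (2 * π) ^ n : ℝ) * ∫ ξ, v ξ * (𝐞(p.1,ξ) * S ξ z p.2) := by
  unfold kern tanFourierInv
  congr 2
  ext ξ
  ring

lemma IsSym.aestronglyMeasurable_integrand (ha : 0 < a)
    (h : IsSym a d S) (hz : z ∈ ℂ₊) (hv : AEStronglyMeasurable v)
    (p : Space n) : AEStronglyMeasurable fun ξ : Tan n => v ξ * (𝐞(p.1,ξ) * S ξ z p.2) := by
  have := (h.continuous ha hz).comp (by fun_prop : Continuous fun ξ : Tan n => (ξ, p.2))
  exact hv.mul (Continuous.aestronglyMeasurable (by fun_prop))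

lemma norm_integrand (x ξ : Tan n) (v s : ℂ) : ‖v * (𝐞(x,ξ) * s)‖ = ‖v * s‖ := by
  rw [norm_mul, norm_mul, norm_exp_I_mul, one_mul, norm_mul]

lemma IsSym.continuousOn_kern (hn : 1 ≤ n) (ha : 0 < a) (h : IsSym a d S) (hz : z ∈ ℂ₊)
    (hv : SymbolBound r A z v) : ContinuousOn (kern v S z) (halfSpace n) := by
  intro p hp
  have hp0 : 0 < p.2 := hp
  have hM := norm_sqz_pos hz
  obtain ⟨C, c, hC, hc, H⟩ := h.exists_mul_le ha r A ‖sqz z‖ hM (half_pos hp0)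
  refine ContinuousAt.continuousWithinAt ?_
  rw [show kern v S z = _ from funext (kern_eq_integral v S z)]
  refine continuousAt_const.mul ?_
  refine continuousAt_of_dominated (bound := fun ξ => C * ((1 + ‖ξ‖) ^ (n + 1))⁻¹)
    (.of_forall fun p =>
      h.aestronglyMeasurable_integrand ha hz (hv.aestronglyMeasurable hn) p) ?_
    ((integrable_tail n one_pos).const_mul C) ?_
  · filter_upwards [(isOpen_lt continuous_const continuous_snd).mem_nhds
      (show p ∈ {p : Space n | p.2 / 2 < _} from half_lt_self hp0)] with p' hp'
    filter_upwards [ae_ne_zero hn] with ξ hξ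
    rw [norm_integrand]
    refine (H z hz le_rfl le_rfl v hv p'.2 (le_of_lt hp') ξ hξ).trans ?_
    gcongr
    refine mul_le_of_le_one_right hC.le (exp_le_one_iff.2 ?_)
    have : (p.2 / 2) < p'.2 := hp'
    have : 0 < c * p'.2 := mul_pos hc (by linarith)
    linarith
  · refine .of_forall fun ξ => ?_
    have := (h.continuous ha hz).comp (by fun_prop : Continuous fun p : Space n => (ξ, p.2))
    have h2 : Continuous fun p : Space n => v ξ * (𝐞(p.1,ξ) *
        S ξ z p.2) := continuous_const.mul (Continuous.mul (by fun_prop) this)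
    exact h2.continuousAt

lemma IsSym.hasLineDerivAt_kern (hn : 1 ≤ n) (ha : 0 < a) (h : IsSym a d S) (hz : z ∈ ℂ₊)
    (hv : SymbolBound r A z v) (j : Fin (n + 1)) {p : Space n} (hp : 0 < p.2) :
    HasLineDerivAt ℝ (kern v S z) (kern v (symDeriv j S) z p) p (basisVec n j) := by
  have hM := norm_sqz_pos hz
  have h' := h.deriv_coord ha j
  obtain ⟨C, c, hC, hc, H⟩ := h'.exists_mul_le ha r A ‖sqz z‖ hM (half_pos hp)
  rw [show kern v S z = _ from funext (kern_eq_integral v S z)]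
  rw [kern_eq_integral]
  unfold HasLineDerivAt
  refine HasDerivAt.const_mul _ ?_
  have hnear : {τ : ℝ | p.2 / 2 < (p + τ • basisVec n j).2} ∈ nhds (0 : ℝ) := by
    refine (isOpen_lt continuous_const (by fun_prop)).mem_nhds ?_
    simpa using half_lt_self hp
  have key := hasDerivAt_integral_of_dominated_loc_of_deriv_le (μ := (volume : Measure (Tan n)))
    (F := fun (τ : ℝ) ξ => v ξ * (𝐞((p + τ • basisVec n j).1,ξ) * S ξ z (p + τ • basisVec n j).2))
    (F' := fun (τ : ℝ) ξ => v ξ * (𝐞((p + τ • basisVec n j).1,ξ) * symDeriv j S ξ z (p + τ • basisVec n j).2))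
    (bound := fun ξ => C * ((1 + ‖ξ‖) ^ (n + 1))⁻¹) (x₀ := 0) hnear
    (.of_forall fun τ =>
      h.aestronglyMeasurable_integrand ha hz (hv.aestronglyMeasurable hn) _) ?_
    (h'.aestronglyMeasurable_integrand ha hz (hv.aestronglyMeasurable hn) _) ?_
    ((integrable_tail n one_pos).const_mul C) ?_
  · simpa using key.2
  · refine (h.integrable_mul hn ha hz hv hp).congr' (h.aestronglyMeasurable_integrand ha hz
      (hv.aestronglyMeasurable hn) _) (.of_forall fun ξ => ?_)
    rw [norm_integrand]
    simp
  · filter_upwards [ae_ne_zero hn] with ξ hξ τ hτ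
    have hτ' : p.2 / 2 < (p + τ • basisVec n j).2 := hτ
    rw [norm_integrand]
    refine (H z hz le_rfl le_rfl v hv _ (le_of_lt hτ') ξ hξ).trans ?_
    gcongr
    refine mul_le_of_le_one_right hC.le (exp_le_one_iff.2 ?_)
    have : 0 < c * (p + τ • basisVec n j).2 := mul_pos hc (by linarith)
    linarith
  · refine .of_forall fun ξ τ _ => ?_
    exact (h.hasDerivAt_integrand ha j ξ hz p τ).const_mul _

/-! ## Dependence on the parameter -/

/-- The bounds of a multiplier of type `1`. -/
structure SymbolFamily (r : ℤ) (A : ℕ → ℝ) (w : Tan n → ℂ → ℂ) : Prop where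
  holomorphic : ∀ ξ ≠ 0, DifferentiableOn ℂ (w ξ) ℂ₊
  bound : ∀ i ≤ 1, ∀ z ∈ ℂ₊, SymbolBound r A z fun ξ => eulerDeriv^[i] (w ξ) z

lemma SymbolFamily.bound_zero (hw : SymbolFamily r A w)
    (hz : z ∈ ℂ₊) : SymbolBound r A z fun ξ => w ξ z := hw.bound 0 zero_le_one z hz

lemma SymbolFamily.bound_one (hw : SymbolFamily r A w)
    (hz : z ∈ ℂ₊) : SymbolBound r A z fun ξ => eulerDeriv (w ξ) z := hw.bound 1 le_rfl z hz

lemma IsMultiplierWith.symbolFamily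
    (hw : IsMultiplierWith (r : ℝ) A w) : SymbolFamily r (fun k => n ^ k * A k) w :=
  ⟨hw.holomorphic, fun _ hi _ hz => hw.symbolBound hi hz⟩

lemma IsSym.exists_hasDerivAt_kern (hn : 1 ≤ n) (ha : 0 < a)
    (h : IsSym a d S) : ∃ S', IsSym a d S' ∧ ∀ (r : ℤ) (A : ℕ → ℝ) (w : Tan n → ℂ → ℂ), SymbolFamily r A w →
      ∀ z ∈ ℂ₊, ∀ p : Space n, 0 < p.2 → HasDerivAt (fun z => kern (fun ξ => w ξ z) S z p)
        ((kern (fun ξ => eulerDeriv (w ξ) z) S z p + kern (fun ξ => w ξ z) S' z p) / z) z := by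
  obtain ⟨S', h', hd⟩ := h.exists_hasDerivAt_z ha
  refine ⟨S', h', fun r A w hw z hz p hp => ?_⟩
  have hz0 : 0 < z.re := hz
  set s : Set ℂ := ball z (z.re / 2) with hs
  have hs1 : ∀ z' ∈ s, z.re / 2 < z'.re ∧ ‖z'‖ ≤ ‖z‖ + z.re := by
    intro z' hz'
    rw [hs, mem_ball, dist_eq_norm] at hz'
    have h1 := abs_re_le_norm (z' - z)
    rw [sub_re] at h1
    have h2 := abs_le.1 (h1.trans hz'.le)
    have h3 := norm_sub_norm_le z' z
    constructor
    · have := lt_of_le_of_lt h1 hz'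
      linarith [(abs_lt.1 this).1]
    · linarith
  have hsr : ∀ z' ∈ s, z' ∈ ℂ₊ := fun z' hz' => by
    have := (hs1 z' hz').1
    change 0 < z'.re
    linarith
  have hM : 0 < sqrt (z.re / 2) := sqrt_pos.2 (by linarith)
  have hM1 : ∀ z' ∈ s, sqrt (z.re / 2) ≤ ‖sqz z'‖ ∧ ‖sqz z'‖ ≤ sqrt (‖z‖ + z.re) := by
    intro z' hz'
    obtain ⟨h1, h2⟩ := hs1 z' hz'
    have e : ‖sqz z'‖ = sqrt ‖z'‖ := by rw [← norm_sqz_sq z', Real.sqrt_sq (norm_nonneg _)]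
    rw [e]
    exact ⟨Real.sqrt_le_sqrt (h1.le.trans (re_le_norm z')), Real.sqrt_le_sqrt h2⟩
  obtain ⟨C, c, hC, hc, H⟩ := h.exists_mul_le ha r A (sqrt (‖z‖ + z.re)) hM hp
  obtain ⟨C', c', hC', hc', H'⟩ := h'.exists_mul_le ha r A (sqrt (‖z‖ + z.re)) hM hp
  have hv0 : ∀ z' ∈ s, SymbolBound r A z' fun ξ => w ξ z' := fun z' hz' => hw.bound_zero (hsr z' hz')
  have hv1 : ∀ z' ∈ s, SymbolBound r A z' fun ξ => eulerDeriv (w ξ) z' := fun z' hz' => hw.bound_one (hsr z' hz')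
  have hzs : z ∈ s := Metric.mem_ball_self (by linarith)
  have hsn : s ∈ nhds z := Metric.ball_mem_nhds z (by linarith)
  have m1 := h.aestronglyMeasurable_integrand ha hz ((hv1 z hzs).aestronglyMeasurable hn) p
  have m2 := h'.aestronglyMeasurable_integrand ha hz ((hv0 z hzs).aestronglyMeasurable hn) p
  have i1 : Integrable fun ξ : Tan n => eulerDeriv (w ξ) z * (𝐞(p.1,ξ) * S ξ z p.2) :=
    (h.integrable_mul hn ha hz (hv1 z hzs) hp).congr' m1 (.of_forall fun ξ => (norm_integrand _ _ _ _).symm)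
  have i2 : Integrable fun ξ : Tan n => w ξ z * (𝐞(p.1,ξ) * S' ξ z p.2) :=
    (h'.integrable_mul hn ha hz (hv0 z hzs) hp).congr' m2 (.of_forall fun ξ => (norm_integrand _ _ _ _).symm)
  simp only [kern_eq_integral]
  rw [← mul_add, mul_div_assoc, ← integral_add i1 i2, ← integral_div]
  refine HasDerivAt.const_mul _ ?_
  refine (hasDerivAt_integral_of_dominated_loc_of_deriv_le (μ := (volume : Measure (Tan n)))
    (F := fun z' ξ => w ξ z' * (𝐞(p.1,ξ) * S ξ z' p.2))
    (F' := fun z' ξ => (eulerDeriv (w ξ) z' * (𝐞(p.1,ξ) * S ξ z' p.2) + w ξ z' * (𝐞(p.1,ξ) * S' ξ z' p.2)) / z')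
    (bound := fun ξ => (C + C') / (z.re / 2) * ((1 + ‖ξ‖) ^ (n + 1))⁻¹) (x₀ := z) hsn
    ?_ ?_ ?_ ?_ ((integrable_tail n one_pos).const_mul _) ?_).2
  · filter_upwards [hsn] with z' hz'
    exact h.aestronglyMeasurable_integrand ha (hsr z' hz') ((hv0 z' hz').aestronglyMeasurable hn) p
  · exact (h.integrable_mul hn ha hz (hv0 z hzs) hp).congr'
      (h.aestronglyMeasurable_integrand ha hz ((hv0 z hzs).aestronglyMeasurable hn) p)
      (.of_forall fun ξ => (norm_integrand _ _ _ _).symm)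
  · exact ((i1.add i2).div_const _).aestronglyMeasurable
  · filter_upwards [ae_ne_zero hn] with ξ hξ z' hz'
    have hre := (hs1 z' hz').1
    have e1 := H z' (hsr z' hz') (hM1 z' hz').1 (hM1 z' hz').2 _ (hv1 z' hz') p.2 le_rfl ξ hξ
    have e2 := H' z' (hsr z' hz') (hM1 z' hz').1 (hM1 z' hz').2 _ (hv0 z' hz') p.2 le_rfl ξ hξ
    have x1 : C * exp (-(c * p.2)) ≤ C := mul_le_of_le_one_right hC.le
      (exp_le_one_iff.2 (neg_nonpos.2 (by positivity)))
    have x2 : C' * exp (-(c' * p.2)) ≤ C' := mul_le_of_le_one_right hC'.le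
      (exp_le_one_iff.2 (neg_nonpos.2 (by positivity)))
    rw [norm_div, div_eq_mul_inv, div_eq_mul_inv, mul_right_comm]
    refine mul_le_mul ?_ ?_ (by positivity) (by positivity)
    · refine (norm_add_le _ _).trans ?_
      rw [norm_integrand, norm_integrand, add_mul]
      exact add_le_add (e1.trans (by gcongr)) (e2.trans (by gcongr))
    · gcongr
      exact hre.le.trans (re_le_norm z')
  · filter_upwards [ae_ne_zero hn] with ξ hξ z' hz'
    have hz'0 := rhp_ne_zero (hsr z' hz')
    have d1 : HasDerivAt (w ξ) (eulerDeriv (w ξ) z' / z') z' := by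
      rw [eulerDeriv, smul_eq_mul, mul_div_cancel_left₀ _ hz'0]
      exact ((hw.holomorphic ξ hξ).differentiableAt (isOpen_rightHalfPlane.mem_nhds (hsr z' hz'))).hasDerivAt
    refine (d1.mul ((hd ξ z' (hsr z' hz') p.2).const_mul _)).congr_deriv ?_
    ring

end Kernels

/-! ## Operators with a kernel of the form `κ (x' - y', x_N + y_N)` -/

section KernelOp
variable {n : ℕ} {q : ℝ≥0∞}
variable {κ : Space n → ℂ} {C : ℝ} {ψ : Space n → ℂ} {C' : ℝ} {κ' : Space n → ℂ}

/-- `κ (x' - y', x_N + y_N)`. -/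
def reflKer (κ : Space n → ℂ) (x y : Space n) : ℂ := κ (x.1 - y.1, x.2 + y.2)

/-- `κ` is continuous and dominated by the homogeneous majorant. -/
structure Dominated (C : ℝ) (κ : Space n → ℂ) : Prop where
  continuousOn : ContinuousOn κ (halfSpace n)
  le : ∀ p ∈ halfSpace n, ‖κ p‖ ≤ C * ((‖p.1‖ + p.2) ^ (n + 1))⁻¹

lemma aestronglyMeasurable_reflKer (hκ : ContinuousOn κ (halfSpace n)) :
    AEStronglyMeasurable (uncurry (reflKer κ)) ((halfVol n).prod (halfVol n)) := by
  rw [Measure.prod_restrict]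
  refine ContinuousOn.aestronglyMeasurable ?_ ((measurableSet_halfSpace n).prod (measurableSet_halfSpace n))
  refine hκ.comp (f := fun p : Space n × Space n => (p.1.1 - p.2.1, p.1.2 + p.2.2)) (by fun_prop) ?_
  rintro ⟨x, y⟩ ⟨hx, hy⟩
  exact add_pos (show 0 < x.2 from hx) (show 0 < y.2 from hy)

lemma Dominated.enorm_le (h : Dominated C κ) {x y : Space n} (hx : 0 < x.2)
    (hy : 0 < y.2) : ‖reflKer κ x y‖ₑ ≤ ofReal C * majorant n x y := by
  have hp : ((x.1 - y.1, x.2 + y.2) : Space n) ∈ halfSpace n := add_pos hx hy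
  have h1 := h.le _ hp
  have hC : 0 ≤ C := by
    have h2 := (norm_nonneg _).trans h1
    by_contra hneg
    push Not at hneg
    have h3 : 0 < ((‖x.1 - y.1‖ + (x.2 + y.2)) ^ (n + 1))⁻¹ := by positivity
    have h4 := mul_neg_of_neg_of_pos hneg h3
    exact absurd h2 (not_le.2 h4)
  rw [← ofReal_norm, majorant, ← ofReal_mul hC]
  exact ofReal_le_ofReal h1

lemma LqBounded.const_mul {α : Type*} [MeasurableSpace α] {μ : Measure α} {k0 : α → α → ℝ≥0∞} {D : ℝ≥0∞}
    (h : LqBounded μ q k0 D) {C : ℝ≥0∞} (hC : C ≠ ⊤) :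
    LqBounded μ q (fun x y => C * k0 x y) (C ^ q.toReal * D) := by
  intro g hg
  simp only [mul_assoc, lintegral_const_mul' C _ hC]
  simp only [mul_rpow_of_nonneg _ _ toReal_nonneg]
  rw [lintegral_const_mul' _ _ (rpow_ne_top_of_nonneg toReal_nonneg hC)]
  gcongr
  exact h g hg

variable [Fact (1 ≤ q)]

/-- The operator `f ↦ ∫ κ (x' - y', x_N + y_N) f(y) dy` on `L_q` of the half-space. -/
def kernelOp (q : ℝ≥0∞) [Fact (1 ≤ q)] (κ : Space n → ℂ) : Lq n q →L[ℂ] Lq n q :=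
  open Classical in
  if h : ∃ T : Lq n q →L[ℂ] Lq n q, ∀ f : Lq n q,
    T f =ᵐ[halfVol n] fun x => ∫ y, reflKer κ x y * f y ∂halfVol n then h.choose else 0

lemma exists_norm_kernelOp_le (n : ℕ) (hq1 : 1 < q) (hq2 : q ≠ ⊤) : ∃ M : ℝ, 0 ≤ M ∧
    ∀ (C : ℝ) (κ : Space n → ℂ), 0 ≤ C → Dominated C κ →
      (∀ f : Lq n q, kernelOp q κ f =ᵐ[halfVol n] fun x => ∫ y, reflKer κ x y * f y ∂halfVol n) ∧
      ‖kernelOp q κ‖ ≤ M * C := by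
  obtain ⟨D, hD, hb⟩ := exists_lqBounded_majorant n hq1 hq2
  have hq0 := toReal_exponent_pos hq2
  refine ⟨D ^ (1 / q.toReal), by positivity, fun C κ hC hκ => ?_⟩
  have hb' := hb.const_mul (ofReal_ne_top (r := C))
  rw [ofReal_rpow_of_nonneg hC hq0.le, ← ofReal_mul (by positivity)] at hb'
  obtain ⟨T, hT, hTn⟩ := exists_integralOperator hq2 (by positivity) hb'
    (aestronglyMeasurable_reflKer hκ.continuousOn) (by
      filter_upwards [ae_halfVol n] with x hx
      filter_upwards [ae_halfVol n] with y hy using hκ.enorm_le hx hy)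
  have hex : ∃ T : Lq n q →L[ℂ] Lq n q, ∀ f : Lq n q,
      T f =ᵐ[halfVol n] fun x => ∫ y, reflKer κ x y * f y ∂halfVol n := ⟨T, hT⟩
  have hs : ∀ f : Lq n q, kernelOp q κ f =ᵐ[halfVol n]
      fun x => ∫ y, reflKer κ x y * f y ∂halfVol n := by
    intro f
    unfold kernelOp
    rw [dif_pos hex]
    exact hex.choose_spec f
  have he : kernelOp q κ = T := by
    ext1 f
    exact Lp.ext ((hs f).trans (hT f).symm)
  refine ⟨hs, ?_⟩
  rw [he]
  refine hTn.trans (le_of_eq ?_)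
  rw [mul_rpow (by positivity) hD, ← Real.rpow_mul hC, mul_one_div_cancel hq0.ne', Real.rpow_one, mul_comm]

lemma Dominated.kernelOp_ae (hq1 : 1 < q) (hq2 : q ≠ ⊤) (hC : 0 ≤ C) (hκ : Dominated C κ) (f : Lq n q) :
    kernelOp q κ f =ᵐ[halfVol n] fun x => ∫ y, reflKer κ x y * f y ∂halfVol n := by
  obtain ⟨M, -, H⟩ := exists_norm_kernelOp_le n hq1 hq2
  exact (H C κ hC hκ).1 f

lemma Dominated.hasMajorant (hq1 : 1 < q) (hq2 : q ≠ ⊤) (hC : 0 ≤ C)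
    (hκ : Dominated C κ) : HasMajorant (fun x y => ofReal C * majorant n x y) (kernelOp q κ) := by
  refine ⟨reflKer κ, ?_, fun f => hκ.kernelOp_ae hq1 hq2 hC f⟩
  filter_upwards [(aestronglyMeasurable_reflKer hκ.continuousOn).prodMk_left, ae_halfVol n] with x h1 hx
  refine ⟨h1, ?_⟩
  filter_upwards [ae_halfVol n] with y hy using hκ.enorm_le hx hy

/-- The family of all operators with a dominated kernel is `R`-bounded. -/
lemma exists_isRBoundedWith_kernelOp (n : ℕ) (hq1 : 1 < q) (hq2 : q ≠ ⊤) (hC : 0 ≤ C) :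
    ∃ K : ℝ, 0 ≤ K ∧ IsRBoundedWith q.toReal K {T : Lq n q →L[ℂ] Lq n q |
      ∃ κ, Dominated C κ ∧ T = kernelOp q κ} := by
  obtain ⟨D, hD, hb⟩ := exists_lqBounded_majorant n hq1 hq2
  have hb' := hb.const_mul (ofReal_ne_top (r := C))
  obtain ⟨K, hK, H⟩ := exists_isRBoundedWith_hasMajorant hq2
    (mul_ne_top (rpow_ne_top_of_nonneg toReal_nonneg ofReal_ne_top) ofReal_ne_top) hb'
  refine ⟨K, hK, H.mono le_rfl ?_⟩
  rintro T ⟨κ, hκ, rfl⟩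
  exact hκ.hasMajorant hq1 hq2 hC

/-- Absolute integrability of `ψ(x) κ(x, y) f(y)`. -/
lemma Dominated.integrable_prod (hq1 : 1 < q) (hq2 : q ≠ ⊤)
    (hκ : Dominated C κ) (f : Lq n q) (hψ : Continuous ψ) (hs : HasCompactSupport ψ) :
    Integrable (fun p : Space n × Space n => ψ p.1 * (reflKer κ p.1 p.2 * f p.2))
      ((halfVol n).prod (halfVol n)) := by
  obtain ⟨D, hD, hb⟩ := exists_lqBounded_majorant n hq1 hq2
  have hp1r : 1 < q.toReal := one_lt_toReal hq1 hq2
  have hpc := (Real.HolderConjugate.conjExponent hp1r).symm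
  have hfm : AEMeasurable (fun y => ‖f y‖ₑ) (halfVol n) := (Lp.aestronglyMeasurable f).enorm
  have hm0 : AEStronglyMeasurable (fun p : Space n × Space n => ψ p.1 * (reflKer κ p.1 p.2 * f p.2))
      ((halfVol n).prod (halfVol n)) :=
    (hψ.comp continuous_fst).aestronglyMeasurable.mul
      ((aestronglyMeasurable_reflKer hκ.continuousOn).mul (Lp.aestronglyMeasurable f).comp_snd)
  refine ⟨hm0, ?_⟩
  rw [hasFiniteIntegral_iff_enorm, lintegral_prod _ hm0.enorm]
  have hG : AEMeasurable (fun x => ∫⁻ y, majorant n x y * ‖f y‖ₑ ∂halfVol n) (halfVol n) :=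
    ((measurable_majorant n).aemeasurable.mul hfm.comp_snd).lintegral_prod_right'
  have hψm : AEMeasurable (fun x => ‖ψ x‖ₑ) (halfVol n) := hψ.aestronglyMeasurable.enorm
  have step : ∫⁻ x, ∫⁻ y, ‖ψ x * (reflKer κ x y * f y)‖ₑ ∂halfVol n ∂halfVol n ≤
      ofReal C * ∫⁻ x, ((fun x => ‖ψ x‖ₑ) * fun x => ∫⁻ y, majorant n x y * ‖f y‖ₑ ∂halfVol n) x
        ∂halfVol n := by
    rw [← lintegral_const_mul' _ _ ofReal_ne_top]
    refine lintegral_mono_ae ?_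
    filter_upwards [ae_halfVol n] with x hx
    rw [Pi.mul_apply, mul_left_comm, ← lintegral_const_mul' _ _ ofReal_ne_top, ← lintegral_const_mul' _ _ enorm_ne_top]
    refine lintegral_mono_ae ?_
    filter_upwards [ae_halfVol n] with y hy
    rw [enorm_mul, enorm_mul, ← mul_assoc (ofReal C)]
    gcongr
    exact hκ.enorm_le hx hy
  refine step.trans_lt (mul_lt_top ofReal_lt_top ?_)
  refine (lintegral_mul_le_Lp_mul_Lq _ hpc hψm hG).trans_lt (mul_lt_top ?_ ?_)
  · refine rpow_lt_top_of_nonneg (by have := hpc.pos; positivity) ?_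
    have h1 : MemLp ψ (ofReal q.toReal.conjExponent) (halfVol n) := (hψ.memLp_of_hasCompactSupport hs)
    have h2 := lintegral_rpow_enorm_lt_top_of_eLpNorm_lt_top (by simpa using hpc.pos) ofReal_ne_top h1.2
    rw [toReal_ofReal hpc.pos.le] at h2
    exact h2.ne
  · refine rpow_lt_top_of_nonneg (by positivity) (ne_top_of_le_ne_top ?_ (hb _ hfm))
    refine mul_ne_top ofReal_ne_top ?_
    rw [← ofReal_norm_Lp_rpow hq2]
    exact ofReal_ne_top

lemma Dominated.integral_mul_kernelOp (hq1 : 1 < q) (hq2 : q ≠ ⊤) (hC : 0 ≤ C)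
    (hκ : Dominated C κ) (f : Lq n q) (hψ : Continuous ψ) (hs : HasCompactSupport ψ) :
    ∫ x in halfSpace n, ψ x * kernelOp q κ f x =
      ∫ y in halfSpace n, (∫ x in halfSpace n, ψ x * reflKer κ x y) * f y := by
  have hint := hκ.integrable_prod hq1 hq2 f hψ hs
  calc ∫ x in halfSpace n, ψ x * kernelOp q κ f x
      = ∫ x in halfSpace n, ∫ y in halfSpace n, ψ x * (reflKer κ x y * f y) := by
        refine integral_congr_ae ?_
        filter_upwards [hκ.kernelOp_ae hq1 hq2 hC f] with x hx
        rw [hx, ← integral_const_mul]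
    _ = ∫ y in halfSpace n, ∫ x in halfSpace n, ψ x * (reflKer κ x y * f y) := integral_integral_swap hint
    _ = _ := by
        refine integral_congr_ae (.of_forall fun y => ?_)
        simp only
        rw [← integral_mul_const]
        simp only [mul_assoc]

lemma Dominated.isWeakDeriv (hq1 : 1 < q) (hq2 : q ≠ ⊤) (hC : 0 ≤ C) (hC' : 0 ≤ C') (hκ : Dominated C κ) (hκ' : Dominated C' κ') {k : ℕ} (j : Fin k → Fin (n + 1))
    (h : ∀ φ : Space n → ℂ, IsTest φ → tsupport φ ⊆ halfSpace n → ∀ y ∈ halfSpace n,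
      ∫ x in halfSpace n, partialDeriv j φ x * reflKer κ x y =
        (-1) ^ k * ∫ x in halfSpace n, φ x * reflKer κ' x y) (f : Lq n q) :
    IsWeakDeriv j (kernelOp q κ f) (kernelOp q κ' f) := by
  intro φ hφ hs
  rw [hκ.integral_mul_kernelOp hq1 hq2 hC f (hφ.continuous_partialDeriv j) (hφ.hasCompactSupport_partialDeriv j),
    hκ'.integral_mul_kernelOp hq1 hq2 hC' f hφ.1.continuous hφ.2, ← integral_const_mul]
  refine integral_congr_ae ?_
  filter_upwards [ae_restrict_mem (measurableSet_halfSpace n)] with y hy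
  rw [h φ hφ hs y hy, mul_assoc]

lemma kernelOp_const_mul (hq1 : 1 < q) (hq2 : q ≠ ⊤) (hC : 0 ≤ C)
    (hκ : Dominated C κ) (c : ℂ) : Dominated (‖c‖ * C) (fun p => c * κ p) ∧
      kernelOp q (fun p => c * κ p) = c • kernelOp q κ := by
  have h1 : Dominated (‖c‖ * C) (fun p => c * κ p) := by
    refine ⟨continuousOn_const.mul hκ.continuousOn, fun p hp => ?_⟩
    rw [norm_mul, mul_assoc]
    exact mul_le_mul_of_nonneg_left (hκ.le p hp) (norm_nonneg _)
  refine ⟨h1, ?_⟩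
  ext1 f
  refine Lp.ext ?_
  rw [smul_apply]
  filter_upwards [h1.kernelOp_ae hq1 hq2 (by positivity) f, hκ.kernelOp_ae hq1 hq2 hC f,
    Lp.coeFn_smul c (kernelOp q κ f)] with x e1 e2 e3
  rw [e1, e3, Pi.smul_apply, e2, smul_eq_mul, ← integral_const_mul]
  simp only [reflKer, mul_assoc]

lemma Dominated.integrable_ae (hq1 : 1 < q) (hq2 : q ≠ ⊤) (hκ : Dominated C κ) (f : Lq n q) :
    ∀ᵐ x ∂halfVol n, Integrable (fun y => reflKer κ x y * f y) (halfVol n) := by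
  obtain ⟨D, hD, hb⟩ := exists_lqBounded_majorant n hq1 hq2
  have hq0 := toReal_exponent_pos hq2
  have hfm : AEMeasurable (fun y => ‖f y‖ₑ) (halfVol n) := (Lp.aestronglyMeasurable f).enorm
  have hG : AEMeasurable (fun x => (∫⁻ y, majorant n x y * ‖f y‖ₑ ∂halfVol n) ^ q.toReal) (halfVol n) :=
    ((measurable_majorant n).aemeasurable.mul hfm.comp_snd).lintegral_prod_right'.pow_const _
  have hfin := ae_lt_top' hG (ne_top_of_le_ne_top (mul_ne_top ofReal_ne_top (by
    rw [← ofReal_norm_Lp_rpow hq2]; exact ofReal_ne_top)) (hb _ hfm))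
  filter_upwards [hfin, (aestronglyMeasurable_reflKer hκ.continuousOn).prodMk_left, ae_halfVol n]
    with x h1 h2 hx
  refine ⟨h2.mul (Lp.aestronglyMeasurable f), ?_⟩
  rw [hasFiniteIntegral_iff_enorm]
  have h3 : ∫⁻ y, ‖reflKer κ x y * f y‖ₑ ∂halfVol n ≤
      ofReal C * ∫⁻ y, majorant n x y * ‖f y‖ₑ ∂halfVol n := by
    rw [← lintegral_const_mul' _ _ ofReal_ne_top]
    refine lintegral_mono_ae ?_
    filter_upwards [ae_halfVol n] with y hy
    rw [enorm_mul, ← mul_assoc]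
    gcongr
    exact hκ.enorm_le hx hy
  exact h3.trans_lt (mul_lt_top ofReal_lt_top ((ENNReal.rpow_lt_top_iff_of_pos hq0).1 h1))

lemma Dominated.add (h : Dominated C κ) (h' : Dominated C' κ') : Dominated (C + C') fun p => κ p + κ' p :=
  ⟨h.continuousOn.add h'.continuousOn, fun p hp => by
    rw [add_mul]; exact (norm_add_le _ _).trans (add_le_add (h.le p hp) (h'.le p hp))⟩

lemma Dominated.mono (h : Dominated C κ) (hC : C ≤ C') : Dominated C' κ :=
  ⟨h.continuousOn, fun p hp => (h.le p hp).trans (by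
    have h0 : 0 < p.2 := hp
    gcongr)⟩

lemma kernelOp_add (hq1 : 1 < q) (hq2 : q ≠ ⊤) (hC : 0 ≤ C) (hC' : 0 ≤ C')
    (hκ : Dominated C κ) (hκ' : Dominated C' κ') :
    kernelOp q (fun p => κ p + κ' p) = kernelOp q κ + kernelOp q κ' := by
  ext1 f
  refine Lp.ext ?_
  rw [add_apply]
  filter_upwards [(hκ.add hκ').kernelOp_ae hq1 hq2 (by positivity) f, hκ.kernelOp_ae hq1 hq2 hC f,
    hκ'.kernelOp_ae hq1 hq2 hC' f, Lp.coeFn_add (kernelOp q κ f) (kernelOp q κ' f),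
    hκ.integrable_ae hq1 hq2 f, hκ'.integrable_ae hq1 hq2 f] with x e1 e2 e3 e4 i1 i2
  rw [e1, e4, Pi.add_apply, e2, e3, ← integral_add i1 i2]
  simp only [reflKer, add_mul]

/-- Holomorphy of the operator in a parameter, from pointwise holomorphy of the kernel. -/
lemma hasDerivAt_kernelOp (hq1 : 1 < q) (hq2 : q ≠ ⊤) {R : ℝ} (hC : 0 < C) (hR : 0 < R) {z0 : ℂ}
    {κ κ' : ℂ → Space n → ℂ} (h : ∀ z ∈ ball z0 R, Dominated C (κ z))
    (h' : ∀ z ∈ ball z0 R, Dominated C (κ' z))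
    (hd : ∀ z ∈ ball z0 R, ∀ p ∈ halfSpace n, HasDerivAt (fun z => κ z p) (κ' z p) z) :
    HasDerivAt (fun z => kernelOp q (κ z)) (kernelOp q (κ' z0)) z0 := by
  obtain ⟨M, hM, H⟩ := exists_norm_kernelOp_le n hq1 hq2
  have hz₀ : z0 ∈ ball z0 R := Metric.mem_ball_self hR
  have lip : ∀ p ∈ halfSpace n, ∀ z ∈ ball z0 R,
      ‖κ' z p - κ' z0 p‖ ≤ 3 * C / R * ((‖p.1‖ + p.2) ^ (n + 1))⁻¹ * ‖z - z0‖ := by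
    intro p hp z hz
    have hp0 : 0 < p.2 := hp
    have hdiff : DifferentiableOn ℂ (fun z => κ' z p) (ball z0 R) := by
      have : DifferentiableOn ℂ (deriv fun z => κ z p) (ball z0 R) :=
        DifferentiableOn.deriv (fun z hz => (hd z hz p hp).differentiableAt.differentiableWithinAt)
          isOpen_ball
      exact this.congr fun z hz => (hd z hz p hp).deriv.symm
    have hmap : MapsTo (fun z => κ' z p) (ball z0 R)
        (ball (κ' z0 p) (3 * C * ((‖p.1‖ + p.2) ^ (n + 1))⁻¹)) := by
      intro z hz
      rw [mem_ball, dist_eq_norm]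
      have a1 := (h' z hz).le p hp
      have a2 := (h' z0 hz₀).le p hp
      have a3 : 0 < C * ((‖p.1‖ + p.2) ^ (n + 1))⁻¹ := by positivity
      refine (norm_sub_le _ _).trans_lt ?_
      linarith
    have := Complex.dist_le_div_mul_dist_of_mapsTo_ball hdiff
      (hmap.mono_right Metric.ball_subset_closedBall) hz
    rw [dist_eq_norm, dist_eq_norm] at this
    refine this.trans (le_of_eq ?_)
    ring
  have quad : ∀ p ∈ halfSpace n, ∀ z ∈ ball z0 R,
      ‖κ z p - κ z0 p - (z - z0) * κ' z0 p‖ ≤ 3 * C / R * ((‖p.1‖ + p.2) ^ (n + 1))⁻¹ * ‖z - z0‖ * ‖z - z0‖ := by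
    intro p hp z hz
    have hp0 : 0 < p.2 := hp
    set s := Metric.closedBall z0 ‖z - z0‖ with hs
    have hsub : s ⊆ ball z0 R := Metric.closedBall_subset_ball (by
      rwa [mem_ball, dist_eq_norm] at hz)
    have hder : ∀ w ∈ s, HasDerivWithinAt (fun w => κ w p - w * κ' z0 p) (κ' w p - κ' z0 p) s w := by
      intro w hw
      have := (hd w (hsub hw) p hp).sub ((hasDerivAt_id w).mul_const (κ' z0 p))
      exact (this.congr_deriv (by simp)).hasDerivWithinAt
    have hbound : ∀ w ∈ s, ‖κ' w p - κ' z0 p‖ ≤ 3 * C / R * ((‖p.1‖ + p.2) ^ (n + 1))⁻¹ * ‖z - z0‖ := by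
      intro w hw
      refine (lip p hp w (hsub hw)).trans ?_
      have : ‖w - z0‖ ≤ ‖z - z0‖ := by rwa [hs, Metric.mem_closedBall, dist_eq_norm] at hw
      gcongr
    have := (convex_closedBall z0 ‖z - z0‖).norm_image_sub_le_of_norm_hasDerivWithin_le hder hbound
      (Metric.mem_closedBall_self (norm_nonneg _)) (y := z) (by
        rw [Metric.mem_closedBall, dist_eq_norm])
    refine le_trans (le_of_eq ?_) this
    congr 1; ring
  rw [hasDerivAt_iff_isLittleO]
  have hO : (fun z => kernelOp q (κ z) - kernelOp q (κ z0) - (z - z0) • kernelOp q (κ' z0)) =O[nhds z0]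
      fun z => ‖z - z0‖ ^ 2 := by
    refine Asymptotics.IsBigO.of_bound (M * (3 * C / R)) ?_
    filter_upwards [Metric.ball_mem_nhds z0 hR] with z hz
    obtain ⟨d1, e1⟩ := kernelOp_const_mul (q := q) hq1 hq2 hC.le (h z0 hz₀) (-1)
    obtain ⟨d2, e2⟩ := kernelOp_const_mul (q := q) hq1 hq2 hC.le (h' z0 hz₀) (-(z - z0))
    have e3 := kernelOp_add (q := q) hq1 hq2 hC.le (by positivity) (h z hz) d1
    have e4 := kernelOp_add (q := q) hq1 hq2 (by positivity) (by positivity) ((h z hz).add d1) d2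
    rw [e3, e1, e2] at e4
    have e5 : kernelOp q (κ z) - kernelOp q (κ z0) - (z - z0) • kernelOp q (κ' z0) =
        kernelOp q fun p => κ z p + -1 * κ z0 p + -(z - z0) * κ' z0 p := by
      rw [e4, neg_one_smul, neg_smul]; abel
    rw [e5, norm_pow, norm_norm]
    have hdom : Dominated (3 * C / R * ‖z - z0‖ ^ 2)
        fun p => κ z p + -1 * κ z0 p + -(z - z0) * κ' z0 p := by
      refine ⟨(((h z hz).add d1).add d2).continuousOn, fun p hp => ?_⟩
      refine le_trans (le_of_eq ?_) ((quad p hp z hz).trans (le_of_eq (by ring)))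
      congr 1; ring
    refine (H _ _ (by positivity) hdom).2.trans (le_of_eq (by ring))
  exact hO.trans_isLittleO (Asymptotics.isLittleO_pow_sub_sub z0 one_lt_two)

end KernelOp

section WordDerivatives
variable {n : ℕ} {a : ℝ}
variable {k : ℕ} {φ ψ G : Space n → ℂ} {y : Space n}

lemma IsTest.partialDeriv (h : IsTest φ) (j : Fin k → Fin (n + 1)) : IsTest (partialDeriv j φ) := by
  refine ⟨?_, h.hasCompactSupport_partialDeriv j⟩
  have h1 : ContDiff ℝ ∞ (iteratedFDeriv ℝ k φ) := h.1.iteratedFDeriv_right (by exact_mod_cast le_top)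
  exact (ContinuousMultilinearMap.apply ℝ (fun _ : Fin k => Space n) ℂ
    fun i => basisVec n (j i)).contDiff.comp h1

lemma tsupport_partialDeriv_subset (j : Fin k → Fin (n + 1)) (φ : Space n → ℂ) :
    tsupport (partialDeriv j φ) ⊆ tsupport φ := by
  refine closure_minimal ?_ isClosed_closure
  refine subset_trans ?_ (support_iteratedFDeriv_subset (𝕜 := ℝ) k (f := φ))
  intro x hx h0
  apply hx
  simp only [partialDeriv, h0]
  rfl

lemma IsTest.hasLineDerivAt_partialDeriv (h : IsTest φ) (j : Fin (k + 1) → Fin (n + 1)) (x : Space n) :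
    HasLineDerivAt ℝ (_root_.partialDeriv (Fin.tail j) φ) (_root_.partialDeriv j φ x) x (basisVec n (j 0)) := by
  have h1 : DifferentiableAt ℝ (iteratedFDeriv ℝ k φ) x :=
    h.1.contDiffAt.differentiableAt_iteratedFDeriv (by exact_mod_cast ENat.natCast_lt_top k)
  have h2 := ((ContinuousMultilinearMap.apply ℝ (fun _ : Fin k => Space n) ℂ
    fun i => basisVec n (Fin.tail j i)).hasFDerivAt (x := iteratedFDeriv ℝ k φ x)).comp x h1.hasFDerivAt
  have h3 := h2.hasLineDerivAt (basisVec n (j 0))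
  exact h3

lemma integrable_mul_of_tsupport_subset (hψ : Continuous ψ) (hs : HasCompactSupport ψ)
    (ht : tsupport ψ ⊆ halfSpace n) (hG : ContinuousOn G (halfSpace n)) : Integrable fun x => ψ x * G x := by
  have h1 : tsupport (fun x => ψ x * G x) ⊆ tsupport ψ := closure_mono fun x hx h0 => hx (by simp [h0])
  have hc : Continuous fun x => ψ x * G x :=
    (hψ.continuousOn.mul hG).continuous_of_tsupport_subset (isOpen_halfSpace n) (h1.trans ht)
  exact hc.integrable_of_hasCompactSupport (hs.mul_right)

lemma setIntegral_halfSpace_eq (ht : tsupport ψ ⊆ halfSpace n) :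
    ∫ x in halfSpace n, ψ x * G x = ∫ x, ψ x * G x := by
  refine setIntegral_eq_integral_of_forall_compl_eq_zero fun x hx => ?_
  have : ψ x = 0 := image_eq_zero_of_notMem_tsupport fun h => hx (ht h)
  rw [this, zero_mul]

lemma continuousOn_reflKer_left {κ : Space n → ℂ} (hκ : ContinuousOn κ (halfSpace n))
    (hy : 0 ≤ y.2) : ContinuousOn (fun x => reflKer κ x y) (halfSpace n) := by
  refine hκ.comp (f := fun x : Space n => (x.1 - y.1, x.2 + y.2)) (by fun_prop) fun x hx => ?_
  exact add_pos_of_pos_of_nonneg hx hy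

/-- Derivatives of the kernel along words, tested against `φ`. -/
lemma IsSym.integral_partialDeriv_kern (hn : 1 ≤ n) (ha : 0 < a) {r : ℤ} {A : ℕ → ℝ} {z : ℂ}
    (hz : z ∈ ℂ₊) {v : Tan n → ℂ} (hv : SymbolBound r A z v) (hφ : IsTest φ)
    (hs : tsupport φ ⊆ halfSpace n) (hy : 0 ≤ y.2) (k : ℕ) :
    ∀ (j : Fin k → Fin (n + 1)) {d : ℤ} {S : Symb n}, IsSym a d S →
    ∫ x in halfSpace n, partialDeriv j φ x * reflKer (kern v S z) x y =
      (-1) ^ k * ∫ x in halfSpace n, φ x * reflKer (kern v (symWord k j S) z) x y := by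
  induction k with
  | zero =>
    intro j d S h
    simp only [partialDeriv, iteratedFDeriv_zero_apply, pow_zero, one_mul, symWord]
  | succ k ih =>
    intro j d S h
    have h' := h.deriv_coord ha (j 0)
    set ψ := partialDeriv (Fin.tail j) φ with hψ
    have hψt : IsTest ψ := hφ.partialDeriv _
    have hψs : tsupport ψ ⊆ halfSpace n := (tsupport_partialDeriv_subset _ _).trans hs
    have hds : tsupport (partialDeriv j φ) ⊆ halfSpace n := (tsupport_partialDeriv_subset _ _).trans hs
    have c0 := continuousOn_reflKer_left (h.continuousOn_kern hn ha hz hv) hy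
    have c1 := continuousOn_reflKer_left (h'.continuousOn_kern hn ha hz hv) hy
    have : (volume : Measure (Space n)).IsAddHaarMeasure :=
      inferInstanceAs ((volume : Measure (Tan n)).prod (volume : Measure ℝ)).IsAddHaarMeasure
    have key := integral_bilinear_hasLineDerivAt_right_eq_neg_left_of_integrable
      (μ := (volume : Measure (Space n))) (f := ψ) (f' := partialDeriv j φ)
      (g := fun x => reflKer (kern v S z) x y) (g' := fun x => reflKer (kern v (symDeriv (j 0) S) z) x y)
      (v := basisVec n (j 0)) (B := ContinuousLinearMap.mul ℝ ℂ)
      (integrable_mul_of_tsupport_subset (hφ.continuous_partialDeriv j) (hφ.hasCompactSupport_partialDeriv j) hds c0)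
      (integrable_mul_of_tsupport_subset hψt.1.continuous hψt.2 hψs c1)
      (integrable_mul_of_tsupport_subset hψt.1.continuous hψt.2 hψs c0)
      (fun x _ => hφ.hasLineDerivAt_partialDeriv j x)
      (fun x hx => by
        have hx0 : 0 < x.2 := hψs hx
        have hp : 0 < ((x.1 - y.1, x.2 + y.2) : Space n).2 := add_pos_of_pos_of_nonneg hx0 hy
        have := h.hasLineDerivAt_kern hn ha hz hv (j 0) hp
        unfold HasLineDerivAt at this ⊢
        unfold reflKer
        convert this using 4 with τ
        · simp only [fst_add, smul_fst]; abel
        · simp only [snd_add, smul_snd]; abel)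
    simp only [mul_apply'] at key
    rw [setIntegral_halfSpace_eq hds, ← neg_eq_iff_eq_neg.2 key, ← setIntegral_halfSpace_eq hψs, ih _ h', symWord,
      pow_succ]
    ring

end WordDerivatives

lemma exists_pairing {α : Type*} [MeasurableSpace α] {μ : Measure α} {p q : ℝ≥0∞} [Fact (1 ≤ q)]
    [p.HolderConjugate q] {g : α → ℂ} (hg : MemLp g p μ) :
    ∃ ℓ : Lp ℂ q μ →L[ℂ] ℂ, ∀ f : Lp ℂ q μ, ℓ f = ∫ x, g x * f x ∂μ := by
  have : Fact (1 ≤ p) := ⟨HolderConjugate.one_le p q⟩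
  refine ⟨(ContinuousLinearMap.mul ℂ ℂ).lpPairing μ p q (hg.toLp g), fun f => ?_⟩
  rw [ContinuousLinearMap.lpPairing_eq_integral]
  refine integral_congr_ae ?_
  filter_upwards [hg.coeFn_toLp] with x hx
  rw [mul_apply', hx]

section Sobolev
variable {n m : ℕ} {q : ℝ≥0∞} [Fact (1 ≤ q)]

lemma isClosed_sobolev (n : ℕ) (q : ℝ≥0∞) [Fact (1 ≤ q)] (m : ℕ) :
    IsClosed (sobolev n q m : Set ((k : Fin (m + 1)) → LqTensor n q k)) := by
  have hcont : ∀ ψ : Space n → ℂ, Continuous ψ → HasCompactSupport ψ →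
      Continuous fun f : Lq n q => ∫ x in halfSpace n, ψ x * f x := by
    intro ψ h1 h2
    have : q.conjExponent.HolderConjugate q := HolderConjugate.symm
    obtain ⟨ℓ, hℓ⟩ := exists_pairing (p := q.conjExponent) (q := q) (μ := halfVol n)
      (h1.memLp_of_hasCompactSupport h2)
    simpa only [← hℓ] using ℓ.continuous
  have e : (sobolev n q m : Set ((k : Fin (m + 1)) → LqTensor n q k)) =
      ⋂ (k : Fin (m + 1)) (j : Fin k → Fin (n + 1)) (φ : Space n → ℂ) (_ : IsTest φ)
        (_ : tsupport φ ⊆ halfSpace n), {U | ∫ x in halfSpace n, partialDeriv j φ x *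
          (U ⟨0, m.succ_pos⟩ Fin.elim0) x = (-1) ^ (k : ℕ) * ∫ x in halfSpace n, φ x * (U k j) x} := by
    ext U
    simp only [mem_iInter]
    rfl
  rw [e]
  refine isClosed_iInter fun k => isClosed_iInter fun j => isClosed_iInter fun φ => isClosed_iInter fun hφ =>
    isClosed_iInter fun hs => isClosed_eq ?_ ?_
  · exact (hcont _ (hφ.continuous_partialDeriv j) (hφ.hasCompactSupport_partialDeriv j)).comp
      (f := fun U : (k : Fin (m + 1)) → LqTensor n q k => U ⟨0, m.succ_pos⟩ Fin.elim0) (by fun_prop)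
  · exact continuous_const.mul ((hcont _ hφ.1.continuous hφ.2).comp
      (f := fun U : (k : Fin (m + 1)) → LqTensor n q k => U k j) (by fun_prop))

lemma hasDerivAt_codRestrict {X E : Type*} [NormedAddCommGroup X] [NormedSpace ℂ X] [NormedAddCommGroup E]
    [NormedSpace ℂ E] {p : Submodule ℂ E} (hp : IsClosed (p : Set E)) {V : ℂ → X →L[ℂ] E} {V' : X →L[ℂ] E}
    {W : ℂ → X →L[ℂ] p} {z : ℂ} (h : HasDerivAt V V' z) (hW : ∀ᶠ w in nhds z, p.subtypeL.comp (W w) = V w) :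
    DifferentiableAt ℂ W z := by
  have hz := hW.self_of_nhds
  have hmem : ∀ x, V' x ∈ p := by
    intro x
    have h1 : HasDerivAt (fun w => V w x) (V' x) z := by
      exact (ContinuousLinearMap.apply ℂ E x).hasFDerivAt.comp_hasDerivAt z h
    rw [hasDerivAt_iff_tendsto_slope] at h1
    refine hp.mem_of_tendsto h1 ?_
    filter_upwards [nhdsWithin_le_nhds hW] with w hw
    rw [slope_def_module, ← hw, ← hz]
    exact p.smul_mem _ (p.sub_mem (W w x).2 (W z x).2)
  suffices key : HasDerivAt W (V'.codRestrict p hmem) z from ⟨_, key.hasFDerivAt⟩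
  rw [hasDerivAt_iff_isLittleO] at h
  refine (hasDerivAt_iff_isLittleO (𝕜 := ℂ) (F := X →L[ℂ] p)).2 ?_
  refine Asymptotics.IsLittleO.congr' (Asymptotics.isLittleO_norm_left.1 ?_) (Filter.EventuallyEq.refl _ _)
    (Filter.EventuallyEq.refl _ _)
  refine (Asymptotics.isLittleO_norm_left.2 h).congr' ?_ (Filter.EventuallyEq.refl _ _)
  filter_upwards [hW] with w hw
  rw [← hw, ← hz]
  have : p.subtypeL.comp (W w) - p.subtypeL.comp (W z) - (w - z) • V' =
      p.subtypeₗᵢ.toContinuousLinearMap.comp (W w - W z - (w - z) • V'.codRestrict p hmem) := by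
    ext x
    simp
  rw [this, LinearIsometry.norm_toContinuousLinearMap_comp]

/-- The ambient space of `sobolev n q m`. -/
abbrev JetSpace (n : ℕ) (q : ℝ≥0∞) (m : ℕ) := (k : Fin (m + 1)) → LqTensor n q k

/-- Insertion of a component. -/
def insertion (e : Σ k : Fin (m + 1), (Fin k → Fin (n + 1))) : Lq n q →L[ℂ] JetSpace n q m :=
  (single ℂ (fun k : Fin (m + 1) => LqTensor n q k) e.1).comp
    (single ℂ (fun _ : Fin e.1 → Fin (n + 1) => Lq n q) e.2)

lemma sum_insertion (U : JetSpace n q m) : ∑ e, insertion e (U e.1 e.2) = U := by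
  rw [Fintype.sum_sigma]
  conv_rhs => rw [← Finset.univ_sum_single U]
  refine sum_congr rfl fun k _ => ?_
  simp only [insertion, comp_apply]
  have h := map_sum (single ℂ (fun k : Fin (m + 1) => LqTensor n q k) k)
    (fun y : Fin k → Fin (n + 1) => (Pi.single y (U k y) : LqTensor n q k)) Finset.univ
  refine Eq.trans h.symm ?_
  rw [Finset.univ_sum_single]
  rfl

/-- The operator with given components. -/
def assemble {X : Type*} [NormedAddCommGroup X] [NormedSpace ℂ X]
    (T : (Σ k : Fin (m + 1), (Fin k → Fin (n + 1))) → X →L[ℂ] Lq n q) : X →L[ℂ] JetSpace n q m :=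
  ∑ e, (insertion e).comp (T e)

lemma assemble_apply {X : Type*} [NormedAddCommGroup X] [NormedSpace ℂ X]
    (T : (Σ k : Fin (m + 1), (Fin k → Fin (n + 1))) → X →L[ℂ] Lq n q) (x : X) (k : Fin (m + 1))
    (j : Fin k → Fin (n + 1)) : assemble T x k j = T ⟨k, j⟩ x := by
  have : assemble T x = fun k j => T ⟨k, j⟩ x := by
    rw [← sum_insertion fun k j => T ⟨k, j⟩ x]
    simp [assemble]
  rw [this]

/-- `u ↦ (z^{(m-k)/2} ∇^k u)_k`. -/
def scaledJet (n : ℕ) (q : ℝ≥0∞) [Fact (1 ≤ q)] (m : ℕ) (z : ℂ) : sobolev n q m →L[ℂ] JetSpace n q m :=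
  ContinuousLinearMap.pi fun k =>
    sqz z ^ (m - k) • (proj (R := ℂ) (φ := fun k : Fin (m + 1) => LqTensor n q k) k).comp
      (sobolev n q m).subtypeL

end Sobolev

section SolutionOperators
variable {n m : ℕ} {q : ℝ≥0∞} [Fact (1 ≤ q)] {a : ℝ}
variable {z : ℂ} {r : ℤ} {S : Symb n}

lemma eulerDeriv_congr_of_even {w : Tan n → ℂ → ℂ} (hev : ∀ z ∈ ℂ₊, EvenIfOne fun ξ => w ξ z) (hz : z ∈ ℂ₊) : EvenIfOne fun ξ => eulerDeriv (w ξ) z := by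
  intro h1 ξ
  have : w (-ξ) =ᶠ[nhds z] w ξ := by
    filter_upwards [isOpen_rightHalfPlane.mem_nhds hz] with z' hz'
    exact hev z' hz' h1 ξ
  simp only [eulerDeriv, this.deriv_eq]

lemma IsSym.exists_kernelOp_family (hn : 1 ≤ n) (ha : 0 < a) (hq1 : 1 < q) (hq2 : q ≠ ⊤) {d : ℤ}
    (hdr : r + d = 1) (hS : IsSym a d S) (A : ℕ → ℝ) :
    ∃ C : ℝ, 0 < C ∧ ∀ w : Tan n → ℂ → ℂ, SymbolFamily r A w →
      (∀ z ∈ ℂ₊, EvenIfOne fun ξ => w ξ z) → ∃ κ' : ℂ → Space n → ℂ, ∀ z ∈ ℂ₊,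
        Dominated C (kern (fun ξ => w ξ z) S z) ∧ Dominated C (κ' z) ∧
        HasDerivAt (fun z => kernelOp q (kern (fun ξ => w ξ z) S z)) (z⁻¹ • kernelOp q (κ' z)) z := by
  obtain ⟨S', hS', hd⟩ := hS.exists_hasDerivAt_kern hn ha
  obtain ⟨C, hC, H⟩ := hS.exists_kernel_bound hn ha hdr A
  obtain ⟨C', hC', H'⟩ := hS'.exists_kernel_bound hn ha hdr A
  refine ⟨C + C', by positivity, fun w hw hev => ?_⟩
  have d0 : ∀ z ∈ ℂ₊, Dominated C (kern (fun ξ => w ξ z) S z) := fun z hz =>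
    ⟨hS.continuousOn_kern hn ha hz (hw.bound_zero hz), fun p hp =>
      H z hz _ (hw.bound_zero hz) (hev z hz) p.2 hp p.1⟩
  have d1 : ∀ z ∈ ℂ₊, Dominated C (kern (fun ξ => eulerDeriv (w ξ) z) S z) := fun z hz =>
    ⟨hS.continuousOn_kern hn ha hz (hw.bound_one hz), fun p hp =>
      H z hz _ (hw.bound_one hz) (eulerDeriv_congr_of_even hev hz) p.2 hp p.1⟩
  have d2 : ∀ z ∈ ℂ₊, Dominated C' (kern (fun ξ => w ξ z) S' z) := fun z hz =>
    ⟨hS'.continuousOn_kern hn ha hz (hw.bound_zero hz), fun p hp =>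
      H' z hz _ (hw.bound_zero hz) (hev z hz) p.2 hp p.1⟩
  refine ⟨fun z p => kern (fun ξ => eulerDeriv (w ξ) z) S z p + kern (fun ξ => w ξ z) S' z p,
    fun z hz => ⟨(d0 z hz).mono (by linarith), (d1 z hz).add (d2 z hz), ?_⟩⟩
  have hz0 : 0 < z.re := hz
  have hball : ∀ z' ∈ ball z (z.re / 2), z' ∈ ℂ₊ ∧ ‖z'⁻¹‖ ≤ (z.re / 2)⁻¹ := by
    intro z' hz'
    rw [mem_ball, dist_eq_norm] at hz'
    have h1 := abs_re_le_norm (z' - z)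
    rw [sub_re] at h1
    have h2 := (abs_lt.1 (h1.trans_lt hz')).1
    refine ⟨show 0 < z'.re by linarith, ?_⟩
    rw [norm_inv]
    gcongr
    exact le_trans (by linarith) (re_le_norm z')
  have e := (kernelOp_const_mul (q := q) hq1 hq2 (by positivity) ((d1 z hz).add (d2 z hz)) z⁻¹).2
  rw [← e]
  refine hasDerivAt_kernelOp (C := C + (z.re / 2)⁻¹ * (C + C')) (R := z.re / 2) hq1 hq2 (by positivity)
    (by positivity) (κ := fun z => kern (fun ξ => w ξ z) S z)
    (κ' := fun z p => z⁻¹ * (kern (fun ξ => eulerDeriv (w ξ) z) S z p + kern (fun ξ => w ξ z) S' z p)) ?_ ?_ ?_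
  · intro z' hz'
    have : 0 ≤ (z.re / 2)⁻¹ * (C + C') := by positivity
    exact (d0 z' (hball z' hz').1).mono (by linarith)
  · intro z' hz'
    have h1 := (hball z' hz').1
    refine (kernelOp_const_mul (q := q) hq1 hq2 (by positivity) ((d1 z' h1).add (d2 z' h1)) z'⁻¹).1.mono ?_
    have : ‖z'⁻¹‖ * (C + C') ≤ (z.re / 2)⁻¹ * (C + C') := mul_le_mul_of_nonneg_right (hball z' hz').2 (by positivity)
    linarith
  · intro z' hz' p hp
    refine (hd r A w hw z' (hball z' hz').1 p hp).congr_deriv ?_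
    rw [div_eq_mul_inv, mul_comm]

lemma hasDerivAt_assemble {X : Type*} [NormedAddCommGroup X] [NormedSpace ℂ X]
    {T : (Σ k : Fin (m + 1), (Fin k → Fin (n + 1))) → ℂ → X →L[ℂ] Lq n q}
    {T' : (Σ k : Fin (m + 1), (Fin k → Fin (n + 1))) → X →L[ℂ] Lq n q} (h : ∀ e, HasDerivAt (T e) (T' e) z) :
    HasDerivAt (fun z => assemble fun e => T e z) (assemble T') z := by
  unfold assemble
  refine HasDerivAt.fun_sum fun e _ => ?_
  exact ((hasDerivAt_const z (insertion (m := m) (q := q) e)).clm_comp (h e)).congr_deriv (by simp)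

lemma assemble_smul {X : Type*} [NormedAddCommGroup X] [NormedSpace ℂ X] (c : ℂ)
    (T : (Σ k : Fin (m + 1), (Fin k → Fin (n + 1))) → X →L[ℂ] Lq n q) :
    assemble (fun e => c • T e) = c • assemble T := by
  unfold assemble
  rw [smul_sum]
  simp only [comp_smul]

/-- The symbol of a derivative, scaled to order `m - 2`. -/
def scaledSym (S : Symb n) (e : Σ k : Fin (m + 1), (Fin k → Fin (n + 1))) : Symb n :=
  fun ξ z t => sqz z ^ (m - (e.1 : ℕ)) * symWord e.1 e.2 S ξ z t

lemma IsSym.scaledSym (ha : 0 < a) (hS : IsSym a (-2) S)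
    (e : Σ k : Fin (m + 1), (Fin k → Fin (n + 1))) : IsSym a (m - 2) (scaledSym S e) := by
  have h := (hS.deriv_word ha e.1 e.2).mulSqrt_pow (m - e.1)
  have e1 : (-2 + ((e.1 : ℕ) : ℤ) + ((m - e.1 : ℕ) : ℤ)) = m - 2 := by
    have := Nat.lt_succ_iff.1 e.1.2
    omega
  rw [e1] at h
  exact h

set_option maxHeartbeats 2000000 in
lemma exists_sobolev_kernelOp (hn : 1 ≤ n) (ha : 0 < a) (hq1 : 1 < q) (hq2 : q ≠ ⊤)
    (hrm : r + m = 3) (hS : IsSym a (-2) S) (A : ℕ → ℝ) :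
    ∃ K : ℝ, 0 ≤ K ∧ ∀ w : Tan n → ℂ → ℂ, SymbolFamily r A w → (∀ z ∈ ℂ₊, EvenIfOne fun ξ => w ξ z) →
      ∃ (W : ℂ → Lq n q →L[ℂ] sobolev n q m) (V' : ℂ → Lq n q →L[ℂ] JetSpace n q m),
        (∀ z ∈ ℂ₊, DifferentiableAt ℂ W z) ∧ (∀ z ∈ ℂ₊, ∀ f, toLq (W z f) =ᵐ[halfVol n]
          fun x => ∫ y, reflKer (kern (fun ξ => w ξ z) S z) x y * f y ∂halfVol n) ∧
        (∀ z ∈ ℂ₊, HasDerivAt (fun z => (scaledJet n q m z).comp (W z)) (z⁻¹ • V' z) z) ∧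
        IsRBoundedWith q.toReal K {T | ∃ z ∈ ℂ₊, T = (scaledJet n q m z).comp (W z) ∨ T = V' z} := by
  have hex : ∀ e : (Σ k : Fin (m + 1), (Fin k → Fin (n + 1))), ∃ C : ℝ, 0 < C ∧
      ∀ w : Tan n → ℂ → ℂ, SymbolFamily r A w → (∀ z ∈ ℂ₊, EvenIfOne fun ξ => w ξ z) →
      ∃ κ' : ℂ → Space n → ℂ, ∀ z ∈ ℂ₊, Dominated C (kern (fun ξ => w ξ z) (scaledSym S e) z) ∧ Dominated C (κ' z) ∧
        HasDerivAt (fun z => kernelOp q (kern (fun ξ => w ξ z) (scaledSym S e) z))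
          (z⁻¹ • kernelOp q (κ' z)) z :=
    fun e => (hS.scaledSym ha e).exists_kernelOp_family hn ha hq1 hq2 (by linarith) A
  choose C hC H using hex
  have hCle : ∀ e, C e ≤ ∑ e, C e := fun e =>
    Finset.single_le_sum (f := C) (fun i _ => (hC i).le) (Finset.mem_univ e)
  obtain ⟨K, hK, HK⟩ := exists_isRBoundedWith_kernelOp (q := q) n hq1 hq2
    (sum_nonneg fun e (_ : e ∈ Finset.univ) => (hC e).le)
  have hqr := (one_lt_toReal hq1 hq2).le
  refine ⟨∑ e : (Σ k : Fin (m + 1), (Fin k → Fin (n + 1))),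
    ‖insertion (m := m) (q := q) e‖ * K * ‖ContinuousLinearMap.id ℂ (Lq n q)‖,
    sum_nonneg fun e _ => by positivity, fun w hw hev => ?_⟩
  choose κ' hκ' using fun e => H e w hw hev
  have hval : ∀ z ∈ ℂ₊, ∀ e,
      Dominated (‖(sqz z ^ (m - (e.1 : ℕ)))⁻¹‖ * C e) (kern (fun ξ => w ξ z) (symWord e.1 e.2 S) z) ∧
      kernelOp q (kern (fun ξ => w ξ z) (symWord e.1 e.2 S) z) =
        (sqz z ^ (m - (e.1 : ℕ)))⁻¹ • kernelOp q (kern (fun ξ => w ξ z) (scaledSym S e) z) := by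
    intro z hz e
    have h0 : sqz z ^ (m - (e.1 : ℕ)) ≠ 0 := pow_ne_zero _ (sqz_ne_zero (rhp_ne_zero hz))
    have := kernelOp_const_mul (q := q) hq1 hq2 (hC e).le (hκ' e z hz).1 (sqz z ^ (m - (e.1 : ℕ)))⁻¹
    have e1 : (fun p => (sqz z ^ (m - (e.1 : ℕ)))⁻¹ * kern (fun ξ => w ξ z) (scaledSym S e) z p) =
        kern (fun ξ => w ξ z) (symWord e.1 e.2 S) z := by
      ext p
      unfold scaledSym
      rw [kern_const_mul (fun z => sqz z ^ (m - (e.1 : ℕ))), inv_mul_cancel_left₀ h0]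
    rwa [e1] at this
  obtain ⟨U, hU⟩ : ∃ U : ℂ → Lq n q →L[ℂ] JetSpace n q m, ∀ z, U z = assemble (n := n) (m := m) (q := q) (X := Lq n q) fun e =>
    (sqz z ^ (m - (e.1 : ℕ)))⁻¹ • kernelOp q (kern (fun ξ => w ξ z) (scaledSym S e) z) :=
    ⟨_, fun _ => rfl⟩
  have hmem : ∀ z ∈ ℂ₊, ∀ f, U z f ∈ sobolev n q m := by
    intro z hz f k j
    rw [hU, assemble_apply, assemble_apply, ← (hval z hz _).2, ← (hval z hz _).2]
    refine (hval z hz ⟨⟨0, m.succ_pos⟩, Fin.elim0⟩).1.isWeakDeriv hq1 hq2 (mul_nonneg (norm_nonneg _) (hC _).le)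
      (mul_nonneg (norm_nonneg _) (hC _).le) (hval z hz ⟨k, j⟩).1 j ?_ f
    intro φ hφ hs y hy
    exact hS.integral_partialDeriv_kern hn ha hz (hw.bound_zero hz) hφ hs (le_of_lt hy) k j
  classical
  obtain ⟨W, hWz⟩ : ∃ W : ℂ → Lq n q →L[ℂ] sobolev n q m,
      ∀ z ∈ ℂ₊, (sobolev n q m).subtypeL.comp (W z) = U z := by
    refine ⟨fun z => if h : z ∈ ℂ₊ then (U z).codRestrict (sobolev n q m) (hmem z h) else 0, fun z hz => ?_⟩
    simp only [dif_pos hz]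
    rfl
  obtain ⟨V', hV'⟩ : ∃ V' : ℂ → Lq n q →L[ℂ] JetSpace n q m,
    ∀ z, V' z = assemble (n := n) (m := m) (q := q) (X := Lq n q) fun e => kernelOp q (κ' e z) := ⟨_, fun _ => rfl⟩
  obtain ⟨V, hV⟩ : ∃ V : ℂ → Lq n q →L[ℂ] JetSpace n q m, V = fun z => assemble (n := n) (m := m) (q := q) (X := Lq n q) fun e =>
    kernelOp q (kern (fun ξ => w ξ z) (scaledSym S e) z) := ⟨_, rfl⟩
  have hVz : ∀ z ∈ ℂ₊, (scaledJet n q m z).comp (W z) = V z := by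
    intro z hz
    ext1 f
    funext k j
    have h0 : sqz z ^ (m - (k : ℕ)) ≠ 0 := pow_ne_zero _ (sqz_ne_zero (rhp_ne_zero hz))
    have e1 : (scaledJet n q m z).comp (W z) f k j =
        sqz z ^ (m - (k : ℕ)) • ((sobolev n q m).subtypeL.comp (W z)) f k j := rfl
    rw [e1, hWz z hz, hU, hV, assemble_apply, assemble_apply, smul_apply, smul_inv_smul₀ h0]
  refine ⟨W, V', fun z hz => ?_, fun z hz f => ?_, fun z hz => ?_, ?_⟩
  · refine hasDerivAt_codRestrict (isClosed_sobolev n q m) (V := U) (by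
      rw [show U = _ from funext hU]
      exact hasDerivAt_assemble (n := n) (m := m) (q := q) (X := Lq n q) fun e => ((((hasDerivAt_sqz (rhp_slitPlane hz)).pow (m - (e.1 : ℕ))).inv
        (pow_ne_zero _ (sqz_ne_zero (rhp_ne_zero hz)))).smul (hκ' e z hz).2.2))
      (Filter.mem_of_superset (isOpen_rightHalfPlane.mem_nhds hz) hWz)
  · have e1 : toLq (W z f) = kernelOp q (kern (fun ξ => w ξ z) S z) f := by
      have : toLq (W z f) = ((sobolev n q m).subtypeL.comp (W z)) f ⟨0, m.succ_pos⟩ Fin.elim0 := rfl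
      rw [this, hWz z hz, hU, assemble_apply, ← (hval z hz _).2]
      rfl
    rw [e1]
    exact (hval z hz ⟨⟨0, m.succ_pos⟩, Fin.elim0⟩).1.kernelOp_ae hq1 hq2 (mul_nonneg (norm_nonneg _) (hC _).le) f
  · have h1 : HasDerivAt V (z⁻¹ • V' z) z := by
      rw [hV', hV, ← assemble_smul]
      exact hasDerivAt_assemble (n := n) (m := m) (q := q) (X := Lq n q) fun e => (hκ' e z hz).2.2
    refine h1.congr_of_eventuallyEq ?_
    filter_upwards [isOpen_rightHalfPlane.mem_nhds hz] with z' hz' using hVz z' hz'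
  · refine IsRBoundedWith.sum hqr Finset.univ (C := fun e => ‖insertion (m := m) (q := q) e‖ * K *
      ‖ContinuousLinearMap.id ℂ (Lq n q)‖) (𝒯 := fun e => {T | ∃ R ∈ {T : Lq n q →L[ℂ] Lq n q |
      ∃ κ, Dominated (∑ e, C e) κ ∧ T = kernelOp q κ}, T = (insertion e).comp (R.comp
        (ContinuousLinearMap.id ℂ (Lq n q)))})
      (fun e _ => HK.comp (by linarith) hK (insertion e) (ContinuousLinearMap.id ℂ _) fun T hT => hT) ?_
    rintro T ⟨z, hz, rfl | rfl⟩
    · refine ⟨_, fun e _ => ⟨kernelOp q (kern (fun ξ => w ξ z) (scaledSym S e) z),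
        ⟨_, (hκ' e z hz).1.mono (hCle e), rfl⟩, rfl⟩, ?_⟩
      rw [hVz z hz, hV]
      rfl
    · exact ⟨_, fun e _ => ⟨kernelOp q (κ' e z), ⟨_, (hκ' e z hz).2.1.mono (hCle e), rfl⟩, rfl⟩, by rw [hV']; rfl⟩

end SolutionOperators

section Smoothness
variable {n : ℕ} {a : ℝ}
variable {d : ℤ} {S : Symb n} {z : ℂ} {r : ℤ} {A : ℕ → ℝ} {v : Tan n → ℂ} {p : Space n}

/-- The coordinates on `ℝ^N`. -/
def coordVec (n : ℕ) : Fin (n + 1) → Space n →L[ℝ] ℝ :=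
  Fin.lastCases (snd ℝ _ _)
    fun i => (EuclideanSpace.proj i : Tan n →L[ℝ] ℝ).comp (fst ℝ _ _)

lemma sum_coordVec (x : Space n) : ∑ j, coordVec n j x • basisVec n j = x := by
  rw [Fin.sum_univ_castSucc]
  simp only [coordVec, basisVec, Fin.lastCases_castSucc, Fin.lastCases_last]
  refine Prod.ext ?_ ?_
  · have := (basisFun (Fin n) ℝ).sum_repr x.1
    simpa [Prod.fst_sum] using this
  · simp [Prod.snd_sum]

lemma clm_eq_sum_coordVec (L : Space n →L[ℝ] ℂ) : L = ∑ j, (coordVec n j).smulRight (L (basisVec n j)) := by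
  refine ContinuousLinearMap.ext fun x => ?_
  conv_lhs => rw [← sum_coordVec x]
  simp

lemma IsSym.hasFDerivAt_integrand (ha : 0 < a) (h : IsSym a d S) (ξ : Tan n) (hz : z ∈ ℂ₊) (p : Space n) :
    HasFDerivAt (fun p : Space n => 𝐞(p.1,ξ) * S ξ z p.2)
      (∑ j, (coordVec n j).smulRight (𝐞(p.1,ξ) * symDeriv j S ξ z p.2)) p := by
  obtain ⟨S', h', hd⟩ := h.exists_hasDerivAt_t ha
  have d1 : DifferentiableAt ℝ (fun p : Space n => S ξ z p.2) p :=
    (hd ξ z hz p.2).differentiableAt.comp p differentiableAt_snd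
  have d2 : DifferentiableAt ℝ (fun p : Space n => 𝐞(p.1,ξ)) p := by
    have : DifferentiableAt ℝ (fun p : Space n => (inner ℝ p.1 ξ : ℝ)) p :=
      differentiableAt_fst.inner ℝ (differentiableAt_const ξ)
    have h2 : DifferentiableAt ℝ (fun p : Space n => ((inner ℝ p.1 ξ : ℝ) : ℂ)) p :=
      ofRealCLM.differentiableAt.comp p this
    exact (h2.const_mul I).cexp
  have d := (d2.mul d1).hasFDerivAt
  rw [clm_eq_sum_coordVec (fderiv ℝ _ p)] at d
  have key : ∀ j, fderiv ℝ ((fun p : Space n => 𝐞(p.1,ξ)) * fun p : Space n => S ξ z p.2) p (basisVec n j) =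
      𝐞(p.1,ξ) * symDeriv j S ξ z p.2 := by
    intro j
    have h1 := ((d2.mul d1).hasFDerivAt.hasLineDerivAt (basisVec n j))
    have h2 := h.hasDerivAt_integrand ha j ξ hz p 0
    simp only [zero_smul, add_zero] at h2
    exact HasDerivAt.unique h1 h2
  simp only [key] at d
  exact d

lemma IsSym.differentiableAt_kern (hn : 1 ≤ n) (ha : 0 < a) (h : IsSym a d S) (hz : z ∈ ℂ₊)
    (hv : SymbolBound r A z v) (hp : 0 < p.2) : DifferentiableAt ℝ (kern v S z) p := by
  have hM := norm_sqz_pos hz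
  choose C c hC hc H using fun j => (h.deriv_coord ha j).exists_mul_le ha r A ‖sqz z‖ hM (half_pos hp)
  rw [show kern v S z = _ from funext (kern_eq_integral v S z)]
  refine DifferentiableAt.const_mul ?_ _
  have hnear : {p' : Space n | p.2 / 2 < p'.2} ∈ nhds p :=
    (isOpen_lt continuous_const continuous_snd).mem_nhds (show p.2 / 2 < p.2 from half_lt_self hp)
  refine (hasFDerivAt_integral_of_dominated_of_fderiv_le (μ := (volume : Measure (Tan n)))
    (F := fun (p : Space n) ξ => v ξ * (𝐞(p.1,ξ) * S ξ z p.2))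
    (F' := fun (p : Space n) ξ => v ξ • ∑ j, (coordVec n j).smulRight (𝐞(p.1,ξ) * symDeriv j S ξ z p.2))
    (bound := fun ξ => ∑ j, ‖coordVec n j‖ * (C j * ((1 + ‖ξ‖) ^ (n + 1))⁻¹)) hnear
    (.of_forall fun p' =>
      h.aestronglyMeasurable_integrand ha hz (hv.aestronglyMeasurable hn) _) ?_ ?_ ?_
    (integrable_finsetSum _ fun j _ => ((integrable_tail n one_pos).const_mul _).const_mul _) ?_).differentiableAt
  · refine (h.integrable_mul hn ha hz hv hp).congr' (h.aestronglyMeasurable_integrand ha hz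
      (hv.aestronglyMeasurable hn) _) (.of_forall fun ξ => ?_)
    rw [norm_integrand]
  · refine (hv.aestronglyMeasurable hn).smul (Continuous.aestronglyMeasurable ?_)
    refine continuous_finsetSum _ fun j _ => ?_
    have h1 := ((h.deriv_coord ha j).continuous ha hz).comp (by fun_prop : Continuous fun ξ : Tan n => (ξ, p.2))
    have h2 : Continuous fun ξ : Tan n => 𝐞(p.1,ξ) * symDeriv j S ξ z p.2 := Continuous.mul (by fun_prop) h1
    exact (smulRightL ℝ (Space n) ℂ (coordVec n j)).continuous.comp h2
  · filter_upwards [ae_ne_zero hn] with ξ hξ p' hp'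
    have hp'' : p.2 / 2 < p'.2 := hp'
    rw [smul_sum]
    refine (norm_sum_le _ _).trans (sum_le_sum fun j _ => ?_)
    rw [norm_smul, ContinuousLinearMap.norm_smulRight_apply, mul_left_comm, ← norm_mul, norm_integrand]
    refine mul_le_mul_of_nonneg_left ((H j z hz le_rfl le_rfl v hv _ (le_of_lt hp'') ξ hξ).trans ?_)
      (norm_nonneg _)
    refine mul_le_mul_of_nonneg_right ?_ (by positivity)
    refine mul_le_of_le_one_right (hC j).le (exp_le_one_iff.2 ?_)
    have : 0 < c j * p'.2 := mul_pos (hc j) (by linarith)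
    linarith
  · refine .of_forall fun ξ p' _ => ?_
    exact (h.hasFDerivAt_integrand ha ξ hz p').const_mul (v ξ)

lemma IsSym.contDiffOn_kern (hn : 1 ≤ n) (ha : 0 < a) (hz : z ∈ ℂ₊) (hv : SymbolBound r A z v) (k : ℕ) :
    ∀ {d : ℤ} {S : Symb n}, IsSym a d S → ContDiffOn ℝ k (kern v S z) (halfSpace n) := by
  induction k with
  | zero =>
    intro d S h
    exact contDiffOn_zero.2 (h.continuousOn_kern hn ha hz hv)
  | succ k ih =>
    intro d S h
    have hdiff : ∀ p ∈ halfSpace n, DifferentiableAt ℝ (kern v S z) p := fun p hp =>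
      h.differentiableAt_kern hn ha hz hv hp
    push_cast
    rw [contDiffOn_succ_iff_fderiv_of_isOpen (isOpen_halfSpace n)]
    refine ⟨fun p hp => (hdiff p hp).differentiableWithinAt, by simp, ?_⟩
    have : ContDiffOn ℝ k (fun p => ∑ j, (coordVec n j).smulRight (kern v (symDeriv j S) z p)) (halfSpace n) :=
      ContDiffOn.sum fun j _ => (smulRightL ℝ (Space n) ℂ (coordVec n j)).contDiff.comp_contDiffOn
        (ih (h.deriv_coord ha j))
    refine this.congr fun p hp => ?_
    rw [clm_eq_sum_coordVec (fderiv ℝ (kern v S z) p)]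
    refine sum_congr rfl fun j _ => ?_
    congr 1
    exact HasDerivAt.unique ((hdiff p hp).hasFDerivAt.hasLineDerivAt (basisVec n j))
      (h.hasLineDerivAt_kern hn ha hz hv j hp)

lemma IsSym.fderiv_kern (hn : 1 ≤ n) (ha : 0 < a) (h : IsSym a d S) (hz : z ∈ ℂ₊)
    (hv : SymbolBound r A z v) (j : Fin (n + 1)) (hp : 0 < p.2) :
    fderiv ℝ (kern v S z) p (basisVec n j) = kern v (symDeriv j S) z p :=
  HasDerivAt.unique ((h.differentiableAt_kern hn ha hz hv hp).hasFDerivAt.hasLineDerivAt (basisVec n j))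
    (h.hasLineDerivAt_kern hn ha hz hv j hp)

end Smoothness

section Green
open Filter Topology
variable {n : ℕ} {p q : ℝ≥0∞}
variable {G : Space n → ℂ} {c : Space n → ℝ}

lemma partialDeriv_one (j : Fin 1 → Fin (n + 1)) (φ : Space n → ℂ) (x : Space n) :
    partialDeriv j φ x = fderiv ℝ φ x (basisVec n (j 0)) := by
  rw [partialDeriv, iteratedFDeriv_one_apply]

lemma tendsto_ofReal_complex {f : ℕ → ℝ} {y : ℝ} (h : Tendsto f atTop (𝓝 y)) :
    Tendsto (fun k => (f k : ℂ)) atTop (𝓝 (y : ℂ)) :=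
  (continuous_ofReal.tendsto y).comp h

lemma tendsto_integral_cutoff [Fact (1 ≤ q)] [p.HolderConjugate q] {Gb : Space n → ℂ} {H : Space n → ℝ}
    (hG : MemLp G p (halfVol n)) (hGb : MemLp Gb p (halfVol n)) (hH : MemLp H p (halfVol n))
    (U V : Lq n q) {c cb : ℕ → Space n → ℝ} (hc : ∀ k, Continuous (c k)) (hcb : ∀ k, Continuous (cb k))
    (hle : ∀ k x, |c k x| ≤ 1) (hlim : ∀ x ∈ halfSpace n, Tendsto (fun k => c k x) atTop (𝓝 1))
    (hblim : ∀ x ∈ halfSpace n, Tendsto (fun k => cb k x) atTop (𝓝 0))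
    (hbound : ∀ k, ∀ x ∈ halfSpace n, ‖(cb k x : ℂ) * G x‖ ≤ H x) :
    Tendsto (fun k => ∫ x in halfSpace n, ((c k x : ℂ) * Gb x + (cb k x : ℂ) * G x) * U x) atTop
      (𝓝 (∫ x in halfSpace n, Gb x * U x)) ∧
    Tendsto (fun k => ∫ x in halfSpace n, ((c k x : ℂ) * G x) * V x) atTop
      (𝓝 (∫ x in halfSpace n, G x * V x)) := by
  have hmeas : ∀ {f : Space n → ℝ}, Continuous f →
      AEStronglyMeasurable (fun x => (f x : ℂ)) (halfVol n) := fun hf =>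
    (continuous_ofReal.comp hf).aestronglyMeasurable
  constructor
  · refine tendsto_integral_of_dominated_convergence (fun x => (‖Gb x‖ + H x) * ‖U x‖) (fun k => ?_) ?_
      (fun k => ?_) ?_
    · exact (((hmeas (hc k)).mul hGb.1).add ((hmeas (hcb k)).mul hG.1)).mul (Lp.memLp U).1
    · exact (hGb.norm.add hH).integrable_mul (Lp.memLp U).norm
    · filter_upwards [ae_restrict_mem (measurableSet_halfSpace n)] with x hx
      rw [norm_mul]
      refine mul_le_mul_of_nonneg_right ((norm_add_le _ _).trans (add_le_add ?_ (hbound k x hx))) (norm_nonneg _)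
      rw [norm_mul, norm_real]
      exact mul_le_of_le_one_left (norm_nonneg _) (hle k x)
    · filter_upwards [ae_restrict_mem (measurableSet_halfSpace n)] with x hx
      have h1 : Tendsto (fun k => (c k x : ℂ)) atTop (𝓝 1) := by simpa using tendsto_ofReal_complex (hlim x hx)
      have h2 : Tendsto (fun k => (cb k x : ℂ)) atTop (𝓝 0) := by simpa using tendsto_ofReal_complex (hblim x hx)
      have := ((h1.mul_const (Gb x)).add (h2.mul_const (G x))).mul_const (U x)
      simpa using this
  · refine tendsto_integral_of_dominated_convergence (fun x => ‖G x‖ * ‖V x‖) (fun k => ?_) ?_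
      (fun k => ?_) ?_
    · exact ((hmeas (hc k)).mul hG.1).mul (Lp.memLp V).1
    · exact hG.norm.integrable_mul (Lp.memLp V).norm
    · refine .of_forall fun x => ?_
      rw [norm_mul, norm_mul, norm_real]
      exact mul_le_mul_of_nonneg_right (mul_le_of_le_one_left (norm_nonneg _) (hle k x)) (norm_nonneg _)
    · filter_upwards [ae_restrict_mem (measurableSet_halfSpace n)] with x hx
      have h1 : Tendsto (fun k => (c k x : ℂ)) atTop (𝓝 1) := by simpa using tendsto_ofReal_complex (hlim x hx)
      have := (h1.mul_const (G x)).mul_const (V x)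
      simpa using this

lemma exists_cutoff (n : ℕ) : ∃ (c : ℕ → Space n → ℝ) (D : ℝ), 0 ≤ D ∧ (∀ k, ContDiff ℝ ∞ (c k)) ∧
    (∀ k, HasCompactSupport (c k)) ∧ (∀ k x, |c k x| ≤ 1) ∧ (∀ x, Tendsto (fun k => c k x) atTop (𝓝 1)) ∧
    ∀ k x, ‖fderiv ℝ (c k) x‖ ≤ D * ((k : ℝ) + 1)⁻¹ := by
  let f : ContDiffBump (0 : Space n) := ⟨1, 2, one_pos, one_lt_two⟩
  have hf : ContDiff ℝ ∞ f := f.contDiff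
  obtain ⟨D, hD⟩ := (hf.continuous_fderiv (by simp)).bounded_above_of_compact_support
    (f.hasCompactSupport.fderiv (𝕜 := ℝ))
  have hpos : ∀ k : ℕ, (0 : ℝ) < ((k : ℝ) + 1)⁻¹ := fun k => by positivity
  refine ⟨fun k x => f (((k : ℝ) + 1)⁻¹ • x), D, (norm_nonneg _).trans (hD 0), fun k => ?_, fun k => ?_,
    fun k x => ?_, fun x => ?_, fun k x => ?_⟩
  · exact hf.comp (contDiff_const_smul _)
  · exact f.hasCompactSupport.comp_smul (hpos k).ne'
  · rw [abs_of_nonneg f.nonneg]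
    exact f.le_one
  · have h0 : Tendsto (fun k : ℕ => ((k : ℝ) + 1)⁻¹ • x) atTop (𝓝 0) := by
      have := (tendsto_one_div_add_atTop_nhds_zero_nat (𝕜 := ℝ)).smul_const x
      simpa using this
    have h1 := (hf.continuous.tendsto 0).comp h0
    have h2 : f (0 : Space n) = 1 := f.one_of_mem_closedBall (by simp [f])
    rw [h2] at h1
    exact h1
  · have : fderiv ℝ (fun x => f (((k : ℝ) + 1)⁻¹ • x)) x = ((k : ℝ) + 1)⁻¹ • fderiv ℝ f (((k : ℝ) + 1)⁻¹ • x) :=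
      fderiv_comp_smul _
    rw [this, norm_smul, norm_of_nonneg (hpos k).le, mul_comm]
    exact mul_le_mul_of_nonneg_right (hD _) (hpos k).le

lemma deriv_ofReal_mul (hc : ContDiff ℝ ∞ c) (hG : ContDiff ℝ ∞ G)
    (x e : Space n) : fderiv ℝ (fun x => (c x : ℂ) * G x) x e =
      (c x : ℂ) * fderiv ℝ G x e + (fderiv ℝ c x e : ℂ) * G x := by
  have h1 : HasFDerivAt (fun x => (c x : ℂ)) (ofRealCLM.comp (fderiv ℝ c x)) x :=
    ofRealCLM.hasFDerivAt.comp x (hc.differentiable (by simp) x).hasFDerivAt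
  have h2 : HasFDerivAt (fun x => (c x : ℂ) * G x) _ x := h1.mul (hG.differentiable (by simp) x).hasFDerivAt
  rw [h2.fderiv]
  simp [mul_comm]

lemma isTest_ofReal_mul (hc : ContDiff ℝ ∞ c) (hs : HasCompactSupport c) (hG : ContDiff ℝ ∞ G) : IsTest fun x => (c x : ℂ) * G x := by
  refine ⟨(ofRealCLM.contDiff.comp hc).mul hG, ?_⟩
  refine mul_right (hs.comp_left (g := fun r : ℝ => (r : ℂ)) ofReal_zero)

/-- The boundary cutoffs. -/
def normalCutoff (n k : ℕ) (x : Space n) : ℝ := smoothTransition (((k : ℝ) + 1) * x.2 - 1)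

lemma contDiff_normalCutoff (k : ℕ) : ContDiff ℝ ∞ (normalCutoff n k) :=
  (smoothTransition.contDiff (n := ⊤)).comp ((contDiff_const.mul contDiff_snd).sub contDiff_const)

lemma abs_normalCutoff_le (k : ℕ) (x : Space n) : |normalCutoff n k x| ≤ 1 := by
  rw [normalCutoff, abs_of_nonneg (smoothTransition.nonneg _)]
  exact smoothTransition.le_one _

lemma normalCutoff_eventually {x : Space n} (hx : x ∈ halfSpace n) :
    ∀ᶠ k : ℕ in atTop, normalCutoff n k x = 1 ∧ 2 ≤ ((k : ℝ) + 1) * x.2 := by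
  obtain ⟨N, hN⟩ := exists_nat_gt (2 / x.2)
  filter_upwards [eventually_ge_atTop N] with k hk
  have hx' : 0 < x.2 := hx
  have hk' : (N : ℝ) ≤ k := by exact_mod_cast hk
  rw [div_lt_iff₀ hx'] at hN
  have : 2 ≤ ((k : ℝ) + 1) * x.2 := by nlinarith
  exact ⟨smoothTransition.one_of_one_le (by linarith), this⟩

lemma tsupport_normalCutoff_subset (k : ℕ) : tsupport (normalCutoff n k) ⊆ halfSpace n := by
  have : tsupport (normalCutoff n k) ⊆ {x | 1 ≤ ((k : ℝ) + 1) * x.2} := by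
    refine closure_minimal (fun x hx => ?_) (isClosed_le (by fun_prop) (by fun_prop))
    by_contra h
    refine hx (smoothTransition.zero_of_nonpos ?_)
    simp only [mem_ofPred_eq, not_le] at h
    linarith
  intro x hx
  have h1 : 1 ≤ ((k : ℝ) + 1) * x.2 := this hx
  show 0 < x.2
  have : (0 : ℝ) < (k : ℝ) + 1 := by positivity
  by_contra h
  nlinarith [not_lt.1 h]

lemma fderiv_normalCutoff (k : ℕ) (x e : Space n) : fderiv ℝ (normalCutoff n k) x e =
    ((k : ℝ) + 1) * e.2 * deriv smoothTransition (((k : ℝ) + 1) * x.2 - 1) := by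
  have h1 : HasDerivAt smoothTransition (deriv smoothTransition (((k : ℝ) + 1) * x.2 - 1)) (((k : ℝ) + 1) * x.2 - 1) :=
    ((smoothTransition.contDiff (n := ⊤)).differentiable (by simp) _).hasDerivAt
  have h2 : HasFDerivAt (fun x : Space n => ((k : ℝ) + 1) * x.2 - 1) (((k : ℝ) + 1) • snd ℝ (Tan n) ℝ) x :=
    (hasFDerivAt_snd.const_mul _).sub_const _
  have h3 := h1.comp_hasFDerivAt x h2
  rw [show normalCutoff n k = smoothTransition ∘ fun x : Space n => ((k : ℝ) + 1) * x.2 - 1 from rfl, h3.fderiv]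
  simp only [smul_apply, coe_snd', smul_eq_mul]
  ring

lemma exists_abs_deriv_smoothTransition_le :
    ∃ D, 0 ≤ D ∧ ∀ t, |deriv smoothTransition t| ≤ D ∧ (1 < t → deriv smoothTransition t = 0) := by
  have hc : Continuous (deriv smoothTransition) := (smoothTransition.contDiff (n := 1)).continuous_deriv (by simp)
  have h1 : ∀ t, 1 < t → deriv smoothTransition t = 0 := fun t ht => by
    have : smoothTransition =ᶠ[𝓝 t] fun _ => 1 := by
      filter_upwards [lt_mem_nhds ht] with s hs using smoothTransition.one_of_one_le hs.le
    rw [this.deriv_eq, deriv_const]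
  have h0 : ∀ t, t < 0 → deriv smoothTransition t = 0 := fun t ht => by
    have : smoothTransition =ᶠ[𝓝 t] fun _ => 0 := by
      filter_upwards [gt_mem_nhds ht] with s hs using smoothTransition.zero_of_nonpos hs.le
    rw [this.deriv_eq, deriv_const]
  obtain ⟨D, hD⟩ := (isCompact_Icc (a := (0 : ℝ)) (b := 1)).exists_bound_of_continuousOn hc.continuousOn
  have hD0 : 0 ≤ D := (norm_nonneg _).trans (hD 0 (by simp))
  refine ⟨D, hD0, fun t => ⟨?_, h1 t⟩⟩
  rcases lt_or_ge t 0 with h | h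
  · simpa [h0 t h] using hD0
  rcases lt_or_ge 1 t with h' | h'
  · simpa [h1 t h'] using hD0
  exact hD t ⟨h, h'⟩

/-- Green's formula in a tangential direction. -/
lemma integral_fderiv_tangential [Fact (1 ≤ q)] [p.HolderConjugate q] (hGs : ContDiff ℝ ∞ G)
    (i : Fin n) (hG : MemLp G p (halfVol n))
    (hGb : MemLp (fun x => fderiv ℝ G x (basisVec n i.castSucc)) p (halfVol n)) {U V : Lq n q}
    (hUV : IsWeakDeriv (fun _ : Fin 1 => i.castSucc) U V) :
    ∫ x in halfSpace n, fderiv ℝ G x (basisVec n i.castSucc) * U x = -∫ x in halfSpace n, G x * V x := by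
  obtain ⟨c, D, hD, hcs, hcc, hc1, hlim, hDb⟩ := exists_cutoff n
  set e := basisVec n i.castSucc with he
  have he2 : e.2 = 0 := by simp [he, basisVec]
  have hsm : ∀ k, ContDiff ℝ ∞ fun x => c k x * normalCutoff n k x := fun k =>
    (hcs k).mul (contDiff_normalCutoff k)
  have hder : ∀ k x, fderiv ℝ (fun x => c k x * normalCutoff n k x) x e = fderiv ℝ (c k) x e * normalCutoff n k x := by
    intro k x
    rw [fderiv_fun_mul ((hcs k).differentiable (by simp) x) ((contDiff_normalCutoff k).differentiable (by simp) x)]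
    simp only [add_apply, smul_apply, fderiv_normalCutoff, he2]
    simp [mul_comm]
  have hb : ∀ k x, |fderiv ℝ (fun x => c k x * normalCutoff n k x) x e| ≤ D * ‖e‖ * ((k : ℝ) + 1)⁻¹ := by
    intro k x
    rw [hder, abs_mul]
    refine (mul_le_of_le_one_right (abs_nonneg _) (abs_normalCutoff_le k x)).trans ?_
    refine ((fderiv ℝ (c k) x).le_opNorm e).trans ?_
    calc _ ≤ D * ((k : ℝ) + 1)⁻¹ * ‖e‖ := mul_le_mul_of_nonneg_right (hDb k x) (norm_nonneg _)
      _ = _ := by ring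
  obtain ⟨l1, l2⟩ := tendsto_integral_cutoff hG hGb (hG.norm.const_mul (D * ‖e‖)) U V
    (c := fun k x => c k x * normalCutoff n k x)
    (cb := fun k x => fderiv ℝ (fun x => c k x * normalCutoff n k x) x e)
    (fun k => (hsm k).continuous) (fun k => ((hsm k).continuous_fderiv (by simp)).clm_apply continuous_const)
    (fun k x => by
      rw [abs_mul]
      exact mul_le_one₀ (hc1 k x) (abs_nonneg _) (abs_normalCutoff_le k x))
    (fun x hx => by
      have h2 : Tendsto (fun k => normalCutoff n k x) atTop (𝓝 1) :=
        tendsto_const_nhds.congr' ((normalCutoff_eventually hx).mono fun k hk => hk.1.symm)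
      simpa using (hlim x).mul h2)
    (fun x hx => by
      refine squeeze_zero_norm (hb · x) ?_
      have := (tendsto_one_div_add_atTop_nhds_zero_nat (𝕜 := ℝ)).const_mul (D * ‖e‖)
      simpa using this)
    (fun k x hx => by
      rw [norm_mul, norm_real]
      refine mul_le_mul_of_nonneg_right ((hb k x).trans (mul_le_of_le_one_right (by positivity) ?_)) (norm_nonneg _)
      exact inv_le_one_of_one_le₀ (by simp))
  refine tendsto_nhds_unique l1 (l2.neg.congr fun k => ?_)
  have hφ := isTest_ofReal_mul (hsm k) ((hcc k).mul_right) hGs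
  have := hUV _ hφ ?_
  · simp only [partialDeriv_one, deriv_ofReal_mul (hsm k) hGs] at this
    rw [this]
    simp
  · refine subset_trans (closure_mono fun x hx => ?_) (tsupport_normalCutoff_subset k)
    intro h0
    apply hx
    simp [h0]

/-- Green's formula in the normal direction, with boundary values `g`. -/
lemma integral_fderiv_normal [Fact (1 ≤ q)] [p.HolderConjugate q] (hGs : ContDiff ℝ ∞ G)
    (hG : MemLp G p (halfVol n))
    (hGb : MemLp (fun x => fderiv ℝ G x (basisVec n (Fin.last n))) p (halfVol n))
    (hG0 : MemLp (fun x' : Tan n => G (x', 0)) p) {f : sobolev n q 2} {g : Lp ℂ q (volume : Measure (Tan n))}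
    (hfg : IsTrace f g) : ∫ x in halfSpace n, fderiv ℝ G x (basisVec n (Fin.last n)) * toLq f x =
      -(∫ x in halfSpace n, G x * weakGrad n q 1 (by norm_num) f (fun _ => Fin.last n) x)
        - ∫ x' : Tan n, G (x', 0) * g x' := by
  obtain ⟨c, D, hD, hcs, hcc, hc1, hlim, hDb⟩ := exists_cutoff n
  set e := basisVec n (Fin.last n) with he
  have hb : ∀ k x, |fderiv ℝ (c k) x e| ≤ D * ‖e‖ * ((k : ℝ) + 1)⁻¹ := by
    intro k x
    refine ((fderiv ℝ (c k) x).le_opNorm e).trans ?_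
    calc _ ≤ D * ((k : ℝ) + 1)⁻¹ * ‖e‖ := mul_le_mul_of_nonneg_right (hDb k x) (norm_nonneg _)
      _ = _ := by ring
  obtain ⟨l1, l2⟩ := tendsto_integral_cutoff hG hGb (hG.norm.const_mul (D * ‖e‖)) (toLq f)
    (weakGrad n q 1 (by norm_num) f (fun _ => Fin.last n)) (c := c)
    (cb := fun k x => fderiv ℝ (c k) x e)
    (fun k => (hcs k).continuous) (fun k => ((hcs k).continuous_fderiv (by simp)).clm_apply continuous_const)
    hc1 (fun x hx => hlim x)
    (fun x hx => by
      refine squeeze_zero_norm (hb · x) ?_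
      have := (tendsto_one_div_add_atTop_nhds_zero_nat (𝕜 := ℝ)).const_mul (D * ‖e‖)
      simpa using this)
    (fun k x hx => by
      rw [norm_mul, norm_real]
      refine mul_le_mul_of_nonneg_right ((hb k x).trans (mul_le_of_le_one_right (by positivity) ?_)) (norm_nonneg _)
      exact inv_le_one_of_one_le₀ (by simp))
  have l3 : Tendsto (fun k => ∫ x' : Tan n, ((c k (x', 0) : ℂ) * G (x', 0)) * g x') atTop
      (𝓝 (∫ x' : Tan n, G (x', 0) * g x')) := by
    refine tendsto_integral_of_dominated_convergence (fun x' => ‖G (x', 0)‖ * ‖g x'‖) (fun k => ?_) ?_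
      (fun k => ?_) ?_
    · refine AEStronglyMeasurable.mul (AEStronglyMeasurable.mul ?_ hG0.1) (Lp.memLp g).1
      exact (continuous_ofReal.comp ((hcs k).continuous.comp (by fun_prop : Continuous fun x' : Tan n => (x', (0 : ℝ))))).aestronglyMeasurable
    · exact hG0.norm.integrable_mul (Lp.memLp g).norm
    · refine .of_forall fun x => ?_
      rw [norm_mul, norm_mul, norm_real]
      exact mul_le_mul_of_nonneg_right (mul_le_of_le_one_left (norm_nonneg _) (hc1 k _)) (norm_nonneg _)
    · refine .of_forall fun x => ?_
      have h1 : Tendsto (fun k => (c k (x, 0) : ℂ)) atTop (𝓝 1) := by simpa using tendsto_ofReal_complex (hlim (x, 0))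
      have := (h1.mul_const (G (x, 0))).mul_const (g x)
      simpa using this
  refine tendsto_nhds_unique l1 ((l2.neg.sub l3).congr fun k => ?_)
  have := hfg _ (isTest_ofReal_mul (hcs k) (hcc k) hGs)
  simp only [partialDeriv_one, deriv_ofReal_mul (hcs k) hGs] at this
  exact this.symm

end Green

section Trace
open Filter Topology
variable {n : ℕ} {q : ℝ≥0∞}

/-- The weak normal derivative may be tested against functions vanishing on the boundary. -/
lemma IsWeakDeriv.integral_of_boundary_zero [Fact (1 ≤ q)] {U V : Lq n q}
    (hUV : IsWeakDeriv (fun _ : Fin 1 => Fin.last n) U V) {ψ : Space n → ℂ} (hψ : IsTest ψ)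
    (h0 : ∀ x', ψ (x', 0) = 0) :
    ∫ x in halfSpace n, fderiv ℝ ψ x (basisVec n (Fin.last n)) * U x = -∫ x in halfSpace n, ψ x * V x := by
  have : q.conjExponent.HolderConjugate q := HolderConjugate.symm
  obtain ⟨D, hD0, hD⟩ := exists_abs_deriv_smoothTransition_le
  obtain ⟨L, hL⟩ := hψ.1.lipschitzWith_of_hasCompactSupport hψ.2 (by simp)
  set e := basisVec n (Fin.last n) with he
  have he2 : e.2 = 1 := by simp [he, basisVec]
  have hψL : ∀ x ∈ halfSpace n, ‖ψ x‖ ≤ L * x.2 := by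
    intro x hx
    have h := hL.dist_le_mul x (x.1, 0)
    rw [h0, dist_zero_right] at h
    refine h.trans (mul_le_mul_of_nonneg_left ?_ L.2)
    have hx' : 0 < x.2 := hx
    rw [Prod.dist_eq]
    simp [abs_of_pos hx', hx'.le]
  have hψ' : Continuous fun x => fderiv ℝ ψ x e := (hψ.1.continuous_fderiv (by simp)).clm_apply continuous_const
  have hψ's : HasCompactSupport fun x => fderiv ℝ ψ x e := hψ.2.fderiv_apply (𝕜 := ℝ) e
  obtain ⟨l1, l2⟩ := tendsto_integral_cutoff (p := q.conjExponent)
    (hψ.1.continuous.memLp_of_hasCompactSupport hψ.2) (hψ'.memLp_of_hasCompactSupport hψ's)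
    (H := (tsupport ψ).indicator fun _ => 2 * D * L)
    (memLp_indicator_const _ (isClosed_tsupport ψ).measurableSet _ (Or.inr hψ.2.isCompact.measure_lt_top.ne)) U V
    (c := normalCutoff n) (cb := fun k x => fderiv ℝ (normalCutoff n k) x e)
    (fun k => (contDiff_normalCutoff k).continuous)
    (fun k => ((contDiff_normalCutoff k).continuous_fderiv (by simp)).clm_apply continuous_const)
    abs_normalCutoff_le
    (fun x hx => tendsto_const_nhds.congr' ((normalCutoff_eventually hx).mono fun k hk => hk.1.symm))
    (fun x hx => by
      refine tendsto_const_nhds.congr' ?_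
      have hx' : 0 < x.2 := hx
      have h2 : Tendsto (fun k : ℕ => ((k : ℝ) + 1) * x.2) atTop atTop :=
        (tendsto_atTop_add_const_right _ _ tendsto_natCast_atTop_atTop).atTop_mul_const hx'
      filter_upwards [h2.eventually_gt_atTop 2] with k hk
      rw [fderiv_normalCutoff, (hD _).2 (by linarith), mul_zero])
    (fun k x hx => by
      by_cases hxs : x ∈ tsupport ψ
      · rw [indicator_of_mem hxs, norm_mul, norm_real, fderiv_normalCutoff, he2, mul_one]
        have hx' : 0 < x.2 := hx
        have hk : (0 : ℝ) < (k : ℝ) + 1 := by positivity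
        rcases le_or_gt (((k : ℝ) + 1) * x.2) 2 with h | h
        · rw [norm_mul, norm_of_nonneg hk.le]
          calc _ ≤ ((k : ℝ) + 1) * D * (L * x.2) := mul_le_mul (mul_le_mul_of_nonneg_left (hD _).1 hk.le)
                  (hψL x hx) (norm_nonneg _) (by positivity)
            _ = (((k : ℝ) + 1) * x.2) * (D * L) := by ring
            _ ≤ 2 * (D * L) := mul_le_mul_of_nonneg_right h (mul_nonneg hD0 L.2)
            _ = _ := by ring
        · rw [(hD _).2 (by linarith), mul_zero, norm_zero, zero_mul]
          exact mul_nonneg (by linarith) L.2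
      · rw [indicator_of_notMem hxs, image_eq_zero_of_notMem_tsupport hxs, mul_zero, norm_zero])
  refine tendsto_nhds_unique l1 (l2.neg.congr fun k => ?_)
  have hφ : IsTest fun x => (normalCutoff n k x : ℂ) * ψ x :=
    ⟨(ofRealCLM.contDiff.comp (contDiff_normalCutoff k)).mul hψ.1, hψ.2.mul_left⟩
  have := hUV _ hφ ?_
  · simp only [partialDeriv_one, deriv_ofReal_mul (contDiff_normalCutoff k) hψ.1] at this
    rw [this]
    simp
  · refine subset_trans (closure_mono fun x hx => ?_) (tsupport_normalCutoff_subset k)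
    intro h0
    apply hx
    simp [h0]

lemma memLp_integral_fiber [Fact (1 ≤ q)] (hq2 : q ≠ ⊤) {F : Space n → ℂ} (hF : MemLp F q (halfVol n))
    {R : ℝ} (hR : ∀ x : Space n, R < x.2 → F x = 0) :
    MemLp (fun x' : Tan n => ∫ t in Ioi (0 : ℝ), F (x', t)) q := by
  have hq0 : q ≠ 0 := (zero_lt_one.trans_le (Fact.out : 1 ≤ q)).ne'
  have hqp : 0 < q.toReal := toReal_pos hq0 hq2
  have hFm := hF.1
  have hfin := (eLpNorm_lt_top_iff_lintegral_rpow_enorm_lt_top hq0 hq2).1 hF.2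
  rw [halfVol_eq_prod] at hFm hfin
  refine ⟨hFm.integral_prod_right', ?_⟩
  rw [eLpNorm_lt_top_iff_lintegral_rpow_enorm_lt_top hq0 hq2]
  rw [lintegral_prod _ (hFm.enorm.pow_const _)] at hfin
  set ν : Measure ℝ := (volume.restrict (Ioi 0)).restrict (Iic R) with hν
  have hνfin : ν univ < ⊤ := by
    rw [hν, Measure.restrict_restrict measurableSet_Iic, Measure.restrict_apply_univ]
    exact (measure_mono (fun t ht => ⟨ht.2.le, ht.1⟩ : Iic R ∩ Ioi 0 ⊆ Icc 0 R)).trans_lt measure_Icc_lt_top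
  set K := (ν univ ^ (1 / (1 : ℝ≥0∞).toReal - 1 / q.toReal)) ^ q.toReal with hK
  have hexp : 0 ≤ 1 / (1 : ℝ≥0∞).toReal - 1 / q.toReal := by
    have : 1 ≤ q.toReal := by
      rw [← toReal_one]
      exact toReal_mono hq2 Fact.out
    simpa using inv_le_one_of_one_le₀ this
  have hKfin : K ≠ ⊤ := (rpow_lt_top_of_nonneg hqp.le (rpow_lt_top_of_nonneg hexp hνfin.ne).ne).ne
  refine lt_of_le_of_lt (lintegral_mono_ae (g := fun x' => K * ∫⁻ t in Ioi (0 : ℝ), ‖F (x', t)‖ₑ ^ q.toReal) ?_) ?_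
  · filter_upwards [hFm.prodMk_left] with x' hx'
    have h1 : ‖∫ t in Ioi (0 : ℝ), F (x', t)‖ₑ ≤ eLpNorm (fun t => F (x', t)) 1 ν := by
      have : ∫ t in Ioi (0 : ℝ), F (x', t) = ∫ t, F (x', t) ∂ν :=
        (setIntegral_eq_integral_of_forall_compl_eq_zero fun t ht => hR _ (not_le.1 ht)).symm
      rw [this, eLpNorm_one_eq_lintegral_enorm]
      exact enorm_integral_le_lintegral_enorm _
    have h2 := h1.trans (eLpNorm_le_eLpNorm_mul_rpow_measure_univ (Fact.out : 1 ≤ q) hx'.restrict)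
    calc ‖∫ t in Ioi (0 : ℝ), F (x', t)‖ₑ ^ q.toReal
        ≤ (eLpNorm (fun t => F (x', t)) q ν * ν univ ^ (1 / (1 : ℝ≥0∞).toReal - 1 / q.toReal)) ^ q.toReal :=
          rpow_le_rpow h2 hqp.le
      _ = K * ∫⁻ t, ‖F (x', t)‖ₑ ^ q.toReal ∂ν := by
          rw [mul_rpow_of_nonneg _ _ hqp.le, mul_comm, eLpNorm_eq_lintegral_rpow_enorm_toReal hq0 hq2,
            ← rpow_mul _ (1 / q.toReal), one_div_mul_cancel hqp.ne', rpow_one]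
      _ ≤ _ := mul_le_mul_right (lintegral_mono' Measure.restrict_le_self le_rfl) _
  · rw [lintegral_const_mul' _ _ hKfin]
    exact mul_lt_top hKfin.lt_top hfin

/-- A smooth function on the line, equal to `1` at `0`, with support in `[-2, 2]`. -/
def lineBump (t : ℝ) : ℝ := smoothTransition (2 - t) * smoothTransition (2 + t)

lemma contDiff_lineBump : ContDiff ℝ ∞ lineBump :=
  ((smoothTransition.contDiff (n := ⊤)).comp (contDiff_const.sub contDiff_id)).mul
    ((smoothTransition.contDiff (n := ⊤)).comp (contDiff_const.add contDiff_id))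

lemma lineBump_zero : lineBump 0 = 1 := by
  simp [lineBump, smoothTransition.one_of_one_le]

lemma lineBump_eq_zero {t : ℝ} (ht : 2 ≤ |t|) : lineBump t = 0 := by
  rcases le_abs'.1 ht with h | h
  · rw [lineBump, smoothTransition.zero_of_nonpos (by linarith : 2 + t ≤ 0), mul_zero]
  · rw [lineBump, smoothTransition.zero_of_nonpos (by linarith : 2 - t ≤ 0), zero_mul]

lemma hasCompactSupport_lineBump : HasCompactSupport lineBump :=
  HasCompactSupport.intro (isCompact_Icc (a := (-2 : ℝ)) (b := 2)) fun t ht =>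
    lineBump_eq_zero (by
      rw [mem_Icc, ← abs_le, not_le] at ht
      exact ht.le)

lemma deriv_lineBump_eq_zero {t : ℝ} (ht : 2 < t) : deriv lineBump t = 0 := by
  have : lineBump =ᶠ[𝓝 t] fun _ => 0 := by
    filter_upwards [lt_mem_nhds ht] with s hs using lineBump_eq_zero (hs.le.trans (le_abs_self s))
  rw [this.deriv_eq, deriv_const]

lemma IsTest.boundary_mul {φ : Space n → ℂ} (hφ : IsTest φ) {η : ℝ → ℝ} (hη : ContDiff ℝ ∞ η)
    (hs : HasCompactSupport η) : IsTest fun x : Space n => φ (x.1, 0) * (η x.2 : ℂ) := by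
  refine ⟨(hφ.1.comp (contDiff_fst.prodMk contDiff_const)).mul
    (ofRealCLM.contDiff.comp (hη.comp contDiff_snd)), ?_⟩
  refine HasCompactSupport.intro ((hφ.2.isCompact.image continuous_fst).prod hs.isCompact) fun x hx => ?_
  rw [mem_prod, not_and_or] at hx
  rcases hx with h | h
  · have : φ (x.1, 0) = 0 := by refine image_eq_zero_of_notMem_tsupport fun h' => h ⟨_, h', rfl⟩
    rw [this, zero_mul]
  · rw [image_eq_zero_of_notMem_tsupport h, ofReal_zero, mul_zero]

/-- Functions in `H_q^2` have boundary traces. -/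
lemma exists_trace [Fact (1 ≤ q)] (hq2 : q ≠ ⊤) (f : sobolev n q 2) :
    ∃ g : Lp ℂ q (volume : Measure (Tan n)), IsTrace f g := by
  set u : Lq n q := toLq f
  set v : Lq n q := weakGrad n q 1 (by norm_num) f (fun _ => Fin.last n)
  have hw : IsWeakDeriv (fun _ : Fin 1 => Fin.last n) u v := f.2 1 (fun _ => Fin.last n)
  have hη' : Continuous (deriv lineBump) := contDiff_lineBump.continuous_deriv (by simp)
  have hηs' : HasCompactSupport (deriv lineBump) := hasCompactSupport_lineBump.deriv
  have hbd : ∀ {c : ℝ → ℝ}, Continuous c → HasCompactSupport c → ∀ U : Lq n q,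
      MemLp (fun x => (c x.2 : ℂ) * U x) q (halfVol n) := by
    intro c hc hs U
    obtain ⟨D, hD⟩ := hc.bounded_above_of_compact_support hs
    refine (Lp.memLp U).of_le_mul (c := D) ?_ (.of_forall fun x => ?_)
    · exact (continuous_ofReal.comp (hc.comp continuous_snd)).aestronglyMeasurable.mul (Lp.memLp U).1
    · rw [norm_mul, norm_real]
      exact mul_le_mul_of_nonneg_right (hD _) (norm_nonneg _)
  set F : Space n → ℂ := fun x => ((deriv lineBump x.2 : ℝ) : ℂ) * u x + (lineBump x.2 : ℂ) * v x with hFdef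
  have hF : MemLp F q (halfVol n) := (hbd hη' hηs' u).add (hbd contDiff_lineBump.continuous hasCompactSupport_lineBump v)
  have hg := (memLp_integral_fiber hq2 hF (R := 2) fun x hx => by
    simp only [hFdef, deriv_lineBump_eq_zero hx, lineBump_eq_zero (hx.le.trans (le_abs_self _)), ofReal_zero,
      zero_mul, add_zero]).neg
  refine ⟨hg.toLp _, fun φ hφ => ?_⟩
  have t0 := hφ.boundary_mul contDiff_lineBump hasCompactSupport_lineBump
  have t1 := hφ.boundary_mul (contDiff_infty_iff_deriv.1 contDiff_lineBump).2 hηs'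
  set e := basisVec n (Fin.last n) with he
  have hd : ∀ x, HasFDerivAt φ (fderiv ℝ φ x) x := fun x => (hφ.1.differentiable (by simp) x).hasFDerivAt
  have hd0 : ∀ x, fderiv ℝ (fun x : Space n => φ (x.1, 0) * (lineBump x.2 : ℂ)) x e = φ (x.1, 0) * ((deriv lineBump x.2 : ℝ) : ℂ) := by
    intro x
    have h1 := ((t0.1.differentiable (by simp) x).hasFDerivAt).hasLineDerivAt e
    refine HasDerivAt.unique h1 ?_
    have h2 : HasDerivAt (fun s : ℝ => lineBump (x.2 + s)) (deriv lineBump x.2) 0 := by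
      have h := (contDiff_lineBump.differentiable (by simp) (x.2 + 0)).hasDerivAt
      rw [add_zero] at h
      have := HasDerivAt.comp_const_add (f := lineBump) (f' := deriv lineBump x.2) x.2 0 (by simpa using h)
      exact this
    have h3 := (h2.ofReal_comp).const_mul (φ (x.1, 0))
    refine h3.congr_of_eventuallyEq (.of_forall fun s => ?_)
    simp [he, basisVec]
  have hψ : IsTest fun x => φ x - φ (x.1, 0) * (lineBump x.2 : ℂ) := ⟨hφ.1.sub t0.1, by
    have := hφ.2.add (t0.2.neg)
    refine this.mono fun x hx h0 => hx ?_
    simpa [sub_eq_add_neg] using h0⟩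
  have key := hw.integral_of_boundary_zero hψ (fun x' => by simp [lineBump_zero])
  have hdψ : ∀ x, fderiv ℝ (fun x => φ x - φ (x.1, 0) * (lineBump x.2 : ℂ)) x e =
      fderiv ℝ φ x e - φ (x.1, 0) * ((deriv lineBump x.2 : ℝ) : ℂ) := by
    intro x
    rw [fderiv_fun_sub (hd x).differentiableAt (t0.1.differentiable (by simp) x), sub_apply, hd0]
  simp only [← he, hdψ, sub_mul] at key
  have iφ' : Integrable (fun x => fderiv ℝ φ x e * u x) (halfVol n) :=
    integrable_test_mul ((hφ.1.continuous_fderiv (by simp)).clm_apply continuous_const) (hφ.2.fderiv_apply (𝕜 := ℝ) e) u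
  have i1 := integrable_test_mul t1.1.continuous t1.2 u
  have iφ := integrable_test_mul hφ.1.continuous hφ.2 v
  have i0 := integrable_test_mul t0.1.continuous t0.2 v
  rw [integral_sub iφ' i1, integral_sub iφ i0] at key
  have fub : ∫ x' : Tan n, φ (x', 0) * (hg.toLp _) x' =
      -((∫ x in halfSpace n, φ (x.1, 0) * ((deriv lineBump x.2 : ℝ) : ℂ) * u x) + ∫ x in halfSpace n, φ (x.1, 0) * (lineBump x.2 : ℂ) * v x) := by
    rw [← integral_add i1 i0]
    have hi : Integrable (fun x : Space n => φ (x.1, 0) * ((deriv lineBump x.2 : ℝ) : ℂ) * u x +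
      φ (x.1, 0) * (lineBump x.2 : ℂ) * v x) (halfVol n) := i1.add i0
    change _ = -∫ x, _ ∂(halfVol n)
    rw [halfVol_eq_prod] at hi ⊢
    rw [integral_prod _ hi, ← integral_neg]
    refine integral_congr_ae ?_
    filter_upwards [hg.coeFn_toLp] with x' hx'
    rw [hx', Pi.neg_apply, mul_neg, ← integral_const_mul]
    congr 1
    refine integral_congr_ae (.of_forall fun t => ?_)
    simp only [hFdef]
    ring
  rw [fub]
  simp only [partialDeriv_one, ← he]
  linear_combination key

end Trace

section Slices
open Filter Topology
variable {n : ℕ} {p q : ℝ≥0∞}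
variable {t : ℝ} {x : Space n}

lemma exists_smooth_extension {G : Space n → ℂ} (ht : 0 < t) (hG : ContDiffOn ℝ ∞ G {y | -t < y.2}) :
    ∃ G' : Space n → ℂ, ContDiff ℝ ∞ G' ∧ (∀ y, 0 ≤ y.2 → G' y = G y) ∧
      ∀ y ∈ halfSpace n, ∀ e, fderiv ℝ G' y e = fderiv ℝ G y e := by
  set s : Space n → ℝ := fun y => smoothTransition (1 + 2 / t * y.2)
  have hs : ContDiff ℝ ∞ s := (smoothTransition.contDiff (n := ⊤)).comp
    (contDiff_const.add (contDiff_const.mul contDiff_snd))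
  have h1 : ∀ y : Space n, 0 ≤ y.2 → (s y : ℂ) * G y = G y := fun y hy => by
    have : s y = 1 := smoothTransition.one_of_one_le (by
      have : 0 ≤ 2 / t * y.2 := by positivity
      linarith)
    rw [this, ofReal_one, one_mul]
  refine ⟨fun y => (s y : ℂ) * G y, contDiff_iff_contDiffAt.2 fun y => ?_, h1, fun y hy e => ?_⟩
  · rcases lt_or_ge (-t) y.2 with h | h
    · exact (ofRealCLM.contDiff.comp hs).contDiffAt.mul
        (hG.contDiffAt ((isOpen_lt continuous_const continuous_snd).mem_nhds h))
    · have : (fun y => (s y : ℂ) * G y) =ᶠ[𝓝 y] fun _ => 0 := by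
        have hy : y.2 < -t / 2 := by linarith
        filter_upwards [(isOpen_lt continuous_snd continuous_const).mem_nhds hy] with x hx
        have hx' : x.2 < -t / 2 := hx
        have : s x = 0 := smoothTransition.zero_of_nonpos (by
          have : 2 / t * x.2 ≤ 2 / t * (-t / 2) := mul_le_mul_of_nonneg_left hx'.le (by positivity)
          have e : 2 / t * (-t / 2) = -1 := by field_simp
          linarith)
        rw [this, ofReal_zero, zero_mul]
      exact contDiffAt_const.congr_of_eventuallyEq this
  · have : (fun y => (s y : ℂ) * G y) =ᶠ[𝓝 y] G := by
      filter_upwards [(isOpen_halfSpace n).mem_nhds hy] with x hx using h1 x (le_of_lt hx)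
    rw [this.fderiv_eq]

lemma memLp_inv_one_add_norm (hn : 1 ≤ n) (hp1 : 1 < p) (hp2 : p ≠ ⊤) (x : Tan n) :
    MemLp (fun y : Tan n => ((1 + ‖x - y‖) ^ n)⁻¹) p := by
  have hp0 : p ≠ 0 := (zero_lt_one.trans hp1).ne'
  have hpr : 1 < p.toReal := one_lt_toReal hp1 hp2
  have hc : Continuous fun y : Tan n => ((1 + ‖x - y‖) ^ n)⁻¹ := Continuous.inv₀ (by fun_prop) fun y => by positivity
  rw [← integrable_norm_rpow_iff hc.aestronglyMeasurable hp0 hp2]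
  have h1 : Integrable (fun y : Tan n => (1 + ‖y‖) ^ (-(n * p.toReal))) := integrable_one_add_norm (by
      rw [finrank_euclideanSpace_fin]
      have : (1 : ℝ) ≤ n := by exact_mod_cast hn
      nlinarith)
  refine (h1.comp_sub_left x).congr (.of_forall fun y => ?_)
  have hpos : 0 < 1 + ‖x - y‖ := by positivity
  show (1 + ‖x - y‖) ^ (-(n * p.toReal)) = ‖((1 + ‖x - y‖) ^ n)⁻¹‖ ^ p.toReal
  rw [norm_of_nonneg (by positivity), rpow_neg hpos.le, Real.rpow_mul hpos.le, rpow_natCast, inv_rpow (by positivity)]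

lemma memLp_exp_mul_inv_one_add_norm (hn : 1 ≤ n) (hp1 : 1 < p) (hp2 : p ≠ ⊤) (x : Tan n) {c : ℝ} (hc : 0 < c) :
    MemLp (fun y : Space n => ((1 + ‖x - y.1‖) ^ n)⁻¹ * exp (-(c * y.2))) p (halfVol n) := by
  have hp0 : p ≠ 0 := (zero_lt_one.trans hp1).ne'
  have hp : 0 < p.toReal := toReal_pos hp0 hp2
  have hcont : Continuous fun y : Space n => ((1 + ‖x - y.1‖) ^ n)⁻¹ * exp (-(c * y.2)) :=
    (Continuous.inv₀ (by fun_prop) fun y => by positivity).mul (by fun_prop)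
  rw [← integrable_norm_rpow_iff hcont.aestronglyMeasurable hp0 hp2, halfVol_eq_prod]
  have h1 := (integrable_norm_rpow_iff (memLp_inv_one_add_norm hn hp1 hp2 x).1 hp0 hp2).2
    (memLp_inv_one_add_norm hn hp1 hp2 x)
  have h2 : Integrable (fun t : ℝ => exp (-(c * p.toReal) * t)) (volume.restrict (Ioi 0)) :=
    integrableOn_exp_mul_Ioi (by nlinarith [mul_pos hc hp]) 0
  refine (h1.mul_prod h2).congr (.of_forall fun y => ?_)
  show ‖((1 + ‖x - y.1‖) ^ n)⁻¹‖ ^ p.toReal * exp (-(c * p.toReal) * y.2) =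
    ‖((1 + ‖x - y.1‖) ^ n)⁻¹ * exp (-(c * y.2))‖ ^ p.toReal
  rw [norm_mul, mul_rpow (norm_nonneg _) (norm_nonneg _), norm_of_nonneg (Real.exp_nonneg _), ← Real.exp_mul]
  congr 2
  ring

variable {a : ℝ} {d r : ℤ} {S : Symb n} {A : ℕ → ℝ} {z : ℂ} {v : Tan n → ℂ}

lemma IsSym.memLp_reflKer (hn : 1 ≤ n) (ha : 0 < a) (h : IsSym a d S) (hz : z ∈ ℂ₊)
    (hv : SymbolBound r A z v) (hp1 : 1 < p) (hp2 : p ≠ ⊤) (hx : x ∈ halfSpace n) :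
    MemLp (fun y => reflKer (kern v S z) x y) p (halfVol n) := by
  obtain ⟨C, c, hC, hc, H⟩ := h.exists_kernel_decay hn ha hz hv hx
  refine ((memLp_exp_mul_inv_one_add_norm hn hp1 hp2 x.1 hc).const_mul C).of_le ?_ ?_
  · refine ContinuousOn.aestronglyMeasurable ?_ (measurableSet_halfSpace n)
    refine (h.continuousOn_kern hn ha hz hv).comp (f := fun y : Space n => (x.1 - y.1, x.2 + y.2)) (by fun_prop) ?_
    intro y hy
    exact add_pos (show 0 < x.2 from hx) (show 0 < y.2 from hy)
  · filter_upwards [ae_halfVol n] with y hy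
    have hx' : 0 < x.2 := hx
    have h1 := H (x.2 + y.2) (by linarith) (x.1 - y.1)
    refine h1.trans (le_trans ?_ (le_abs_self _))
    have h2 : exp (-(c * (x.2 + y.2))) ≤ exp (-(c * y.2)) := exp_le_exp.2 (by nlinarith)
    calc _ = C * (((1 + ‖x.1 - y.1‖) ^ n)⁻¹ * exp (-(c * (x.2 + y.2)))) := by ring
      _ ≤ _ := by gcongr

lemma IsSym.memLp_kern_slice (hn : 1 ≤ n) (ha : 0 < a) (h : IsSym a d S) (hz : z ∈ ℂ₊)
    (hv : SymbolBound r A z v) (hp1 : 1 < p) (hp2 : p ≠ ⊤) (x : Tan n) (ht : 0 < t) :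
    MemLp (fun y => kern v S z (x - y, t)) p := by
  obtain ⟨C, c, hC, hc, H⟩ := h.exists_kernel_decay hn ha hz hv ht
  refine ((memLp_inv_one_add_norm hn hp1 hp2 x).const_mul C).of_le ?_ (.of_forall fun y => ?_)
  · refine Continuous.aestronglyMeasurable ?_
    refine continuousOn_univ.1 ((h.continuousOn_kern hn ha hz hv).comp (f := fun y : Tan n => (x - y, t))
      (by fun_prop) fun y _ => ht)
  · refine (H t le_rfl (x - y)).trans (le_trans ?_ (le_abs_self _))
    refine mul_le_mul_of_nonneg_right (mul_le_of_le_one_right hC.le (exp_le_one_iff.2 ?_)) (by positivity)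
    nlinarith [mul_pos hc ht]

lemma IsSym.contDiffOn_reflKer (hn : 1 ≤ n) (ha : 0 < a) (h : IsSym a d S) (hz : z ∈ ℂ₊)
    (hv : SymbolBound r A z v) (x : Space n) :
    ContDiffOn ℝ ∞ (fun y => reflKer (kern v S z) x y) {y | -x.2 < y.2} := by
  refine contDiffOn_infty.2 fun k => (h.contDiffOn_kern hn ha hz hv k).comp
    (f := fun y : Space n => (x.1 - y.1, x.2 + y.2)) (ContDiff.contDiffOn ?_) fun y hy => ?_
  · exact (contDiff_const.sub contDiff_fst).prodMk (contDiff_const.add contDiff_snd)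
  · have : -x.2 < y.2 := hy
    show 0 < x.2 + y.2
    linarith

lemma IsSym.hasLineDerivAt_reflKer (hn : 1 ≤ n) (ha : 0 < a) (h : IsSym a d S) (hz : z ∈ ℂ₊)
    (hv : SymbolBound r A z v) {y : Space n} (hxy : 0 < x.2 + y.2) (j : Fin (n + 1)) :
    fderiv ℝ (fun y => reflKer (kern v S z) x y) y (basisVec n j) =
      (if j = Fin.last n then 1 else -1) * reflKer (kern v (symDeriv j S) z) x y := by
  have h1 := (h.differentiableAt_kern hn ha hz hv (p := (x.1 - y.1, x.2 + y.2)) hxy).hasFDerivAt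
  have h2 : HasFDerivAt (fun y : Space n => (x.1 - y.1, x.2 + y.2))
      ((-fst ℝ (Tan n) ℝ).prod (snd ℝ (Tan n) ℝ)) y :=
    (hasFDerivAt_fst.const_sub x.1).prodMk (hasFDerivAt_snd.const_add x.2)
  have h3 := h1.comp y h2
  have h4 : fderiv ℝ (fun y => reflKer (kern v S z) x y) y = _ := h3.fderiv
  rw [h4, comp_apply]
  have h5 := h.fderiv_kern hn ha hz hv j (p := (x.1 - y.1, x.2 + y.2)) hxy
  have e : ((-fst ℝ (Tan n) ℝ).prod (snd ℝ (Tan n) ℝ)) (basisVec n j) =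
      (if j = Fin.last n then (1 : ℝ) else -1) • basisVec n j := by
    induction j using Fin.lastCases with
    | last => simp [basisVec]
    | cast i => simp [basisVec, Fin.castSucc_ne_last]
  rw [e, map_smul, h5]
  split_ifs <;> simp [reflKer]

lemma IsSym.integral_reflKer_tangential [Fact (1 ≤ q)] (hq1 : 1 < q) (hq2 : q ≠ ⊤) (hn : 1 ≤ n) (ha : 0 < a)
    (h : IsSym a d S) (hz : z ∈ ℂ₊) (hv : SymbolBound r A z v) (hx : x ∈ halfSpace n)
    (i : Fin n) {U V : Lq n q} (hUV : IsWeakDeriv (fun _ : Fin 1 => i.castSucc) U V) :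
    ∫ y in halfSpace n, reflKer (kern v (symDeriv i.castSucc S) z) x y * U y =
      ∫ y in halfSpace n, reflKer (kern v S z) x y * V y := by
  obtain ⟨hp1, hp2, hpq⟩ := holderConjugate_conjExponent hq1 hq2
  obtain ⟨G, hG, hG1, hG2⟩ := exists_smooth_extension hx (h.contDiffOn_reflKer hn ha hz hv x)
  have e1 : (fun y => reflKer (kern v S z) x y) =ᵐ[halfVol n] G := by
    filter_upwards [ae_halfVol n] with y hy using (hG1 y hy.le).symm
  have e2 : (fun y => -reflKer (kern v (symDeriv i.castSucc S) z) x y) =ᵐ[halfVol n]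
      fun y => fderiv ℝ G y (basisVec n i.castSucc) := by
    filter_upwards [ae_halfVol n] with y hy
    rw [hG2 y hy, h.hasLineDerivAt_reflKer hn ha hz hv (add_pos hx hy), if_neg (Fin.castSucc_ne_last i), neg_one_mul]
  have key := integral_fderiv_tangential hG i ((h.memLp_reflKer hn ha hz hv hp1 hp2 hx).ae_eq e1)
    (((h.deriv_coord ha i.castSucc).memLp_reflKer hn ha hz hv hp1 hp2 hx).neg.ae_eq e2) hUV
  have i1 : ∫ y in halfSpace n, fderiv ℝ G y (basisVec n i.castSucc) * U y =
      -∫ y in halfSpace n, reflKer (kern v (symDeriv i.castSucc S) z) x y * U y := by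
    rw [← integral_neg]
    refine integral_congr_ae ?_
    filter_upwards [e2] with y hy
    rw [← hy, neg_mul]
  have i2 : ∫ y in halfSpace n, G y * V y = ∫ y in halfSpace n, reflKer (kern v S z) x y * V y := by
    refine integral_congr_ae ?_
    filter_upwards [e1] with y hy
    rw [hy]
  rw [i1, i2] at key
  exact neg_injective key

lemma IsSym.integral_reflKer_normal [Fact (1 ≤ q)] (hq1 : 1 < q) (hq2 : q ≠ ⊤) (hn : 1 ≤ n) (ha : 0 < a)
    (h : IsSym a d S) (hz : z ∈ ℂ₊) (hv : SymbolBound r A z v) (hx : x ∈ halfSpace n)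
    {f : sobolev n q 2} {g : Lp ℂ q (volume : Measure (Tan n))} (hfg : IsTrace f g) :
    ∫ y, kern v S z (x.1 - y, x.2) * g y =
      -(∫ y in halfSpace n, reflKer (kern v (symDeriv (Fin.last n) S) z) x y * toLq f y) -
      ∫ y in halfSpace n, reflKer (kern v S z) x y * weakGrad n q 1 (by norm_num) f (fun _ => Fin.last n) y := by
  obtain ⟨hp1, hp2, hpq⟩ := holderConjugate_conjExponent hq1 hq2
  obtain ⟨G, hG, hG1, hG2⟩ := exists_smooth_extension hx (h.contDiffOn_reflKer hn ha hz hv x)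
  have e1 : (fun y => reflKer (kern v S z) x y) =ᵐ[halfVol n] G := by
    filter_upwards [ae_halfVol n] with y hy using (hG1 y hy.le).symm
  have e2 : (fun y => reflKer (kern v (symDeriv (Fin.last n) S) z) x y) =ᵐ[halfVol n]
      fun y => fderiv ℝ G y (basisVec n (Fin.last n)) := by
    filter_upwards [ae_halfVol n] with y hy
    rw [hG2 y hy, h.hasLineDerivAt_reflKer hn ha hz hv (add_pos hx hy), if_pos rfl, one_mul]
  have e3 : ∀ y' : Tan n, G (y', 0) = kern v S z (x.1 - y', x.2) := fun y' => by rw [hG1 _ le_rfl, reflKer, add_zero]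
  have key := integral_fderiv_normal hG ((h.memLp_reflKer hn ha hz hv hp1 hp2 hx).ae_eq e1)
    (((h.deriv_coord ha (Fin.last n)).memLp_reflKer hn ha hz hv hp1 hp2 hx).ae_eq e2)
    (by simpa only [e3] using h.memLp_kern_slice hn ha hz hv hp1 hp2 x.1 hx) hfg
  simp only [e3] at key
  have i1 : ∫ y in halfSpace n, fderiv ℝ G y (basisVec n (Fin.last n)) * toLq f y =
      ∫ y in halfSpace n, reflKer (kern v (symDeriv (Fin.last n) S) z) x y * toLq f y := by
    refine integral_congr_ae ?_
    filter_upwards [e2] with y hy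
    rw [← hy]
  have i2 : ∀ V : Lq n q, ∫ y in halfSpace n, G y * V y = ∫ y in halfSpace n, reflKer (kern v S z) x y * V y := by
    intro V
    refine integral_congr_ae ?_
    filter_upwards [e1] with y hy
    rw [hy]
  rw [i1, i2] at key
  linear_combination key

end Slices

section Representation
open Filter Topology
variable {n : ℕ} {q : ℝ≥0∞} {a : ℝ} {r : ℤ} {A : ℕ → ℝ} {z : ℂ} {v : Tan n → ℂ}
variable {S₀ : Symb n} {x : Space n}

lemma kern_sum (hn : 1 ≤ n) (ha : 0 < a) (hz : z ∈ ℂ₊) (hv : SymbolBound r A z v)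
    {ι : Type*} [Fintype ι] {d : ι → ℤ} {S : ι → Symb n} (hS : ∀ i, IsSym a (d i) (S i)) (c : ι → ℂ) (h : ∀ ξ t, S₀ ξ z t = ∑ i, c i * S i ξ z t) {p : Space n} (hp : 0 < p.2) :
    kern v S₀ z p = ∑ i, c i * kern v (S i) z p := by
  unfold kern tanFourierInv
  have e : ∀ ξ, 𝐞(p.1,ξ) * (v ξ * S₀ ξ z p.2) =
      ∑ i, c i * (𝐞(p.1,ξ) * (v ξ * S i ξ z p.2)) := by
    intro ξ
    rw [h, mul_sum, mul_sum]
    exact sum_congr rfl fun i _ => by ring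
  simp only [e]
  rw [integral_finsetSum _ fun i _ => (integrable_exp_mul_of ((hS i).integrable_mul hn ha hz hv hp) p.1).const_mul _,
    mul_sum]
  refine sum_congr rfl fun i _ => ?_
  rw [integral_const_mul]
  ring

lemma integral_reflKer_sum [Fact (1 ≤ q)] (hq1 : 1 < q) (hq2 : q ≠ ⊤) (hn : 1 ≤ n) (ha : 0 < a)
    (hz : z ∈ ℂ₊) (hv : SymbolBound r A z v)
    {ι : Type*} [Fintype ι] {d : ι → ℤ} {S : ι → Symb n} (hS : ∀ i, IsSym a (d i) (S i)) (c : ι → ℂ) (h : ∀ ξ t, S₀ ξ z t = ∑ i, c i * S i ξ z t) (hx : x ∈ halfSpace n)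
    (V : Lq n q) : ∫ y in halfSpace n, reflKer (kern v S₀ z) x y * V y =
      ∑ i, c i * ∫ y in halfSpace n, reflKer (kern v (S i) z) x y * V y := by
  obtain ⟨hp1, hp2, hpq⟩ := holderConjugate_conjExponent hq1 hq2
  have hi : ∀ i, Integrable (fun y => reflKer (kern v (S i) z) x y * V y) (halfVol n) := fun i =>
    ((hS i).memLp_reflKer hn ha hz hv hp1 hp2 hx).integrable_mul (Lp.memLp V)
  simp only [← integral_const_mul]
  rw [← integral_finsetSum _ fun i _ => (hi i).const_mul _]
  refine integral_congr_ae ?_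
  filter_upwards [ae_halfVol n] with y hy
  have := kern_sum hn ha hz hv hS c h (p := (x.1 - y.1, x.2 + y.2)) (add_pos hx hy)
  simp only [reflKer] at this ⊢
  rw [this, sum_mul]
  exact sum_congr rfl fun i _ => by ring

/-- `B^i t^l e^{-B t}` with `B = √(|ξ|² + a z)`. -/
def expSym (a : ℝ) (i : ℤ) (l : ℕ) (ξ : Tan n) (z : ℂ) (t : ℝ) : ℂ :=
  root a ξ z ^ i * (t : ℂ) ^ l * Complex.exp (-root a ξ z * t)

/-- `(1 - B t) e^{-B t} B^{-2}`. -/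
def tauSym (a : ℝ) (ξ : Tan n) (z : ℂ) (t : ℝ) : ℂ := expSym a (-2) 0 ξ z t + -1 * expSym a (-1) 1 ξ z t

lemma isSym_tauSym : IsSym a (-2) (tauSym a : Symb n) :=
  (IsSym.basic (-2) 0 (by simp)).add ((IsSym.basic (-1) 1 (by norm_num)).smul (-1))

/-- The components of the data that enter the representation. -/
abbrev DataIndex (n : ℕ) := (Unit ⊕ Unit) ⊕ (Fin n ⊕ Fin n)

/-- The symbols of the representation of the boundary operator by volume integrals. -/
def volumeSym (a : ℝ) : DataIndex n → Symb n
  | .inl (.inl _) => fun ξ z t => (-a : ℂ) * tauSym a ξ z t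
  | .inl (.inr _) => fun ξ z t => (-a : ℂ) * (sqz z * expSym a (-2) 1 ξ z t)
  | .inr (.inl _) => tauSym a
  | .inr (.inr j) => symDeriv j.castSucc (expSym a (-2) 1)

/-- The component of the data that is paired with `volumeSym`. -/
def dataProj (n : ℕ) (q : ℝ≥0∞) [Fact (1 ≤ q)] : DataIndex n → DataSpace n q →L[ℂ] Lq n q
  | .inl (.inl _) => (proj (R := ℂ) (φ := fun _ : Fin 0 → Fin (n + 1) => Lq n q) Fin.elim0).comp
      ((snd ℂ _ _).comp (snd ℂ (LqTensor n q 2) (LqTensor n q 1 × LqTensor n q 0)))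
  | .inl (.inr _) => (proj (R := ℂ) (φ := fun _ : Fin 1 → Fin (n + 1) => Lq n q) fun _ => Fin.last n).comp
      ((fst ℂ _ _).comp (snd ℂ (LqTensor n q 2) (LqTensor n q 1 × LqTensor n q 0)))
  | .inr (.inl j) => (proj (R := ℂ) (φ := fun _ : Fin 2 → Fin (n + 1) => Lq n q)
      ![j.castSucc, j.castSucc]).comp (fst ℂ (LqTensor n q 2) (LqTensor n q 1 × LqTensor n q 0))
  | .inr (.inr j) => (proj (R := ℂ) (φ := fun _ : Fin 2 → Fin (n + 1) => Lq n q)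
      ![Fin.last n, j.castSucc]).comp (fst ℂ (LqTensor n q 2) (LqTensor n q 1 × LqTensor n q 0))

lemma isSym_expSym (i : ℤ) (l : ℕ) {d : ℤ} (h : d = i - l) : IsSym a d (expSym a i l : Symb n) :=
  IsSym.basic i l h

lemma isSym_volumeSym (ha : 0 < a) (c : DataIndex n) : IsSym a (-2) (volumeSym a c) := by
  rcases c with (_ | _) | (_ | j)
  · exact isSym_tauSym.smul _
  · exact ((isSym_expSym (-2) 1 (d := -3) (by norm_num)).mulSqrt (by norm_num)).smul _
  · exact isSym_tauSym
  · exact (isSym_expSym (-2) 1 (d := -3) (by norm_num)).deriv_coord ha j.castSucc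

lemma symDeriv_castSucc (j : Fin n) (S : Symb n) (ξ : Tan n) (z : ℂ) (t : ℝ) :
    symDeriv j.castSucc S ξ z t = I * ((ξ j : ℂ) * S ξ z t) := by
  simp only [symDeriv, Fin.lastCases_castSucc]

lemma root_sq_eq (ξ : Tan n) (z : ℂ) : root a ξ z ^ 2 = (∑ j, (ξ j : ℂ) ^ 2) + a * z := by
  rw [root_sq, radicand, norm_sq_eq]
  push_cast
  congr 1
  refine sum_congr rfl fun j _ => ?_
  rw [norm_eq_abs, ← ofReal_pow, sq_abs, ofReal_pow]

lemma root_sq_mul_eq_sum (S S' : Symb n) (ξ : Tan n) (t : ℝ) (h : S' ξ z t = root a ξ z ^ 2 * S ξ z t) :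
    S' ξ z t = ∑ o : Option (Fin n), (o.elim (a * z : ℂ) fun _ => -1) *
      (o.elim S fun j => symDeriv j.castSucc (symDeriv j.castSucc S)) ξ z t := by
  rw [h, root_sq_eq, Fintype.sum_option, add_mul, sum_mul, add_comm]
  simp only [Option.elim_none, Option.elim_some, symDeriv_castSucc]
  congr 1
  refine sum_congr rfl fun j _ => ?_
  linear_combination ((ξ j : ℂ) ^ 2 * S ξ z t) * I_sq

lemma symDeriv_last_expSym (ha : 0 < a) (hz : z ∈ ℂ₊) (ξ : Tan n) (t : ℝ) :
    symDeriv (Fin.last n) (expSym a 0 1) ξ z t = root a ξ z ^ 2 * tauSym a ξ z t := by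
  have hr := root_ne_zero ha hz ξ
  simp only [symDeriv, Fin.lastCases_last]
  have h1 : HasDerivAt (fun t : ℝ => (t : ℂ)) 1 t := ofRealCLM.hasDerivAt
  have h2 := (h1.const_mul (-root a ξ z)).cexp
  have h3 := h1.mul h2
  have h4 : expSym a 0 1 ξ z = (fun t : ℝ => (t : ℂ)) * fun t : ℝ => Complex.exp (-root a ξ z * t) := by
    ext t; simp [expSym]
  have e2 : root a ξ z ^ (-2 : ℤ) = (root a ξ z ^ 2)⁻¹ := by rw [zpow_neg]; norm_cast
  rw [h4, h3.deriv, tauSym, expSym, expSym, e2, zpow_neg_one]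
  field_simp

lemma expSym_zero_one (ha : 0 < a) (hz : z ∈ ℂ₊) (ξ : Tan n) (t : ℝ) :
    expSym a 0 1 ξ z t = root a ξ z ^ 2 * expSym a (-2) 1 ξ z t := by
  have hr := root_ne_zero ha hz ξ
  rw [expSym, expSym, zpow_neg]
  norm_cast
  field_simp

lemma isWeakDeriv_second [Fact (1 ≤ q)] (f : sobolev n q 2) (i j : Fin (n + 1)) :
    IsWeakDeriv (fun _ : Fin 1 => j) (weakGrad n q 1 (by norm_num) f fun _ => i)
      (weakGrad n q 2 le_rfl f ![i, j]) := by
  intro φ hφ hs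
  have h1 : ∫ x in halfSpace n, partialDeriv (fun _ : Fin 1 => i) (partialDeriv (fun _ : Fin 1 => j) φ) x * toLq f x =
      (-1) ^ 1 * ∫ x in halfSpace n, partialDeriv (fun _ : Fin 1 => j) φ x *
        weakGrad n q 1 (by norm_num) f (fun _ => i) x := f.2 1 (fun _ => i) (partialDeriv (fun _ : Fin 1 => j) φ) (hφ.partialDeriv _)
    ((tsupport_partialDeriv_subset _ _).trans hs)
  have h2 : ∫ x in halfSpace n, partialDeriv ![i, j] φ x * toLq f x =
      (-1) ^ 2 * ∫ x in halfSpace n, φ x * weakGrad n q 2 le_rfl f ![i, j] x := f.2 2 ![i, j] φ hφ hs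
  have e : ∀ x, partialDeriv (fun _ : Fin 1 => i) (partialDeriv (fun _ : Fin 1 => j) φ) x = partialDeriv ![i, j] φ x := by
    intro x
    rw [partialDeriv_one]
    have h := hφ.hasLineDerivAt_partialDeriv ![i, j] x
    have ht : Fin.tail ![i, j] = fun _ : Fin 1 => j := by ext k; fin_cases k; rfl
    rw [ht] at h
    exact HasDerivAt.unique (((hφ.partialDeriv _).1.differentiable (by simp) x).hasFDerivAt.hasLineDerivAt _) h
  simp only [e] at h1
  rw [h2] at h1
  linear_combination h1

/-- The boundary operator as a sum of volume integrals of the data. -/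
lemma integral_kern_eq_sum [Fact (1 ≤ q)] (hq1 : 1 < q) (hq2 : q ≠ ⊤) (hn : 1 ≤ n) (ha : 0 < a)
    (hz : z ∈ ℂ₊) (hv : SymbolBound r A z v) (hx : x ∈ halfSpace n)
    {f : sobolev n q 2} {g : Lp ℂ q (volume : Measure (Tan n))} (hfg : IsTrace f g) :
    ∫ y, kern v (expSym a 0 1) z (x.1 - y, x.2) * g y =
      ∑ c, ∫ y in halfSpace n, reflKer (kern v (volumeSym a c) z) x y * dataProj n q c (opT n q z f) y := by
  have hσ : IsSym a (-1) (expSym a 0 1 : Symb n) := isSym_expSym 0 1 (by norm_num)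
  have hσ2 : IsSym a (-3) (expSym a (-2) 1 : Symb n) := isSym_expSym (-2) 1 (by norm_num)
  have hτ : IsSym a (-2) (tauSym a : Symb n) := isSym_tauSym
  rw [hσ.integral_reflKer_normal hq1 hq2 hn ha hz hv hx hfg]
  have hopt : ∀ {d : ℤ} {S : Symb n}, IsSym a d S → ∀ o : Option (Fin n),
      IsSym a (o.elim d fun _ => d + 1 + 1) (o.elim S fun j => symDeriv j.castSucc (symDeriv j.castSucc S)) := by
    rintro d S hS (_ | j)
    · exact hS
    · exact (hS.deriv_coord ha _).deriv_coord ha _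
  rw [integral_reflKer_sum hq1 hq2 hn ha hz hv (hopt hτ) _
      (fun ξ t => root_sq_mul_eq_sum (a := a) _ _ ξ t (symDeriv_last_expSym ha hz ξ t)) hx,
    integral_reflKer_sum hq1 hq2 hn ha hz hv (hopt hσ2) _
      (fun ξ t => root_sq_mul_eq_sum (a := a) _ _ ξ t (expSym_zero_one ha hz ξ t)) hx]
  simp only [Fintype.sum_option, Fintype.sum_sum_type, Option.elim_none, Option.elim_some, Finset.univ_unique,
    Finset.sum_singleton]
  have t1 : ∀ i : Fin (n + 1), IsWeakDeriv (fun _ : Fin 1 => i) (toLq f) (weakGrad n q 1 (by norm_num) f fun _ => i) :=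
    fun i => f.2 1 fun _ => i
  have t2 : ∀ j : Fin n, ∫ y in halfSpace n, reflKer (kern v (symDeriv j.castSucc (symDeriv j.castSucc (tauSym a))) z) x y *
      toLq f y = ∫ y in halfSpace n, reflKer (kern v (volumeSym a (.inr (.inl j))) z) x y *
        dataProj n q (.inr (.inl j)) (opT n q z f) y := fun j => by
    rw [(hτ.deriv_coord ha j.castSucc).integral_reflKer_tangential hq1 hq2 hn ha hz hv hx j (t1 _),
      hτ.integral_reflKer_tangential hq1 hq2 hn ha hz hv hx j (isWeakDeriv_second f j.castSucc j.castSucc)]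
    rfl
  have t3 : ∀ j : Fin n, ∫ y in halfSpace n, reflKer (kern v (symDeriv j.castSucc (symDeriv j.castSucc (expSym a (-2) 1))) z) x y *
      weakGrad n q 1 (by norm_num) f (fun _ => Fin.last n) y =
      ∫ y in halfSpace n, reflKer (kern v (volumeSym a (.inr (.inr j))) z) x y *
        dataProj n q (.inr (.inr j)) (opT n q z f) y := fun j => by
    rw [(hσ2.deriv_coord ha j.castSucc).integral_reflKer_tangential hq1 hq2 hn ha hz hv hx j
      (isWeakDeriv_second f (Fin.last n) j.castSucc)]
    rfl
  have t4 : ∫ y in halfSpace n, reflKer (kern v (volumeSym a (.inl (.inl ()))) z) x y *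
        dataProj n q (.inl (.inl ())) (opT n q z f) y =
      -(a * z * ∫ y in halfSpace n, reflKer (kern v (tauSym a) z) x y * toLq f y) := by
    have e : (dataProj n q (.inl (.inl ())) (opT n q z f) : Lq n q) = z • toLq f := rfl
    rw [e, ← integral_const_mul, ← integral_neg]
    refine integral_congr_ae ?_
    filter_upwards [Lp.coeFn_smul z (toLq f)] with y hy
    rw [hy, Pi.smul_apply, smul_eq_mul]
    simp only [reflKer, volumeSym]
    rw [kern_const_mul (fun _ => (-a : ℂ))]
    ring
  have t5 : ∫ y in halfSpace n, reflKer (kern v (volumeSym a (.inl (.inr ()))) z) x y *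
        dataProj n q (.inl (.inr ())) (opT n q z f) y =
      -(a * z * ∫ y in halfSpace n, reflKer (kern v (expSym a (-2) 1) z) x y *
        weakGrad n q 1 (by norm_num) f (fun _ => Fin.last n) y) := by
    have e : (dataProj n q (.inl (.inr ())) (opT n q z f) : Lq n q) =
      sqz z • weakGrad n q 1 (by norm_num) f (fun _ => Fin.last n) := rfl
    rw [e, ← integral_const_mul, ← integral_neg]
    refine integral_congr_ae ?_
    filter_upwards [Lp.coeFn_smul (sqz z) (weakGrad n q 1 (by norm_num) f (fun _ => Fin.last n))] with y hy
    rw [hy, Pi.smul_apply, smul_eq_mul]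
    simp only [reflKer, volumeSym]
    rw [kern_const_mul (fun _ => (-a : ℂ)), kern_const_mul sqz]
    linear_combination (-a * kern v (expSym a (-2) 1) z (x.1 - y.1, x.2 + y.2) *
      weakGrad n q 1 (by norm_num) f (fun _ => Fin.last n) y) * sqz_sq z
  simp only [t2, t3, PUnit.default_eq_unit] 
  rw [t4, t5]
  simp only [neg_one_mul, Finset.sum_neg_distrib]
  ring

end Representation

section Multiplier
open Filter Topology
variable {n : ℕ} {q : ℝ≥0∞} {a : ℝ} {r : ℤ} {A : ℕ → ℝ} {z : ℂ} {v : Tan n → ℂ}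
variable {φ m : Tan n → ℂ}

lemma continuous_tanFourierInv (hφ : Integrable φ) : Continuous (tanFourierInv φ) := by
  refine continuous_const.mul (continuous_of_dominated (bound := fun ξ => ‖φ ξ‖) (fun x => ?_) (fun x => ?_) hφ.norm ?_)
  · exact (integrable_exp_mul_of hφ x).1
  · exact .of_forall fun ξ => by rw [norm_mul, norm_exp_I_mul, one_mul]
  · exact .of_forall fun ξ => by fun_prop

lemma tanFourier_mul_tanFourierInv (hm : Integrable m) (hφ : Integrable φ) (y : Tan n) :
    tanFourier (fun ξ => m ξ * tanFourierInv φ ξ) y = ∫ x, φ x * tanFourierInv m (x - y) := by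
  have hi : Integrable (uncurry fun ξ x : Tan n => 𝐞(ξ,x) *
      (Complex.exp (-I * (inner ℝ ξ y : ℝ)) * m ξ * φ x)) := by
    have h1 : Integrable (fun p : Tan n × Tan n => m p.1 * φ p.2) := hm.mul_prod hφ
    refine h1.mono ?_ (.of_forall fun p => ?_)
    · refine AEStronglyMeasurable.mul (Continuous.aestronglyMeasurable (by fun_prop)) ?_
      have : AEStronglyMeasurable (fun p : Tan n × Tan n => Complex.exp (-I * (inner ℝ p.1 y : ℝ)) *
          (m p.1 * φ p.2)) := (Continuous.aestronglyMeasurable (by fun_prop)).mul h1.1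
      exact this.congr (.of_forall fun p => (mul_assoc _ _ _).symm)
    · simp only [uncurry, norm_mul, norm_exp_I_mul, one_mul]
      rw [norm_exp_neg_I_mul, one_mul]
  unfold tanFourier tanFourierInv
  have e1 : ∀ ξ : Tan n, Complex.exp (-I * (inner ℝ ξ y : ℝ)) * (m ξ * ((1 / (2 * π) ^ n : ℝ) * ∫ x, 𝐞(ξ,x) * φ x)) =
      (1 / (2 * π) ^ n : ℝ) * ∫ x, 𝐞(ξ,x) *
        (Complex.exp (-I * (inner ℝ ξ y : ℝ)) * m ξ * φ x) := by
    intro ξ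
    have : ∀ x, 𝐞(ξ,x) * (Complex.exp (-I * (inner ℝ ξ y : ℝ)) * m ξ * φ x) =
        (Complex.exp (-I * (inner ℝ ξ y : ℝ)) * m ξ) * (𝐞(ξ,x) * φ x) :=
      fun x => by ring
    simp only [this, integral_const_mul]
    ring
  have e2 : ∀ x : Tan n, φ x * ((1 / (2 * π) ^ n : ℝ) * ∫ ξ, 𝐞((x - y),ξ) * m ξ) = (1 / (2 * π) ^ n : ℝ) * ∫ ξ, 𝐞(ξ,x) *
        (Complex.exp (-I * (inner ℝ ξ y : ℝ)) * m ξ * φ x) := by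
    intro x
    rw [mul_left_comm, ← integral_const_mul (φ x)]
    congr 2
    ext ξ
    rw [inner_sub_left, real_inner_comm, real_inner_comm ξ y, ofReal_sub, mul_sub, sub_eq_add_neg, exp_add, ← neg_mul]
    ring
  simp only [e1, e2, integral_const_mul]
  congr 1
  exact integral_integral_swap hi

lemma isFourierMultiplier_of_kernel [Fact (1 ≤ q)] {p : ℝ≥0∞} [hpq : p.HolderConjugate q] (hp1 : 1 < p)
    (hp2 : p ≠ ⊤) (hq2 : q ≠ ⊤) (hm : Integrable m) (hK : MemLp (tanFourierInv m) p)
    (g : Lp ℂ q (volume : Measure (Tan n))) :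
    IsFourierMultiplier m g fun x => ∫ y, tanFourierInv m (x - y) * g y := by
  intro φ
  have hφ : Integrable φ := φ.integrable
  have hKc := continuous_tanFourierInv hm
  have hp0 : p ≠ 0 := HolderConjugate.ne_zero p q
  have hq0 : q ≠ 0 := (zero_lt_one.trans_le (Fact.out : 1 ≤ q)).ne'
  have hconj : p.toReal.HolderConjugate q.toReal :=
    HolderConjugate.toReal (one_lt_toReal hp1 hp2)
  have hprod : Integrable (uncurry fun x y : Tan n => φ x * tanFourierInv m (x - y) * g y) := by
    have h1 := (integrable_norm_rpow_iff hK.1 hp0 hp2).2 hK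
    have h2 := (integrable_norm_rpow_iff (Lp.memLp g).1 hq0 hq2).2 (Lp.memLp g)
    have h3 : Integrable (fun w : Tan n × Tan n => ‖φ w.2‖ * ‖tanFourierInv m (-(w.1 - w.2))‖ ^ p.toReal) :=
      hφ.norm.convolution_integrand (ContinuousLinearMap.mul ℝ ℝ) h1.comp_neg
    have h4 : Integrable (fun w : Tan n × Tan n => ‖φ w.1‖ * ‖tanFourierInv m (w.1 - w.2)‖ ^ p.toReal) := by
      refine h3.swap.congr (.of_forall fun w => ?_)
      simp
    have h5 : Integrable (fun w : Tan n × Tan n => ‖φ w.1‖ * ‖g w.2‖ ^ q.toReal) := hφ.norm.mul_prod h2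
    refine ((h4.add h5).const_mul 1).mono' ?_ (.of_forall fun w => ?_)
    · exact (Continuous.aestronglyMeasurable (φ.continuous.comp continuous_fst |>.mul
        (hKc.comp (continuous_fst.sub continuous_snd)))).mul (Lp.memLp g).1.comp_snd
    · simp only [uncurry, norm_mul, Pi.add_apply, one_mul]
      rw [mul_assoc, ← mul_add]
      exact mul_le_mul_of_nonneg_left (hconj.mul_le_add (norm_nonneg _) (norm_nonneg _)) (norm_nonneg _)
  have e1 : ∀ x, (∫ y, tanFourierInv m (x - y) * g y) * φ x = ∫ y, φ x * tanFourierInv m (x - y) * g y := by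
    intro x
    rw [← integral_mul_const]
    congr 1
    ext y
    ring
  have e2 : ∀ y, g y * tanFourier (fun ξ => m ξ * tanFourierInv φ ξ) y =
      ∫ x, φ x * tanFourierInv m (x - y) * g y := by
    intro y
    rw [tanFourier_mul_tanFourierInv hm hφ, ← integral_const_mul]
    congr 1
    ext x
    ring
  simp only [e1, e2]
  refine ⟨?_, hprod.integral_prod_left, hprod.integral_prod_right, integral_integral_swap hprod⟩
  refine hm.mul_bdd (c := ∫ ξ, ‖φ ξ‖) (continuous_tanFourierInv hφ).aestronglyMeasurable
    (.of_forall fun x => norm_tanFourierInv_le _ x)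

lemma IsFourierMultiplier.congr {σ g h h' : Tan n → ℂ} (hh : IsFourierMultiplier σ g h) (e : h =ᵐ[volume] h') :
    IsFourierMultiplier σ g h' := by
  intro φ
  obtain ⟨h1, h2, h3, h4⟩ := hh φ
  have e' : (fun x => h x * φ x) =ᵐ[volume] fun x => h' x * φ x := by
    filter_upwards [e] with x hx
    rw [hx]
  exact ⟨h1, h2.congr e', h3, (integral_congr_ae e').symm.trans h4⟩

/-- A function given by the volume representation is the value of the boundary operator. -/
lemma isBoundaryOperatorValue_of_ae [Fact (1 ≤ q)] (hq1 : 1 < q) (hq2 : q ≠ ⊤) (hn : 1 ≤ n) (ha : 0 < a)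
    {w : Tan n → ℂ → ℂ} (hz : z ∈ ℂ₊) (hv : SymbolBound r A z fun ξ => w ξ z) {f : sobolev n q 2}
    {u : Lq n q} (hu : u =ᵐ[halfVol n] fun x => ∑ c, ∫ y in halfSpace n,
      reflKer (kern (fun ξ => w ξ z) (volumeSym a c) z) x y * dataProj n q c (opT n q z f) y) :
    IsBoundaryOperatorValue w a z f u := by
  obtain ⟨hp1, hp2, hpq⟩ := holderConjugate_conjExponent hq1 hq2
  obtain ⟨g, hg⟩ := exists_trace hq2 f
  refine ⟨g, hg, ?_⟩
  have hu' : u =ᵐ[halfVol n] fun x => ∫ y, kern (fun ξ => w ξ z) (expSym a 0 1) z (x.1 - y, x.2) * g y := by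
    filter_upwards [hu, ae_halfVol n] with x hx hx0
    rw [hx, integral_kern_eq_sum hq1 hq2 hn ha hz hv hx0 hg]
  rw [halfVol_eq_prod] at hu'
  have hswap := Measure.ae_ae_of_ae_prod (Measure.measurePreserving_swap.quasiMeasurePreserving.ae hu')
  filter_upwards [hswap, ae_restrict_mem measurableSet_Ioi] with t ht ht0r
  have hσ : IsSym a (-1) (expSym a 0 1 : Symb n) := isSym_expSym 0 1 (by norm_num)
  have e : boundarySymbol w a z t = fun ξ => w ξ z * expSym a 0 1 ξ z t := by
    ext ξ
    simp only [boundarySymbol, expSym, zpow_zero, one_mul, pow_one, mul_assoc]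
    rfl
  rw [e]
  refine IsFourierMultiplier.congr (isFourierMultiplier_of_kernel hp1 hp2 hq2 (hσ.integrable_mul hn ha hz hv ht0r) ?_ g) ?_
  · have := (hσ.memLp_kern_slice hn ha hz hv hp1 hp2 0 ht0r)
    have h2 := (Measure.measurePreserving_neg (volume : Measure (Tan n)))
    have h3 := this.comp_measurePreserving h2
    refine h3.ae_eq (.of_forall fun x => ?_)
    simp [kern]
  · filter_upwards [ht] with x hx using hx.symm

end Multiplier

section Cauchy
open Filter Topology

variable {w : ℂ}
lemma integral_horizontal_eq_zero {G : ℂ → ℂ} {ε K p : ℝ} (hε : 0 < ε) (hp : 1 < p)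
    (hG : ∀ w : ℂ, ε ≤ w.im → DifferentiableAt ℂ G w)
    (hK : ∀ w : ℂ, ε ≤ w.im → ‖G w‖ ≤ K * (1 + ‖w‖) ^ (-p)) : ∫ x : ℝ, G (x + ε * I) = 0 := by
  have hK0 : 0 ≤ K := by
    have h := (norm_nonneg _).trans (hK (ε * I) (by simp))
    have : 0 < (1 + ‖(ε : ℂ) * I‖) ^ (-p) := Real.rpow_pos_of_pos (by positivity) _
    exact nonneg_of_mul_nonneg_left h this
  have hcont : Continuous fun x : ℝ => G (x + ε * I) := by
    refine continuous_iff_continuousAt.2 fun x => ?_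
    exact (hG (x + ε * I) (by simp)).continuousAt.comp (f := fun x : ℝ => (x : ℂ) + ε * I) (by fun_prop)
  have hint : Integrable fun x : ℝ => G (x + ε * I) := by
    have h1 : Integrable fun x : ℝ => (1 + ‖x‖) ^ (-p) := integrable_one_add_norm (by simpa using hp)
    refine (h1.const_mul K).mono' hcont.aestronglyMeasurable (.of_forall fun x => ?_)
    refine (hK _ (by simp)).trans (mul_le_mul_of_nonneg_left ?_ hK0)
    refine Real.rpow_le_rpow_of_nonpos (by positivity) ?_ (by linarith)
    have := abs_re_le_norm (x + ε * I)
    simp only [add_re, ofReal_re, mul_re, I_re, mul_zero, ofReal_im, I_im, mul_one, sub_zero, add_zero] at this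
    rw [norm_eq_abs]
    linarith
  have hlim := intervalIntegral_tendsto_integral hint tendsto_neg_atTop_atBot tendsto_id
  refine tendsto_nhds_unique hlim ?_
  refine squeeze_zero_norm' (a := fun T => 4 * K * T ^ (-(p - 1))) ?_ ?_
  swap
  · simpa using (tendsto_rpow_neg_atTop (by linarith : 0 < p - 1)).const_mul (4 * K)
  filter_upwards [eventually_gt_atTop 0] with T hT
  have hTm : ∀ w : ℂ, ε ≤ w.im → T ≤ ‖w‖ → ‖G w‖ ≤ K * T ^ (-p) := fun w hw hTw =>
    (hK w hw).trans (mul_le_mul_of_nonneg_left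
      (Real.rpow_le_rpow_of_nonpos hT (by linarith) (by linarith)) hK0)
  have hrect := Complex.integral_boundary_rect_eq_zero_of_differentiableOn G (⟨-T, ε⟩ : ℂ) (⟨T, ε + T⟩ : ℂ)
    (fun w hw => (hG w (by
      have h2 := (Complex.mem_reProdIm.1 hw).2
      rw [uIcc_of_le (by linarith : ε ≤ ε + T)] at h2
      exact h2.1)).differentiableWithinAt)
  simp only at hrect
  have b1 : ‖∫ x : ℝ in (-T)..T, G (x + (ε + T : ℝ) * I)‖ ≤ K * T ^ (-p) * |T - -T| := by
    refine intervalIntegral.norm_integral_le_of_norm_le_const fun x _ => hTm _ (by simp [hT.le]) ?_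
    have := abs_im_le_norm (x + (ε + T : ℝ) * I)
    simp only [add_im, ofReal_im, mul_im, ofReal_re, I_im, mul_one, I_re, mul_zero, add_zero, zero_add] at this
    rw [abs_of_pos (by linarith)] at this
    linarith
  have b2 : ∀ τ : ℝ, |τ| = T → ‖∫ y : ℝ in ε..(ε + T), G (τ + y * I)‖ ≤ K * T ^ (-p) * |ε + T - ε| := by
    intro τ hτ
    refine intervalIntegral.norm_integral_le_of_norm_le_const fun y hy => hTm _ ?_ ?_
    · rw [uIoc_of_le (by linarith)] at hy
      simpa using hy.1.le
    · have := abs_re_le_norm (τ + y * I)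
      simpa [hτ] using this
  have b3 := b2 T (abs_of_pos hT)
  have b4 := b2 (-T) (by rw [abs_neg, abs_of_pos hT])
  have e : ∫ x : ℝ in (-T)..T, G (x + ε * I) = (∫ x : ℝ in (-T)..T, G (x + (ε + T : ℝ) * I)) -
      I • (∫ y : ℝ in ε..(ε + T), G ((T : ℝ) + y * I)) +
      I • ∫ y : ℝ in ε..(ε + T), G ((-T : ℝ) + y * I) := by
    linear_combination hrect
  have hTp : T * T ^ (-p) = T ^ (-(p - 1)) := by rw [show -(p - 1) = 1 + -p by ring, rpow_add hT, Real.rpow_one]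
  have hI : ∀ w : ℂ, ‖I • w‖ = ‖w‖ := fun w => by rw [norm_smul, norm_I, one_mul]
  change ‖∫ x : ℝ in (-T)..T, G (x + ε * I)‖ ≤ _
  rw [e]
  refine (norm_add_le _ _).trans ((add_le_add_left (norm_sub_le _ _) _).trans ?_)
  rw [hI, hI, ← hTp]
  rw [show |T - -T| = 2 * T by rw [abs_of_nonneg (by linarith)]; ring] at b1
  rw [show |ε + T - ε| = T by rw [abs_of_nonneg (by linarith)]; ring] at b3 b4
  nlinarith

/-- The Poisson kernel of the half-plane. -/
def poissonHalf (ε s : ℝ) : ℝ := ε / (π * (s ^ 2 + ε ^ 2))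

/-- The conjugate Poisson kernel of the half-plane. -/
def conjPoisson (ε s : ℝ) : ℝ := s / (π * (s ^ 2 + ε ^ 2))

variable {ε : ℝ}

lemma continuous_poissonHalf (hε : 0 < ε) : Continuous (poissonHalf ε) :=
  continuous_const.div (by fun_prop) fun s => by positivity

lemma continuous_conjPoisson (hε : 0 < ε) : Continuous (conjPoisson ε) :=
  continuous_id.div (by fun_prop) fun s => by positivity

lemma poissonHalf_pos (hε : 0 < ε) (s : ℝ) : 0 < poissonHalf ε s := by
  unfold poissonHalf; positivity

lemma cauchyKernel_eq (hε : 0 < ε) (s : ℝ) : I / π * (s + ε * I)⁻¹ =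
    (poissonHalf ε s : ℂ) + I * (conjPoisson ε s : ℂ) := by
  have h0 : ((s ^ 2 + ε ^ 2 : ℝ) : ℂ) ≠ 0 := by rw [Complex.ofReal_ne_zero]; positivity
  have h1 : (s + ε * I : ℂ) ≠ 0 := by
    intro h
    have := congrArg im h
    simp [hε.ne'] at this
  have hpi : (π : ℂ) ≠ 0 := by simp [pi_ne_zero]
  have h2 : ((s ^ 2 + ε ^ 2 : ℝ) : ℂ) = (s + ε * I) * (s - ε * I) := by
    push_cast
    linear_combination ((ε : ℂ) ^ 2) * I_sq
  rw [poissonHalf, conjPoisson]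
  push_cast at h2 h0 ⊢
  rw [h2] at h0 ⊢
  have h3 := right_ne_zero_of_mul h0
  have h4 : (ε : ℂ) + I * s = I * (s - ε * I) := by linear_combination (ε : ℂ) * I_sq
  have h5 : (ε : ℂ) / (π * ((s + ε * I) * (s - ε * I))) + I * (s / (π * ((s + ε * I) * (s - ε * I)))) =
      I * (s - ε * I) / (π * ((s + ε * I) * (s - ε * I))) := by
    rw [← h4]; ring
  rw [h5]
  generalize (s - ε * I : ℂ) = Y at h3
  generalize (s + ε * I : ℂ) = X at h1
  field_simp

/-- `(i/π) ∫ f(s) / (w - s) ds`. -/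
def cauchyIntegral (f : ℝ → ℝ) (w : ℂ) : ℂ := ∫ s : ℝ, (f s : ℂ) * (I / π * (w - s)⁻¹)

variable {f : ℝ → ℝ} {R : ℝ}

lemma le_norm_sub_of_im (hε : 0 < ε) (hw : ε ≤ w.im) {s : ℝ} (hs : |s| ≤ R) :
    1 + ‖w‖ ≤ ((1 + R) / ε + 1) * ‖w - s‖ := by
  have h1 : ε ≤ ‖w - s‖ := by
    have := abs_im_le_norm (w - s)
    simp only [sub_im, ofReal_im, sub_zero] at this
    exact (hw.trans (le_abs_self _)).trans this
  have h2 : ‖w‖ ≤ ‖w - s‖ + R := by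
    have := norm_add_le (w - s) (s : ℂ)
    rw [sub_add_cancel, norm_real] at this
    exact this.trans (by simpa using hs)
  have hR : 0 ≤ 1 + R := by linarith [abs_nonneg s]
  have h3 : 1 + R ≤ (1 + R) / ε * ‖w - s‖ := by
    rw [div_mul_eq_mul_div, le_div_iff₀ hε]
    exact mul_le_mul_of_nonneg_left h1 hR
  linarith

lemma norm_cauchyIntegrand_le (hε : 0 < ε) (hR : ∀ s, R < |s| → f s = 0) (hw : ε ≤ w.im) (s : ℝ) :
    ‖(f s : ℂ) * (I / π * (w - s)⁻¹)‖ ≤ |f s| * (((1 + R) / ε + 1) / (1 + ‖w‖)) := by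
  rcases lt_or_ge R |s| with h | h
  · simp [hR s h]
  have hw0 : 0 < 1 + ‖w‖ := by positivity
  have h1 := le_norm_sub_of_im hε hw h
  have hD : 0 < (1 + R) / ε + 1 := by
    have : 0 ≤ R := (abs_nonneg s).trans h
    positivity
  have h2 : 0 < ‖w - s‖ := by
    by_contra h'
    nlinarith [not_lt.1 h']
  rw [norm_mul, norm_mul, norm_div, norm_I, norm_real, norm_real, norm_of_nonneg pi_pos.le, norm_inv, norm_eq_abs]
  refine mul_le_mul_of_nonneg_left ?_ (abs_nonneg _)
  refine (inv_pi_mul_le (by positivity)).trans ?_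
  rw [le_div_iff₀ hw0, inv_mul_le_iff₀ h2, mul_comm]
  exact h1

lemma norm_cauchyIntegral_le (hε : 0 < ε) (hf : Integrable f) (hR : ∀ s, R < |s| → f s = 0)
    (hw : ε ≤ w.im) : ‖cauchyIntegral f w‖ ≤ ((∫ s, |f s|) * ((1 + R) / ε + 1)) * (1 + ‖w‖)⁻¹ := by
  refine (norm_integral_le_of_norm_le (hf.abs.mul_const _)
    (.of_forall (norm_cauchyIntegrand_le hε hR hw))).trans (le_of_eq ?_)
  rw [integral_mul_const]
  ring

lemma differentiableAt_cauchyIntegral (hf : Integrable f) (hw : 0 < w.im) :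
    DifferentiableAt ℂ (cauchyIntegral f) w := by
  have hmeas : ∀ w : ℂ, 0 < w.im → AEStronglyMeasurable (fun s : ℝ => (f s : ℂ) * (I / π * (w - s)⁻¹)) := by
    intro w hw
    refine (continuous_ofReal.comp_aestronglyMeasurable hf.1).mul (Continuous.aestronglyMeasurable ?_)
    refine continuous_const.mul (Continuous.inv₀ (by fun_prop) fun s h => ?_)
    have := congrArg im h
    simp [hw.ne'] at this
  have him : ∀ (w : ℂ) (s : ℝ), |w.im| ≤ ‖w - s‖ := fun w s => by
    have := abs_im_le_norm (w - s)
    simpa using this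
  have hnear : {w' : ℂ | w.im / 2 < w'.im} ∈ 𝓝 w :=
    (isOpen_lt continuous_const Complex.continuous_im).mem_nhds (show w.im / 2 < w.im from half_lt_self hw)
  refine (hasDerivAt_integral_of_dominated_loc_of_deriv_le (F := fun (w : ℂ) (s : ℝ) => (f s : ℂ) * (I / π * (w - s)⁻¹))
    (F' := fun (w : ℂ) (s : ℝ) => (f s : ℂ) * (I / π * (-1 / (w - s) ^ 2)))
    (bound := fun s => |f s| * ((w.im / 2) ^ 2)⁻¹) hnear ?_ ?_ ?_ ?_ (hf.abs.mul_const _) ?_).2.differentiableAt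
  · filter_upwards [hnear] with w' hw'
    exact hmeas w' ((half_pos hw).trans hw')
  · refine (hf.abs.mul_const (w.im)⁻¹).mono' (hmeas w hw) (.of_forall fun s => ?_)
    rw [norm_mul, norm_mul, norm_div, norm_I, norm_real, norm_real, norm_of_nonneg pi_pos.le, norm_inv, norm_eq_abs]
    refine mul_le_mul_of_nonneg_left ?_ (abs_nonneg _)
    refine (inv_pi_mul_le (by positivity)).trans ?_
    exact inv_anti₀ hw ((le_abs_self _).trans (him w s))
  · refine (continuous_ofReal.comp_aestronglyMeasurable hf.1).mul (Continuous.aestronglyMeasurable ?_)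
    refine continuous_const.mul (Continuous.div continuous_const (by fun_prop) fun s h => ?_)
    have := congrArg im (pow_eq_zero_iff (two_ne_zero) |>.1 h)
    simp [hw.ne'] at this
  · refine .of_forall fun s w' hw' => ?_
    have hw'2 : w.im / 2 < w'.im := hw'
    rw [norm_mul, norm_mul, norm_div, norm_div, norm_neg, norm_one, norm_I, norm_real, norm_real,
      norm_of_nonneg pi_pos.le, norm_pow, norm_eq_abs]
    refine mul_le_mul_of_nonneg_left ?_ (abs_nonneg _)
    refine (inv_pi_mul_le (by positivity)).trans ?_
    rw [one_div]
    refine inv_anti₀ (by positivity) (pow_le_pow_left₀ (by positivity) ?_ 2)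
    exact hw'2.le.trans ((le_abs_self _).trans (him w' s))
  · refine .of_forall fun s w' hw' => ?_
    have hw'2 : w.im / 2 < w'.im := hw'
    have hne : w' - s ≠ 0 := fun h => by
      have := congrArg im h
      simp only [sub_im, ofReal_im, sub_zero, Complex.zero_im] at this
      linarith
    exact ((((hasDerivAt_id w').sub_const (s : ℂ)).inv hne).const_mul _).const_mul _

lemma integrable_kernel_mul {k : ℝ → ℝ} (hk : Continuous k) {C : ℝ} (hC : ∀ s, |k s| ≤ C) (hf : Integrable f) (x : ℝ) :
    Integrable fun s => k (x - s) * f s :=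
  hf.bdd_mul (c := C) (hk.comp (by fun_prop)).aestronglyMeasurable (.of_forall fun s => hC _)

lemma abs_poissonHalf_le (hε : 0 < ε) (s : ℝ) : |poissonHalf ε s| ≤ ε⁻¹ := by
  rw [abs_of_pos (poissonHalf_pos hε s), poissonHalf, div_le_iff₀ (by positivity), inv_mul_eq_div, le_div_iff₀ hε]
  nlinarith [pi_gt_three, sq_nonneg s, sq_nonneg ε]

lemma abs_conjPoisson_le (hε : 0 < ε) (s : ℝ) : |conjPoisson ε s| ≤ ε⁻¹ := by
  have h : 0 < π * (s ^ 2 + ε ^ 2) := by positivity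
  rw [conjPoisson, abs_div, abs_of_pos h, div_le_iff₀ h, inv_mul_eq_div, le_div_iff₀ hε]
  have h1 := pi_gt_three
  have h2 : 2 * (|s| * ε) ≤ s ^ 2 + ε ^ 2 := by
    have := two_mul_le_add_sq |s| ε
    rw [sq_abs] at this
    linarith
  nlinarith [sq_nonneg s, sq_nonneg ε]

lemma cauchyIntegral_eq (hε : 0 < ε) (hf : Integrable f) (x : ℝ) : cauchyIntegral f (x + ε * I) =
    ((∫ s, poissonHalf ε (x - s) * f s : ℝ) : ℂ) + ((∫ s, conjPoisson ε (x - s) * f s : ℝ) : ℂ) * I := by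
  have h1 := integrable_kernel_mul (continuous_poissonHalf hε) (abs_poissonHalf_le hε) hf x
  have h2 := integrable_kernel_mul (continuous_conjPoisson hε) (abs_conjPoisson_le hε) hf x
  rw [cauchyIntegral, ← integral_complex_ofReal, ← integral_complex_ofReal, ← integral_mul_const, ← integral_add h1.ofReal (h2.ofReal.mul_const _)]
  refine integral_congr_ae (.of_forall fun s => ?_)
  have := cauchyKernel_eq hε (x - s)
  push_cast at this ⊢
  rw [show (x + ε * I - s : ℂ) = x - s + ε * I by ring, this]
  ring

end Cauchy

section Riesz
open Filter Topology

variable {p : ℝ} {f : ℝ → ℝ}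
lemma exists_abs_im_rpow_le (hp1 : 1 < p) (hp2 : p ≤ 2) : ∃ A B : ℝ, 0 ≤ A ∧ 0 ≤ B ∧
    ∀ w : ℂ, 0 < w.re → |w.im| ^ p ≤ A * w.re ^ p - B * (w ^ (p : ℂ)).re := by
  have hpi := pi_pos
  have hp0 : 0 < p := by linarith
  set θ0 := π / 4 * (1 + 1 / p) with hθ
  have hpθ : p * θ0 = π / 4 * (p + 1) := by rw [hθ]; field_simp
  have hθ0 : 0 < θ0 := by positivity
  have hθ1 : θ0 < π / 2 := by
    have : 1 / p < 1 := by rw [div_lt_one hp0]; exact hp1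
    rw [hθ]; nlinarith
  have hc0 : cos (p * θ0) < 0 := by
    apply Real.cos_neg_of_pi_div_two_lt_of_lt <;> rw [hpθ] <;> nlinarith
  have hcos : 0 < cos θ0 := Real.cos_pos_of_mem_Ioo ⟨by linarith, hθ1⟩
  set B := -(cos (p * θ0))⁻¹ with hB
  have hB0 : 0 < B := by rw [hB, neg_pos]; exact inv_lt_zero.2 hc0
  have hcp : 0 < cos θ0 ^ p := Real.rpow_pos_of_pos hcos _
  refine ⟨(1 + B) / cos θ0 ^ p, B, by positivity, hB0.le, fun w hw => ?_⟩
  set θ := |arg w| with hθw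
  have hw0 : w ≠ 0 := fun h => by simp [h] at hw
  have hn : 0 < ‖w‖ := norm_pos_iff.2 hw0
  have hθlt : θ < π / 2 := Complex.abs_arg_lt_pi_div_two_iff.2 (Or.inl hw)
  have hre : w.re = ‖w‖ * cos θ := by rw [hθw, Real.cos_abs, Complex.cos_arg hw0]; field_simp
  have him : |w.im| = ‖w‖ * |sin (arg w)| := by rw [Complex.sin_arg, abs_div, abs_of_pos hn]; field_simp
  have hcosθ : 0 < cos θ := Real.cos_pos_of_mem_Ioo ⟨by linarith [abs_nonneg (arg w)], hθlt⟩
  rw [Complex.cpow_ofReal_re, hre, him, mul_rpow hn.le (abs_nonneg _), mul_rpow hn.le hcosθ.le]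
  have hcc : cos (arg w * p) = cos (p * θ) := by rw [hθw, ← Real.cos_abs, abs_mul, abs_of_pos hp0, mul_comm]
  rw [hcc]
  have hs : |sin (arg w)| ^ p ≤ 1 := Real.rpow_le_one (abs_nonneg _) (Real.abs_sin_le_one _) hp0.le
  have key : |sin (arg w)| ^ p ≤
      (1 + B) / cos θ0 ^ p * cos θ ^ p - B * cos (p * θ) := by
    rcases le_or_gt θ0 θ with h | h
    · have h1 : cos (p * θ) ≤ cos (p * θ0) := by
        refine Real.cos_le_cos_of_nonneg_of_le_pi (by positivity) ?_ (mul_le_mul_of_nonneg_left h hp0.le)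
        nlinarith
      have h2 : 1 ≤ -(B * cos (p * θ)) := by
        have : B * cos (p * θ0) = -1 := by rw [hB, neg_mul, inv_mul_cancel₀ hc0.ne]
        nlinarith
      have h3 : 0 ≤ (1 + B) / cos θ0 ^ p * cos θ ^ p := by
        have := rpow_nonneg hcosθ.le p
        positivity
      linarith
    · have h1 : cos θ0 ≤ cos θ := Real.cos_le_cos_of_nonneg_of_le_pi (abs_nonneg _) (by linarith) h.le
      have h2 : 1 + B ≤ (1 + B) / cos θ0 ^ p * cos θ ^ p := by
        rw [div_mul_eq_mul_div, le_div_iff₀ hcp]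
        exact mul_le_mul_of_nonneg_left (Real.rpow_le_rpow hcos.le h1 hp0.le) (by linarith)
      nlinarith [Real.cos_le_one (p * θ)]
  have hnp : 0 ≤ ‖w‖ ^ p := by positivity
  nlinarith [mul_le_mul_of_nonneg_left key hnp]

lemma lintegral_poissonHalf_le {ε : ℝ} (hε : 0 < ε) : ∫⁻ s, ofReal (poissonHalf ε s) ≤ 1 := by
  have h1 : ∀ s, poissonHalf ε s = (π * ε)⁻¹ * (1 + (s / ε) ^ 2)⁻¹ := by
    intro s
    have : π ≠ 0 := pi_ne_zero
    rw [poissonHalf]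
    field_simp
    ring
  have hi : Integrable fun s : ℝ => (1 + (s / ε) ^ 2)⁻¹ := integrable_inv_one_add_sq.comp_div hε.ne'
  have hi' : Integrable (poissonHalf ε) := by
    rw [show poissonHalf ε = _ from funext h1]
    exact hi.const_mul _
  rw [← ofReal_integral_eq_lintegral_ofReal hi' (.of_forall fun s => (poissonHalf_pos hε s).le)]
  simp only [h1]
  rw [integral_const_mul, Measure.integral_comp_div (fun s : ℝ => (1 + s ^ 2)⁻¹), integral_univ_inv_one_add_sq,
    abs_of_pos hε, smul_eq_mul, mul_comm ε, inv_mul_cancel₀ (by have := pi_pos; positivity), ENNReal.ofReal_one]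

lemma lintegral_convolution_rpow_le {k f : ℝ → ℝ≥0∞} (hk : Measurable k) (hk1 : ∫⁻ s, k s ≤ 1)
    (hf : Measurable f) (hp : 1 < p) : ∫⁻ x, (∫⁻ s, k (x - s) * f s) ^ p ≤ ∫⁻ s, f s ^ p := by
  have hp0 : 0 < p := by linarith
  have hpq := Real.HolderConjugate.conjExponent hp
  have h1 : ∀ x, (∫⁻ s, k (x - s) * f s) ^ p ≤ ∫⁻ s, k (x - s) * f s ^ p := by
    intro x
    have hkx : ∫⁻ s, k (x - s) ≤ 1 := by
      rw [lintegral_sub_left_eq_self (fun s => k s)]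
      exact hk1
    have e : ∀ s, k (x - s) * f s = k (x - s) ^ (1 / p) * f s * k (x - s) ^ (1 / p.conjExponent) := by
      intro s
      rw [mul_right_comm, ← ENNReal.rpow_add_of_nonneg _ _ (by positivity) (by have := hpq.symm.pos; positivity)]
      rw [one_div, one_div, hpq.inv_add_inv_eq_one, rpow_one]
    have h2 := lintegral_mul_le_Lp_mul_Lq volume hpq (f := fun s => k (x - s) ^ (1 / p) * f s)
      (g := fun s => k (x - s) ^ (1 / p.conjExponent)) (by fun_prop) (by fun_prop)
    have h3 : ∀ s, (k (x - s) ^ (1 / p) * f s) ^ p = k (x - s) * f s ^ p := fun s => by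
      rw [mul_rpow_of_nonneg _ _ hp0.le, ← rpow_mul, one_div_mul_cancel hp0.ne', rpow_one]
    have h4 : ∀ s, (k (x - s) ^ (1 / p.conjExponent)) ^ p.conjExponent = k (x - s) := fun s => by
      rw [← rpow_mul, one_div_mul_cancel hpq.symm.pos.ne', rpow_one]
    simp only [Pi.mul_apply, h3, h4] at h2
    simp only [← e] at h2
    calc _ ≤ ((∫⁻ s, k (x - s) * f s ^ p) ^ (1 / p) * 1) ^ p := by
          refine rpow_le_rpow (h2.trans ?_) hp0.le
          gcongr
          exact ENNReal.rpow_le_one hkx (by have := hpq.symm.pos; positivity)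
      _ = _ := by rw [mul_one, ← rpow_mul, one_div_mul_cancel hp0.ne', rpow_one]
  calc _ ≤ ∫⁻ x, ∫⁻ s, k (x - s) * f s ^ p := lintegral_mono h1
    _ = ∫⁻ s, ∫⁻ x, k (x - s) * f s ^ p := lintegral_lintegral_swap (by fun_prop)
    _ = ∫⁻ s, (∫⁻ x, k x) * f s ^ p := by
        refine lintegral_congr fun s => ?_
        rw [lintegral_mul_const _ (by fun_prop), lintegral_sub_right_eq_self (fun x => k x)]
    _ ≤ ∫⁻ s, f s ^ p := by
        refine lintegral_mono fun s => ?_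
        exact mul_le_of_le_one_left' hk1

/-- The conjugate Poisson integral. -/
def conjOp (ε : ℝ) (f : ℝ → ℂ) (x : ℝ) : ℂ := ∫ s, (conjPoisson ε (x - s) : ℂ) * f s

lemma conjOp_ofReal (ε : ℝ) (f : ℝ → ℝ) (x : ℝ) :
    conjOp ε (fun s => (f s : ℂ)) x = ((∫ s, conjPoisson ε (x - s) * f s : ℝ) : ℂ) := by
  rw [conjOp, ← integral_complex_ofReal]
  push_cast
  rfl

/-- Bounded measurable functions with bounded support and nonnegative values. -/
structure IsBump (f : ℝ → ℝ) : Prop where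
  measurable : Measurable f
  nonneg : ∀ s, 0 ≤ f s
  bounded : ∃ R, ∀ s, f s ≤ R ∧ (R < |s| → f s = 0)

lemma IsBump.integrable_rpow (h : IsBump f) (hp : 0 < p) : Integrable fun s => f s ^ p := by
  obtain ⟨R, hR⟩ := h.bounded
  have hR0 : 0 ≤ R := (h.nonneg 0).trans (hR 0).1
  have h1 : Integrable ((Icc (-R) R).indicator fun _ : ℝ => R ^ p) :=
    (integrable_indicator_iff measurableSet_Icc).2 (integrableOn_const measure_Icc_lt_top.ne)
  refine h1.mono' (h.measurable.pow_const p).aestronglyMeasurable (.of_forall fun s => ?_)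
  rw [norm_of_nonneg (rpow_nonneg (h.nonneg s) _)]
  by_cases hs : s ∈ Icc (-R) R
  · rw [indicator_of_mem hs]
    exact Real.rpow_le_rpow (h.nonneg s) (hR s).1 hp.le
  · rw [indicator_of_notMem hs, (hR s).2 (by rwa [← not_le, abs_le]), zero_rpow hp.ne']

lemma IsBump.integrable (h : IsBump f) : Integrable f := by
  simpa using h.integrable_rpow one_pos

lemma IsBump.lintegral_conjOp_le (hp1 : 1 < p) (hp2 : p ≤ 2) : ∃ C : ℝ≥0∞, C ≠ ⊤ ∧
    ∀ ε : ℝ, 0 < ε → ∀ f : ℝ → ℝ, IsBump f →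
      ∫⁻ x, ‖conjOp ε (fun s => (f s : ℂ)) x‖ₑ ^ p ≤ C * ∫⁻ s, ‖(f s : ℂ)‖ₑ ^ p := by
  obtain ⟨A, B, hA, hB, hAB⟩ := exists_abs_im_rpow_le hp1 hp2
  have hp0 : 0 < p := by linarith
  refine ⟨ofReal A, ofReal_ne_top, fun ε hε f hf => ?_⟩
  have hfi := hf.integrable
  obtain ⟨R, hR⟩ := hf.bounded
  rcases (integral_nonneg_of_ae (μ := volume) (.of_forall hf.nonneg)).eq_or_lt' with h0 | h0
  · have hf0 : f =ᵐ[volume] 0 := (integral_eq_zero_iff_of_nonneg hf.nonneg hfi).1 h0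
    have : ∀ x, conjOp ε (fun s => (f s : ℂ)) x = 0 := fun x => by
      rw [conjOp, integral_eq_zero_of_ae]
      filter_upwards [hf0] with s hs
      simp [hs]
    simp [this, ENNReal.zero_rpow_of_pos hp0]
  set F := cauchyIntegral f
  set u : ℝ → ℝ := fun x => ∫ s, poissonHalf ε (x - s) * f s with hu
  set v : ℝ → ℝ := fun x => ∫ s, conjPoisson ε (x - s) * f s with hv
  have hFre : ∀ y : ℝ, 0 < y → ∀ x : ℝ, 0 < (F (x + y * I)).re := by
    intro y hy x
    simp only [F]
    rw [cauchyIntegral_eq hy hfi]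
    simp only [add_re, ofReal_re, mul_re, I_re, ofReal_im, I_im, mul_zero, zero_mul, sub_zero, add_zero]
    rw [integral_pos_iff_support_of_nonneg (fun s => mul_nonneg (poissonHalf_pos hy _).le (hf.nonneg s))
      (integrable_kernel_mul (continuous_poissonHalf hy) (abs_poissonHalf_le hy) hfi x)]
    rw [integral_pos_iff_support_of_nonneg hf.nonneg hfi] at h0
    refine h0.trans_le (measure_mono fun s hs => ?_)
    exact mul_ne_zero (poissonHalf_pos hy _).ne' hs
  have hFw : ∀ w : ℂ, ε ≤ w.im → 0 < (F w).re := by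
    intro w hw
    have := hFre w.im (hε.trans_le hw) w.re
    rwa [re_add_im] at this
  set K := (∫ s, |f s|) * ((1 + R) / ε + 1)
  have hFK : ∀ w : ℂ, ε ≤ w.im → ‖F w‖ ≤ K * (1 + ‖w‖)⁻¹ := fun w hw =>
    norm_cauchyIntegral_le hε hfi (fun s hs => (hR s).2 hs) hw
  have hGdiff : ∀ w : ℂ, ε ≤ w.im → DifferentiableAt ℂ (fun w => F w ^ (p : ℂ)) w := fun w hw =>
    (differentiableAt_cauchyIntegral hfi (hε.trans_le hw)).cpow (differentiableAt_const _) (Or.inl (hFw w hw))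
  have hGK : ∀ w : ℂ, ε ≤ w.im → ‖F w ^ (p : ℂ)‖ ≤ K ^ p * (1 + ‖w‖) ^ (-p) := by
    intro w hw
    have hw1 : 0 < 1 + ‖w‖ := by positivity
    have hK0 : 0 ≤ K := by
      have := (norm_nonneg _).trans (hFK w hw)
      exact nonneg_of_mul_nonneg_left this (inv_pos.2 hw1)
    rw [norm_cpow_real, rpow_neg hw1.le, ← inv_rpow hw1.le, ← mul_rpow hK0 (by positivity)]
    exact Real.rpow_le_rpow (norm_nonneg _) (hFK w hw) hp0.le
  have hzero := integral_horizontal_eq_zero hε hp1 hGdiff hGK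
  have hcontF : Continuous fun x : ℝ => F (x + ε * I) := continuous_iff_continuousAt.2 fun x =>
    (differentiableAt_cauchyIntegral hfi (by simpa using hε)).continuousAt.comp
      (f := fun x : ℝ => (x : ℂ) + ε * I) (by fun_prop)
  have hFeq : ∀ x : ℝ, F (x + ε * I) = (u x : ℂ) + (v x : ℂ) * I := cauchyIntegral_eq hε hfi
  have hure : ∀ x : ℝ, (F (x + ε * I)).re = u x := fun x => by rw [hFeq]; simp
  have hvim : ∀ x : ℝ, (F (x + ε * I)).im = v x := fun x => by rw [hFeq]; simp
  have hGint : Integrable fun x : ℝ => F (x + ε * I) ^ (p : ℂ) := by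
    have h1 : Integrable fun x : ℝ => (1 + ‖x‖) ^ (-p) := integrable_one_add_norm (by simpa using hp1)
    refine (h1.const_mul (K ^ p)).mono' (Continuous.aestronglyMeasurable ?_) (.of_forall fun x => ?_)
    · refine continuous_iff_continuousAt.2 fun x => ?_
      exact (hGdiff (x + ε * I) (by simp)).continuousAt.comp (f := fun x : ℝ => (x : ℂ) + ε * I) (by fun_prop)
    · refine (hGK _ (by simp)).trans (mul_le_mul_of_nonneg_left ?_ ?_)
      · refine Real.rpow_le_rpow_of_nonpos (by positivity) ?_ (by linarith)
        have := abs_re_le_norm (x + ε * I)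
        simp only [add_re, ofReal_re, mul_re, I_re, mul_zero, ofReal_im, I_im, mul_one, sub_zero, add_zero] at this
        rw [norm_eq_abs]
        linarith
      · have h := (norm_nonneg _).trans (hGK (ε * I) (by simp))
        have : 0 < (1 + ‖(ε : ℂ) * I‖) ^ (-p) := Real.rpow_pos_of_pos (by positivity) _
        exact nonneg_of_mul_nonneg_left h this
  have hupos : ∀ x, 0 < u x := fun x => by rw [← hure]; exact hFw _ (by simp)
  have huc : Continuous u := by
    rw [show u = fun x : ℝ => (F (x + ε * I)).re from funext fun x => (hure x).symm]
    exact Complex.continuous_re.comp hcontF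
  have hvc : Continuous v := by
    rw [show v = fun x : ℝ => (F (x + ε * I)).im from funext fun x => (hvim x).symm]
    exact Complex.continuous_im.comp hcontF
  have hui : Integrable fun x => u x ^ p := by
    refine hGint.norm.mono' (huc.rpow_const fun x => Or.inr hp0.le).aestronglyMeasurable (.of_forall fun x => ?_)
    rw [norm_cpow_real, norm_of_nonneg (rpow_nonneg (hupos x).le _)]
    refine Real.rpow_le_rpow (hupos x).le ?_ hp0.le
    rw [← hure]
    exact (le_abs_self _).trans (abs_re_le_norm _)
  have hvi : Integrable fun x => |v x| ^ p := by
    refine hGint.norm.mono' (hvc.abs.rpow_const fun x => Or.inr hp0.le).aestronglyMeasurable (.of_forall fun x => ?_)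
    rw [norm_cpow_real, norm_of_nonneg (rpow_nonneg (abs_nonneg _) _)]
    refine Real.rpow_le_rpow (abs_nonneg _) ?_ hp0.le
    rw [← hvim]
    exact abs_im_le_norm _
  have hmain : ∫ x, |v x| ^ p ≤ A * ∫ x, u x ^ p := by
    have hGre : Integrable fun x : ℝ => (F (x + ε * I) ^ (p : ℂ)).re := hGint.re
    have h1 : ∫ x, |v x| ^ p ≤ ∫ x : ℝ, (A * u x ^ p - B * (F (x + ε * I) ^ (p : ℂ)).re) := by
      refine integral_mono hvi ((hui.const_mul A).sub (hGre.const_mul B)) fun x => ?_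
      have := hAB (F (x + ε * I)) (hFw _ (by simp))
      rwa [hure, hvim] at this
    refine h1.trans (le_of_eq ?_)
    have h2 : ∫ x : ℝ, (F (x + ε * I) ^ (p : ℂ)).re = 0 := by
      have : ∫ x : ℝ, (F (x + ε * I) ^ (p : ℂ)).re = (∫ x : ℝ, F (x + ε * I) ^ (p : ℂ)).re := integral_re hGint
      rw [this, hzero, Complex.zero_re]
    rw [integral_sub (hui.const_mul A) (hGre.const_mul B), integral_const_mul, integral_const_mul, h2, mul_zero, sub_zero]
  have hJ := lintegral_convolution_rpow_le (k := fun s => ofReal (poissonHalf ε s))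
    (f := fun s => ofReal (f s)) (ENNReal.measurable_ofReal.comp (continuous_poissonHalf hε).measurable)
    (lintegral_poissonHalf_le hε) (ENNReal.measurable_ofReal.comp hf.measurable) hp1
  have e1 : ∫⁻ x, ‖conjOp ε (fun s => (f s : ℂ)) x‖ₑ ^ p = ofReal (∫ x, |v x| ^ p) := by
    rw [ofReal_integral_eq_lintegral_ofReal hvi (.of_forall fun x => rpow_nonneg (abs_nonneg _) _)]
    refine lintegral_congr fun x => ?_
    rw [conjOp_ofReal, ← ofReal_norm, norm_real, norm_eq_abs, ofReal_rpow_of_nonneg (abs_nonneg _) hp0.le]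
  have e2 : ofReal (∫ x, u x ^ p) = ∫⁻ x, (∫⁻ s, ofReal (poissonHalf ε (x - s)) * ofReal (f s)) ^ p := by
    rw [ofReal_integral_eq_lintegral_ofReal hui (.of_forall fun x => rpow_nonneg (hupos x).le _)]
    refine lintegral_congr fun x => ?_
    rw [← ofReal_rpow_of_nonneg (hupos x).le hp0.le, hu]
    simp only
    rw [ofReal_integral_eq_lintegral_ofReal
      (integrable_kernel_mul (continuous_poissonHalf hε) (abs_poissonHalf_le hε) hfi x)
      (.of_forall fun s => mul_nonneg (poissonHalf_pos hε _).le (hf.nonneg s))]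
    simp only [ofReal_mul (poissonHalf_pos hε _).le]
  have e3 : ∫⁻ s, ofReal (f s) ^ p = ∫⁻ s, ‖(f s : ℂ)‖ₑ ^ p := by
    refine lintegral_congr fun s => ?_
    rw [← ofReal_norm, norm_real, norm_of_nonneg (hf.nonneg s)]
  rw [e1, ← e3]
  refine (ofReal_le_ofReal hmain).trans ?_
  rw [ofReal_mul hA, e2]
  exact mul_le_mul_right hJ _

end Riesz

section RieszGeneral
open Filter Topology
variable {p : ℝ≥0∞} {ε : ℝ}
variable {f : ℝ → ℂ} {C : ℝ≥0∞} {g : ℝ → ℂ}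

lemma memLp_conjPoisson (hp1 : 1 < p) (hp2 : p ≠ ⊤) (hε : 0 < ε) : MemLp (conjPoisson ε) p := by
  have hp0 : p ≠ 0 := (zero_lt_one.trans hp1).ne'
  have hpr : 1 < p.toReal := one_lt_toReal hp1 hp2
  have h1 : MemLp (fun s : ℝ => (1 + ‖s‖)⁻¹) p := by
    have hc : Continuous fun s : ℝ => (1 + ‖s‖)⁻¹ := Continuous.inv₀ (by fun_prop) fun y => by positivity
    rw [← integrable_norm_rpow_iff hc.aestronglyMeasurable hp0 hp2]
    refine (integrable_one_add_norm (E := ℝ) (μ := volume) (r := p.toReal) (by simpa using hpr)).congr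
      (.of_forall fun s => ?_)
    have hpos : 0 < 1 + ‖s‖ := by positivity
    have hinv : ‖(1 + ‖s‖)⁻¹‖ = (1 + ‖s‖)⁻¹ := norm_of_nonneg (inv_nonneg.2 hpos.le)
    beta_reduce
    rw [hinv, rpow_neg hpos.le, inv_rpow hpos.le]
  refine (h1.const_mul (ε⁻¹ + 1)).of_le (continuous_conjPoisson hε).aestronglyMeasurable (.of_forall fun s => ?_)
  have hpos : 0 < 1 + ‖s‖ := by positivity
  rw [norm_eq_abs, norm_of_nonneg (by positivity), ← div_eq_mul_inv, le_div_iff₀ hpos, mul_add, mul_one]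
  refine add_le_add (abs_conjPoisson_le hε s) ?_
  have h : 0 < π * (s ^ 2 + ε ^ 2) := by positivity
  rw [conjPoisson, abs_div, abs_of_pos h, norm_eq_abs, div_mul_eq_mul_div, abs_mul_abs_self, div_le_one h]
  nlinarith [pi_gt_three, sq_nonneg s, sq_nonneg ε]

lemma integrable_conjPoisson_mul (hp1 : 1 < p) (hp2 : p ≠ ⊤) (hε : 0 < ε) (hf : MemLp f p) (x : ℝ) :
    Integrable fun s => (conjPoisson ε (x - s) : ℂ) * f s := by
  have : Fact (1 ≤ p) := ⟨hp1.le⟩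
  obtain ⟨hq1, hq2, hpq⟩ := holderConjugate_conjExponent hp1 hp2
  have h1 := ((memLp_conjPoisson hq1 hq2 hε).comp_measurePreserving (volume.measurePreserving_sub_left x)).ofReal (K := ℂ)
  exact h1.integrable_mul hf

lemma aestronglyMeasurable_conjOp (hε : 0 < ε) (hf : AEStronglyMeasurable f) :
    AEStronglyMeasurable (conjOp ε f) := by
  have : AEStronglyMeasurable (fun w : ℝ × ℝ => (conjPoisson ε (w.1 - w.2) : ℂ) * f w.2) :=
    (continuous_ofReal.comp ((continuous_conjPoisson hε).comp
      (continuous_fst.sub continuous_snd))).aestronglyMeasurable.mul hf.comp_snd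
  exact this.integral_prod_right'

lemma lintegral_enorm_add_rpow_le {α : Type*} [MeasurableSpace α] {μ : Measure α} {f g : α → ℂ}
    (hf : AEStronglyMeasurable f μ) {r : ℝ} (hr : 1 ≤ r) :
    ∫⁻ x, ‖f x + g x‖ₑ ^ r ∂μ ≤ 2 ^ (r - 1) * (∫⁻ x, ‖f x‖ₑ ^ r ∂μ + ∫⁻ x, ‖g x‖ₑ ^ r ∂μ) := by
  rw [← lintegral_add_left' (hf.enorm.pow_const r), ← lintegral_const_mul' _ _ (by
    exact rpow_ne_top_of_nonneg (by linarith) (by simp))]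
  refine lintegral_mono fun x => ?_
  exact (rpow_le_rpow (enorm_add_le _ _) (by linarith)).trans (ENNReal.rpow_add_le_mul_rpow_add_rpow _ _ hr)

/-- The conjugate Poisson integrals are bounded on `L_p`, uniformly in `ε`. -/
def ConjBounded (p : ℝ≥0∞) (C : ℝ≥0∞) : Prop := ∀ ε : ℝ, 0 < ε → ∀ f : ℝ → ℂ, MemLp f p →
  ∫⁻ x, ‖conjOp ε f x‖ₑ ^ p.toReal ≤ C * ∫⁻ s, ‖f s‖ₑ ^ p.toReal

lemma lintegral_conjOp_nonneg_le (hp1 : 1 < p) (hp2 : p ≠ ⊤) (hε : 0 < ε) (H : ∀ f : ℝ → ℝ, IsBump f →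
      ∫⁻ x, ‖conjOp ε (fun s => (f s : ℂ)) x‖ₑ ^ p.toReal ≤ C * ∫⁻ s, ‖(f s : ℂ)‖ₑ ^ p.toReal)
    {f : ℝ → ℝ} (hf : Measurable f) (hf0 : ∀ s, 0 ≤ f s) (hfp : MemLp (fun s => (f s : ℂ)) p) :
    ∫⁻ x, ‖conjOp ε (fun s => (f s : ℂ)) x‖ₑ ^ p.toReal ≤ C * ∫⁻ s, ‖(f s : ℂ)‖ₑ ^ p.toReal := by
  have hp : 0 < p.toReal := toReal_pos (zero_lt_one.trans hp1).ne' hp2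
  set F : ℕ → ℝ → ℝ := fun k => (Icc (-(k : ℝ)) k).indicator fun s => min (f s) k with hF
  have hFle : ∀ k s, 0 ≤ F k s ∧ F k s ≤ f s := fun k s => by
    simp only [hF]
    by_cases h : s ∈ Icc (-(k : ℝ)) k
    · rw [indicator_of_mem h]
      exact ⟨le_min (hf0 s) k.cast_nonneg, min_le_left _ _⟩
    · rw [indicator_of_notMem h]
      exact ⟨le_rfl, hf0 s⟩
  have hFb : ∀ k, IsBump (F k) := fun k => by
    refine ⟨(hf.min measurable_const).indicator measurableSet_Icc, fun s => (hFle k s).1, k, fun s => ⟨?_, fun hs => ?_⟩⟩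
    · simp only [hF]
      exact indicator_le' (fun _ _ => min_le_right _ _) (fun _ _ => k.cast_nonneg) s
    · simp only [hF]
      refine indicator_of_notMem (fun h => ?_) _
      rw [mem_Icc, ← abs_le] at h
      linarith
  have hFlim : ∀ s, Tendsto (fun k => F k s) atTop (𝓝 (f s)) := fun s => by
    refine tendsto_const_nhds.congr' ?_
    obtain ⟨N, hN⟩ := exists_nat_ge (max (f s) |s|)
    filter_upwards [eventually_ge_atTop N] with k hk
    have hk' : (N : ℝ) ≤ k := by exact_mod_cast hk
    simp only [hF]
    rw [indicator_of_mem (mem_Icc.2 (abs_le.1 (((le_max_right _ _).trans hN).trans hk'))),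
      min_eq_left (((le_max_left _ _).trans hN).trans hk')]
  have hlim : ∀ x, Tendsto (fun k => conjOp ε (fun s => (F k s : ℂ)) x) atTop (𝓝 (conjOp ε (fun s => (f s : ℂ)) x)) := by
    intro x
    refine tendsto_integral_of_dominated_convergence (fun s => ‖(conjPoisson ε (x - s) : ℂ) * (f s : ℂ)‖) (fun k => ?_)
      (integrable_conjPoisson_mul hp1 hp2 hε hfp x).norm (fun k => .of_forall fun s => ?_)
      (.of_forall fun s => ?_)
    · exact (continuous_ofReal.comp ((continuous_conjPoisson hε).comp
        (continuous_const.sub continuous_id))).aestronglyMeasurable.mul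
        (measurable_ofReal.comp (hFb k).measurable).aestronglyMeasurable
    · rw [norm_mul, norm_mul, norm_real, norm_real, norm_real, norm_of_nonneg (hFle k s).1, norm_of_nonneg (hf0 s)]
      exact mul_le_mul_of_nonneg_left (hFle k s).2 (norm_nonneg _)
    · exact (tendsto_ofReal_complex (hFlim s)).const_mul _
  have hmeas : ∀ k, AEMeasurable fun x => ‖conjOp ε (fun s => (F k s : ℂ)) x‖ₑ ^ p.toReal := fun k =>
    (aestronglyMeasurable_conjOp hε
      (measurable_ofReal.comp (hFb k).measurable).aestronglyMeasurable).enorm.pow_const _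
  calc ∫⁻ x, ‖conjOp ε (fun s => (f s : ℂ)) x‖ₑ ^ p.toReal
      = ∫⁻ x, liminf (fun k => ‖conjOp ε (fun s => (F k s : ℂ)) x‖ₑ ^ p.toReal) atTop := by
        refine lintegral_congr fun x => ?_
        exact (((ENNReal.continuous_rpow_const.tendsto _).comp ((continuous_enorm.tendsto _).comp (hlim x))).liminf_eq).symm
    _ ≤ liminf (fun k => ∫⁻ x, ‖conjOp ε (fun s => (F k s : ℂ)) x‖ₑ ^ p.toReal) atTop := lintegral_liminf_le' hmeas
    _ ≤ liminf (fun _ : ℕ => C * ∫⁻ s, ‖(f s : ℂ)‖ₑ ^ p.toReal) atTop := by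
        refine liminf_le_liminf (.of_forall fun k => (H _ (hFb k)).trans ?_)
        refine mul_le_mul_right (lintegral_mono fun s => rpow_le_rpow ?_ hp.le) _
        rw [← ofReal_norm, ← ofReal_norm, norm_real, norm_real, norm_of_nonneg (hFle k s).1, norm_of_nonneg (hf0 s)]
        exact ofReal_le_ofReal (hFle k s).2
    _ = _ := liminf_const _

lemma conjOp_add (hp1 : 1 < p) (hp2 : p ≠ ⊤) (hε : 0 < ε) (hf : MemLp f p) (hg : MemLp g p) (x : ℝ) :
    conjOp ε (fun s => f s + g s) x = conjOp ε f x + conjOp ε g x := by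
  simp only [conjOp, mul_add]
  exact integral_add (integrable_conjPoisson_mul hp1 hp2 hε hf x) (integrable_conjPoisson_mul hp1 hp2 hε hg x)

lemma conjOp_const_mul (c : ℂ) (f : ℝ → ℂ) (x : ℝ) : conjOp ε (fun s => c * f s) x = c * conjOp ε f x := by
  simp only [conjOp, mul_left_comm _ c, integral_const_mul]

lemma conjOp_congr (h : f =ᵐ[volume] g) : conjOp ε f = conjOp ε g := by
  ext x
  refine integral_congr_ae ?_
  filter_upwards [h] with s hs
  rw [hs]

lemma conjBounded_of_bump (hp1 : 1 < p) (hp2 : p ≠ ⊤) (H : ∀ ε : ℝ, 0 < ε → ∀ f : ℝ → ℝ, IsBump f →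
      ∫⁻ x, ‖conjOp ε (fun s => (f s : ℂ)) x‖ₑ ^ p.toReal ≤ C * ∫⁻ s, ‖(f s : ℂ)‖ₑ ^ p.toReal) :
    ConjBounded p (2 ^ (p.toReal - 1) * 2 * (2 ^ (p.toReal - 1) * 2 * C)) := by
  intro ε hε
  have hp : 0 < p.toReal := toReal_pos (zero_lt_one.trans hp1).ne' hp2
  have hpr : 1 ≤ p.toReal := by
    rw [← toReal_one]
    exact toReal_mono hp2 hp1.le
  have key : ∀ {D : ℝ≥0∞} {f g : ℝ → ℂ} (c : ℂ), ‖c‖ = 1 → MemLp f p → MemLp g p →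
      ∫⁻ x, ‖conjOp ε f x‖ₑ ^ p.toReal ≤ D * ∫⁻ s, ‖f s‖ₑ ^ p.toReal →
      ∫⁻ x, ‖conjOp ε g x‖ₑ ^ p.toReal ≤ D * ∫⁻ s, ‖g s‖ₑ ^ p.toReal →
      (∀ s, ‖f s‖ ≤ ‖f s + c * g s‖) → (∀ s, ‖g s‖ ≤ ‖f s + c * g s‖) →
      ∫⁻ x, ‖conjOp ε (fun s => f s + c * g s) x‖ₑ ^ p.toReal ≤
        2 ^ (p.toReal - 1) * 2 * D * ∫⁻ s, ‖f s + c * g s‖ₑ ^ p.toReal := by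
    intro D f g c hc hf hg h1 h2 h3 h4
    have e : ∀ x, conjOp ε (fun s => f s + c * g s) x = conjOp ε f x + c * conjOp ε g x := fun x => by
      rw [conjOp_add hp1 hp2 hε hf (hg.const_mul c), conjOp_const_mul]
    have hmono : ∀ {k : ℝ → ℂ}, (∀ s, ‖k s‖ ≤ ‖f s + c * g s‖) →
        ∫⁻ s, ‖k s‖ₑ ^ p.toReal ≤ ∫⁻ s, ‖f s + c * g s‖ₑ ^ p.toReal := fun hk =>
      lintegral_mono fun s => rpow_le_rpow (enorm_le_iff_norm_le.2 (hk s)) hp.le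
    have hce : ∀ w : ℂ, ‖c * w‖ₑ = ‖w‖ₑ := fun w => by rw [enorm_mul, ← ofReal_norm, hc, ENNReal.ofReal_one, one_mul]
    simp only [e]
    refine (lintegral_enorm_add_rpow_le (aestronglyMeasurable_conjOp hε hf.1) hpr).trans ?_
    simp only [hce]
    calc _ ≤ 2 ^ (p.toReal - 1) * (D * (∫⁻ s, ‖f s + c * g s‖ₑ ^ p.toReal) + D * ∫⁻ s, ‖f s + c * g s‖ₑ ^ p.toReal) := by
          gcongr
          · exact h1.trans (mul_le_mul_right (hmono h3) _)
          · exact h2.trans (mul_le_mul_right (hmono h4) _)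
      _ = _ := by rw [← two_mul]; ring
  have hreal : ∀ f : ℝ → ℝ, Measurable f → MemLp (fun s => (f s : ℂ)) p →
      ∫⁻ x, ‖conjOp ε (fun s => (f s : ℂ)) x‖ₑ ^ p.toReal ≤
        2 ^ (p.toReal - 1) * 2 * C * ∫⁻ s, ‖(f s : ℂ)‖ₑ ^ p.toReal := by
    intro f hf hfp
    have hsum : ∀ s, ((max (f s) 0 : ℝ) : ℂ) + -1 * ((max (-f s) 0 : ℝ) : ℂ) = f s := fun s => by
      rw [neg_one_mul, ← sub_eq_add_neg, ← ofReal_sub, max_zero_sub_max_neg_zero_eq_self]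
    have hle1 : ∀ s, ‖((max (f s) 0 : ℝ) : ℂ)‖ ≤ ‖(f s : ℂ)‖ := fun s => by
      rw [norm_real, norm_real, norm_of_nonneg (le_max_right _ _)]
      exact max_le (le_abs_self _) (abs_nonneg _)
    have hle2 : ∀ s, ‖((max (-f s) 0 : ℝ) : ℂ)‖ ≤ ‖(f s : ℂ)‖ := fun s => by
      rw [norm_real, norm_real, norm_of_nonneg (le_max_right _ _)]
      exact max_le (neg_le_abs _) (abs_nonneg _)
    have m1 : Measurable fun s => max (f s) 0 := hf.max measurable_const
    have m2 : Measurable fun s => max (-f s) 0 := hf.neg.max measurable_const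
    have l1 : MemLp (fun s => ((max (f s) 0 : ℝ) : ℂ)) p :=
      hfp.of_le (measurable_ofReal.comp m1).aestronglyMeasurable (.of_forall hle1)
    have l2 : MemLp (fun s => ((max (-f s) 0 : ℝ) : ℂ)) p :=
      hfp.of_le (measurable_ofReal.comp m2).aestronglyMeasurable (.of_forall hle2)
    have := key (-1) (by simp) l1 l2 (lintegral_conjOp_nonneg_le hp1 hp2 hε (H ε hε) m1 (fun s => le_max_right _ _) l1)
      (lintegral_conjOp_nonneg_le hp1 hp2 hε (H ε hε) m2 (fun s => le_max_right _ _) l2)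
      (fun s => by rw [hsum]; exact hle1 s) (fun s => by rw [hsum]; exact hle2 s)
    simpa only [hsum] using this
  intro f hf
  obtain ⟨g, hg, hfg⟩ := hf.1
  have hgp : MemLp g p := hf.ae_eq hfg
  have e1 : ∫⁻ s, ‖f s‖ₑ ^ p.toReal = ∫⁻ s, ‖g s‖ₑ ^ p.toReal := by
    refine lintegral_congr_ae ?_
    filter_upwards [hfg] with s hs
    rw [hs]
  rw [conjOp_congr hfg, e1]
  have hsum : ∀ s, ((g s).re : ℂ) + I * ((g s).im : ℂ) = g s := fun s => by rw [mul_comm]; exact re_add_im _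
  have hle1 : ∀ s, ‖((g s).re : ℂ)‖ ≤ ‖g s‖ := fun s => by rw [norm_real]; exact abs_re_le_norm _
  have hle2 : ∀ s, ‖((g s).im : ℂ)‖ ≤ ‖g s‖ := fun s => by rw [norm_real]; exact abs_im_le_norm _
  have m1 : Measurable fun s => (g s).re := Complex.measurable_re.comp hg.measurable
  have m2 : Measurable fun s => (g s).im := Complex.measurable_im.comp hg.measurable
  have l1 : MemLp (fun s => ((g s).re : ℂ)) p :=
    hgp.of_le (measurable_ofReal.comp m1).aestronglyMeasurable (.of_forall hle1)
  have l2 : MemLp (fun s => ((g s).im : ℂ)) p :=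
    hgp.of_le (measurable_ofReal.comp m2).aestronglyMeasurable (.of_forall hle2)
  have := key I (by simp) l1 l2 (hreal _ m1 l1) (hreal _ m2 l2)
    (fun s => by rw [hsum]; exact hle1 s) (fun s => by rw [hsum]; exact hle2 s)
  simpa only [hsum] using this

end RieszGeneral

section RieszDual
open Filter Topology
variable {p q : ℝ≥0∞} {ε : ℝ}
variable {f : ℝ → ℝ}

lemma conjPoisson_neg (ε s : ℝ) : conjPoisson ε (-s) = -conjPoisson ε s := by
  rw [conjPoisson, conjPoisson, neg_sq, neg_div]

lemma integral_conjOp_mul (hp1 : 1 < p) (hp2 : p ≠ ⊤) (hε : 0 < ε) {f g : ℝ → ℂ} (hf : Integrable f)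
    (hg : MemLp g p) : ∫ x, conjOp ε f x * g x = -∫ s, f s * conjOp ε g s := by
  have : Fact (1 ≤ p) := ⟨hp1.le⟩
  obtain ⟨hq1, hq2, hpq⟩ := holderConjugate_conjExponent hp1 hp2
  have hconj : p.conjExponent.toReal.HolderConjugate p.toReal :=
    HolderConjugate.toReal (one_lt_toReal hq1 hq2)
  have hkL := memLp_conjPoisson hq1 hq2 hε
  have hprod : Integrable (uncurry fun s x : ℝ => f s * (conjPoisson ε (x - s) : ℂ) * g x) := by
    have h1 := (integrable_norm_rpow_iff hkL.1 (zero_lt_one.trans hq1).ne' hq2).2 hkL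
    have h2 := (integrable_norm_rpow_iff hg.1 (zero_lt_one.trans hp1).ne' hp2).2 hg
    have h3 : Integrable (fun w : ℝ × ℝ => ‖f w.2‖ * ‖conjPoisson ε (w.1 - w.2)‖ ^ p.conjExponent.toReal) :=
      hf.norm.convolution_integrand (ContinuousLinearMap.mul ℝ ℝ) h1
    have h4 : Integrable (fun w : ℝ × ℝ => ‖f w.1‖ * ‖conjPoisson ε (w.2 - w.1)‖ ^ p.conjExponent.toReal) := h3.swap
    have h5 : Integrable (fun w : ℝ × ℝ => ‖f w.1‖ * ‖g w.2‖ ^ p.toReal) := hf.norm.mul_prod h2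
    refine (h4.add h5).mono' ?_ (.of_forall fun w => ?_)
    · exact (hf.1.comp_fst.mul (continuous_ofReal.comp ((continuous_conjPoisson hε).comp
        (continuous_snd.sub continuous_fst))).aestronglyMeasurable).mul hg.1.comp_snd
    · simp only [uncurry, norm_mul, Pi.add_apply, norm_real]
      rw [mul_assoc, ← mul_add]
      exact mul_le_mul_of_nonneg_left (hconj.mul_le_add (norm_nonneg _) (norm_nonneg _)) (norm_nonneg _)
  have e1 : ∀ x, conjOp ε f x * g x = ∫ s, f s * (conjPoisson ε (x - s) : ℂ) * g x := by
    intro x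
    rw [conjOp, ← integral_mul_const]
    congr 1
    ext s
    ring
  have e2 : ∀ s, -(f s * conjOp ε g s) = ∫ x, f s * (conjPoisson ε (x - s) : ℂ) * g x := by
    intro s
    rw [conjOp, ← integral_const_mul, ← integral_neg]
    congr 1
    ext x
    rw [← neg_sub x s, conjPoisson_neg]
    push_cast
    ring
  rw [← integral_neg]
  simp only [e1, e2]
  exact (integral_integral_swap hprod).symm

lemma IsBump.memLp_conjOp (hp1 : 1 < p) (hp2 : p ≠ ⊤) (hε : 0 < ε) (hf : IsBump f) :
    MemLp (conjOp ε fun s => (f s : ℂ)) p := by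
  have hp0 : p ≠ 0 := (zero_lt_one.trans hp1).ne'
  have hpr : 1 < p.toReal := one_lt_toReal hp1 hp2
  obtain ⟨R, hR⟩ := hf.bounded
  have hm := aestronglyMeasurable_conjOp hε hf.integrable.ofReal.1 (f := fun s => (f s : ℂ))
  rw [← integrable_norm_rpow_iff hm hp0 hp2]
  set K := (∫ s, |f s|) * ((1 + R) / ε + 1)
  have hK : ∀ x : ℝ, ‖conjOp ε (fun s => (f s : ℂ)) x‖ ≤ K * (1 + ‖x‖)⁻¹ := by
    intro x
    have h1 := norm_cauchyIntegral_le hε hf.integrable (fun s hs => (hR s).2 hs) (w := x + ε * I) (by simp)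
    have h2 := abs_im_le_norm (cauchyIntegral f (x + ε * I))
    have h3 : |x| ≤ ‖(x + ε * I : ℂ)‖ := by simpa using abs_re_le_norm (x + ε * I)
    rw [cauchyIntegral_eq hε hf.integrable] at h1 h2
    rw [conjOp_ofReal, norm_real, norm_eq_abs]
    have h4 : 0 ≤ K := by refine nonneg_of_mul_nonneg_left ((norm_nonneg _).trans h1) (by positivity)
    simp only [add_im, ofReal_im, mul_im, ofReal_re, I_im, mul_one, I_re, mul_zero, add_zero, zero_add] at h2
    refine (h2.trans h1).trans (mul_le_mul_of_nonneg_left (inv_anti₀ (by positivity) ?_) h4)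
    rw [norm_eq_abs]
    linarith
  have h1 : Integrable fun x : ℝ => (1 + ‖x‖) ^ (-p.toReal) := integrable_one_add_norm (by simpa using hpr)
  refine (h1.const_mul (K ^ p.toReal)).mono' ?_ (.of_forall fun x => ?_)
  · exact (hm.norm.aemeasurable.pow_const _).aestronglyMeasurable
  · have hx : 0 < 1 + ‖x‖ := by positivity
    have h4 : 0 ≤ K := nonneg_of_mul_nonneg_left ((norm_nonneg _).trans (hK x)) (inv_pos.2 hx)
    rw [norm_of_nonneg (rpow_nonneg (norm_nonneg _) _), rpow_neg hx.le, ← inv_rpow hx.le,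
      ← mul_rpow h4 (inv_nonneg.2 hx.le)]
    exact Real.rpow_le_rpow (norm_nonneg _) (hK x) (by linarith)

lemma IsBump.lintegral_conjOp_le_of_dual [hpq : p.HolderConjugate q] (hp1 : 1 < p) (hp2 : p ≠ ⊤) (hq1 : 1 < q)
    (hq2 : q ≠ ⊤) {C : ℝ≥0∞} (hC : ConjBounded q C) (hε : 0 < ε) (hf : IsBump f) :
    ∫⁻ x, ‖conjOp ε (fun s => (f s : ℂ)) x‖ₑ ^ p.toReal ≤
      C ^ (p.toReal / q.toReal) * ∫⁻ s, ‖(f s : ℂ)‖ₑ ^ p.toReal := by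
  have hp0 : p ≠ 0 := (zero_lt_one.trans hp1).ne'
  have hq0 : q ≠ 0 := (zero_lt_one.trans hq1).ne'
  have hconj : p.toReal.HolderConjugate q.toReal :=
    HolderConjugate.toReal (one_lt_toReal hp1 hp2)
  set r := p.toReal
  set r' := q.toReal
  have hr0 : 0 < r := hconj.pos
  have hr'0 : 0 < r' := hconj.symm.pos
  set v : ℝ → ℂ := conjOp ε fun s => (f s : ℂ) with hv
  have hvL : MemLp v p := hf.memLp_conjOp hp1 hp2 hε
  set g : ℝ → ℂ := fun x => (starRingEnd ℂ) (v x) * ((‖v x‖ ^ (r - 2) : ℝ) : ℂ) with hg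
  have hrr : (r - 1) * r' = r := hconj.sub_one_mul_conj
  have hgn : ∀ x, ‖g x‖ = ‖v x‖ ^ (r - 1) := by
    intro x
    rw [hg]
    simp only [norm_mul, RCLike.norm_conj, norm_real]
    rw [norm_of_nonneg (rpow_nonneg (norm_nonneg _) _)]
    rcases (norm_nonneg (v x)).eq_or_lt with h | h
    · rw [← h, zero_mul, zero_rpow (by linarith [hconj.lt])]
    · rw [show r - 1 = 1 + (r - 2) by ring, rpow_add h, Real.rpow_one]
  have hvg : ∀ x, v x * g x = ((‖v x‖ ^ r : ℝ) : ℂ) := by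
    intro x
    rw [hg]
    simp only
    rw [← mul_assoc, Complex.mul_conj, normSq_eq_norm_sq, ← Complex.ofReal_mul]
    congr 1
    rcases (norm_nonneg (v x)).eq_or_lt with h | h
    · rw [← h, zero_rpow hr0.ne']; simp
    · rw [show r = 2 + (r - 2) by ring, rpow_add h]
      norm_cast
      congr 2
      ring
  have hgm : AEStronglyMeasurable g := (Complex.continuous_conj.comp_aestronglyMeasurable hvL.1).mul
      (measurable_ofReal.comp_aemeasurable (hvL.1.norm.aemeasurable.pow_const _)).aestronglyMeasurable
  have hgr : ∀ x, ‖g x‖ ^ r' = ‖v x‖ ^ r := fun x => by rw [hgn, ← Real.rpow_mul (norm_nonneg _), hrr]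
  have hvi : Integrable fun x => ‖v x‖ ^ r := (integrable_norm_rpow_iff hvL.1 hp0 hp2).2 hvL
  have hgL : MemLp g q := by
    rw [← integrable_norm_rpow_iff hgm hq0 hq2]
    exact hvi.congr (.of_forall fun x => (hgr x).symm)
  set X := ∫⁻ x, ‖v x‖ₑ ^ r with hX
  set F := ∫⁻ s, ‖(f s : ℂ)‖ₑ ^ r with hF
  have hXtop : X ≠ ⊤ := ((eLpNorm_lt_top_iff_lintegral_rpow_enorm_lt_top hp0 hp2).1 hvL.2).ne
  have hgX : ∫⁻ x, ‖g x‖ₑ ^ r' = X := by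
    refine lintegral_congr fun x => ?_
    rw [← ofReal_norm, ← ofReal_norm, ofReal_rpow_of_nonneg (norm_nonneg _) hr'0.le,
      ofReal_rpow_of_nonneg (norm_nonneg _) hr0.le, hgr]
  have h1 : X = ‖∫ x, v x * g x‖ₑ := by
    simp only [hvg]
    rw [integral_complex_ofReal, ← ofReal_norm, norm_real, norm_of_nonneg
      (integral_nonneg_of_ae (.of_forall fun x => rpow_nonneg (norm_nonneg _) _)),
      ofReal_integral_eq_lintegral_ofReal hvi (.of_forall fun x => rpow_nonneg (norm_nonneg _) _)]
    refine lintegral_congr fun x => ?_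
    rw [← ofReal_norm, ofReal_rpow_of_nonneg (norm_nonneg _) hr0.le]
  have h2 : X ≤ F ^ (1 / r) * (C * X) ^ (1 / r') := by
    have h1' : ∫ x, v x * g x = -∫ s, (f s : ℂ) * conjOp ε g s :=
      integral_conjOp_mul hq1 hq2 hε hf.integrable.ofReal hgL
    rw [h1', enorm_neg] at h1
    rw [h1]
    refine (enorm_integral_le_lintegral_enorm _).trans ?_
    simp only [enorm_mul]
    refine (lintegral_mul_le_Lp_mul_Lq volume hconj hf.integrable.ofReal.1.enorm
      (aestronglyMeasurable_conjOp hε hgm).enorm).trans ?_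
    rw [← h1, ← hgX]
    refine mul_le_mul_right (rpow_le_rpow ?_ (by positivity)) _
    exact hC ε hε g hgL
  rcases eq_or_ne X 0 with h0 | h0
  · rw [h0]; exact zero_le
  rw [mul_rpow_of_nonneg _ _ (by positivity : 0 ≤ 1 / r')] at h2
  have hsplit : X = X ^ (1 / r) * X ^ (1 / r') := by
    rw [← ENNReal.rpow_add _ _ h0 hXtop, one_div, one_div, hconj.inv_add_inv_eq_one, rpow_one]
  have h3 : X ^ (1 / r) ≤ F ^ (1 / r) * C ^ (1 / r') := by
    have hne : X ^ (1 / r') ≠ 0 := (ENNReal.rpow_pos (pos_iff_ne_zero.2 h0) hXtop).ne'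
    have hnt : X ^ (1 / r') ≠ ⊤ := rpow_ne_top_of_nonneg (by positivity) hXtop
    rw [← mul_assoc] at h2
    nth_rewrite 1 [hsplit] at h2
    exact (ENNReal.mul_le_mul_iff_left hne hnt).1 h2
  have h4 := rpow_le_rpow h3 hr0.le
  rw [mul_rpow_of_nonneg _ _ hr0.le, ← rpow_mul, ← rpow_mul, ← rpow_mul,
    one_div_mul_cancel hr0.ne', rpow_one, rpow_one, one_div_mul_eq_div, mul_comm] at h4
  exact h4

/-- M. Riesz: the conjugate Poisson integrals are uniformly bounded on `L_p`. -/
lemma exists_conjBounded (hp1 : 1 < p) (hp2 : p ≠ ⊤) : ∃ C : ℝ≥0∞, C ≠ ⊤ ∧ ConjBounded p C := by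
  have hsmall : ∀ {p : ℝ≥0∞}, 1 < p → p ≠ ⊤ → p ≤ 2 → ∃ C : ℝ≥0∞, C ≠ ⊤ ∧ ConjBounded p C := by
    intro p hp1 hp2 h2
    have hpr : 1 < p.toReal := one_lt_toReal hp1 hp2
    have hp2r : p.toReal ≤ 2 := by
      have := toReal_mono (by simp) h2
      simpa using this
    obtain ⟨C, hC, H⟩ := IsBump.lintegral_conjOp_le hpr hp2r
    refine ⟨_, ?_, conjBounded_of_bump hp1 hp2 H⟩
    have : (2 : ℝ≥0∞) ^ (p.toReal - 1) ≠ ⊤ := rpow_ne_top_of_nonneg (by linarith) (by simp)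
    finiteness
  rcases le_or_gt p 2 with h2 | h2
  · exact hsmall hp1 hp2 h2
  have : Fact (1 ≤ p) := ⟨hp1.le⟩
  have hpq : p.HolderConjugate p.conjExponent := inferInstance
  have hpq' : p.conjExponent.HolderConjugate p := HolderConjugate.symm
  have hq1 : 1 < p.conjExponent := (HolderConjugate.lt_top_iff_one_lt p _).1 hp2.lt_top
  have hq2 : p.conjExponent ≠ ⊤ := ((HolderConjugate.lt_top_iff_one_lt _ p).2 hp1).ne
  have hpr : 1 < p.toReal := one_lt_toReal hp1 hp2
  have hconj : p.toReal.HolderConjugate p.conjExponent.toReal := HolderConjugate.toReal hpr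
  have hq2r : p.conjExponent ≤ 2 := by
    rw [← ENNReal.toReal_le_toReal hq2 (by simp)]
    have h3 : 2 < p.toReal := by
      have := toReal_strict_mono hp2 h2
      simpa using this
    have h4 : (2 : ℝ≥0∞).toReal = 2 := by simp
    rw [h4, hconj.conjugate_eq, div_le_iff₀ (by linarith)]
    linarith
  obtain ⟨C, hC, H⟩ := hsmall hq1 hq2 hq2r
  refine ⟨_, ?_, conjBounded_of_bump hp1 hp2 fun ε hε f hf =>
    hf.lintegral_conjOp_le_of_dual hp1 hp2 hq1 hq2 H hε⟩
  have h5 : (2 : ℝ≥0∞) ^ (p.toReal - 1) ≠ ⊤ := rpow_ne_top_of_nonneg (by linarith) (by simp)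
  have h6 : C ^ (p.toReal / p.conjExponent.toReal) ≠ ⊤ := rpow_ne_top_of_nonneg (by positivity) hC
  finiteness

end RieszDual

section Hilbert
open Filter Topology

variable {s ε : ℝ}
/-- The Hilbert transform, as an absolutely convergent integral for regular `φ`. -/
def hilb (φ : ℝ → ℂ) (x : ℝ) : ℂ :=
  ∫ s in Ioi (0 : ℝ), ((π * s)⁻¹ : ℂ) * (φ (x - s) - φ (x + s))

/-- Bounds on the size, the Lipschitz constant and the support of a function on the line. -/
structure LipBump (L M R : ℝ) (φ : ℝ → ℂ) : Prop where
  lip : ∀ u v, ‖φ u - φ v‖ ≤ L * |u - v|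
  le : ∀ u, ‖φ u‖ ≤ M
  supp : ∀ u, R < |u| → φ u = 0

variable {L M R : ℝ} {φ : ℝ → ℂ}

lemma LipBump.continuous (h : LipBump L M R φ) : Continuous φ := by
  have : LipschitzWith L.toNNReal φ := LipschitzWith.of_dist_le_mul fun u v => by
    rw [dist_eq_norm, Real.dist_eq]
    exact (h.lip u v).trans (mul_le_mul_of_nonneg_right (Real.le_coe_toNNReal L) (abs_nonneg _))
  exact this.continuous

lemma LipBump.integrable (h : LipBump L M R φ) : Integrable φ := by
  refine h.continuous.integrable_of_hasCompactSupport (HasCompactSupport.intro (isCompact_Icc (a := -R) (b := R)) fun x hx => ?_)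
  refine h.supp x (lt_of_not_ge fun h' => hx (abs_le.1 h'))

lemma LipBump.norm_sub_le (h : LipBump L M R φ) (hR : 0 ≤ R) (x : ℝ) (hs : 0 < s) : ‖φ (x - s) - φ (x + s)‖ ≤
      s * (Icc (|x| - R) (|x| + R)).indicator (fun _ => (2 * L * (1 + R) + 2 * M) * (1 + |x|)⁻¹) s := by
  have hL : 0 ≤ L := by simpa using (norm_nonneg _).trans (h.lip 1 0)
  have hM : 0 ≤ M := (norm_nonneg _).trans (h.le 0)
  by_cases hm : s ∈ Icc (|x| - R) (|x| + R)
  · rw [indicator_of_mem hm]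
    have h1 : ‖φ (x - s) - φ (x + s)‖ ≤ 2 * L * s := by
      refine (h.lip _ _).trans_eq ?_
      rw [show x - s - (x + s) = -(2 * s) by ring, abs_neg, abs_of_pos (by linarith)]
      ring
    have h2 : ‖φ (x - s) - φ (x + s)‖ ≤ 2 * M := (_root_.norm_sub_le _ _).trans (by linarith [h.le (x - s), h.le (x + s)])
    have hx : 0 < 1 + |x| := by positivity
    rw [← mul_assoc, ← div_eq_mul_inv, le_div_iff₀ hx]
    calc _ ≤ ‖φ (x - s) - φ (x + s)‖ * ((1 + R) + s) := mul_le_mul_of_nonneg_left (by linarith [hm.1]) (norm_nonneg _)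
      _ ≤ _ := by
          rw [mul_add]
          have := mul_le_mul_of_nonneg_right h1 (by linarith : 0 ≤ 1 + R)
          have := mul_le_mul_of_nonneg_right h2 hs.le
          nlinarith
  · rw [indicator_of_notMem hm, mul_zero]
    have e : ∀ u, |u| = |x - s| ∨ |u| = |x + s| → φ u = 0 := fun u hu => by
      refine h.supp u (lt_of_not_ge fun h' => hm ?_)
      rcases hu with hu | hu <;> rw [hu] at h' <;> have := abs_le.1 h' <;>
        rcases abs_cases x with ⟨e, _⟩ | ⟨e, _⟩ <;> rw [e] <;> constructor <;> linarith
    rw [e _ (Or.inl rfl), e _ (Or.inr rfl), sub_zero, norm_zero]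

lemma conjOp_eq_integral_Ioi (hε : 0 < ε) (h : LipBump L M R φ) (x : ℝ) :
    conjOp ε φ x = ∫ s in Ioi (0 : ℝ), (conjPoisson ε s : ℂ) * (φ (x - s) - φ (x + s)) := by
  have hi : ∀ g : ℝ → ℂ, Integrable g → Integrable fun s => (conjPoisson ε s : ℂ) * g s := fun g hg => by
    refine hg.bdd_mul (c := ε⁻¹) (continuous_ofReal.comp (continuous_conjPoisson hε)).aestronglyMeasurable
      (.of_forall fun s => ?_)
    rw [norm_real]
    exact abs_conjPoisson_le hε s
  have h1 := hi _ (h.integrable.comp_sub_left x)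
  have h2 := hi _ (h.integrable.comp_add_left x)
  have e : conjOp ε φ x = ∫ s, (conjPoisson ε s : ℂ) * φ (x - s) := by
    rw [conjOp, ← integral_sub_left_eq_self _ volume x]
    simp only [sub_sub_cancel]
  rw [e, ← setIntegral_univ, ← Iic_union_Ioi (a := (0 : ℝ)),
    setIntegral_union (Iic_disjoint_Ioi le_rfl) measurableSet_Ioi h1.integrableOn h1.integrableOn]
  have e2 : ∫ s in Iic (0 : ℝ), (conjPoisson ε s : ℂ) * φ (x - s) =
      -∫ s in Ioi (0 : ℝ), (conjPoisson ε s : ℂ) * φ (x + s) := by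
    have := integral_comp_neg_Ioi (0 : ℝ) fun s => (conjPoisson ε s : ℂ) * φ (x - s)
    rw [neg_zero] at this
    rw [← this, ← integral_neg]
    refine integral_congr_ae (.of_forall fun s => ?_)
    simp only [conjPoisson_neg, sub_neg_eq_add]
    push_cast
    ring
  rw [e2]
  simp only [mul_sub]
  rw [integral_sub h1.integrableOn h2.integrableOn]
  ring

lemma abs_conjPoisson_le_inv (ε : ℝ) (hs : 0 < s) : |conjPoisson ε s| ≤ (π * s)⁻¹ := by
  have := pi_pos
  rw [conjPoisson, abs_of_nonneg (by positivity), inv_eq_one_div, div_le_div_iff₀ (by positivity) (by positivity)]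
  nlinarith [mul_nonneg pi_pos.le (sq_nonneg ε)]

lemma LipBump.norm_mul_sub_le (h : LipBump L M R φ) (hR : 0 ≤ R) (x : ℝ) (hs : 0 < s) {k : ℝ}
    (hk : |k| ≤ (π * s)⁻¹) : ‖(k : ℂ) * (φ (x - s) - φ (x + s))‖ ≤
      (Icc (|x| - R) (|x| + R)).indicator (fun _ => (2 * L * (1 + R) + 2 * M) * (1 + |x|)⁻¹) s := by
  have h1 := h.norm_sub_le hR x hs
  have h2 : |k| ≤ s⁻¹ := hk.trans (inv_anti₀ hs (by nlinarith [pi_gt_three]))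
  rw [norm_mul, norm_real, norm_eq_abs]
  refine (mul_le_mul h2 h1 (norm_nonneg _) (by positivity)).trans_eq ?_
  rw [← mul_assoc, inv_mul_cancel₀ hs.ne', one_mul]

lemma LipBump.norm_conjOp_le (h : LipBump L M R φ) (hR : 0 ≤ R) (hε : 0 < ε) (x : ℝ) :
    ‖conjOp ε φ x‖ ≤ 2 * R * (2 * L * (1 + R) + 2 * M) * (1 + |x|)⁻¹ := by
  have hL : 0 ≤ L := by simpa using (norm_nonneg _).trans (h.lip 1 0)
  have hM : 0 ≤ M := (norm_nonneg _).trans (h.le 0)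
  set g := (Icc (|x| - R) (|x| + R)).indicator fun _ : ℝ => (2 * L * (1 + R) + 2 * M) * (1 + |x|)⁻¹ with hg
  have hgi : Integrable g := (integrable_indicator_iff measurableSet_Icc).2 (integrableOn_const measure_Icc_lt_top.ne)
  have hg0 : ∀ s, 0 ≤ g s := fun s => indicator_nonneg (fun _ _ => by positivity) s
  rw [conjOp_eq_integral_Ioi hε h]
  calc _ ≤ ∫ s in Ioi (0 : ℝ), g s := norm_integral_le_of_norm_le hgi.integrableOn
        ((ae_restrict_mem measurableSet_Ioi).mono fun s hs => h.norm_mul_sub_le hR x hs (abs_conjPoisson_le_inv ε hs))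
    _ ≤ ∫ s, g s := setIntegral_le_integral hgi (.of_forall hg0)
    _ = _ := by
        rw [hg, integral_indicator measurableSet_Icc, setIntegral_const, Real.volume_real_Icc_of_le (by linarith), smul_eq_mul]
        ring

lemma LipBump.tendsto_conjOp (h : LipBump L M R φ) (hR : 0 ≤ R) (x : ℝ) :
    Tendsto (fun ε => conjOp ε φ x) (𝓝[>] 0) (𝓝 (hilb φ x)) := by
  set g := (Icc (|x| - R) (|x| + R)).indicator fun _ : ℝ => (2 * L * (1 + R) + 2 * M) * (1 + |x|)⁻¹ with hg
  have hgi : Integrable g := (integrable_indicator_iff measurableSet_Icc).2 (integrableOn_const measure_Icc_lt_top.ne)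
  have hpos : ∀ᶠ ε in 𝓝[>] (0 : ℝ), 0 < ε := self_mem_nhdsWithin
  have hc := h.continuous
  refine Tendsto.congr' (f₁ := fun ε => ∫ s in Ioi (0 : ℝ), (conjPoisson ε s : ℂ) * (φ (x - s) - φ (x + s))) ?_ ?_
  · filter_upwards [hpos] with ε hε using (conjOp_eq_integral_Ioi hε h x).symm
  refine tendsto_integral_filter_of_dominated_convergence g ?_ ?_ hgi.integrableOn ?_
  · filter_upwards [hpos] with ε hε
    have := continuous_conjPoisson hε
    fun_prop
  · filter_upwards with ε
    exact (ae_restrict_mem measurableSet_Ioi).mono fun s hs => h.norm_mul_sub_le hR x hs (abs_conjPoisson_le_inv ε hs)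
  · filter_upwards [ae_restrict_mem measurableSet_Ioi] with s hs
    have hs0 : s ≠ 0 := (ne_of_gt hs : s ≠ 0)
    have h1 : Tendsto (fun ε => conjPoisson ε s) (𝓝[>] 0) (𝓝 (π * s)⁻¹) := by
      have hcon : ContinuousAt (fun ε => conjPoisson ε s) 0 := by
        unfold conjPoisson
        exact continuousAt_const.div (by fun_prop) (by have := pi_pos; positivity)
      have e : conjPoisson 0 s = (π * s)⁻¹ := by
        have := pi_ne_zero
        unfold conjPoisson
        field_simp
        ring
      rw [← e]
      exact hcon.tendsto.mono_left nhdsWithin_le_nhds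
    have h2 := ((continuous_ofReal.tendsto _).comp h1).mul_const (φ (x - s) - φ (x + s))
    push_cast at h2
    exact h2

lemma LipBump.norm_hilb_le (h : LipBump L M R φ) (hR : 0 ≤ R) (x : ℝ) :
    ‖hilb φ x‖ ≤ 2 * R * (2 * L * (1 + R) + 2 * M) * (1 + |x|)⁻¹ :=
  le_of_tendsto (h.tendsto_conjOp hR x).norm (by
    filter_upwards [self_mem_nhdsWithin] with ε hε using h.norm_conjOp_le hR hε x)

end Hilbert

section Line
open Filter Topology

variable {F : Space 1 → ℂ} {C : ℝ≥0∞}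
lemma measurePreserving_coord_zero : MeasurePreserving fun y : Tan 1 => y 0 :=
  (volume_preserving_funUnique (Fin 1) ℝ).comp (EuclideanSpace.volume_preserving_symm_measurableEquiv_toLp (Fin 1))

/-- The identification of `ℝ` with the one-dimensional tangential space. -/
def line : ℝ ≃ᵐ Tan 1 :=
  (funUnique (Fin 1) ℝ).symm.trans (MeasurableEquiv.toLp 2 (Fin 1 → ℝ))

lemma line_apply_zero (s : ℝ) : line s 0 = s := rfl

lemma measurePreserving_line : MeasurePreserving line :=
  ((EuclideanSpace.volume_preserving_symm_measurableEquiv_toLp (Fin 1)).symm _).comp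
    ((volume_preserving_funUnique (Fin 1) ℝ).symm _)

lemma continuous_line : Continuous line := by
  have : Continuous fun s : ℝ => (toLp 2 fun _ : Fin 1 => s : Tan 1) := by fun_prop
  exact this

lemma integral_line (F : Tan 1 → ℂ) : ∫ s, F (line s) = ∫ y, F y :=
  measurePreserving_line.integral_comp' F

lemma lintegral_line (F : Tan 1 → ℝ≥0∞) : ∫⁻ s, F (line s) = ∫⁻ y, F y :=
  measurePreserving_line.lintegral_comp_emb line.measurableEmbedding F

lemma norm_eq_abs_coord_zero (y : Tan 1) : ‖y‖ = |y 0| := by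
  rw [norm_eq, Fin.sum_univ_one, norm_eq_abs, Real.sqrt_sq_eq_abs, abs_abs]

/-- The conjugate Poisson integral in the tangential variable. -/
def conjHalf (ε : ℝ) (F : Space 1 → ℂ) (x : Space 1) : ℂ :=
  conjOp ε (fun s => F (line s, x.2)) (x.1 0)

variable {q : ℝ≥0∞} {ε : ℝ}

lemma stronglyMeasurable_conjHalf (hε : 0 < ε) (hF : StronglyMeasurable F) :
    StronglyMeasurable (conjHalf ε F) := by
  have h1 : StronglyMeasurable fun p : Space 1 × ℝ => (conjPoisson ε (p.1.1 0 - p.2) : ℂ) * F (line p.2, p.1.2) := by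
    refine StronglyMeasurable.mul ?_ (hF.comp_measurable ?_)
    · have := continuous_conjPoisson hε
      exact Continuous.stronglyMeasurable (by fun_prop)
    · exact (line.measurable.comp measurable_snd).prodMk (measurable_snd.comp measurable_fst)
  exact h1.integral_prod_right

lemma ae_slice {P : Space 1 → Prop} (h : ∀ᵐ x ∂halfVol 1, P x) :
    ∀ᵐ t ∂volume.restrict (Ioi (0 : ℝ)), ∀ᵐ s : ℝ, P (line s, t) := by
  rw [halfVol_eq_prod] at h
  have h1 := Measure.ae_ae_of_ae_prod ((Measure.measurePreserving_swap (μ := volume.restrict (Ioi (0 : ℝ))) (ν := (volume : Measure (Tan 1)))).quasiMeasurePreserving.ae h)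
  filter_upwards [h1] with t ht using measurePreserving_line.quasiMeasurePreserving.ae ht

lemma ae_of_slice {P : ℝ → Prop} (h : ∀ᵐ t ∂volume.restrict (Ioi (0 : ℝ)), P t) : ∀ᵐ x ∂halfVol 1, P x.2 := by
  rw [halfVol_eq_prod]
  exact Measure.quasiMeasurePreserving_snd.ae h

lemma conjHalf_congr {G : Space 1 → ℂ} (h : F =ᵐ[halfVol 1] G) : conjHalf ε F =ᵐ[halfVol 1] conjHalf ε G := by
  filter_upwards [ae_of_slice (ae_slice h)] with x hx
  exact congrFun (conjOp_congr hx) _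

lemma measurable_lintegral_slice {F : Space 1 → ℝ≥0∞} (hF : Measurable F) :
    Measurable fun t => ∫⁻ s, F (line s, t) := by
  have h : Measurable fun p : ℝ × ℝ => F (line p.2, p.1) :=
    hF.comp ((line.measurable.comp measurable_snd).prodMk measurable_fst)
  exact h.lintegral_prod_right'

lemma lintegral_half (F : Space 1 → ℝ≥0∞) (hF : Measurable F) :
    ∫⁻ x, F x ∂halfVol 1 = ∫⁻ t in Ioi (0 : ℝ), ∫⁻ s, F (line s, t) := by
  rw [halfVol_eq_prod, lintegral_prod_symm _ hF.aemeasurable]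
  exact lintegral_congr fun t => (lintegral_line fun y => F (y, t)).symm

variable [Fact (1 ≤ q)]

lemma ae_memLp_slice (hq : q ≠ ⊤) (F : Lq 1 q) :
    ∀ᵐ t ∂volume.restrict (Ioi (0 : ℝ)), MemLp (fun s => F (line s, t)) q := by
  have hm : Measurable fun x => ‖F x‖ₑ ^ q.toReal := (Lp.stronglyMeasurable F).measurable.enorm.pow_const _
  have h1 : ∫⁻ x, ‖F x‖ₑ ^ q.toReal ∂halfVol 1 ≠ ⊤ := by
    rw [← ofReal_norm_Lp_rpow hq]
    exact ofReal_ne_top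
  rw [lintegral_half _ hm] at h1
  filter_upwards [ae_lt_top (measurable_lintegral_slice hm) h1] with t ht
  refine ⟨((Lp.stronglyMeasurable F).comp_measurable (line.measurable.prodMk measurable_const)).aestronglyMeasurable, ?_⟩
  rw [eLpNorm_lt_top_iff_lintegral_rpow_enorm_lt_top (zero_lt_one.trans_le Fact.out).ne' hq]
  exact ht

lemma lintegral_conjHalf_le (hq : q ≠ ⊤) (hC : ConjBounded q C) (hε : 0 < ε) (F : Lq 1 q) :
    ∫⁻ x, ‖conjHalf ε F x‖ₑ ^ q.toReal ∂halfVol 1 ≤ C * ∫⁻ x, ‖F x‖ₑ ^ q.toReal ∂halfVol 1 := by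
  have hm : Measurable fun x => ‖F x‖ₑ ^ q.toReal := (Lp.stronglyMeasurable F).measurable.enorm.pow_const _
  have hm' : Measurable fun x => ‖conjHalf ε F x‖ₑ ^ q.toReal :=
    (stronglyMeasurable_conjHalf hε (Lp.stronglyMeasurable F)).measurable.enorm.pow_const _
  rw [lintegral_half _ hm', lintegral_half _ hm, ← lintegral_const_mul _ (measurable_lintegral_slice hm)]
  refine lintegral_mono_ae ?_
  filter_upwards [ae_memLp_slice hq F] with t ht
  simp only [conjHalf, line_apply_zero]
  exact hC ε hε (fun s => F (line s, t)) ht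

lemma memLp_conjHalf (hq : q ≠ ⊤) (hCt : C ≠ ⊤) (hC : ConjBounded q C) (hε : 0 < ε) (F : Lq 1 q) :
    MemLp (conjHalf ε F) q (halfVol 1) := by
  refine ⟨(stronglyMeasurable_conjHalf hε (Lp.stronglyMeasurable F)).aestronglyMeasurable, ?_⟩
  rw [eLpNorm_lt_top_iff_lintegral_rpow_enorm_lt_top (zero_lt_one.trans_le Fact.out).ne' hq]
  refine (lintegral_conjHalf_le hq hC hε F).trans_lt (mul_lt_top hCt.lt_top ?_)
  rw [← ofReal_norm_Lp_rpow hq]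
  exact ofReal_lt_top

lemma exists_conjHalf_operator (hq1 : 1 < q) (hq2 : q ≠ ⊤) : ∃ B : ℝ, 0 ≤ B ∧ ∀ ε : ℝ, 0 < ε →
    ∃ T : Lq 1 q →L[ℂ] Lq 1 q, (∀ F, T F =ᵐ[halfVol 1] conjHalf ε F) ∧ ∀ F, ‖T F‖ ≤ B * ‖F‖ := by
  obtain ⟨C, hCt, hC⟩ := exists_conjBounded hq1 hq2
  have hq0 := toReal_exponent_pos hq2
  refine ⟨C.toReal ^ q.toReal⁻¹, by positivity, fun ε hε => ?_⟩
  have hM := fun F : Lq 1 q => memLp_conjHalf hq2 hCt hC hε F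
  let T : Lq 1 q →ₗ[ℂ] Lq 1 q :=
    { toFun := fun F => (hM F).toLp _
      map_add' := fun F G => by
        rw [← MemLp.toLp_add]
        refine MemLp.toLp_congr _ _ ((conjHalf_congr (Lp.coeFn_add F G)).trans ?_)
        filter_upwards [ae_of_slice (ae_memLp_slice hq2 F), ae_of_slice (ae_memLp_slice hq2 G)] with x h1 h2
        exact conjOp_add hq1 hq2 hε h1 h2 _
      map_smul' := fun c F => by
        rw [RingHom.id_apply, ← MemLp.toLp_const_smul]
        refine MemLp.toLp_congr _ _ ((conjHalf_congr (Lp.coeFn_smul c F)).trans ?_)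
        exact .of_forall fun x => conjOp_const_mul c _ _ }
  have hT : ∀ F, T F =ᵐ[halfVol 1] conjHalf ε F := fun F => MemLp.coeFn_toLp (hM F)
  have hb : ∀ F, ‖T F‖ ≤ C.toReal ^ q.toReal⁻¹ * ‖F‖ := fun F => by
    have h1 : ofReal (‖T F‖ ^ q.toReal) ≤ C * ofReal (‖F‖ ^ q.toReal) := by
      rw [ofReal_norm_Lp_rpow hq2, ofReal_norm_Lp_rpow hq2]
      refine le_trans (le_of_eq (lintegral_congr_ae ?_)) (lintegral_conjHalf_le hq2 hC hε F)
      filter_upwards [hT F] with x hx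
      rw [hx]
    rw [← ofReal_toReal hCt, ← ofReal_mul toReal_nonneg, ENNReal.ofReal_le_ofReal_iff (by positivity)] at h1
    rw [← Real.rpow_le_rpow_iff (norm_nonneg _) (by positivity) hq0, mul_rpow (by positivity) (norm_nonneg _),
      ← Real.rpow_mul toReal_nonneg, inv_mul_cancel₀ hq0.ne', Real.rpow_one]
    exact h1
  exact ⟨T.mkContinuous _ hb, hT, hb⟩

end Line

section HilbertOperator
open Filter Topology
variable {q : ℝ≥0∞} [Fact (1 ≤ q)]
variable {g : Space 1 → ℂ}

lemma Lp.tendsto_of_dominated {α : Type*} [MeasurableSpace α] {μ : Measure α} (hq : q ≠ ⊤) {u : ℕ → Lp ℂ q μ}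
    {u0 : Lp ℂ q μ} {D : α → ℝ} (hD : MemLp D q μ) (h : ∀ k, ∀ᵐ x ∂μ, ‖u k x‖ ≤ D x)
    (h₀ : ∀ᵐ x ∂μ, ‖u0 x‖ ≤ D x)
    (hlim : ∀ᵐ x ∂μ, Tendsto (fun k => u k x) atTop (𝓝 (u0 x))) : Tendsto u atTop (𝓝 u0) := by
  have hq0 := toReal_exponent_pos hq
  have h1 : Tendsto (fun k => ∫⁻ x, ‖u k x - u0 x‖ₑ ^ q.toReal ∂μ) atTop (𝓝 (∫⁻ _, 0 ∂μ)) := by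
    refine tendsto_lintegral_of_dominated_convergence' (fun x => ‖D x + D x‖ₑ ^ q.toReal) (fun k => ?_) (fun k => ?_) ?_ ?_
    · exact ((Lp.aestronglyMeasurable (u k)).sub (Lp.aestronglyMeasurable u0)).enorm.pow_const _
    · filter_upwards [h k, h₀] with x hx hx0
      refine rpow_le_rpow (enorm_le_iff_norm_le.2 ?_) hq0.le
      have h2 : 0 ≤ D x := (norm_nonneg _).trans hx0
      rw [norm_of_nonneg (by linarith)]
      exact (norm_sub_le _ _).trans (add_le_add hx hx0)
    · exact (lintegral_rpow_enorm_lt_top_of_eLpNorm_lt_top (zero_lt_one.trans_le Fact.out).ne' hq (hD.add hD).2).ne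
    · filter_upwards [hlim] with x hx
      have h2 := (hx.sub_const (u0 x)).enorm
      rw [sub_self, enorm_zero] at h2
      have h3 := (ENNReal.continuous_rpow_const (y := q.toReal)).tendsto 0 |>.comp h2
      rw [ENNReal.zero_rpow_of_pos hq0] at h3
      exact h3
  rw [lintegral_zero] at h1
  have h2 : ∀ k, ∫⁻ x, ‖u k x - u0 x‖ₑ ^ q.toReal ∂μ = ofReal (‖u k - u0‖ ^ q.toReal) := fun k => by
    rw [ofReal_norm_Lp_rpow hq]
    refine lintegral_congr_ae ?_
    filter_upwards [Lp.coeFn_sub (u k) u0] with x hx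
    rw [hx, Pi.sub_apply]
  simp only [h2] at h1
  have h3 : Tendsto (fun k => ‖u k - u0‖ ^ q.toReal) atTop (𝓝 0) := by
    have := (ENNReal.tendsto_toReal ENNReal.zero_ne_top).comp h1
    refine this.congr fun k => ?_
    simp only [Function.comp]
    exact toReal_ofReal (by positivity)
  have h4 := h3.rpow_const (p := q.toReal⁻¹) (Or.inr (by positivity))
  rw [zero_rpow (by positivity)] at h4
  rw [tendsto_iff_norm_sub_tendsto_zero]
  refine h4.congr fun k => ?_
  rw [← Real.rpow_mul (norm_nonneg _), mul_inv_cancel₀ hq0.ne', Real.rpow_one]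

lemma exists_limit_operator {E : Type*} [NormedAddCommGroup E] [NormedSpace ℂ E] [CompleteSpace E]
    {T : ℕ → E →L[ℂ] E} {B : ℝ} (hB : ∀ k F, ‖T k F‖ ≤ B * ‖F‖) {s : Set E} (hs : Dense s)
    (h : ∀ F ∈ s, CauchySeq fun k => T k F) : ∃ H : E →L[ℂ] E, ∀ F, Tendsto (fun k => T k F) atTop (𝓝 (H F)) := by
  have hc : ∀ F, CauchySeq fun k => T k F := fun F => by
    refine Metric.cauchySeq_iff.2 fun ε hε => ?_
    have hδ : 0 < ε / (3 * (|B| + 1)) := by positivity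
    obtain ⟨G, hG, hFG⟩ := Metric.dense_iff.1 hs F _ hδ
    obtain ⟨N, hN⟩ := Metric.cauchySeq_iff.1 (h _ hFG) (ε / 3) (by positivity)
    refine ⟨N, fun k hk l hl => ?_⟩
    have h1 : ∀ k, dist (T k F) (T k G) ≤ ε / 3 := fun k => by
      rw [dist_eq_norm, ← map_sub]
      rw [mem_ball, dist_comm, dist_eq_norm] at hG
      calc _ ≤ B * ‖F - G‖ := hB k _
        _ ≤ (|B| + 1) * (ε / (3 * (|B| + 1))) :=
            mul_le_mul (by linarith [le_abs_self B]) hG.le (norm_nonneg _) (by positivity)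
        _ = _ := by field_simp
    calc _ ≤ dist (T k F) (T k G) + dist (T k G) (T l G) + dist (T l G) (T l F) := dist_triangle4 _ _ _ _
      _ < ε / 3 + ε / 3 + ε / 3 := by
          have := h1 l
          rw [dist_comm] at this
          linarith [h1 k, hN k hk l hl]
      _ = ε := by ring
  choose H hH using fun F => cauchySeq_tendsto_of_complete (hc F)
  exact ⟨continuousLinearMapOfTendsto T (tendsto_pi_nhds.2 hH), hH⟩

/-- The Hilbert transform in the tangential variable. -/
def hilbHalf (g : Space 1 → ℂ) (x : Space 1) : ℂ := hilb (fun s => g (line s, x.2)) (x.1 0)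

lemma exists_lipBump (hs : HasCompactSupport g) (hg : ContDiff ℝ ∞ g) :
    ∃ L M R : ℝ, 0 ≤ R ∧ (∀ t, LipBump L M R fun s => g (line s, t)) ∧ ∀ x, R < x.2 → g x = 0 := by
  obtain ⟨L, hL⟩ := ContDiff.lipschitzWith_of_hasCompactSupport (𝕂 := ℝ) hs hg (by simp)
  obtain ⟨M, hM⟩ := hs.exists_bound_of_continuous hg.continuous
  obtain ⟨R, hR⟩ := hs.isBounded.subset_closedBall (0 : Space 1)
  have hz : ∀ x, max R 0 < ‖x‖ → g x = 0 := fun x hx => by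
    refine image_eq_zero_of_notMem_tsupport fun h => ?_
    have := hR h
    rw [mem_closedBall_zero_iff] at this
    exact absurd ((le_max_left R 0).trans_lt hx) (not_lt.2 this)
  refine ⟨L, M, max R 0, le_max_right _ _, fun t => ⟨fun u v => ?_, fun u => hM _, fun u hu => hz _ ?_⟩, fun x hx => hz x ?_⟩
  · have h1 := hL.dist_le_mul (line u, t) (line v, t)
    rw [dist_eq_norm] at h1
    refine h1.trans_eq ?_
    rw [dist_eq_norm, Prod.mk_sub_mk, sub_self, Prod.norm_mk, norm_zero, max_eq_left (norm_nonneg _),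
      norm_eq_abs_coord_zero]
    rfl
  · refine hu.trans_le (le_trans (le_of_eq ?_) (norm_fst_le (line u, t)))
    rw [norm_eq_abs_coord_zero, line_apply_zero]
  · exact hx.trans_le ((le_abs_self _).trans (norm_snd_le x))

lemma tendsto_conjHalf_operator (hq1 : 1 < q) (hq2 : q ≠ ⊤) {T : ℕ → Lq 1 q →L[ℂ] Lq 1 q} {ε : ℕ → ℝ}
    (hε : ∀ k, 0 < ε k) (hlim : Tendsto ε atTop (𝓝 0)) (hT : ∀ k F, T k F =ᵐ[halfVol 1] conjHalf (ε k) F) (hs : HasCompactSupport g) (hg : ContDiff ℝ ∞ g) {F : Lq 1 q} (hF : F =ᵐ[halfVol 1] g) :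
    ∃ u : Lq 1 q, u =ᵐ[halfVol 1] hilbHalf g ∧ Tendsto (fun k => T k F) atTop (𝓝 u) := by
  obtain ⟨L, M, R, hR, hb, hz⟩ := exists_lipBump hs hg
  set B := 2 * R * (2 * L * (1 + R) + 2 * M) with hB
  have hB0 : 0 ≤ B := by
    have := (norm_nonneg _).trans ((hb 0).norm_hilb_le hR 0)
    simpa [hB] using this
  set D : Space 1 → ℝ := fun x => B * exp R * (((1 + ‖0 - x.1‖) ^ 1)⁻¹ * exp (-(1 * x.2))) with hD
  have hDm : MemLp D q (halfVol 1) := (memLp_exp_mul_inv_one_add_norm le_rfl hq1 hq2 0 one_pos).const_mul _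
  have hε' : Tendsto ε atTop (𝓝[>] 0) := tendsto_nhdsWithin_iff.2 ⟨hlim, .of_forall hε⟩
  have hpt : ∀ x, Tendsto (fun k => conjHalf (ε k) g x) atTop (𝓝 (hilbHalf g x)) := fun x =>
    ((hb x.2).tendsto_conjOp hR (x.1 0)).comp hε'
  have hle : ∀ k x, ‖conjHalf (ε k) g x‖ ≤ D x := fun k x => by
    rcases lt_or_ge R x.2 with h | h
    · have e : conjHalf (ε k) g x = 0 := by
        rw [conjHalf, conjOp]
        simp only [hz (line _, x.2) h, mul_zero, integral_zero]
      rw [e, norm_zero]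
      positivity
    · refine ((hb x.2).norm_conjOp_le hR (hε k) (x.1 0)).trans ?_
      have h1 : 1 ≤ exp R * exp (-(1 * x.2)) := by
        rw [← Real.exp_add]
        exact Real.one_le_exp (by linarith)
      have e : D x = B * (1 + |x.1 0|)⁻¹ * (exp R * exp (-(1 * x.2))) := by
        rw [hD]
        simp only [zero_sub, norm_neg, pow_one, norm_eq_abs_coord_zero]
        ring
      rw [e]
      exact le_mul_of_one_le_right (by positivity) h1
  have hTk : ∀ k, T k F =ᵐ[halfVol 1] conjHalf (ε k) g := fun k => (hT k F).trans (conjHalf_congr hF)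
  have hm : AEStronglyMeasurable (hilbHalf g) (halfVol 1) := by
    refine aestronglyMeasurable_of_tendsto_ae atTop (f := fun k => conjHalf (ε k) g) (fun k => ?_)
      (.of_forall hpt)
    exact (stronglyMeasurable_conjHalf (hε k) hg.continuous.stronglyMeasurable).aestronglyMeasurable
  have hle0 : ∀ x, ‖hilbHalf g x‖ ≤ D x := fun x =>
    le_of_tendsto (hpt x).norm (.of_forall fun k => hle k x)
  have hmem : MemLp (hilbHalf g) q (halfVol 1) := hDm.mono' hm (.of_forall hle0)
  have hu := hmem.coeFn_toLp
  refine ⟨hmem.toLp _, hu, Lp.tendsto_of_dominated hq2 hDm (fun k => ?_) ?_ ?_⟩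
  · filter_upwards [hTk k] with x hx
    rw [hx]
    exact hle k x
  · filter_upwards [hu] with x hx
    rw [hx]
    exact hle0 x
  · filter_upwards [hu, ae_all_iff.2 hTk] with x hx hx'
    simp only [hx, hx']
    exact hpt x

/-- `H` extends the tangential Hilbert transform of test functions. -/
def IsHilbertOperator {q : ℝ≥0∞} [Fact (1 ≤ q)] (H : Lq 1 q →L[ℂ] Lq 1 q) : Prop :=
  ∀ (F : Lq 1 q) (g : Space 1 → ℂ), HasCompactSupport g → ContDiff ℝ ∞ g → F =ᵐ[halfVol 1] g →
    H F =ᵐ[halfVol 1] hilbHalf g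

lemma exists_hilbert_operator (hq1 : 1 < q) (hq2 : q ≠ ⊤) : ∃ H : Lq 1 q →L[ℂ] Lq 1 q,
    IsHilbertOperator H := by
  obtain ⟨B, hB, hT⟩ := exists_conjHalf_operator hq1 hq2
  have hε : ∀ k : ℕ, 0 < 1 / ((k : ℝ) + 1) := fun k => by positivity
  choose T hT hTB using fun k : ℕ => hT _ (hε k)
  have key := fun (F : Lq 1 q) g hs hg hF => tendsto_conjHalf_operator (F := F) (g := g) hq1 hq2 hε
    tendsto_one_div_add_atTop_nhds_zero_nat hT hs hg hF
  obtain ⟨H, hH⟩ := exists_limit_operator hTB (Lp.dense_hasCompactSupport_contDiff hq2) (by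
    rintro F ⟨g, hF, hs, hg⟩
    obtain ⟨u, -, hu⟩ := key F g hs hg hF
    exact hu.cauchySeq)
  refine ⟨H, fun F g hs hg hF => ?_⟩
  obtain ⟨u, hu, hlim⟩ := key F g hs hg hF
  rwa [tendsto_nhds_unique (hH F) hlim]

end HilbertOperator

section Inversion
open Filter Topology FourierTransform
variable {n : ℕ}
variable {ξ : Tan 1}

lemma tanFourierInv_eq_fourierInv (m : Tan n → ℂ) (x : Tan n) :
    tanFourierInv m ((2 * π) • x) = (((2 * π) ^ n)⁻¹ : ℝ) * 𝓕⁻ m x := by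
  rw [tanFourierInv, Real.fourierInv_eq', one_div]
  congr 1
  refine integral_congr_ae (.of_forall fun ξ => ?_)
  simp only [smul_eq_mul, real_inner_smul_left, real_inner_comm x ξ]
  congr 2
  push_cast
  ring

lemma tanFourierInv_tanFourierInv {m : Tan n → ℂ} (hm : Integrable m) (hK : Integrable (tanFourierInv m)) {ξ : Tan n}
    (hc : ContinuousAt m (-ξ)) : tanFourierInv (tanFourierInv m) ξ = (((2 * π) ^ n)⁻¹ : ℝ) * m (-ξ) := by
  have hpi : (2 * π : ℝ) ≠ 0 := by have := pi_pos; positivity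
  have h1 : 𝓕⁻ m = fun x => ((2 * π) ^ n : ℝ) * tanFourierInv m ((2 * π) • x) := by
    ext x
    rw [tanFourierInv_eq_fourierInv, ← mul_assoc, ← Complex.ofReal_mul, mul_inv_cancel₀ (pow_ne_zero n hpi), ofReal_one, one_mul]
  have h2 : Integrable (𝓕⁻ m) := by
    rw [h1]
    exact (hK.comp_smul hpi).const_mul _
  have h3 : Integrable (𝓕 m) := by
    refine (h2.comp_neg).congr (.of_forall fun x => ?_)
    show 𝓕⁻ m (-x) = 𝓕 m x
    rw [Real.fourierInv_eq_fourier_neg, neg_neg]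
  rw [← hm.fourier_fourierInv_eq h3 hc, tanFourierInv, Real.fourier_eq']
  have h4 := Measure.integral_comp_smul (volume : Measure (Tan n))
    (fun x => 𝐞(ξ,x) * tanFourierInv m x) (2 * π)
  rw [finrank_euclideanSpace_fin, abs_of_pos (by have := pi_pos; positivity)] at h4
  have h5 : ∫ x, 𝐞(ξ,x) * tanFourierInv m x =
      ((2 * π) ^ n : ℝ) * ∫ x : Tan n, Complex.exp (I * (inner ℝ ξ ((2 * π) • x) : ℝ)) *
        tanFourierInv m ((2 * π) • x) := by
    rw [h4, real_smul, ← mul_assoc, ← Complex.ofReal_mul, mul_inv_cancel₀ (pow_ne_zero n hpi), ofReal_one, one_mul]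
  rw [h5, one_div, ← integral_const_mul]
  congr 1
  refine integral_congr_ae (.of_forall fun x => ?_)
  simp only [h1, smul_eq_mul, real_inner_smul_right, inner_neg_right, real_inner_comm x ξ]
  rw [mul_left_comm]
  congr 2
  push_cast
  ring

/-- The sign of the only tangential frequency, for `n = 1`. -/
def freqSign (ξ : Tan 1) : ℝ := if 0 < ξ 0 then 1 else -1

lemma freqSign_mul_self (ξ : Tan 1) : freqSign ξ * freqSign ξ = 1 := by
  rw [freqSign]; split_ifs <;> norm_num

lemma norm_freqSign (ξ : Tan 1) : ‖(freqSign ξ : ℂ)‖ = 1 := by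
  rw [freqSign]; split_ifs <;> simp

lemma measurable_freqSign : Measurable freqSign :=
  Measurable.ite (measurableSet_lt measurable_const measurePreserving_coord_zero.measurable) measurable_const measurable_const

lemma coord_zero_ne_zero (hξ : ξ ≠ 0) : ξ 0 ≠ 0 := fun h => hξ (by
  ext i
  rw [Subsingleton.elim i 0, h]
  rfl)

lemma freqSign_neg (hξ : ξ ≠ 0) : freqSign (-ξ) = -freqSign ξ := by
  have h0 := coord_zero_ne_zero hξ
  have e : (-ξ) 0 = -(ξ 0) := rfl
  rw [freqSign, freqSign, e]
  rcases lt_or_gt_of_ne h0 with h | h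
  · rw [if_pos (by linarith), if_neg (by linarith), neg_neg]
  · rw [if_neg (by linarith), if_pos h]

/-- The symbol of the conjugate Poisson integral. -/
def conjSymbol (ε : ℝ) (ξ : Tan 1) : ℂ := -I * freqSign ξ * exp (-(ε * |ξ 0|))

variable {ε : ℝ}

lemma norm_conjSymbol (ξ : Tan 1) : ‖conjSymbol ε ξ‖ = exp (-(ε * |ξ 0|)) := by
  rw [conjSymbol, norm_mul, norm_mul, norm_neg, norm_I, norm_freqSign, one_mul, one_mul, norm_real,
    norm_of_nonneg (Real.exp_nonneg _)]

lemma norm_conjSymbol_le (hε : 0 ≤ ε) (ξ : Tan 1) : ‖conjSymbol ε ξ‖ ≤ 1 := by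
  rw [norm_conjSymbol]
  exact exp_le_one_iff.2 (neg_nonpos.2 (by positivity))

lemma measurable_conjSymbol : Measurable (conjSymbol ε) := by
  have h1 := measurable_freqSign
  have h2 : Measurable fun ξ : Tan 1 => ξ 0 := measurePreserving_coord_zero.measurable
  unfold conjSymbol
  fun_prop

lemma conjSymbol_neg (hξ : ξ ≠ 0) : conjSymbol ε (-ξ) = -conjSymbol ε ξ := by
  have e : (-ξ) 0 = -(ξ 0) := rfl
  rw [conjSymbol, conjSymbol, freqSign_neg hξ, e, abs_neg]
  push_cast
  ring

lemma integrable_exp_neg_abs (hε : 0 < ε) : Integrable fun s : ℝ => exp (-(ε * |s|)) := by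
  rw [← integrableOn_univ, ← Iic_union_Ioi (a := (0 : ℝ))]
  refine IntegrableOn.union ?_ ?_
  · refine (integrableOn_exp_mul_Iic hε 0).congr_fun (fun s hs => ?_) measurableSet_Iic
    simp only [abs_of_nonpos (mem_Iic.1 hs)]
    congr 1; ring
  · refine (integrableOn_exp_mul_Ioi (neg_neg_iff_pos.2 hε) 0).congr_fun (fun s hs => ?_) measurableSet_Ioi
    simp only [abs_of_pos (mem_Ioi.1 hs)]
    congr 1; ring

lemma integrable_conjSymbol (hε : 0 < ε) : Integrable (conjSymbol ε) := by
  refine Integrable.mono' (g := fun ξ : Tan 1 => exp (-(ε * |ξ 0|))) ?_ measurable_conjSymbol.aestronglyMeasurable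
    (.of_forall fun ξ => (norm_conjSymbol ξ).le)
  exact measurePreserving_coord_zero.integrable_comp_of_integrable (integrable_exp_neg_abs hε)

lemma tanFourierInv_conjSymbol (hε : 0 < ε) (x : Tan 1) : tanFourierInv (conjSymbol ε) x = conjPoisson ε (x 0) := by
  set b := x 0 with hb
  have hint : Integrable fun s : ℝ => 𝐞(x,(line s)) * conjSymbol ε (line s) := by
    have h := measurePreserving_line.integrable_comp_of_integrable (integrable_exp_mul_of (integrable_conjSymbol hε) x)
    exact h
  have hin : ∀ s, (inner ℝ x (line s) : ℝ) = b * s := fun s => by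
    rw [PiLp.inner_apply, Fin.sum_univ_one, line_apply_zero]
    simp [hb, mul_comm]
  rw [tanFourierInv, ← integral_line, ← setIntegral_univ, ← Iic_union_Ioi (a := (0 : ℝ)),
    setIntegral_union (Iic_disjoint_Ioi le_rfl) measurableSet_Ioi hint.integrableOn hint.integrableOn]
  have e1 : ∫ s in Iic (0 : ℝ), 𝐞(x,(line s)) * conjSymbol ε (line s) =
      I * (1 / (I * b + ε)) := by
    have := integral_exp_mul_complex_Iic (a := I * b + ε) (by simpa using hε) 0
    rw [ofReal_zero, mul_zero, exp_zero] at this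
    rw [← this, ← integral_const_mul]
    refine setIntegral_congr_fun measurableSet_Iic fun s hs => ?_
    have hs' : s ≤ 0 := hs
    have hsg : freqSign (line s) = -1 := if_neg (not_lt.2 hs')
    simp only [conjSymbol, hsg, line_apply_zero, hin, abs_of_nonpos hs']
    rw [ofReal_exp, mul_left_comm, ← exp_add]
    push_cast
    rw [neg_mul_neg, mul_one]
    congr 2
    ring
  have e2 : ∫ s in Ioi (0 : ℝ), 𝐞(x,(line s)) * conjSymbol ε (line s) =
      -I * (-1 / (I * b - ε)) := by
    have := integral_exp_mul_complex_Ioi (a := I * b - ε) (by simpa using hε) 0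
    rw [ofReal_zero, mul_zero, exp_zero] at this
    rw [← this, ← integral_const_mul]
    refine setIntegral_congr_fun measurableSet_Ioi fun s hs => ?_
    have hs' : 0 < s := hs
    have hsg : freqSign (line s) = 1 := if_pos hs'
    simp only [conjSymbol, hsg, line_apply_zero, hin, abs_of_pos hs']
    rw [ofReal_exp, mul_left_comm, ← exp_add]
    push_cast
    rw [mul_one]
    congr 2
    ring
  rw [e1, e2, conjPoisson]
  have hpi : (π : ℂ) ≠ 0 := by exact_mod_cast pi_ne_zero
  have h1 : I * b + ε ≠ 0 := fun h => hε.ne' (by simpa using congrArg re h)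
  have h2 : I * b - ε ≠ 0 := fun h => hε.ne' (by simpa using congrArg re h)
  have h3 : ((b : ℂ) ^ 2 + ε ^ 2) = -((I * b + ε) * (I * b - ε)) := by
    ring_nf
    rw [I_sq]
    ring
  push_cast
  rw [h3]
  field_simp
  ring_nf
  rw [I_sq]
  ring

lemma integral_mul_conjPoisson (hε : 0 < ε) {m : Tan 1 → ℂ} (hm : Integrable m) (hK : Integrable (tanFourierInv m))
    (hc : ∀ ξ ≠ 0, ContinuousAt m ξ) (x : Tan 1) :
    ∫ y, tanFourierInv m y * (conjPoisson ε ((x - y) 0) : ℂ) = tanFourierInv (fun ξ => m ξ * conjSymbol ε ξ) x := by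
  have h1 := tanFourier_mul_tanFourierInv (integrable_conjSymbol hε) hK x
  simp only [tanFourierInv_conjSymbol hε] at h1
  have e1 : ∫ y, tanFourierInv m y * (conjPoisson ε ((x - y) 0) : ℂ) =
      -∫ y, tanFourierInv m y * (conjPoisson ε ((y - x) 0) : ℂ) := by
    rw [← integral_neg]
    refine integral_congr_ae (.of_forall fun y => ?_)
    have : (x - y) 0 = -((y - x) 0) := by rw [← neg_sub]; rfl
    simp only [this, conjPoisson_neg]
    push_cast
    ring
  rw [e1, ← h1, tanFourier, tanFourierInv, ← integral_neg_eq_self, ← integral_neg, one_div, ← integral_const_mul]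
  refine integral_congr_ae ?_
  filter_upwards [ae_ne_zero le_rfl] with ξ hξ
  rw [tanFourierInv_tanFourierInv hm hK (by rw [neg_neg]; exact hc ξ hξ), conjSymbol_neg hξ, neg_neg, inner_neg_left, real_inner_comm x ξ]
  push_cast
  rw [neg_mul_neg]
  ring

end Inversion

section Transfer
open Filter Topology
variable {ε : ℝ} {m : Tan 1 → ℂ} {φ : ℝ → ℂ}

lemma integral_mul_conjOp (hε : 0 < ε) (hm : Integrable m) (hK : Integrable (tanFourierInv m))
    (hc : ∀ ξ ≠ 0, ContinuousAt m ξ) (hφ : Integrable φ) (x : Tan 1) :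
    ∫ y : Tan 1, tanFourierInv m (x - y) * conjOp ε φ (y 0) =
      ∫ s, tanFourierInv (fun ξ => m ξ * conjSymbol ε ξ) (x - line s) * φ s := by
  have hint : Integrable (fun p : Tan 1 × ℝ => (conjPoisson ε (p.1 0 - p.2) : ℂ) * (tanFourierInv m (x - p.1) * φ p.2))
      (volume.prod volume) := by
    refine ((hK.comp_sub_left x).mul_prod hφ).bdd_mul (c := ε⁻¹) ?_ (.of_forall fun p => ?_)
    · have := continuous_conjPoisson hε
      exact Continuous.aestronglyMeasurable (by fun_prop)
    · rw [norm_real]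
      exact abs_conjPoisson_le hε _
  have h1 : ∀ y : Tan 1, tanFourierInv m (x - y) * conjOp ε φ (y 0) =
      ∫ s, (conjPoisson ε (y 0 - s) : ℂ) * (tanFourierInv m (x - y) * φ s) := fun y => by
    rw [conjOp, ← integral_const_mul]
    refine integral_congr_ae (.of_forall fun s => ?_)
    ring
  simp only [h1]
  rw [integral_integral_swap hint]
  refine integral_congr_ae (.of_forall fun s => ?_)
  have h2 := integral_mul_conjPoisson hε hm hK hc (x - line s)
  simp only
  rw [← h2, ← integral_mul_const, ← integral_sub_left_eq_self _ volume x]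
  refine integral_congr_ae (.of_forall fun y => ?_)
  have e : (x - line s - y) 0 = (x - y) 0 - s := by
    rw [sub_right_comm]
    rfl
  simp only [sub_sub_cancel, e]
  ring

lemma tendsto_tanFourierInv_conjSymbol (hm : Integrable m) (x : Tan 1) :
    Tendsto (fun ε => tanFourierInv (fun ξ => m ξ * conjSymbol ε ξ) x) (𝓝[>] 0)
      (𝓝 (tanFourierInv (fun ξ => m ξ * (-I * freqSign ξ)) x)) := by
  refine Tendsto.const_mul _ (tendsto_integral_filter_of_dominated_convergence (fun ξ => ‖m ξ‖) ?_ ?_ hm.norm ?_)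
  · filter_upwards with ε
    exact (by fun_prop : Continuous fun ξ : Tan 1 => 𝐞(x,ξ)).aestronglyMeasurable.mul
      (hm.1.mul measurable_conjSymbol.aestronglyMeasurable)
  · filter_upwards [self_mem_nhdsWithin] with ε hε
    filter_upwards with ξ
    rw [norm_mul, norm_exp_I_mul, one_mul, norm_mul]
    exact mul_le_of_le_one_right (norm_nonneg _) (norm_conjSymbol_le (le_of_lt hε) ξ)
  · filter_upwards with ξ
    have hcont : Continuous fun ε => 𝐞(x,ξ) * (m ξ * conjSymbol ε ξ) := by
      unfold conjSymbol
      fun_prop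
    have := hcont.tendsto 0
    simp only [conjSymbol, zero_mul, neg_zero, Real.exp_zero, ofReal_one, mul_one] at this ⊢
    exact this.mono_left nhdsWithin_le_nhds

lemma integral_mul_hilb (hm : Integrable m) (hK : Integrable (tanFourierInv m))
    (hc : ∀ ξ ≠ 0, ContinuousAt m ξ) {L M R : ℝ} (h : LipBump L M R φ) (hR : 0 ≤ R) (x : Tan 1) :
    ∫ y : Tan 1, tanFourierInv m (x - y) * hilb φ (y 0) =
      ∫ s, tanFourierInv (fun ξ => m ξ * (-I * freqSign ξ)) (x - line s) * φ s := by
  have hK' : Integrable fun y => tanFourierInv m (x - y) := hK.comp_sub_left x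
  set B := 2 * R * (2 * L * (1 + R) + 2 * M) with hB
  have hB0 : 0 ≤ B := by
    have := (norm_nonneg _).trans (h.norm_hilb_le hR 0)
    simpa [hB] using this
  have h1 : Tendsto (fun ε => ∫ y : Tan 1, tanFourierInv m (x - y) * conjOp ε φ (y 0)) (𝓝[>] 0)
      (𝓝 (∫ y : Tan 1, tanFourierInv m (x - y) * hilb φ (y 0))) := by
    refine tendsto_integral_filter_of_dominated_convergence (fun y => ‖tanFourierInv m (x - y)‖ * B) ?_ ?_
      (hK'.norm.mul_const _) (.of_forall fun y => (h.tendsto_conjOp hR (y 0)).const_mul _)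
    · filter_upwards [self_mem_nhdsWithin] with ε hε
      exact hK'.1.mul ((aestronglyMeasurable_conjOp hε h.integrable.1).comp_quasiMeasurePreserving
        measurePreserving_coord_zero.quasiMeasurePreserving)
    · filter_upwards [self_mem_nhdsWithin] with ε hε
      filter_upwards with y
      rw [norm_mul]
      refine mul_le_mul_of_nonneg_left ((h.norm_conjOp_le hR hε _).trans ?_) (norm_nonneg _)
      exact mul_le_of_le_one_right hB0 (inv_le_one_of_one_le₀ (by linarith [abs_nonneg (y 0)]))
  have h2 : Tendsto (fun ε => ∫ s, tanFourierInv (fun ξ => m ξ * conjSymbol ε ξ) (x - line s) * φ s) (𝓝[>] 0)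
      (𝓝 (∫ s, tanFourierInv (fun ξ => m ξ * (-I * freqSign ξ)) (x - line s) * φ s)) := by
    have hi : ∀ ε, 0 < ε → Integrable fun ξ => m ξ * conjSymbol ε ξ := fun ε hε => by
      refine hm.norm.mono' (hm.1.mul measurable_conjSymbol.aestronglyMeasurable) (.of_forall fun ξ => ?_)
      rw [norm_mul]
      exact mul_le_of_le_one_right (norm_nonneg _) (norm_conjSymbol_le hε.le ξ)
    refine tendsto_integral_filter_of_dominated_convergence
      (fun s => (∫ ξ, ‖m ξ‖) * ‖φ s‖) ?_ ?_ (h.integrable.norm.const_mul _)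
      (.of_forall fun s => (tendsto_tanFourierInv_conjSymbol hm _).mul_const _)
    · filter_upwards [self_mem_nhdsWithin] with ε hε
      have h3 := continuous_tanFourierInv (hi ε hε)
      have := continuous_line
      exact Continuous.aestronglyMeasurable (by fun_prop) |>.mul h.integrable.1
    · filter_upwards [self_mem_nhdsWithin] with ε hε
      filter_upwards with s
      rw [norm_mul]
      refine mul_le_mul_of_nonneg_right ((norm_tanFourierInv_le _ _).trans ?_) (norm_nonneg _)
      refine integral_mono (hi ε hε).norm hm.norm fun ξ => ?_
      simp only [norm_mul]
      exact mul_le_of_le_one_right (norm_nonneg _) (norm_conjSymbol_le (le_of_lt hε) ξ)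
  refine tendsto_nhds_unique (h1.congr' ?_) h2
  filter_upwards [self_mem_nhdsWithin] with ε hε
  exact integral_mul_conjOp hε hm hK hc h.integrable x

end Transfer

section TransferHalf
open Filter Topology
variable {a : ℝ} {r : ℤ} {S : Tan 1 → ℂ → ℝ → ℂ} {A A' : ℕ → ℝ} {z : ℂ} {v : Tan 1 → ℂ} {q : ℝ≥0∞}

lemma IsSym.integrable_kern_slice (ha : 0 < a) {k : ℕ} (hrk : r + k = 3) (h : IsSym a (-2) S)
    (hz : z ∈ ℂ₊) (hv : SymbolBound r A z v) (he : EvenIfOne v) {t : ℝ} (ht : 0 < t) :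
    Integrable (tanFourierInv fun ξ => v ξ * S ξ z t) := by
  obtain ⟨C, hC, H⟩ := (h.mulSqrt_pow k).exists_kernel_bound le_rfl ha (r := r) (by omega) A
  have hs : 0 < ‖sqz z ^ k‖ := norm_pos_iff.2 (pow_ne_zero _ (sqz_ne_zero (rhp_ne_zero hz)))
  have h1 : 0 < min 1 t := lt_min one_pos ht
  have hcont := continuous_tanFourierInv (h.integrable_mul le_rfl ha hz hv ht)
  refine ((integrable_tail 1 one_pos).const_mul (‖sqz z ^ k‖⁻¹ * (C * ((min 1 t) ^ 2)⁻¹))).mono' hcont.aestronglyMeasurable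
    (.of_forall fun x => ?_)
  have h2 := H z hz v hv he t ht x
  have h3 := kern_const_mul (fun z => sqz z ^ k) v S z (x, t)
  simp only [kern] at h3
  rw [h3, norm_mul] at h2
  rw [mul_assoc, inv_mul_eq_div, le_div_iff₀' hs]
  refine h2.trans ?_
  rw [mul_assoc, ← mul_inv, ← mul_pow]
  refine mul_le_mul_of_nonneg_left (inv_anti₀ (by positivity) (pow_le_pow_left₀ (by positivity) ?_ _)) hC.le
  rw [mul_add, mul_one]
  nlinarith [min_le_left 1 t, min_le_right 1 t, norm_nonneg x, mul_le_of_le_one_left (norm_nonneg x) (min_le_left 1 t)]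

lemma IsSym.integral_reflKer_hilbert [Fact (1 ≤ q)] (hq1 : 1 < q) (hq2 : q ≠ ⊤) (ha : 0 < a) {k : ℕ}
    (hrk : r + k = 3) (h : IsSym a (-2) S) (hz : z ∈ ℂ₊) (hv : SymbolBound r A z v) (he : EvenIfOne v)
    (hv' : SymbolBound r A' z fun ξ => freqSign ξ * v ξ) {H : Lq 1 q →L[ℂ] Lq 1 q}
    (hH : IsHilbertOperator H) {x : Space 1} (hx : x ∈ halfSpace 1) (F : Lq 1 q) :
    ∫ y, reflKer (kern v S z) x y * H F y ∂halfVol 1 =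
      -I * ∫ y, reflKer (kern (fun ξ => freqSign ξ * v ξ) S z) x y * F y ∂halfVol 1 := by
  obtain ⟨hp1, hp2, hpq⟩ := holderConjugate_conjExponent hq1 hq2
  have m1 := h.memLp_reflKer le_rfl ha hz hv hp1 hp2 hx
  have m2 := h.memLp_reflKer le_rfl ha hz hv' hp1 hp2 hx
  obtain ⟨l1, hl1⟩ := exists_pairing (q := q) m1
  obtain ⟨l2, hl2⟩ := exists_pairing (q := q) m2
  rw [← hl1, ← hl2]
  suffices hs : (fun F => l1 (H F)) = fun F => -I * l2 F from congrFun hs F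
  refine Continuous.ext_on (Lp.dense_hasCompactSupport_contDiff hq2) (by fun_prop) (by fun_prop) ?_
  rintro F ⟨g, hF, hs, hg⟩
  have hHF := hH F g hs hg hF
  obtain ⟨L, M, R, hR, hb, -⟩ := exists_lipBump hs hg
  have hx0 : 0 < x.2 := hx
  simp only [hl1, hl2]
  have i1 : Integrable (fun y => reflKer (kern v S z) x y * hilbHalf g y) (halfVol 1) :=
    m1.integrable_mul ((Lp.memLp (H F)).ae_eq hHF)
  have i2 : Integrable (fun y => reflKer (kern (fun ξ => freqSign ξ * v ξ) S z) x y * g y) (halfVol 1) :=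
    m2.integrable_mul ((Lp.memLp F).ae_eq hF)
  have e1 : ∫ y, reflKer (kern v S z) x y * H F y ∂halfVol 1 =
      ∫ y, reflKer (kern v S z) x y * hilbHalf g y ∂halfVol 1 :=
    integral_congr_ae (hHF.mono fun y hy => by simp only [hy])
  have e2 : ∫ y, reflKer (kern (fun ξ => freqSign ξ * v ξ) S z) x y * F y ∂halfVol 1 =
      ∫ y, reflKer (kern (fun ξ => freqSign ξ * v ξ) S z) x y * g y ∂halfVol 1 :=
    integral_congr_ae (hF.mono fun y hy => by simp only [hy])
  rw [e1, e2]
  rw [halfVol_eq_prod] at i1 i2 ⊢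
  rw [integral_prod_symm _ i1, integral_prod_symm _ i2, ← integral_const_mul]
  refine integral_congr_ae ?_
  filter_upwards [ae_restrict_mem measurableSet_Ioi] with t ht
  have ht' : 0 < x.2 + t := add_pos hx0 ht
  have key := integral_mul_hilb (h.integrable_mul le_rfl ha hz hv ht')
    (h.integrable_kern_slice ha hrk hz hv he ht') (fun ξ hξ => ?_) (hb t) hR x.1
  · refine key.trans ?_
    rw [← integral_line, ← integral_const_mul]
    refine integral_congr_ae (.of_forall fun s => ?_)
    have e3 : tanFourierInv (fun ξ => v ξ * S ξ z (x.2 + t) * (-I * freqSign ξ)) (x.1 - line s) =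
        -I * kern (fun ξ => freqSign ξ * v ξ) S z (x.1 - line s, x.2 + t) := by
      rw [← kern_const_mul fun _ => -I]
      unfold kern
      congr 1
      ext ξ
      ring
    simp only [reflKer]
    rw [e3, mul_assoc]
  · refine ContinuousAt.mul (hv.smooth.continuousOn.continuousAt (isOpen_compl_singleton.mem_nhds hξ)) ?_
    exact ((h.continuous ha hz).comp (by fun_prop : Continuous fun ξ : Tan 1 => (ξ, x.2 + t))).continuousAt

end TransferHalf

section Parity
open Filter Topology
variable {n : ℕ} {r : ℤ} {A : ℕ → ℝ} {z : ℂ} {v : Tan n → ℂ} {σ : Tan n → ℝ} {τ : ℝ}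
variable {v' : Tan n → ℂ}

/-- `σ` is locally constant away from `0`, with values in `[-1, 1]`. -/
def IsSignLike (σ : Tan n → ℝ) : Prop := ∀ ξ ≠ 0, (σ =ᶠ[𝓝 ξ] fun _ => σ ξ) ∧ |σ ξ| ≤ 1

lemma isSignLike_one : IsSignLike fun _ : Tan n => (1 : ℝ) := fun ξ _ => ⟨EventuallyEq.rfl, by simp⟩

lemma isSignLike_freqSign : IsSignLike freqSign := fun ξ hξ => by
  have hcont : Continuous fun ξ : Tan 1 => ξ 0 := by fun_prop
  refine ⟨?_, by rw [freqSign]; split_ifs <;> simp⟩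
  rcases lt_or_gt_of_ne (coord_zero_ne_zero hξ) with h | h
  · filter_upwards [(isOpen_lt hcont continuous_const).mem_nhds h] with η hη
    rw [freqSign, freqSign, if_neg (not_lt.2 (le_of_lt hη)), if_neg (not_lt.2 h.le)]
  · filter_upwards [(isOpen_lt continuous_const hcont).mem_nhds h] with η hη
    rw [freqSign, freqSign, if_pos hη, if_pos h]

lemma SymbolBound.reflect (h : SymbolBound r A z v) (hσ : IsSignLike σ) (hτ : |τ| ≤ 1) :
    SymbolBound r A z fun ξ => (σ ξ : ℂ) * ((v ξ + τ * v (-ξ)) / 2) := by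
  have hv : ∀ ξ ≠ 0, ContDiffAt ℝ ∞ v ξ := fun ξ hξ => h.smooth.contDiffAt (isOpen_compl_singleton.mem_nhds hξ)
  have hv' : ∀ ξ ≠ 0, ContDiffAt ℝ ∞ (fun ξ => v (-ξ)) ξ := fun ξ hξ =>
    (hv (-ξ) (neg_ne_zero.2 hξ)).comp ξ contDiff_neg.contDiffAt
  have he : ∀ ξ ≠ 0, (fun ξ => (σ ξ : ℂ) * ((v ξ + τ * v (-ξ)) / 2)) =ᶠ[𝓝 ξ]
      ((σ ξ / 2 : ℝ) • (v + (τ • fun ξ => v (-ξ)))) := fun ξ hξ => by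
    filter_upwards [(hσ ξ hξ).1] with η hη
    rw [hη]
    simp only [Pi.smul_apply, Pi.add_apply, real_smul]
    push_cast
    ring
  have hτv : ∀ ξ ≠ 0, ContDiffAt ℝ ∞ (τ • fun ξ => v (-ξ)) ξ := fun ξ hξ => contDiffAt_const.smul (hv' ξ hξ)
  have hadd : ∀ ξ ≠ 0, ContDiffAt ℝ ∞ (v + (τ • fun ξ => v (-ξ))) ξ := fun ξ hξ =>
    (hv ξ hξ).add (hτv ξ hξ)
  have hsm : ∀ ξ ≠ 0, ContDiffAt ℝ ∞ ((σ ξ / 2 : ℝ) • (v + (τ • fun ξ => v (-ξ)))) ξ := fun ξ hξ =>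
    (contDiffAt_const (c := σ ξ / 2)).smul (hadd ξ hξ)
  refine ⟨fun ξ hξ => ((hsm ξ hξ).congr_of_eventuallyEq (he ξ hξ)).contDiffWithinAt, fun k ξ hξ e => ?_⟩
  have hk : ((k : ℕ∞) : WithTop ℕ∞) ≤ (∞ : WithTop ℕ∞) := by exact_mod_cast le_top
  have b1 := h.bound k ξ hξ e
  have b2 := h.bound k (-ξ) (neg_ne_zero.2 hξ) (-e)
  have ew : weight z (-ξ) = weight z ξ := by rw [weight, weight, norm_neg]
  rw [ew, norm_neg] at b2
  have en : (iteratedFDeriv ℝ k (fun ξ => v (-ξ)) ξ fun _ => e) = iteratedFDeriv ℝ k v (-ξ) fun _ => -e := by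
    have h1 := (ContinuousLinearEquiv.neg ℝ (M := Tan n)).iteratedFDerivWithin_comp_right v uniqueDiffOn_univ (x := ξ)
      (mem_univ _) k
    rw [preimage_univ, iteratedFDerivWithin_univ, iteratedFDerivWithin_univ] at h1
    exact congrArg (fun T => T fun _ => e) h1
  rw [(he ξ hξ).iteratedFDeriv ℝ k |>.self_of_nhds, iteratedFDeriv_const_smul_apply ((hadd ξ hξ).of_le hk),
    iteratedFDeriv_add_apply ((hv ξ hξ).of_le hk) ((hτv ξ hξ).of_le hk),
    iteratedFDeriv_const_smul_apply ((hv' ξ hξ).of_le hk)]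
  simp only [_root_.smul_apply, _root_.add_apply, en]
  set X := A k * ‖e‖ ^ k * weight z ξ ^ (r - k)
  have hX : 0 ≤ X := (norm_nonneg _).trans b1
  have b3 : ‖τ • iteratedFDeriv ℝ k v (-ξ) fun _ => -e‖ ≤ X := by
    rw [norm_smul]
    exact (mul_le_of_le_one_left (norm_nonneg _) hτ).trans b2
  rw [norm_smul, norm_eq_abs, abs_div, abs_two]
  have b4 := (norm_add_le _ _).trans (add_le_add b1 b3)
  calc _ ≤ 1 / 2 * (X + X) := mul_le_mul (by linarith [(hσ ξ hξ).2]) b4 (norm_nonneg _) (by norm_num)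
    _ = X := by ring

lemma SymbolBound.congr (h : SymbolBound r A z v) (he : ∀ ξ ≠ 0, v' ξ = v ξ) : SymbolBound r A z v' := by
  have hev : ∀ ξ ≠ 0, v' =ᶠ[𝓝 ξ] v := fun ξ hξ => by
    filter_upwards [isOpen_compl_singleton.mem_nhds hξ] with η hη using he η hη
  refine ⟨h.smooth.congr fun ξ hξ => he ξ hξ, fun k ξ hξ e => ?_⟩
  rw [((hev ξ hξ).iteratedFDeriv ℝ k).self_of_nhds]
  exact h.bound k ξ hξ e

lemma SymbolFamily.reflect {w : Tan n → ℂ → ℂ} (hw : SymbolFamily r A w) (hσ : IsSignLike σ) (hτ : |τ| ≤ 1) :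
    SymbolFamily r A fun ξ z => (σ ξ : ℂ) * ((w ξ z + τ * w (-ξ) z) / 2) := by
  refine ⟨fun ξ hξ => ?_, fun i hi z hz => ((hw.bound i hi z hz).reflect hσ hτ).congr fun ξ hξ => ?_⟩
  · have h1 := hw.holomorphic ξ hξ
    have h2 := hw.holomorphic (-ξ) (neg_ne_zero.2 hξ)
    fun_prop
  · have h1 := ((hw.holomorphic ξ hξ).differentiableAt (isOpen_rightHalfPlane.mem_nhds hz)).hasDerivAt
    have h2 := ((hw.holomorphic (-ξ) (neg_ne_zero.2 hξ)).differentiableAt (isOpen_rightHalfPlane.mem_nhds hz)).hasDerivAt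
    interval_cases i
    · rfl
    · have h3 := (((h1.add (h2.const_mul (τ : ℂ))).div_const 2).const_mul (σ ξ : ℂ)).deriv
      simp only [iterate_one, eulerDeriv, smul_eq_mul]
      refine (congrArg (z * ·) h3).trans ?_
      ring

lemma kern_add_left {a : ℝ} {d : ℤ} {S : Symb n} {A' : ℕ → ℝ} (hn : 1 ≤ n) (ha : 0 < a)
    (h : IsSym a d S) (hz : z ∈ ℂ₊) (hv : SymbolBound r A z v) (hv' : SymbolBound r A' z v')
    {p : Space n} (hp : p ∈ halfSpace n) :
    kern (fun ξ => v ξ + v' ξ) S z p = kern v S z p + kern v' S z p := by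
  have hp' : 0 < p.2 := hp
  unfold kern tanFourierInv
  rw [← mul_add, ← integral_add (integrable_exp_mul_of (h.integrable_mul hn ha hz hv hp') _)
    (integrable_exp_mul_of (h.integrable_mul hn ha hz hv' hp') _)]
  congr 2
  ext ξ
  ring

end Parity

section Assembly
open Filter Topology
variable {n m : ℕ} {q : ℝ≥0∞} [Fact (1 ≤ q)] {a : ℝ} {r : ℤ}

lemma toLq_sum {ι : Type*} (s : Finset ι) (u : ι → sobolev n q m) : toLq (∑ i ∈ s, u i) = ∑ i ∈ s, toLq (u i) := by
  simp only [toLq, map_sum, Finset.sum_apply]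

lemma exists_sum_kernelOp {ι X : Type*} [Fintype ι] [NormedAddCommGroup X] [NormedSpace ℂ X] (hn : 1 ≤ n)
    (ha : 0 < a) (hq1 : 1 < q) (hq2 : q ≠ ⊤) (hrm : r + m = 3) {S : ι → Symb n}
    (hS : ∀ i, IsSym a (-2) (S i)) (A : ℕ → ℝ) (ϖ : ι → X →L[ℂ] Lq n q) :
    ∃ K : ℝ, 0 ≤ K ∧ ∀ w : ι → Tan n → ℂ → ℂ, (∀ i, SymbolFamily r A (w i)) →
      (∀ i, ∀ z ∈ ℂ₊, EvenIfOne fun ξ => w i ξ z) →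
      ∃ (W : ℂ → X →L[ℂ] sobolev n q m) (V' : ℂ → X →L[ℂ] JetSpace n q m), (∀ z ∈ ℂ₊, DifferentiableAt ℂ W z) ∧
        (∀ z ∈ ℂ₊, ∀ D, toLq (W z D) =ᵐ[halfVol n] fun x =>
          ∑ i, ∫ y, reflKer (kern (fun ξ => w i ξ z) (S i) z) x y * ϖ i D y ∂halfVol n) ∧
        (∀ z ∈ ℂ₊, HasDerivAt (fun z => (scaledJet n q m z).comp (W z)) (z⁻¹ • V' z) z) ∧
        IsRBoundedWith q.toReal K {T | ∃ z ∈ ℂ₊, T = (scaledJet n q m z).comp (W z) ∨ T = V' z} := by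
  have hqr : 1 ≤ q.toReal := by
    rw [← toReal_one]
    exact toReal_mono hq2 Fact.out
  choose K hK H using fun i => exists_sobolev_kernelOp (m := m) hn ha hq1 hq2 hrm (hS i) A
  refine ⟨∑ i, ‖ContinuousLinearMap.id ℂ (JetSpace n q m)‖ * K i * ‖ϖ i‖,
    sum_nonneg fun i _ => mul_nonneg (mul_nonneg (norm_nonneg _) (hK i)) (norm_nonneg _), fun w hw he => ?_⟩
  choose W V' hW hval hder hR using fun i => H i (w i) (hw i) (he i)
  have hsum : ∀ z, (scaledJet n q m z).comp (∑ i, (W i z).comp (ϖ i)) =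
      ∑ i, ((scaledJet n q m z).comp (W i z)).comp (ϖ i) := fun z => by
    rw [comp_finsetSum]
    rfl
  refine ⟨fun z => ∑ i, (W i z).comp (ϖ i), fun z => ∑ i, (V' i z).comp (ϖ i), fun z hz => ?_, fun z hz D => ?_,
    fun z hz => ?_, ?_⟩
  · exact DifferentiableAt.fun_sum fun i _ => (hW i z hz).clm_comp (differentiableAt_const _)
  · rw [_root_.sum_apply, toLq_sum]
    refine (Lp.coeFn_finsetSum _ _).trans ?_
    filter_upwards [ae_all_iff.2 fun i => hval i z hz (ϖ i D)] with x hx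
    rw [Finset.sum_apply]
    exact sum_congr rfl fun i _ => hx i
  · simp only [hsum]
    have h1 := HasDerivAt.fun_sum (u := Finset.univ) fun i _ => (hder i z hz).clm_comp (hasDerivAt_const z (ϖ i))
    refine h1.congr_deriv ?_
    rw [smul_sum]
    refine sum_congr rfl fun i _ => ?_
    rw [comp_zero, add_zero, smul_comp]
  · refine IsRBoundedWith.sum hqr Finset.univ
      (fun i _ => (hR i).comp (by linarith) (hK i) (𝒰 := {T | ∃ z ∈ ℂ₊, T = ((scaledJet n q m z).comp (W i z)).comp (ϖ i) ∨
        T = (V' i z).comp (ϖ i)}) (ContinuousLinearMap.id ℂ _) (ϖ i) ?_) ?_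
    · rintro T ⟨z, hz, rfl | rfl⟩
      · exact ⟨_, ⟨z, hz, Or.inl rfl⟩, rfl⟩
      · exact ⟨_, ⟨z, hz, Or.inr rfl⟩, rfl⟩
    · rintro T ⟨z, hz, rfl | rfl⟩
      · exact ⟨_, fun i _ => ⟨z, hz, Or.inl rfl⟩, hsum z⟩
      · exact ⟨_, fun i _ => ⟨z, hz, Or.inr rfl⟩, rfl⟩

end Assembly

section BoundaryOperator
open Filter Topology
variable {n m : ℕ} {q : ℝ≥0∞} [Fact (1 ≤ q)] {a : ℝ} {r : ℤ}
variable {A : ℕ → ℝ} {z : ℂ} {w : Tan n → ℂ → ℂ} {K : ℝ} {W : ℂ → DataSpace n q →L[ℂ] sobolev n q m} {V' : ℂ → DataSpace n q →L[ℂ] JetSpace n q m}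

/-- `W` represents the boundary operator with symbol `w` by volume integrals, and the scaled jets of `W` and their
Euler derivatives `V'` are `R`-bounded. -/
structure IsSolutionFamily (a : ℝ) (w : Tan n → ℂ → ℂ) (K : ℝ) (W : ℂ → DataSpace n q →L[ℂ] sobolev n q m)
    (V' : ℂ → DataSpace n q →L[ℂ] JetSpace n q m) : Prop where
  differentiableAt : ∀ z ∈ ℂ₊, DifferentiableAt ℂ W z
  value : ∀ z ∈ ℂ₊, ∀ D, toLq (W z D) =ᵐ[halfVol n] fun x =>
    ∑ c, ∫ y in halfSpace n, reflKer (kern (fun ξ => w ξ z) (volumeSym a c) z) x y * dataProj n q c D y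
  hasDerivAt : ∀ z ∈ ℂ₊, HasDerivAt (fun z => (scaledJet n q m z).comp (W z)) (z⁻¹ • V' z) z
  rBounded : IsRBoundedWith q.toReal K {T | ∃ z ∈ ℂ₊, T = (scaledJet n q m z).comp (W z) ∨ T = V' z}

lemma exists_isSolutionFamily_of_two_le (hn : 2 ≤ n) (ha : 0 < a) (hq1 : 1 < q) (hq2 : q ≠ ⊤) (hrm : r + m = 3)
    (A : ℕ → ℝ) : ∃ K : ℝ, 0 ≤ K ∧ ∀ w : Tan n → ℂ → ℂ, SymbolFamily r A w →
      ∃ (W : ℂ → DataSpace n q →L[ℂ] sobolev n q m) (V' : ℂ → DataSpace n q →L[ℂ] JetSpace n q m),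
        IsSolutionFamily a w K W V' := by
  obtain ⟨K, hK, H⟩ := exists_sum_kernelOp (m := m) (by omega) ha hq1 hq2 hrm (isSym_volumeSym (n := n) ha) A (dataProj n q)
  refine ⟨K, hK, fun w hw => ?_⟩
  obtain ⟨W, V', h1, h2, h3, h4⟩ := H (fun _ => w) (fun _ => hw) fun _ z _ h => by omega
  exact ⟨W, V', h1, h2, h3, h4⟩

lemma integral_reflKer_parity (ha : 0 < a) (hq1 : 1 < q) (hq2 : q ≠ ⊤) (hrm : r + m = 3)
    {S : Tan 1 → ℂ → ℝ → ℂ} (h : IsSym a (-2) S) (hz : z ∈ ℂ₊) {v : Tan 1 → ℂ}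
    (hv : SymbolBound r A z v) {H : Lq 1 q →L[ℂ] Lq 1 q}
    (hH : IsHilbertOperator H) {x : Space 1} (hx : x ∈ halfSpace 1) (F : Lq 1 q) :
    ∫ y, reflKer (kern v S z) x y * F y ∂halfVol 1 =
      ∫ y, reflKer (kern (fun ξ => ((1 : ℝ) : ℂ) * ((v ξ + (1 : ℝ) * v (-ξ)) / 2)) S z) x y * F y ∂halfVol 1 +
      ∫ y, reflKer (kern (fun ξ => (freqSign ξ : ℂ) * ((v ξ + (-1 : ℝ) * v (-ξ)) / 2)) S z) x y *
        (I • H) F y ∂halfVol 1 := by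
  obtain ⟨hp1, hp2, hpq⟩ := holderConjugate_conjExponent hq1 hq2
  have he := hv.reflect isSignLike_one (τ := 1) (by simp)
  have hd := hv.reflect isSignLike_one (τ := -1) (by simp)
  have ho := hv.reflect isSignLike_freqSign (τ := -1) (by simp)
  have hdo : (fun ξ => (freqSign ξ : ℂ) * ((freqSign ξ : ℂ) * ((v ξ + (-1 : ℝ) * v (-ξ)) / 2))) =
      fun ξ => ((1 : ℝ) : ℂ) * ((v ξ + (-1 : ℝ) * v (-ξ)) / 2) := by
    ext ξ
    rw [← mul_assoc, ← Complex.ofReal_mul, freqSign_mul_self]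
  have heven : EvenIfOne fun ξ => (freqSign ξ : ℂ) * ((v ξ + (-1 : ℝ) * v (-ξ)) / 2) := fun _ ξ => by
    rcases eq_or_ne ξ 0 with rfl | hξ
    · rw [neg_zero]
    · simp only [freqSign_neg hξ, neg_neg]
      push_cast
      ring
  have key := h.integral_reflKer_hilbert hq1 hq2 ha hrm hz ho heven (by rw [hdo]; exact hd) hH hx F
  rw [hdo] at key
  have e1 : ∫ y, reflKer (kern (fun ξ => (freqSign ξ : ℂ) * ((v ξ + (-1 : ℝ) * v (-ξ)) / 2)) S z) x y *
        (I • H) F y ∂halfVol 1 =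
      ∫ y, reflKer (kern (fun ξ => ((1 : ℝ) : ℂ) * ((v ξ + (-1 : ℝ) * v (-ξ)) / 2)) S z) x y * F y ∂halfVol 1 := by
    have e2 : ∫ y, reflKer (kern (fun ξ => (freqSign ξ : ℂ) * ((v ξ + (-1 : ℝ) * v (-ξ)) / 2)) S z) x y *
        (I • H) F y ∂halfVol 1 = I *
        ∫ y, reflKer (kern (fun ξ => (freqSign ξ : ℂ) * ((v ξ + (-1 : ℝ) * v (-ξ)) / 2)) S z) x y * H F y ∂halfVol 1 := by
      rw [← integral_const_mul]
      refine integral_congr_ae ?_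
      filter_upwards [Lp.coeFn_smul I (H F)] with y hy
      rw [_root_.smul_apply, hy, Pi.smul_apply, smul_eq_mul]
      ring
    rw [e2, key, ← mul_assoc, mul_neg, Complex.I_mul_I, neg_neg, one_mul]
  rw [e1]
  refine Eq.trans (integral_congr_ae ?_) (integral_add
    ((h.memLp_reflKer le_rfl ha hz he hp1 hp2 hx).integrable_mul (Lp.memLp F))
    ((h.memLp_reflKer le_rfl ha hz hd hp1 hp2 hx).integrable_mul (Lp.memLp F)))
  filter_upwards [ae_halfVol 1] with y hy
  have := kern_add_left le_rfl ha h hz he hd (p := (x.1 - y.1, x.2 + y.2)) (add_pos hx hy)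
  simp only [reflKer]
  rw [← add_mul, ← this]
  congr 2
  ext ξ
  push_cast
  ring

lemma exists_isSolutionFamily_one (ha : 0 < a) (hq1 : 1 < q) (hq2 : q ≠ ⊤) (hrm : r + m = 3)
    (A : ℕ → ℝ) : ∃ K : ℝ, 0 ≤ K ∧ ∀ w : Tan 1 → ℂ → ℂ, SymbolFamily r A w →
      ∃ (W : ℂ → DataSpace 1 q →L[ℂ] sobolev 1 q m) (V' : ℂ → DataSpace 1 q →L[ℂ] JetSpace 1 q m),
        IsSolutionFamily a w K W V' := by
  obtain ⟨H, hH⟩ := exists_hilbert_operator hq1 hq2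
  obtain ⟨K, hK, hW⟩ := exists_sum_kernelOp (m := m) le_rfl ha hq1 hq2 hrm
    (S := Sum.elim (volumeSym a) (volumeSym a))
    (fun i => by rcases i with c | c <;> exact isSym_volumeSym ha c) A
    (Sum.elim (dataProj 1 q) fun c => (I • H).comp (dataProj 1 q c))
  refine ⟨K, hK, fun w hw => ?_⟩
  have he := hw.reflect isSignLike_one (τ := 1) (by simp)
  have ho := hw.reflect isSignLike_freqSign (τ := -1) (by simp)
  obtain ⟨W, V', h1, h2, h3, h4⟩ := hW (Sum.elim
      (fun _ ξ z => ((1 : ℝ) : ℂ) * ((w ξ z + (1 : ℝ) * w (-ξ) z) / 2))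
      fun _ ξ z => (freqSign ξ : ℂ) * ((w ξ z + (-1 : ℝ) * w (-ξ) z) / 2))
    (fun i => by rcases i with c | c <;> assumption) (fun i z _ _ ξ => by
      rcases i with c | c
      · simp only [Sum.elim_inl, neg_neg]
        push_cast
        ring
      · simp only [Sum.elim_inr, neg_neg]
        rcases eq_or_ne ξ 0 with rfl | hξ
        · rw [neg_zero]
        · rw [freqSign_neg hξ]
          push_cast
          ring)
  refine ⟨W, V', h1, fun z hz D => ?_, h3, h4⟩
  filter_upwards [h2 z hz D, ae_halfVol 1] with x hx hx0
  rw [hx, Fintype.sum_sum_type, ← sum_add_distrib]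
  exact sum_congr rfl fun c _ =>
    (integral_reflKer_parity ha hq1 hq2 hrm (isSym_volumeSym ha c) hz (hw.bound_zero hz) hH hx0 _).symm

lemma exists_isSolutionFamily (hn : 1 ≤ n) (ha : 0 < a) (hq1 : 1 < q) (hq2 : q ≠ ⊤) (hrm : r + m = 3)
    (A : ℕ → ℝ) : ∃ K : ℝ, 0 ≤ K ∧ ∀ w : Tan n → ℂ → ℂ, SymbolFamily r A w →
      ∃ (W : ℂ → DataSpace n q →L[ℂ] sobolev n q m) (V' : ℂ → DataSpace n q →L[ℂ] JetSpace n q m),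
        IsSolutionFamily a w K W V' := by
  rcases hn.eq_or_lt with rfl | h
  · exact exists_isSolutionFamily_one ha hq1 hq2 hrm A
  · exact exists_isSolutionFamily_of_two_le h ha hq1 hq2 hrm A

lemma IsSolutionFamily.isRBoundedWith (h : IsSolutionFamily a w K W V') (hq : q ≠ ⊤) (hK : 0 ≤ K)
    {Y : Type*} [NormedAddCommGroup Y] [NormedSpace ℂ Y] (P : JetSpace n q m →L[ℂ] Y)
    {O : ℂ → sobolev n q m →L[ℂ] Y} (hO : ∀ z, O z = P.comp (scaledJet n q m z)) {i : ℕ} (hi : i ≤ 1) :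
    IsRBoundedWith q.toReal (‖P‖ * K * ‖ContinuousLinearMap.id ℂ (DataSpace n q)‖ + 1)
      ((eulerDeriv^[i] fun z => (O z).comp (W z)) '' ℂ₊) := by
  refine (h.rBounded.comp (toReal_exponent_pos hq) hK P (ContinuousLinearMap.id ℂ _)
    (𝒰 := (eulerDeriv^[i] fun z => (O z).comp (W z)) '' ℂ₊) ?_).mono (by linarith) subset_rfl
  have e : (fun z => (O z).comp (W z)) = fun z => P.comp ((scaledJet n q m z).comp (W z)) := by
    ext1 z
    rw [hO]
    rfl
  rintro T ⟨z, hz, rfl⟩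
  rw [e]
  interval_cases i
  · exact ⟨_, ⟨z, hz, Or.inl rfl⟩, rfl⟩
  · refine ⟨_, ⟨z, hz, Or.inr rfl⟩, ?_⟩
    have h1 := ((hasDerivAt_const z P).clm_comp (h.hasDerivAt z hz)).deriv
    rw [iterate_one, eulerDeriv, h1, zero_comp, zero_add, comp_smul, smul_inv_smul₀ (rhp_ne_zero hz)]
    rfl

lemma IsSolutionFamily.isBoundaryOperatorValue
    (h : IsSolutionFamily a w K W V') (hn : 1 ≤ n) (ha : 0 < a) (hq1 : 1 < q) (hq2 : q ≠ ⊤)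
    (hw : SymbolFamily r A w) (hz : z ∈ ℂ₊) (f : sobolev n q 2) :
    IsBoundaryOperatorValue w a z f (toLq (W z (opT n q z f))) :=
  isBoundaryOperatorValue_of_ae hq1 hq2 hn ha hz (hw.bound_zero hz) (h.value z hz _)

/-- The components of a jet, in decreasing order. -/
def jetToTarget (n : ℕ) (q : ℝ≥0∞) [Fact (1 ≤ q)] : JetSpace n q 3 →L[ℂ] TargetSpace n q :=
  let ϖ := fun k : Fin 4 => proj (R := ℂ) (φ := fun k : Fin 4 => LqTensor n q k) k
  (ϖ 3).prod ((ϖ 2).prod ((ϖ 1).prod (ϖ 0)))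

/-- The components of a jet, in decreasing order. -/
def jetToData (n : ℕ) (q : ℝ≥0∞) [Fact (1 ≤ q)] : JetSpace n q 2 →L[ℂ] DataSpace n q :=
  let ϖ := fun k : Fin 3 => proj (R := ℂ) (φ := fun k : Fin 3 => LqTensor n q k) k
  (ϖ 2).prod ((ϖ 1).prod (ϖ 0))

lemma opS_eq (z : ℂ) : opS n q z = (jetToTarget n q).comp (scaledJet n q 3 z) := by
  have e1 : z = sqz z ^ 2 := (sqz_sq z).symm
  have e3 : z ^ (3 / 2 : ℂ) = sqz z ^ 3 := by
    rw [sqz, ← Complex.cpow_nat_mul]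
    norm_num
  refine ContinuousLinearMap.ext fun u => ?_
  refine Prod.ext (one_smul ℂ (weakGrad n q 3 le_rfl u)).symm (Prod.ext ?_ (Prod.ext ?_ ?_))
  · exact (congrArg (· • weakGrad n q 2 (by norm_num) u) (pow_one (sqz z))).symm
  · exact congrArg (· • weakGrad n q 1 (by norm_num) u) e1
  · exact congrArg (· • weakGrad n q 0 (by norm_num) u) e3

lemma opT_eq (z : ℂ) : opT n q z = (jetToData n q).comp (scaledJet n q 2 z) := by
  have e1 : z = sqz z ^ 2 := (sqz_sq z).symm
  refine ContinuousLinearMap.ext fun u => ?_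
  refine Prod.ext (one_smul ℂ (weakGrad n q 2 le_rfl u)).symm (Prod.ext ?_ ?_)
  · exact (congrArg (· • weakGrad n q 1 (by norm_num) u) (pow_one (sqz z))).symm
  · exact congrArg (· • weakGrad n q 0 (by norm_num) u) e1

lemma exists_boundaryOperator (hn : 1 ≤ n) (ha : 0 < a) (hq1 : 1 < q) (hq2 : q ≠ ⊤) (hrm : r + m = 3) (A : ℕ → ℝ)
    {Y : Type*} [NormedAddCommGroup Y] [NormedSpace ℂ Y] (P : JetSpace n q m →L[ℂ] Y)
    {O : ℂ → sobolev n q m →L[ℂ] Y} (hO : ∀ z, O z = P.comp (scaledJet n q m z)) :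
    ∃ p C : ℝ, 1 ≤ p ∧ 0 < C ∧ ∀ w : Tan n → ℂ → ℂ, IsMultiplierWith (r : ℝ) A w →
      ∃ W : ℂ → (DataSpace n q →L[ℂ] sobolev n q m), DifferentiableOn ℂ W ℂ₊ ∧
        (∀ z ∈ ℂ₊, ∀ f : sobolev n q 2, IsBoundaryOperatorValue w a z f (toLq (W z (opT n q z f)))) ∧
        ∀ i ≤ 1, IsRBoundedWith p C ((eulerDeriv^[i] fun z => (O z).comp (W z)) '' ℂ₊) := by
  have hp : 1 ≤ q.toReal := by
    rw [← toReal_one]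
    exact toReal_mono hq2 Fact.out
  obtain ⟨K, hK, H⟩ := exists_isSolutionFamily hn ha hq1 hq2 hrm fun k => n ^ k * A k
  refine ⟨q.toReal, ‖P‖ * K * ‖ContinuousLinearMap.id ℂ (DataSpace n q)‖ + 1, hp, by positivity, fun w hw => ?_⟩
  obtain ⟨W, V', h⟩ := H w hw.symbolFamily
  exact ⟨W, fun z hz => (h.differentiableAt z hz).differentiableWithinAt,
    fun z hz f => h.isBoundaryOperatorValue hn ha hq1 hq2 hw.symbolFamily hz f,
    fun i hi => h.isRBoundedWith hq2 hK P hO hi⟩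

end BoundaryOperator

end

theorem lemma5p4 (n : ℕ) (hn : 1 ≤ n) (q : ℝ≥0∞) [Fact (1 ≤ q)] (hq₁ : 1 < q) (hq₂ : q ≠ ⊤)
    (a : ℝ) (ha : 0 < a) (A : ℕ → ℝ) :
    (∃ p C : ℝ, 1 ≤ p ∧ 0 < C ∧
      ∀ w : Tan n → ℂ → ℂ, IsMultiplierWith 0 A w →
        ∃ W : ℂ → (DataSpace n q →L[ℂ] sobolev n q 3),
          DifferentiableOn ℂ W rightHalfPlane ∧
          (∀ z ∈ rightHalfPlane, ∀ f : sobolev n q 2,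
            IsBoundaryOperatorValue w a z f (toLq (W z (opT n q z f)))) ∧
          ∀ i ≤ 1, IsRBoundedWith p C
            ((eulerDeriv^[i] fun z => (opS n q z).comp (W z)) '' rightHalfPlane)) ∧
    (∃ p C : ℝ, 1 ≤ p ∧ 0 < C ∧
      ∀ w : Tan n → ℂ → ℂ, IsMultiplierWith 1 A w →
        ∃ W : ℂ → (DataSpace n q →L[ℂ] sobolev n q 2),
          DifferentiableOn ℂ W rightHalfPlane ∧
          (∀ z ∈ rightHalfPlane, ∀ f : sobolev n q 2,
            IsBoundaryOperatorValue w a z f (toLq (W z (opT n q z f)))) ∧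
          ∀ i ≤ 1, IsRBoundedWith p C
            ((eulerDeriv^[i] fun z => (opT n q z).comp (W z)) '' rightHalfPlane)) := by
  have h₀ := exists_boundaryOperator (r := 0) hn ha hq₁ hq₂ (by norm_num) A (jetToTarget n q) opS_eq
  have h₁ := exists_boundaryOperator (r := 1) hn ha hq₁ hq₂ (by norm_num) A (jetToData n q) opT_eq
  rw [Int.cast_zero] at h₀
  rw [Int.cast_one] at h₁
  exact ⟨h₀, h₁⟩
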